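/- **Theorem (asymptotic distribution of a random sample).** *Setting.* Let $\gamma\in(0,1)$ and let $B_0:\mathbb R^d\times\mathbb R^d\to[0,1]$ and $B:\{0,1\}\times\mathbb R^d\times\mathbb R^d\to[0,1]$ be Borel functions such that $B_0$ and $B(0,\cdot,\cdot),B(1,\cdot,\cdot)$ are continuous Lebesgue-a.e. On one probability space let, for each $n\in\mathbb N$, $Z^n_i(t)\in\mathbb R^d$ $(1\le i\le n,\ t\in\mathbb N_0)$ be opinions, $A^n(t)=(A^n_{ij}(t))_{i,j\le n}$ symmetric $\{0,1\}$-valued adjacency matrices with $A^n_{ii}(t)=1$, and let $\xi_i(t)\in\mathbb R^d$ $(i\in\mathbb N,\ t\in\mathbb N_0)$ be noise variables, with $$Z^n_i(t+1)=(1-\gamma)Z^n_i(t)+\gamma\,\frac{\sum_{j=1}^n A^n_{ij}(t)Z^n_j(t)}{\sum_{j=1}^n A^n_{ij}(t)}+\xi_i(t).$$ Write $x[s]=(x(0),\dots,x(s))$, $\mathcal F^n_t=\sigma(Z^n[t],A^n[t])$, $\mathcal F^{A,n}_0=\sigma(Z^n(0))$ and $\mathcal F^{A,n}_t=\sigma(Z^n[t],A^n[t-1])$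 for $t\ge1$. Assume: 1. (Conditional structure) The $\xi_i(t)$ are i.i.d. with an absolutely continuous law, and for every $t\in\mathbb N_0$ the family $(\xi_i(t))_{i}$ is independent of $\bigvee_n\mathcal F^n_t$. For all $n,t$, the variables $A^n_{ij}(t)$, $i<j$, are conditionally independent given $\mathcal F^{A,n}_t$, and for all $i\ne j$, $\mathbb P(A^n_{ij}(t)=1\mid\mathcal F^{A,n}_t)$ equals $B_0(Z^n_i(0),Z^n_j(0))$ if $t=0$ and $B(A^n_{ij}(t-1),Z^n_i(t),Z^n_j(t))$ if $t\ge1$. 2. (Initial conditions) For each $n$, $(Z^n_1(0),\dots,Z^n_n(0))$ is exchangeable, and there is an absolutely continuous probability measure $\mu_0$ on $\mathbb R^d$ with $(Z^n_1(0),Z^n_2(0))\Rightarrow\mu_0\otimes\mu_0$ as $n\to\infty$. 3. (Moments) $\limsup_{n}\mathbb E\,e^{C|Z^n_1(0)|}<\infty$ and $\mathbb E\,e^{C|\xi_1(0)|}<\infty$ for all $C\in\mathbb R$. 4. (Range of interaction) Either (i) there is $C_b>0$ with $\inf_{x,y}B_0(x,y)e^{C_b|x-y|}>0$ and $\inf_{a,x,y}B(a,x,y)e^{C_b|x-y|}>0$;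 or (ii) there is $C_b>0$ with $B_0(x,y)=B(a,x,y)=0$ whenever $a\in\{0,1\}$ and $|x-y|>C_b$, and for all $a,z$, $B_0(z,z)>0$, $B(a,z,z)>0$, $B_0$ is continuous at $(z,z)$ and $B(a,\cdot,\cdot)$ is continuous at $(z,z)$. *Limiting process.* For trajectories $z,w$ let $B_0(z[0],w[0])=B_0(z(0),w(0))$ and, for $s\ge1$, $B_s(z[s],w[s])=pB(1,z(s),w(s))+(1-p)B(0,z(s),w(s))$ with $p=B_{s-1}(z[s-1],w[s-1])$. Fix $k$ and $t\in\mathbb N_0$. A *limiting mean-field process* up to time $t$ consists of opinions $Z^{(i)}(s)$, edges $A^{(ij)}(s)\in\{0,1\}$ and noise $\xi_i(s)$ $(1\le i,j\le k,\ 0\le s\le t)$ on some probability space such that: the $Z^{(i)}(0)$ are i.i.d. with law $\mu_0$; the $\xi_i(s)$ are i.i.d. with the law of the noise above, and $(\xi_i(s))_{i\le k}$ is independent of $\sigma(Z^{(1:k)}[s],A^{(1:k,1:k)}[s])$ for each $s$; for $s<t$, with $\mu_s$ the law of $Z^{(i)}[s]$, $$Z^{(i)}(s+1)=(1-\gamma)Z^{(i)}(s)+\gamma\,\frac{\int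 w(s)\,B_s(Z^{(i)}[s],w)\,\mu_s(dw)}{\int B_s(Z^{(i)}[s],w)\,\mu_s(dw)}+\xi_i(s);$$ $A^{(ij)}=A^{(ji)}$, $A^{(ii)}=1$; and for each $s$ the variables $A^{(ij)}(s)$, $i<j$, are conditionally independent given $\mathcal G^{A,k}_s:=\sigma(Z^{(1:k)}[s],A^{(1:k,1:k)}[s-1])$ ($:=\sigma(Z^{(1:k)}(0))$ for $s=0$), with $\mathbb P(A^{(ij)}(s)=1\mid\mathcal G^{A,k}_s)$ equal to $B_0(Z^{(i)}(0),Z^{(j)}(0))$ if $s=0$ and to $B(A^{(ij)}(s-1),Z^{(i)}(s),Z^{(j)}(s))$ if $s\ge1$. *Conclusion.* For all $k$ and $t$, a limiting mean-field process up to time $t$ exists, and for every such process, at all times $s<t$, $Z^{(i)}(s)$ is integrable and the denominator above is a.s. positive. Moreover, for each $n$ let $m^n_1,\dots,m^n_k$ be a uniform random sample of size $k$ from $\{1,\dots,n\}$, with replacement for all $n$, or without replacement for all $n\ge k$, which is independent of $\mathcal F^n_t$. Then, as $n\to\infty$, $$\bigl(Z^n_{m^n_{1:k}}[t],\,A^n_{m^n_{1:k},m^n_{1:k}}[t]\bigr)\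 \Rightarrow\ \bigl(Z^{(1:k)}[t],\,A^{(1:k,1:k)}[t]\bigr)$$ in distribution. -/

import Mathlib

open MeasureTheory ProbabilityTheory Filter

/-- Data and regularity of the interaction functions. The set `{0,1}` is modelled by `Bool`
(`true` means that the edge is present). `B0` governs the edges at time `0` and `B` the edges at
later times; both are probabilities, Borel, and continuous Lebesgue-almost everywhere. -/
structure IsInteractionPair {d : ℕ}
    (B0 : EuclideanSpace ℝ (Fin d) → EuclideanSpace ℝ (Fin d) → ℝ)
    (B : Bool → EuclideanSpace ℝ (Fin d) → EuclideanSpace ℝ (Fin d) → ℝ) : Prop where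
  measurable_zero : Measurable (Function.uncurry B0)
  measurable_succ : ∀ a, Measurable (Function.uncurry (B a))
  mem_zero : ∀ x y, B0 x y ∈ Set.Icc (0 : ℝ) 1
  mem_succ : ∀ a x y, B a x y ∈ Set.Icc (0 : ℝ) 1
  ae_continuous_zero : ∀ᵐ p ∂volume, ContinuousAt (Function.uncurry B0) p
  ae_continuous_succ : ∀ a, ∀ᵐ p ∂volume, ContinuousAt (Function.uncurry (B a)) p

/-- Interactions which decay at most exponentially in the distance of the opinions. -/
def AtMostExponentialDecay {d : ℕ}
    (B0 : EuclideanSpace ℝ (Fin d) → EuclideanSpace ℝ (Fin d) → ℝ)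
    (B : Bool → EuclideanSpace ℝ (Fin d) → EuclideanSpace ℝ (Fin d) → ℝ) : Prop :=
  ∃ Cb : ℝ, 0 < Cb ∧ ∃ c : ℝ, 0 < c ∧
    (∀ x y, c ≤ B0 x y * Real.exp (Cb * ‖x - y‖)) ∧
    (∀ a x y, c ≤ B a x y * Real.exp (Cb * ‖x - y‖))

/-- Interactions of finite range, positive and continuous at the diagonal. -/
def FiniteRange {d : ℕ}
    (B0 : EuclideanSpace ℝ (Fin d) → EuclideanSpace ℝ (Fin d) → ℝ)
    (B : Bool → EuclideanSpace ℝ (Fin d) → EuclideanSpace ℝ (Fin d) → ℝ) : Prop :=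
  (∃ Cb : ℝ, 0 < Cb ∧ ∀ x y, Cb < ‖x - y‖ → B0 x y = 0 ∧ ∀ a, B a x y = 0) ∧
  (∀ z, 0 < B0 z z ∧ ContinuousAt (Function.uncurry B0) (z, z)) ∧
  (∀ a z, 0 < B a z z ∧ ContinuousAt (Function.uncurry (B a)) (z, z))

/-- The σ-algebra generated by the opinions at times `r < p` and the edges at times `r < q`.
With `(p, q) = (s + 1, s + 1)` it is the full history at time `s`; with `(p, q) = (s + 1, s)` it
is the information available just before the edges at time `s` are drawn. -/
@[reducible] def history {Ω ι : Type*} {d : ℕ} (Z : ι → ℕ → Ω → EuclideanSpace ℝ (Fin d))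
    (A : ι → ι → ℕ → Ω → Bool) (p q : ℕ) : MeasurableSpace Ω :=
  (⨆ i, ⨆ r, ⨆ _ : r < p, MeasurableSpace.comap (Z i r) inferInstance) ⊔
    (⨆ i, ⨆ j, ⨆ r, ⨆ _ : r < q, MeasurableSpace.comap (A i j r) inferInstance)

/-- Mutual conditional independence, given the σ-algebra `m`, of a family of random bits. -/
def MutuallyCondIndep {Ω ι : Type*} [MeasurableSpace Ω] (P : Measure Ω) (m : MeasurableSpace Ω)
    (X : ι → Ω → Bool) : Prop :=
  ∀ (S : Finset ι) (b : ι → Bool),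
    P⟦⋂ e ∈ S, X e ⁻¹' {b e} | m⟧ =ᵐ[P] ∏ e ∈ S, P⟦X e ⁻¹' {b e} | m⟧

/-- The probability that the edge between two agents with opinion trajectories `z`, `w` and edge
trajectory `a` is present at time `s`, given the information available just before it is drawn. -/
def edgeProb {d : ℕ} (B0 : EuclideanSpace ℝ (Fin d) → EuclideanSpace ℝ (Fin d) → ℝ)
    (B : Bool → EuclideanSpace ℝ (Fin d) → EuclideanSpace ℝ (Fin d) → ℝ) :
    ℕ → (ℕ → EuclideanSpace ℝ (Fin d)) → (ℕ → EuclideanSpace ℝ (Fin d)) → (ℕ → Bool) → ℝ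
  | 0, z, w, _ => B0 (z 0) (w 0)
  | s + 1, z, w, a => B (a s) (z (s + 1)) (w (s + 1))

/-- The local average `L_i` of the opinions of the neighbours of `i` (the degree, a sum of zeros
and ones, is in the denominator). -/
noncomputable def neighborAverage {d n : ℕ} (z : Fin n → EuclideanSpace ℝ (Fin d))
    (a : Fin n → Fin n → Bool) (i : Fin n) : EuclideanSpace ℝ (Fin d) :=
  (∑ j, if a i j then (1 : ℝ) else 0)⁻¹ • ∑ j, if a i j then z j else 0

/-- The co-evolving system of `n` agents with opinions `Z i s` and adjacency matrix
`A i j s`, driven by the noise `ξ`. -/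
structure IsCoevolvingSystem {Ω : Type*} [MeasurableSpace Ω] (P : Measure Ω) {d : ℕ} (γ : ℝ)
    (B0 : EuclideanSpace ℝ (Fin d) → EuclideanSpace ℝ (Fin d) → ℝ)
    (B : Bool → EuclideanSpace ℝ (Fin d) → EuclideanSpace ℝ (Fin d) → ℝ)
    (ξ : ℕ → ℕ → Ω → EuclideanSpace ℝ (Fin d)) (n : ℕ)
    (Z : Fin n → ℕ → Ω → EuclideanSpace ℝ (Fin d))
    (A : Fin n → Fin n → ℕ → Ω → Bool) : Prop where
  measurable_opinion : ∀ i s, Measurable (Z i s)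
  measurable_edge : ∀ i j s, Measurable (A i j s)
  evolve : ∀ i s, ∀ᵐ ω ∂P, Z i (s + 1) ω = (1 - γ) • Z i s ω +
    γ • neighborAverage (fun j => Z j s ω) (fun j l => A j l s ω) i + ξ i s ω
  symm : ∀ i j s, ∀ᵐ ω ∂P, A i j s ω = A j i s ω
  diag : ∀ i s, ∀ᵐ ω ∂P, A i i s ω = true
  edge_law : ∀ i j s, i ≠ j → P⟦A i j s ⁻¹' {true} | history Z A (s + 1) s⟧ =ᵐ[P]
    fun ω => edgeProb B0 B s (fun r => Z i r ω) (fun r => Z j r ω) (fun r => A i j r ω)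
  edge_condIndep : ∀ s, MutuallyCondIndep P (history Z A (s + 1) s)
    (fun e : {e : Fin n × Fin n // e.1 < e.2} => A e.1.1 e.1.2 s)

/-- The noise `ξ i s` (agent `i`, time `s`) is i.i.d. and absolutely continuous, and the noise at
time `s` is independent of the joint history at time `s` of all the systems. -/
structure IsSystemNoise {Ω : Type*} [MeasurableSpace Ω] (P : Measure Ω) {d : ℕ}
    (ξ : ℕ → ℕ → Ω → EuclideanSpace ℝ (Fin d))
    (Z : (n : ℕ) → Fin n → ℕ → Ω → EuclideanSpace ℝ (Fin d))
    (A : (n : ℕ) → Fin n → Fin n → ℕ → Ω → Bool) : Prop where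
  measurable : ∀ i s, Measurable (ξ i s)
  indep : iIndepFun (fun p : ℕ × ℕ => ξ p.1 p.2) P
  identDistrib : ∀ i s, P.map (ξ i s) = P.map (ξ 0 0)
  absolutelyContinuous : P.map (ξ 0 0) ≪ volume
  indep_history : ∀ s, Indep (⨆ i, MeasurableSpace.comap (ξ i s) inferInstance)
    (⨆ n, history (Z n) (A n) (s + 1) (s + 1)) P

/-- Initial conditions: for each `n` the initial opinions are exchangeable, and two of them are in
the limit `n → ∞` independent with the absolutely continuous law `μ0`. -/
structure IsInitialCondition {Ω : Type*} [MeasurableSpace Ω] (P : Measure Ω)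
    [IsProbabilityMeasure P] {d : ℕ} (μ0 : Measure (EuclideanSpace ℝ (Fin d)))
    [IsProbabilityMeasure μ0]
    (Z : (n : ℕ) → Fin n → ℕ → Ω → EuclideanSpace ℝ (Fin d)) : Prop where
  exchangeable : ∀ (n : ℕ) (σ : Equiv.Perm (Fin n)),
    P.map (fun ω i => Z n (σ i) 0 ω) = P.map (fun ω i => Z n i 0 ω)
  absolutelyContinuous : μ0 ≪ volume
  tendsto_pair : TendstoInDistribution
    (fun (n : ℕ) ω => (Z (n + 2) 0 0 ω, Z (n + 2) 1 0 ω)) atTop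
    (fun p : EuclideanSpace ℝ (Fin d) × EuclideanSpace ℝ (Fin d) => p)
    (fun _ => P) (μ0.prod μ0)

/-- Finiteness of all exponential moments of the noise and, in the limit superior, of the initial
opinions. -/
structure HasExponentialMoments {Ω : Type*} [MeasurableSpace Ω] (P : Measure Ω) {d : ℕ}
    (ξ : ℕ → ℕ → Ω → EuclideanSpace ℝ (Fin d))
    (Z : (n : ℕ) → Fin n → ℕ → Ω → EuclideanSpace ℝ (Fin d)) : Prop where
  initial : ∀ C : ℝ, limsup (fun n : ℕ =>
    ∫⁻ ω, ENNReal.ofReal (Real.exp (C * ‖Z (n + 1) 0 0 ω‖)) ∂P) atTop < ⊤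
  noise : ∀ C : ℝ, ∫⁻ ω, ENNReal.ofReal (Real.exp (C * ‖ξ 0 0 ω‖)) ∂P < ⊤

/-- The functions `B_s`, recursively defined by `B_s = p B(1, ·) + (1 - p) B(0, ·)` with
`p = B_{s-1}`. The value `B_s(z, w)` depends on the trajectories `z`, `w` up to time `s` only. -/
def trajProb {d : ℕ} (B0 : EuclideanSpace ℝ (Fin d) → EuclideanSpace ℝ (Fin d) → ℝ)
    (B : Bool → EuclideanSpace ℝ (Fin d) → EuclideanSpace ℝ (Fin d) → ℝ) :
    ℕ → (ℕ → EuclideanSpace ℝ (Fin d)) → (ℕ → EuclideanSpace ℝ (Fin d)) → ℝ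
  | 0, z, w => B0 (z 0) (w 0)
  | s + 1, z, w => trajProb B0 B s z w * B true (z (s + 1)) (w (s + 1)) +
      (1 - trajProb B0 B s z w) * B false (z (s + 1)) (w (s + 1))

/-- `E[B_s(z, Z')]` where the trajectory `Z'` has law `μ`. -/
noncomputable def meanFieldMass {d : ℕ}
    (B0 : EuclideanSpace ℝ (Fin d) → EuclideanSpace ℝ (Fin d) → ℝ)
    (B : Bool → EuclideanSpace ℝ (Fin d) → EuclideanSpace ℝ (Fin d) → ℝ) (s : ℕ)
    (μ : Measure (ℕ → EuclideanSpace ℝ (Fin d))) (z : ℕ → EuclideanSpace ℝ (Fin d)) : ℝ :=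
  ∫ w, trajProb B0 B s z w ∂μ

/-- The mean-field average `E[Z'(s) B_s(z, Z')] / E[B_s(z, Z')]` where `Z'` has law `μ`. If `Z`
and `Z'` are independent with law `μ`, then at `z = Z` it is the ratio of the conditional
expectations given `Z`. -/
noncomputable def meanFieldAverage {d : ℕ}
    (B0 : EuclideanSpace ℝ (Fin d) → EuclideanSpace ℝ (Fin d) → ℝ)
    (B : Bool → EuclideanSpace ℝ (Fin d) → EuclideanSpace ℝ (Fin d) → ℝ) (s : ℕ)
    (μ : Measure (ℕ → EuclideanSpace ℝ (Fin d))) (z : ℕ → EuclideanSpace ℝ (Fin d)) :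
    EuclideanSpace ℝ (Fin d) :=
  (meanFieldMass B0 B s μ z)⁻¹ • ∫ w, trajProb B0 B s z w • w s ∂μ

/-- `(Z, A)` is, up to the time `t`, a limiting mean-field process for `k` agents, with initial
law `μ0` and noise law `ν`. Processes are indexed by all of `ℕ`, but only the times up to `t` are
constrained. The edges `A i j` with `i > j` are determined by symmetry. -/
structure IsLimitingMeanField {Ω : Type*} [MeasurableSpace Ω] (P : Measure Ω) {d : ℕ} (γ : ℝ)
    (B0 : EuclideanSpace ℝ (Fin d) → EuclideanSpace ℝ (Fin d) → ℝ)
    (B : Bool → EuclideanSpace ℝ (Fin d) → EuclideanSpace ℝ (Fin d) → ℝ)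
    (μ0 ν : Measure (EuclideanSpace ℝ (Fin d))) (k t : ℕ)
    (ξ : Fin k → ℕ → Ω → EuclideanSpace ℝ (Fin d))
    (Z : Fin k → ℕ → Ω → EuclideanSpace ℝ (Fin d))
    (A : Fin k → Fin k → ℕ → Ω → Bool) : Prop where
  measurable_noise : ∀ i s, Measurable (ξ i s)
  measurable_opinion : ∀ i s, Measurable (Z i s)
  measurable_edge : ∀ i j s, Measurable (A i j s)
  init_indep : iIndepFun (fun i => Z i 0) P
  init_law : ∀ i, P.map (Z i 0) = μ0
  noise_indep : iIndepFun (fun p : Fin k × Fin (t + 1) => ξ p.1 p.2) P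
  noise_law : ∀ i, ∀ s ≤ t, P.map (ξ i s) = ν
  noise_indep_history : ∀ s ≤ t, Indep (⨆ i, MeasurableSpace.comap (ξ i s) inferInstance)
    (history Z A (s + 1) (s + 1)) P
  evolve : ∀ i, ∀ s < t, ∀ᵐ ω ∂P, Z i (s + 1) ω = (1 - γ) • Z i s ω +
    γ • meanFieldAverage B0 B s (P.map (fun ω' r => Z i r ω')) (fun r => Z i r ω) + ξ i s ω
  symm : ∀ i j, ∀ s ≤ t, ∀ᵐ ω ∂P, A i j s ω = A j i s ω
  diag : ∀ i, ∀ s ≤ t, ∀ᵐ ω ∂P, A i i s ω = true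
  edge_law : ∀ i j, ∀ s ≤ t, i < j →
    P⟦A i j s ⁻¹' {true} | history Z A (s + 1) s⟧ =ᵐ[P]
      fun ω => edgeProb B0 B s (fun r => Z i r ω) (fun r => Z j r ω) (fun r => A i j r ω)
  edge_condIndep : ∀ s ≤ t, MutuallyCondIndep P (history Z A (s + 1) s)
    (fun e : {e : Fin k × Fin k // e.1 < e.2} => A e.1.1 e.1.2 s)

/-- `m` is a uniform random sample with replacement of size `k` from `n` agents. -/
def IsSampleWithReplacement {Ω : Type*} [MeasurableSpace Ω] (P : Measure Ω) {k n : ℕ}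
    (m : Ω → Fin k → Fin n) : Prop :=
  P.map m = uniformOn Set.univ

/-- `m` is a uniform random sample without replacement of size `k` from `n` agents. -/
def IsSampleWithoutReplacement {Ω : Type*} [MeasurableSpace Ω] (P : Measure Ω) {k n : ℕ}
    (m : Ω → Fin k → Fin n) : Prop :=
  P.map m = uniformOn {f : Fin k → Fin n | Function.Injective f}

/-- The opinion trajectories and the adjacency trajectories up to time `t` of the agents
`m 0, …, m (k - 1)`. -/
def sampledTrajectory {Ω ι : Type*} {d k : ℕ} (t : ℕ)
    (Z : ι → ℕ → Ω → EuclideanSpace ℝ (Fin d)) (A : ι → ι → ℕ → Ω → Bool)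
    (m : Fin k → ι) (ω : Ω) :
    (Fin k → Fin (t + 1) → EuclideanSpace ℝ (Fin d)) ×
      (Fin k → Fin k → Fin (t + 1) → Bool) :=
  (fun i s => Z (m i) s ω, fun i j s => A (m i) (m j) s ω)

/-- The Borel structure of the space of sampled trajectories (found by unification, the default
instance search is too small for it). -/
instance sampledTrajectory_opensMeasurableSpace {d k t : ℕ} :
    OpensMeasurableSpace ((Fin k → Fin (t + 1) → EuclideanSpace ℝ (Fin d)) ×
      (Fin k → Fin k → Fin (t + 1) → Bool)) :=
  Prod.opensMeasurableSpace

/-! The proof is propagation of chaos by induction over time, tested on uniform samples. The law of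
the states of `k` agents drawn with replacement is the mixture `avgLaw` of the laws over all
`k`-tuples. The share of non-injective tuples tends to zero (`tendsto_avg_injective`), so identities
valid only for distinct agents suffice, and sampling without replacement has the same limit. At time
`0`, exchangeability and the convergence of pairs give a mean-square law of large numbers for the
empirical distribution, hence product limits for every `k` (`IsInitialCondition.weakTendsto`).

A time step has two halves. When the edges are drawn, a test function is replaced by its conditional
mean `edgeAverage`. This is continuous at almost every state of the limiting process, because there
two opinions have an absolutely continuous joint law, and the mapping theorem applies
(`SampleTendsto.edge_step`). When the opinions move, `SampleTendsto.opinion_step` averages over the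
noise and uses Slutsky's theorem; it needs that the local averages are close in probability to a
function of the agent's own trajectory, the mean-field average.

This closeness follows from the convergence of samples of size three. Averaged over `i`, the mean
square of `N⁻¹ ∑ j, A i j φ(Z j) - g(Z i)` is an average over triples `(i, j, l)` of inner products.
In the limiting process with three agents the trajectories are independent and, given them, two
edges of one agent are independent with probabilities `trajProb` (`integral_two_edges`), so the
limit of the average is zero (`integral_inner_edges_eq_zero`). The three-agent process is therefore
carried through the induction beside the `k`-agent one. Exponential moments justify truncating the
opinions, and the quotient is under control because the limiting mass is almost surely positive
(`ae_meanFieldMass_pos`).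

Exponential moments, averaged over the agents, propagate in time. With finite range a local average
stays within the range of the agent's own opinion. Otherwise Jensen's inequality bounds its
exponential by a sum over all agents divided by the degree, a second-moment estimate replaces the
inverse degree by the inverse of its conditional mean (`integral_mul_inv_degree_le`), and the
factorised lower bound on the edge probabilities closes the estimate by Cauchy–Schwarz and the power
mean inequality (`sum_mul_inv_le_sum_exp`).

Limiting processes are built from independent drivers, with thresholds for the edges
(`isLimitingMeanField_driven`). Uniqueness of the trajectory law needs no separate argument: two
limiting processes are limits of the same samples (`SampleTendsto.map_cutTraj_eq`). -/

open scoped Topology BoundedContinuousFunction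

/-! ### Weak convergence and the mapping theorem -/

section WeakConvergence

/-- Weak convergence of a sequence of measures, tested on bounded continuous functions. -/
def WeakTendsto {X : Type*} [TopologicalSpace X] [MeasurableSpace X]
    (μs : ℕ → Measure X) (μ : Measure X) : Prop :=
  ∀ f : X →ᵇ ℝ, Tendsto (fun n => ∫ x, f x ∂(μs n)) atTop (𝓝 (∫ x, f x ∂μ))

lemma weakTendsto_iff_tendsto_probabilityMeasure {X : Type*} [TopologicalSpace X]
    [MeasurableSpace X] [OpensMeasurableSpace X] {μs : ℕ → Measure X} {μ : Measure X}
    [hs : ∀ n, IsProbabilityMeasure (μs n)] [h : IsProbabilityMeasure μ] :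
    WeakTendsto μs μ ↔ Tendsto (β := ProbabilityMeasure X) (fun n => ⟨μs n, hs n⟩) atTop
      (𝓝 ⟨μ, h⟩) := by
  refine Iff.trans ?_ (ProbabilityMeasure.tendsto_iff_forall_integral_tendsto
    (μs := fun n => ⟨μs n, hs n⟩) (μ := ⟨μ, h⟩)).symm
  rfl

/-- The mapping theorem for bounded functions which are continuous almost everywhere. -/
theorem WeakTendsto.tendsto_integral_of_ae_continuousAt {X : Type*} [TopologicalSpace X]
    [MeasurableSpace X] [OpensMeasurableSpace X] [HasOuterApproxClosed X]
    {μs : ℕ → Measure X} {μ : Measure X} [∀ n, IsProbabilityMeasure (μs n)]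
    [IsProbabilityMeasure μ] (h : WeakTendsto μs μ) {f : X → ℝ} (hf : Measurable f) {C : ℝ}
    (hC : ∀ x, |f x| ≤ C) (hcont : ∀ᵐ x ∂μ, ContinuousAt f x) :
    Tendsto (fun n => ∫ x, f x ∂(μs n)) atTop (𝓝 (∫ x, f x ∂μ)) := by
  have hp : ∀ ν : Measure X, IsProbabilityMeasure ν → IsProbabilityMeasure (ν.map f) :=
    fun ν _ => Measure.isProbabilityMeasure_map hf.aemeasurable
  have hmap : Tendsto (β := ProbabilityMeasure ℝ) (fun n => ⟨(μs n).map f, hp _ inferInstance⟩)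
      atTop (𝓝 ⟨μ.map f, hp _ inferInstance⟩) := by
    refine tendsto_of_forall_isClosed_limsup_le' fun F hF => ?_
    have h1 := ProbabilityMeasure.limsup_measure_closed_le_of_tendsto
      (weakTendsto_iff_tendsto_probabilityMeasure.mp h) (isClosed_closure (s := f ⁻¹' F))
    simp only [ProbabilityMeasure.coe_mk] at h1 ⊢
    rw [Measure.map_apply hf hF.measurableSet]
    calc limsup (fun n => (μs n).map f F) atTop
        ≤ limsup (fun n => μs n (closure (f ⁻¹' F))) atTop := by
          refine limsup_le_limsup (Eventually.of_forall fun n => ?_)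
          change (μs n).map f F ≤ μs n (closure (f ⁻¹' F))
          rw [Measure.map_apply hf hF.measurableSet]
          exact measure_mono subset_closure
      _ ≤ μ (closure (f ⁻¹' F)) := h1
      _ ≤ μ (f ⁻¹' F) := by
          refine measure_mono_ae ?_
          -- A point of the closure of `f ⁻¹' F` at which `f` is continuous is mapped into the
          -- closure of `F`, which is `F`. So taking the closure adds only a null set.
          filter_upwards [hcont] with x hx hxF
          have := hx.continuousWithinAt (s := f ⁻¹' F)
          have h2 := this.mem_closure_image hxF
          exact (hF.closure_subset_iff.mpr (Set.image_preimage_subset f F)) h2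
  replace hmap := ProbabilityMeasure.tendsto_iff_forall_integral_tendsto.mp hmap
  -- Clamping makes the identity bounded without changing the values of `f`. The bound `|C|` avoids
  -- having to show `0 ≤ C`.
  let g : ℝ →ᵇ ℝ := BoundedContinuousFunction.ofNormedAddCommGroup
    (fun x : ℝ => max (-C) (min x C)) (by fun_prop) |C| (by
      intro x
      rw [Real.norm_eq_abs, abs_le]
      rcases le_or_gt 0 C with h0 | h0
      · rw [abs_of_nonneg h0]; simp [h0]
      · rw [abs_of_neg h0]
        refine ⟨?_, ?_⟩
        · have := le_max_left (-C) (min x C); linarith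
        · exact max_le le_rfl ((min_le_right _ _).trans (by linarith)))
  have hg : ∀ x, g (f x) = f x := by
    intro x
    have := abs_le.mp (hC x)
    change max (-C) (min (f x) C) = f x
    rw [min_eq_left this.2, max_eq_right this.1]
  have h3 := hmap g
  simp only [ProbabilityMeasure.coe_mk] at h3
  have key : ∀ ν : Measure X, ∫ x, g x ∂(ν.map f) = ∫ x, f x ∂ν := by
    intro ν
    rw [integral_map hf.aemeasurable g.continuous.aestronglyMeasurable]
    simp_rw [hg]
  simpa only [key] using h3

end WeakConvergence

/-! ### Averages over tuples of agents and mixtures of laws -/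

section Averages

/-- The average of a real function on a finite type. -/
noncomputable def avg {T : Type*} [Fintype T] (F : T → ℝ) : ℝ := (∑ t, F t) / Fintype.card T

variable {T : Type*} [Fintype T]

lemma avg_mono {F G : T → ℝ} (h : ∀ t, F t ≤ G t) : avg F ≤ avg G := by
  unfold avg; gcongr; exact h _

lemma avg_add (F G : T → ℝ) : avg (fun t => F t + G t) = avg F + avg G := by
  unfold avg; rw [Finset.sum_add_distrib, add_div]

lemma avg_sub (F G : T → ℝ) : avg (fun t => F t - G t) = avg F - avg G := by
  unfold avg; rw [Finset.sum_sub_distrib, sub_div]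

lemma avg_const_mul (c : ℝ) (F : T → ℝ) : avg (fun t => c * F t) = c * avg F := by
  unfold avg; rw [← Finset.mul_sum, mul_div_assoc]

lemma avg_const [Nonempty T] (c : ℝ) : avg (fun _ : T => c) = c := by
  unfold avg
  have : (Fintype.card T : ℝ) ≠ 0 := Nat.cast_ne_zero.mpr Fintype.card_ne_zero
  simp [this]

lemma avg_nonneg {F : T → ℝ} (h : ∀ t, 0 ≤ F t) : 0 ≤ avg F :=
  div_nonneg (Finset.sum_nonneg fun t _ => h t) (Nat.cast_nonneg _)

lemma abs_avg_le (F : T → ℝ) : |avg F| ≤ avg fun t => |F t| := by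
  unfold avg
  rw [abs_div, abs_of_nonneg (Nat.cast_nonneg (Fintype.card T) : (0 : ℝ) ≤ _)]
  gcongr
  exact Finset.abs_sum_le_sum_abs _ _

lemma avg_sum {κ : Type*} (s : Finset κ) (F : κ → T → ℝ) :
    avg (fun t => ∑ i ∈ s, F i t) = ∑ i ∈ s, avg (F i) := by
  unfold avg
  rw [Finset.sum_comm, Finset.sum_div]

lemma avg_equiv {T' : Type*} [Fintype T'] (e : T ≃ T') (F : T' → ℝ) :
    avg (fun t => F (e t)) = avg F := by
  unfold avg
  rw [Fintype.card_congr e, e.sum_comp]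

lemma avg_prod {T' : Type*} [Fintype T'] (F : T × T' → ℝ) :
    avg F = avg fun t => avg fun t' => F (t, t') := by
  unfold avg
  rw [Fintype.card_prod, Fintype.sum_prod_type, ← Finset.sum_div, div_div]
  push_cast
  rw [mul_comm (Fintype.card T : ℝ)]

/-- Peeling off one coordinate at a time turns an average over triples into the iterated averages
that arise when a square is expanded. -/
lemma avg_fin_succ {α : Type*} [Fintype α] {n : ℕ} (F : (Fin (n + 1) → α) → ℝ) :
    avg F = avg fun a : α => avg fun m : Fin n → α => F (Fin.cons (α := fun _ => α) a m) := by
  rw [← avg_equiv (Fin.consEquiv fun _ => α) F, avg_prod]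
  rfl

lemma avg_fin_zero {α : Type*} [Fintype α] (F : (Fin 0 → α) → ℝ) : avg F = F Fin.elim0 := by
  unfold avg
  simp [Subsingleton.elim (default : Fin 0 → α) Fin.elim0]

/-- The average over tuples of a function of one coordinate. -/
lemma avg_eval {α : Type*} [Fintype α] [Nonempty α] {n : ℕ} (i : Fin n) (G : α → ℝ) :
    avg (fun m : Fin n → α => G (m i)) = avg G := by
  induction n with
  | zero => exact i.elim0
  | succ n ih =>
    rw [avg_fin_succ]
    refine Fin.cases ?_ (fun j => ?_) i
    · simp only [Fin.cons_zero]
      congr 1; ext a; rw [avg_const]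
    · simp only [Fin.cons_succ]
      rw [ih j, avg_const]

/-- At least `(n + 1 - k) ^ k` of the `(n + 1) ^ k` tuples are injective, a share of at least `(1 -
k / (n + 1)) ^ k`, which tends to one. Hence repeated agents in a sample never matter in the limit.
-/
lemma tendsto_avg_injective (k : ℕ) :
    Tendsto (fun n : ℕ => avg fun m : Fin k → Fin (n + 1) =>
      if Function.Injective m then (0 : ℝ) else 1) atTop (𝓝 0) := by
  classical
  have hcard : ∀ n : ℕ, (avg fun m : Fin k → Fin (n + 1) =>
      if Function.Injective m then (0 : ℝ) else 1) =
      1 - ((n + 1).descFactorial k : ℝ) / ((n + 1 : ℕ) : ℝ) ^ k := by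
    intro n
    have h1 : (avg fun m : Fin k → Fin (n + 1) => if Function.Injective m then (0 : ℝ) else 1) =
        avg (fun _ : Fin k → Fin (n + 1) => (1 : ℝ)) - avg fun m : Fin k → Fin (n + 1) =>
          if Function.Injective m then (1 : ℝ) else 0 := by
      rw [← avg_sub]
      congr 1; ext m; split_ifs <;> simp
    rw [h1, avg_const]
    congr 1
    unfold avg
    rw [Finset.sum_boole]
    have h2 : (Finset.univ.filter fun m : Fin k → Fin (n + 1) => Function.Injective m).card =
        (n + 1).descFactorial k := by
      rw [← Fintype.card_subtype]
      rw [Fintype.card_congr (Equiv.subtypeInjectiveEquivEmbedding (Fin k) (Fin (n + 1)))]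
      simp
    rw [h2]
    simp
  simp_rw [hcard]
  have hlow : ∀ᶠ n : ℕ in atTop, (1 - (k : ℝ) / ((n + 1 : ℕ) : ℝ)) ^ k ≤
      ((n + 1).descFactorial k : ℝ) / ((n + 1 : ℕ) : ℝ) ^ k := by
    filter_upwards [eventually_ge_atTop k] with n hn
    have h := Nat.pow_sub_le_descFactorial (n + 1) k
    have hpos : (0 : ℝ) < ((n + 1 : ℕ) : ℝ) := by positivity
    rw [le_div_iff₀ (by positivity), ← mul_pow, sub_mul, div_mul_cancel₀ _ hpos.ne', one_mul]
    have h' : ((n + 1 - k : ℕ) : ℝ) ^ k ≤ ((n + 1).descFactorial k : ℝ) := by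
      refine le_trans ?_ (Nat.cast_le.mpr h)
      push_cast
      gcongr
      omega
    rwa [Nat.cast_sub (by omega)] at h'
  have hupp : ∀ n : ℕ, ((n + 1).descFactorial k : ℝ) / ((n + 1 : ℕ) : ℝ) ^ k ≤ 1 := by
    intro n
    rw [div_le_one (by positivity)]
    exact_mod_cast Nat.descFactorial_le_pow (n + 1) k
  have h0 : Tendsto (fun n : ℕ => (1 - (k : ℝ) / ((n + 1 : ℕ) : ℝ)) ^ k) atTop (𝓝 1) := by
    have : Tendsto (fun n : ℕ => (k : ℝ) / ((n + 1 : ℕ) : ℝ)) atTop (𝓝 0) :=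
      (tendsto_const_div_atTop_nhds_zero_nat (k : ℝ)).comp (tendsto_add_atTop_nat 1)
    simpa using ((tendsto_const_nhds (x := (1 : ℝ))).sub this).pow k
  have h1 : Tendsto (fun n : ℕ => ((n + 1).descFactorial k : ℝ) / ((n + 1 : ℕ) : ℝ) ^ k) atTop
      (𝓝 1) :=
    tendsto_of_tendsto_of_tendsto_of_le_of_le' h0 tendsto_const_nhds hlow
      (Eventually.of_forall hupp)
  simpa using (tendsto_const_nhds (x := (1 : ℝ))).sub h1

/-- Functions of `k`-tuples which agree on injective tuples have asymptotically the same
average. -/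
lemma tendsto_avg_sub_of_eq_on_injective {k : ℕ} {F G : (n : ℕ) → (Fin k → Fin (n + 1)) → ℝ}
    {C : ℝ} (hF : ∀ n m, |F n m| ≤ C) (hG : ∀ n m, |G n m| ≤ C)
    (h : ∀ n m, Function.Injective m → F n m = G n m) :
    Tendsto (fun n => avg (F n) - avg (G n)) atTop (𝓝 0) := by
  have h1 : Tendsto (fun n : ℕ => 2 * C * avg fun m : Fin k → Fin (n + 1) =>
      if Function.Injective m then (0 : ℝ) else 1) atTop (𝓝 0) := by
    simpa using (tendsto_avg_injective k).const_mul (2 * C)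
  refine squeeze_zero_norm (fun n => ?_) h1
  rw [← avg_sub, ← avg_const_mul]
  refine (abs_avg_le _).trans (avg_mono fun m => ?_)
  split_ifs with hm
  · simp [h n m hm]
  · have := abs_sub (F n m) (G n m)
    linarith [hF n m, hG n m]

lemma integral_avg {Ω : Type*} [MeasurableSpace Ω] {P : Measure Ω} {F : T → Ω → ℝ}
    (hF : ∀ t, Integrable (F t) P) : ∫ ω, avg (fun t => F t ω) ∂P = avg fun t => ∫ ω, F t ω ∂P := by
  unfold avg
  rw [integral_div, integral_finsetSum _ fun t _ => hF t]

lemma integrable_avg {Ω : Type*} [MeasurableSpace Ω] {P : Measure Ω} {F : T → Ω → ℝ}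
    (hF : ∀ t, Integrable (F t) P) : Integrable (fun ω => avg fun t => F t ω) P :=
  (integrable_finsetSum _ fun t _ => hF t).div_const _

/-- The mixture with equal weights of the laws of finitely many random elements. -/
noncomputable def avgLaw {Ω X : Type*} [MeasurableSpace Ω] [MeasurableSpace X] (P : Measure Ω)
    (W : T → Ω → X) : Measure X :=
  (Fintype.card T : ENNReal)⁻¹ • ∑ t, P.map (W t)

lemma isProbabilityMeasure_avgLaw {Ω X : Type*} [MeasurableSpace Ω] [MeasurableSpace X]
    [Nonempty T] {P : Measure Ω} [IsProbabilityMeasure P] {W : T → Ω → X}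
    (hW : ∀ t, Measurable (W t)) : IsProbabilityMeasure (avgLaw P W) := by
  constructor
  unfold avgLaw
  have : ∀ t, P.map (W t) Set.univ = 1 := fun t => by
    rw [Measure.map_apply (hW t) MeasurableSet.univ]; simp
  simp only [Measure.smul_apply, Measure.coe_finsetSum, Finset.sum_apply, this, Finset.sum_const,
    Finset.card_univ, nsmul_eq_mul, mul_one, smul_eq_mul]
  exact ENNReal.inv_mul_cancel (by simp) (by simp)

lemma integral_avgLaw {Ω X : Type*} [MeasurableSpace Ω] [MeasurableSpace X]
    {P : Measure Ω} [IsProbabilityMeasure P] {W : T → Ω → X}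
    (hW : ∀ t, Measurable (W t)) {f : X → ℝ} (hf : Measurable f) {C : ℝ} (hC : ∀ x, |f x| ≤ C) :
    ∫ x, f x ∂(avgLaw P W) = avg fun t => ∫ ω, f (W t ω) ∂P := by
  unfold avgLaw avg
  have hp : ∀ t, IsProbabilityMeasure (P.map (W t)) := fun t =>
    Measure.isProbabilityMeasure_map (hW t).aemeasurable
  rw [integral_smul_measure, integral_finsetSum_measure]
  · simp_rw [integral_map (hW _).aemeasurable hf.aestronglyMeasurable]
    simp [div_eq_inv_mul]
  · intro t _
    exact Integrable.of_bound hf.aestronglyMeasurable C (Eventually.of_forall hC)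

end Averages

/-! ### Slutsky's theorem and integration over independent elements -/

section Slutsky

/-- Slutsky's theorem for mixtures of laws: a perturbation which tends to zero in probability
does not change the limit in distribution. -/
theorem WeakTendsto.prodMk_of_tendsto_zero {Ω X G : Type*} [MeasurableSpace Ω] {P : Measure Ω}
    [IsProbabilityMeasure P] [TopologicalSpace X] [TopologicalSpace.PseudoMetrizableSpace X]
    [SecondCountableTopology X] [MeasurableSpace X] [BorelSpace X]
    [NormedAddCommGroup G] [SecondCountableTopology G] [MeasurableSpace G] [BorelSpace G]
    {T : ℕ → Type*} [∀ n, Fintype (T n)] [∀ n, Nonempty (T n)]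
    {W : ∀ n, T n → Ω → X} {ε : ∀ n, T n → Ω → G} (hW : ∀ n t, Measurable (W n t))
    (hε : ∀ n t, Measurable (ε n t)) {μ : Measure X} [IsProbabilityMeasure μ]
    (h : WeakTendsto (fun n => avgLaw P (W n)) μ)
    (h0 : Tendsto (fun n => avg fun t => ∫ ω, min 1 ‖ε n t ω‖ ∂P) atTop (𝓝 0)) :
    WeakTendsto (fun n => avgLaw P fun t ω => (W n t ω, ε n t ω))
      (μ.map fun x => (x, (0 : G))) := by
  let := TopologicalSpace.pseudoMetrizableSpacePseudoMetric X
  have hpair : ∀ n t, Measurable fun ω => (W n t ω, ε n t ω) :=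
    fun n t => (hW n t).prodMk (hε n t)
  have h00 : Measurable fun x : X => (x, (0 : G)) := by fun_prop
  have : ∀ n, IsProbabilityMeasure (avgLaw P fun t ω => (W n t ω, ε n t ω)) :=
    fun n => isProbabilityMeasure_avgLaw (hpair n)
  have : IsProbabilityMeasure (μ.map fun x => (x, (0 : G))) :=
    Measure.isProbabilityMeasure_map h00.aemeasurable
  rw [weakTendsto_iff_tendsto_probabilityMeasure]
  -- Bounded Lipschitz test functions suffice, and for these the effect of the perturbation is
  -- quantitative.
  refine tendsto_iff_forall_lipschitz_integral_tendsto.mpr ?_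
  rintro f ⟨C, hC⟩ ⟨L, hL⟩
  obtain ⟨x0⟩ : Nonempty X := by
    by_contra hne
    rw [not_nonempty_iff] at hne
    have := measure_univ (μ := μ)
    rw [Measure.eq_zero_of_isEmpty μ] at this
    simp at this
  have hfc : Continuous f := hL.continuous
  have hfm : Measurable f := hfc.measurable
  have hfb : ∀ p, |f p| ≤ |f (x0, 0)| + C := fun p => by
    have h1 := hC p (x0, 0)
    rw [Real.dist_eq] at h1
    have := abs_sub_abs_le_abs_sub (f p) (f (x0, 0))
    linarith
  have hf0b : ∀ x, |f (x, 0)| ≤ |f (x0, 0)| + C := fun x => hfb _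
  have hC0 : 0 ≤ C := dist_nonneg.trans (hC (x0, 0) (x0, 0))
  change Tendsto (fun n => ∫ p, f p ∂(avgLaw P fun t ω => (W n t ω, ε n t ω))) atTop
    (𝓝 (∫ p, f p ∂(μ.map fun x => (x, (0 : G)))))
  rw [integral_map h00.aemeasurable hfm.aestronglyMeasurable]
  let g : X →ᵇ ℝ := BoundedContinuousFunction.ofNormedAddCommGroup
    (fun x => f (x, 0)) (by fun_prop) (|f (x0, 0)| + C) hf0b
  have hg := h g
  change Tendsto (fun n => ∫ x, f (x, 0) ∂(avgLaw P (W n))) atTop (𝓝 (∫ x, f (x, 0) ∂μ)) at hg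
  have hdiff : Tendsto (fun n => (∫ p, f p ∂(avgLaw P fun t ω => (W n t ω, ε n t ω))) -
      ∫ x, f (x, 0) ∂(avgLaw P (W n))) atTop (𝓝 0) := by
    -- The change `|f (w, e) - f (w, 0)|` is at most `C`, the bound on the oscillation, and at most
    -- `L * ‖e‖`; so it is at most `(C + L) * min 1 ‖e‖`.
    refine squeeze_zero_norm (fun n => ?_) (by simpa using h0.const_mul (C + L))
    rw [integral_avgLaw (hpair n) hfm hfb,
      integral_avgLaw (hW n) (f := fun x => f (x, 0)) (by fun_prop) hf0b, ← avg_sub,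
      ← avg_const_mul]
    refine (abs_avg_le _).trans (avg_mono fun t => ?_)
    have i1 : Integrable (fun ω => f (W n t ω, ε n t ω)) P :=
      Integrable.of_bound (hfm.comp (hpair n t)).aestronglyMeasurable _
        (Eventually.of_forall fun _ => hfb _)
    have i2 : Integrable (fun ω => f (W n t ω, 0)) P :=
      Integrable.of_bound (hfm.comp ((hW n t).prodMk measurable_const)).aestronglyMeasurable _
        (Eventually.of_forall fun _ => hfb _)
    have i3 : Integrable (fun ω => min 1 ‖ε n t ω‖) P :=
      Integrable.of_bound (measurable_const.min (hε n t).norm).aestronglyMeasurable 1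
        (Eventually.of_forall fun ω => by
          rw [Real.norm_of_nonneg (le_min zero_le_one (norm_nonneg _))]
          exact min_le_left _ _)
    rw [← integral_sub i1 i2, ← integral_const_mul]
    refine (abs_integral_le_integral_abs).trans
      (integral_mono (i1.sub i2).abs (i3.const_mul _) fun ω => ?_)
    have h1 := hC (W n t ω, ε n t ω) (W n t ω, 0)
    have h2 := hL.dist_le_mul (W n t ω, ε n t ω) (W n t ω, 0)
    rw [Real.dist_eq] at h1 h2
    have h3 : dist (W n t ω, ε n t ω) (W n t ω, (0 : G)) = ‖ε n t ω‖ := by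
      rw [Prod.dist_eq]; simp
    rw [h3] at h2
    change |f (W n t ω, ε n t ω) - f (W n t ω, 0)| ≤ (C + L) * min 1 ‖ε n t ω‖
    rcases le_total 1 ‖ε n t ω‖ with h4 | h4
    · rw [min_eq_left h4]; linarith [L.2]
    · rw [min_eq_right h4]
      have : 0 ≤ C * ‖ε n t ω‖ := by positivity
      linarith
  simpa using hdiff.add hg

/-- Integration of a function of two independent random elements. -/
lemma integral_eq_integral_integral_of_indepFun {Ω α β : Type*} [MeasurableSpace Ω]
    [MeasurableSpace α] [MeasurableSpace β] {P : Measure Ω} [IsProbabilityMeasure P]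
    {W : Ω → α} {ξ : Ω → β} (hW : Measurable W) (hξ : Measurable ξ) (h : IndepFun W ξ P)
    {f : α × β → ℝ} (hf : Measurable f) {C : ℝ} (hC : ∀ x, |f x| ≤ C) :
    ∫ ω, f (W ω, ξ ω) ∂P = ∫ ω, ∫ v, f (W ω, v) ∂(P.map ξ) ∂P := by
  have h1 := (indepFun_iff_map_prod_eq_prod_map_map hW.aemeasurable hξ.aemeasurable).mp h
  have := Measure.isProbabilityMeasure_map (μ := P) hW.aemeasurable
  have := Measure.isProbabilityMeasure_map (μ := P) hξ.aemeasurable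
  have hi : Integrable f ((P.map W).prod (P.map ξ)) :=
    Integrable.of_bound hf.aestronglyMeasurable C (Eventually.of_forall hC)
  have hpair : Measurable fun ω => (W ω, ξ ω) := hW.prodMk hξ
  rw [← integral_map (φ := fun ω => (W ω, ξ ω)) hpair.aemeasurable hf.aestronglyMeasurable,
    h1, integral_prod f hi, integral_map hW.aemeasurable]
  exact hf.stronglyMeasurable.integral_prod_right'.aestronglyMeasurable

end Slutsky

/-! ### Integrals against conditionally independent bits -/

section EdgeLaw

/-- The probability that a random bit which is `true` with probability `p` has the value `b`. -/
def bitWeight (p : ℝ) (b : Bool) : ℝ := if b then p else 1 - p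

lemma bitWeight_mem {p : ℝ} (hp : p ∈ Set.Icc (0 : ℝ) 1) (b : Bool) :
    bitWeight p b ∈ Set.Icc (0 : ℝ) 1 := by
  obtain ⟨h0, h1⟩ := hp
  cases b <;> simp [bitWeight] <;> constructor <;> linarith

lemma sum_bitWeight (p : ℝ) : ∑ b, bitWeight p b = 1 := by
  simp [bitWeight]

lemma measurable_bitWeight (b : Bool) : Measurable fun p => bitWeight p b := by
  cases b
  · simp only [bitWeight, Bool.false_eq_true, if_false]; fun_prop
  · simp only [bitWeight, if_true]; fun_prop

/-- Integration against products of indicators of conditionally independent bits. -/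
lemma MutuallyCondIndep.integral_mul_prod {Ω ι : Type*} {m : MeasurableSpace Ω}
    [mΩ : MeasurableSpace Ω] {P : Measure Ω} [IsProbabilityMeasure P] (hm : m ≤ mΩ) {X : ι → Ω → Bool}
    (hX : ∀ e, Measurable (X e)) (h : MutuallyCondIndep P m X) {q : ι → Ω → ℝ}
    (hq : ∀ e, P⟦X e ⁻¹' {true} | m⟧ =ᵐ[P] q e) (S : Finset ι) (b : ι → Bool) {V : Ω → ℝ}
    (hV : Measurable[m] V) {C : ℝ} (hC : ∀ ω, |V ω| ≤ C) :
    ∫ ω, V ω * ∏ e ∈ S, (if X e ω = b e then (1 : ℝ) else 0) ∂P =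
      ∫ ω, V ω * ∏ e ∈ S, bitWeight (q e ω) (b e) ∂P := by
  have hq' : ∀ e, P⟦X e ⁻¹' {b e} | m⟧ =ᵐ[P] fun ω => bitWeight (q e ω) (b e) := by
    intro e
    cases hb : b e with
    | true => simpa [bitWeight] using hq e
    | false =>
      have h1 : (X e ⁻¹' {false}).indicator (fun _ => (1 : ℝ)) =
          (fun _ => (1 : ℝ)) - (X e ⁻¹' {true}).indicator (fun _ => (1 : ℝ)) := by
        ext ω
        by_cases hω : X e ω = true <;> simp [Set.indicator, hω]
      have hi : Integrable ((X e ⁻¹' {true}).indicator fun _ => (1 : ℝ)) P :=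
        (integrable_const 1).indicator (hX e (measurableSet_singleton _))
      rw [h1]
      have h2 := condExp_sub (integrable_const (1 : ℝ)) hi m
      filter_upwards [h2, hq e] with ω h2 h3
      rw [h2, Pi.sub_apply, h3, condExp_const hm]
      simp [bitWeight]
  have hprod : P⟦⋂ e ∈ S, X e ⁻¹' {b e} | m⟧ =ᵐ[P]
      fun ω => ∏ e ∈ S, bitWeight (q e ω) (b e) := by
    refine (h S b).trans ?_
    have : ∀ᵐ ω ∂P, ∀ e ∈ S, (P⟦X e ⁻¹' {b e} | m⟧) ω = bitWeight (q e ω) (b e) := by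
      rw [Finset.eventually_all]
      exact fun e _ => hq' e
    filter_upwards [this] with ω hω
    rw [Finset.prod_apply]
    exact Finset.prod_congr rfl hω
  have hset : MeasurableSet (⋂ e ∈ S, X e ⁻¹' {b e}) :=
    Finset.measurableSet_biInter _ fun e _ => hX e (measurableSet_singleton _)
  have hind : ∀ ω, ∏ e ∈ S, (if X e ω = b e then (1 : ℝ) else 0) =
      (⋂ e ∈ S, X e ⁻¹' {b e}).indicator (fun _ => (1 : ℝ)) ω := by
    intro ω
    rw [Finset.prod_ite_zero]
    simp [Set.indicator]
  simp_rw [hind]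
  have hi : Integrable ((⋂ e ∈ S, X e ⁻¹' {b e}).indicator fun _ => (1 : ℝ)) P :=
    (integrable_const 1).indicator hset
  have hVs : StronglyMeasurable[m] V := hV.stronglyMeasurable
  have hprodi : Integrable (V * (⋂ e ∈ S, X e ⁻¹' {b e}).indicator fun _ => (1 : ℝ)) P :=
    hi.bdd_mul (hV.mono hm le_rfl).aestronglyMeasurable (Eventually.of_forall hC)
  -- The factor `V` is `m`-measurable, so it leaves the conditional expectation, and the integral
  -- sees the indicator only through its conditional probability.
  have h1 := condExp_mul_of_stronglyMeasurable_left hVs hprodi hi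
  have h2 := integral_condExp (μ := P) hm
    (f := V * (⋂ e ∈ S, X e ⁻¹' {b e}).indicator fun _ => (1 : ℝ))
  change ∫ ω, (V * (⋂ e ∈ S, X e ⁻¹' {b e}).indicator fun _ => (1 : ℝ)) ω ∂P = _
  rw [← h2]
  refine integral_congr_ae ?_
  filter_upwards [h1, hprod] with ω h1 h3
  rw [h1, Pi.mul_apply, h3]

end EdgeLaw

/-! ### Trajectories cut at a time, so that one state space serves all times -/

section Cut

variable {α : Type*} [Inhabited α]

/-- The trajectory `z` before time `p`, continued by a default value. -/
def cutTraj (p : ℕ) (z : ℕ → α) : ℕ → α := fun r => if r < p then z r else default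

lemma cutTraj_apply_of_lt {p r : ℕ} (h : r < p) (z : ℕ → α) : cutTraj p z r = z r := by
  simp [cutTraj, h]

lemma cutTraj_succ (p : ℕ) (z : ℕ → α) :
    cutTraj (p + 1) z = Function.update (cutTraj p z) p (z p) := by
  ext r
  rcases lt_trichotomy r p with h | h | h
  · simp [cutTraj, h, h.ne, Nat.lt_succ_of_lt h]
  · subst h; simp [cutTraj]
  · simp [cutTraj, h.ne', not_lt.mpr h.le, show ¬ r < p + 1 by omega]

lemma cutTraj_congr {p : ℕ} {z w : ℕ → α} (h : ∀ r < p, z r = w r) :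
    cutTraj p z = cutTraj p w := by
  ext r
  unfold cutTraj
  split_ifs with hr
  · exact h r hr
  · rfl

@[fun_prop]
lemma continuous_cutTraj [TopologicalSpace α] (p : ℕ) :
    Continuous (cutTraj p : (ℕ → α) → ℕ → α) := by
  refine continuous_pi fun r => ?_
  unfold cutTraj
  split_ifs <;> fun_prop

@[fun_prop]
lemma measurable_cutTraj [MeasurableSpace α] (p : ℕ) :
    Measurable (cutTraj p : (ℕ → α) → ℕ → α) := by
  refine measurable_pi_lambda _ fun r => ?_
  unfold cutTraj
  split_ifs <;> fun_prop

end Cut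

/-! ### Edge probabilities: dependence on the past, bounds, measurability -/

section EdgeProb

variable {d : ℕ} {B0 : EuclideanSpace ℝ (Fin d) → EuclideanSpace ℝ (Fin d) → ℝ}
  {B : Bool → EuclideanSpace ℝ (Fin d) → EuclideanSpace ℝ (Fin d) → ℝ}

lemma edgeProb_congr {s : ℕ} {z z' w w' : ℕ → EuclideanSpace ℝ (Fin d)} {a a' : ℕ → Bool}
    (hz : ∀ r ≤ s, z r = z' r) (hw : ∀ r ≤ s, w r = w' r) (ha : ∀ r < s, a r = a' r) :
    edgeProb B0 B s z w a = edgeProb B0 B s z' w' a' := by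
  cases s with
  | zero => simp [edgeProb, hz, hw]
  | succ s => simp [edgeProb, hz (s + 1) le_rfl, hw (s + 1) le_rfl, ha s (Nat.lt_succ_self s)]

lemma trajProb_congr {s : ℕ} {z z' w w' : ℕ → EuclideanSpace ℝ (Fin d)}
    (hz : ∀ r ≤ s, z r = z' r) (hw : ∀ r ≤ s, w r = w' r) :
    trajProb B0 B s z w = trajProb B0 B s z' w' := by
  induction s with
  | zero => simp [trajProb, hz, hw]
  | succ s ih =>
    simp only [trajProb, hz (s + 1) le_rfl, hw (s + 1) le_rfl,
      ih (fun r hr => hz r (by omega)) (fun r hr => hw r (by omega))]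

lemma edgeProb_mem (hB : IsInteractionPair B0 B) (s : ℕ) (z w : ℕ → EuclideanSpace ℝ (Fin d))
    (a : ℕ → Bool) : edgeProb B0 B s z w a ∈ Set.Icc (0 : ℝ) 1 := by
  cases s with
  | zero => exact hB.mem_zero _ _
  | succ s => exact hB.mem_succ _ _ _

lemma trajProb_mem (hB : IsInteractionPair B0 B) (s : ℕ) (z w : ℕ → EuclideanSpace ℝ (Fin d)) :
    trajProb B0 B s z w ∈ Set.Icc (0 : ℝ) 1 := by
  induction s with
  | zero => exact hB.mem_zero _ _
  | succ s ih =>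
    obtain ⟨h0, h1⟩ := ih
    obtain ⟨h2, h3⟩ := hB.mem_succ true (z (s + 1)) (w (s + 1))
    obtain ⟨h4, h5⟩ := hB.mem_succ false (z (s + 1)) (w (s + 1))
    constructor
    · simp only [trajProb]
      exact add_nonneg (mul_nonneg h0 h2) (mul_nonneg (by linarith) h4)
    · simp only [trajProb]
      nlinarith

/-- This is the law of total probability over the value of the edge one step earlier. -/
lemma bitWeight_trajProb_succ (s : ℕ) (z w : ℕ → EuclideanSpace ℝ (Fin d)) (b : Bool) :
    bitWeight (trajProb B0 B (s + 1) z w) b =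
      ∑ a, bitWeight (trajProb B0 B s z w) a * bitWeight (B a (z (s + 1)) (w (s + 1))) b := by
  cases b <;> simp only [bitWeight, trajProb, Fintype.sum_bool] <;> simp <;> ring

lemma measurable_of_bool_prod {α β : Type*} [MeasurableSpace α] [MeasurableSpace β]
    {f : Bool × α → β} (h : ∀ b, Measurable fun x => f (b, x)) : Measurable f :=
  measurable_from_prod_countable_right h

lemma measurable_edgeProb (hB : IsInteractionPair B0 B) (s : ℕ) :
    Measurable fun p : (ℕ → EuclideanSpace ℝ (Fin d)) × (ℕ → EuclideanSpace ℝ (Fin d)) ×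
      (ℕ → Bool) => edgeProb B0 B s p.1 p.2.1 p.2.2 := by
  cases s with
  | zero =>
    exact hB.measurable_zero.comp (f := fun p : (ℕ → EuclideanSpace ℝ (Fin d)) ×
      (ℕ → EuclideanSpace ℝ (Fin d)) × (ℕ → Bool) => (p.1 0, p.2.1 0)) (by fun_prop)
  | succ s =>
    have h : Measurable fun p : Bool × (EuclideanSpace ℝ (Fin d) × EuclideanSpace ℝ (Fin d)) =>
        B p.1 p.2.1 p.2.2 := measurable_of_bool_prod fun b => hB.measurable_succ b
    exact h.comp (f := fun p : (ℕ → EuclideanSpace ℝ (Fin d)) × (ℕ → EuclideanSpace ℝ (Fin d)) ×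
      (ℕ → Bool) => (p.2.2 s, (p.1 (s + 1), p.2.1 (s + 1)))) (by fun_prop)

lemma measurable_trajProb (hB : IsInteractionPair B0 B) (s : ℕ) :
    Measurable fun p : (ℕ → EuclideanSpace ℝ (Fin d)) × (ℕ → EuclideanSpace ℝ (Fin d)) =>
      trajProb B0 B s p.1 p.2 := by
  induction s with
  | zero =>
    exact hB.measurable_zero.comp (f := fun p : (ℕ → EuclideanSpace ℝ (Fin d)) ×
      (ℕ → EuclideanSpace ℝ (Fin d)) => (p.1 0, p.2 0)) (by fun_prop)
  | succ s ih =>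
    have h : ∀ b, Measurable fun p : (ℕ → EuclideanSpace ℝ (Fin d)) ×
        (ℕ → EuclideanSpace ℝ (Fin d)) => B b (p.1 (s + 1)) (p.2 (s + 1)) := fun b =>
      (hB.measurable_succ b).comp (f := fun p : (ℕ → EuclideanSpace ℝ (Fin d)) ×
      (ℕ → EuclideanSpace ℝ (Fin d)) => (p.1 (s + 1), p.2 (s + 1))) (by fun_prop)
    simp only [trajProb]
    exact (ih.mul (h true)).add ((measurable_const.sub ih).mul (h false))

end EdgeProb

/-! ### States of finitely many agents, and averaging over the edges -/

section State

/-- Opinion and edge trajectories of `k` agents. -/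
abbrev TrajState (k d : ℕ) : Type :=
  (Fin k → ℕ → EuclideanSpace ℝ (Fin d)) × (Fin k → Fin k → ℕ → Bool)

instance borelSpace_trajState {k d : ℕ} : BorelSpace (TrajState k d) :=
  have : BorelSpace (Fin k → Fin k → ℕ → Bool) := Pi.borelSpace
  Prod.borelSpace

/-- The (unordered, off-diagonal) pairs of `k` agents. -/
abbrev EdgeIdx (k : ℕ) : Type := {e : Fin k × Fin k // e.1 < e.2}

variable {Ω : Type*} {d k : ℕ}

/-- The opinions before time `p` and the edges before time `q`, as a random element. -/
def procState (p q : ℕ) (Z : Fin k → ℕ → Ω → EuclideanSpace ℝ (Fin d))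
    (A : Fin k → Fin k → ℕ → Ω → Bool) (ω : Ω) : TrajState k d :=
  (fun i => cutTraj p fun r => Z i r ω, fun i j => cutTraj q fun r => A i j r ω)

lemma measurable_opinion_history {ι : Type*} {Z : ι → ℕ → Ω → EuclideanSpace ℝ (Fin d)}
    {A : ι → ι → ℕ → Ω → Bool} {p q r : ℕ} (hr : r < p) (i : ι) :
    Measurable[history Z A p q] (Z i r) := by
  rw [measurable_iff_comap_le]
  exact le_sup_of_le_left (le_iSup_of_le i (le_iSup_of_le r (le_iSup_of_le hr le_rfl)))

lemma measurable_edge_history {ι : Type*} {Z : ι → ℕ → Ω → EuclideanSpace ℝ (Fin d)}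
    {A : ι → ι → ℕ → Ω → Bool} {p q r : ℕ} (hr : r < q) (i j : ι) :
    Measurable[history Z A p q] (A i j r) := by
  rw [measurable_iff_comap_le]
  exact le_sup_of_le_right
    (le_iSup_of_le i (le_iSup_of_le j (le_iSup_of_le r (le_iSup_of_le hr le_rfl))))

lemma history_le_iff {ι : Type*} {Z : ι → ℕ → Ω → EuclideanSpace ℝ (Fin d)}
    {A : ι → ι → ℕ → Ω → Bool} {p q : ℕ} {m : MeasurableSpace Ω} :
    history Z A p q ≤ m ↔ (∀ i, ∀ r < p, Measurable[m] (Z i r)) ∧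
      ∀ i j, ∀ r < q, Measurable[m] (A i j r) := by
  simp only [history, sup_le_iff, iSup_le_iff, measurable_iff_comap_le]

lemma history_le {ι : Type*} [mΩ : MeasurableSpace Ω] {Z : ι → ℕ → Ω → EuclideanSpace ℝ (Fin d)}
    {A : ι → ι → ℕ → Ω → Bool} (hZ : ∀ i s, Measurable (Z i s))
    (hA : ∀ i j s, Measurable (A i j s)) (p q : ℕ) : history Z A p q ≤ mΩ :=
  history_le_iff.mpr ⟨fun i r _ => hZ i r, fun i j r _ => hA i j r⟩

lemma history_comp_le {ι κ : Type*} {Z : ι → ℕ → Ω → EuclideanSpace ℝ (Fin d)}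
    {A : ι → ι → ℕ → Ω → Bool} (m : κ → ι) (p q : ℕ) :
    history (fun i => Z (m i)) (fun i j => A (m i) (m j)) p q ≤ history Z A p q :=
  history_le_iff.mpr ⟨fun i _ hr => measurable_opinion_history hr (m i),
    fun i j _ hr => measurable_edge_history hr (m i) (m j)⟩

lemma measurable_cutTraj_comp {α : Type*} [Inhabited α] [MeasurableSpace α]
    {m : MeasurableSpace Ω} {p : ℕ} {f : ℕ → Ω → α} (hf : ∀ r < p, Measurable (f r)) :
    Measurable fun ω => cutTraj p fun r => f r ω := by
  refine measurable_pi_lambda _ fun r => ?_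
  unfold cutTraj
  split_ifs with h
  · exact hf r h
  · exact measurable_const

lemma measurable_procState {m : MeasurableSpace Ω} {p q : ℕ}
    {Z : Fin k → ℕ → Ω → EuclideanSpace ℝ (Fin d)}
    {A : Fin k → Fin k → ℕ → Ω → Bool} (hZ : ∀ i, ∀ r < p, Measurable (Z i r))
    (hA : ∀ i j, ∀ r < q, Measurable (A i j r)) : Measurable (procState p q Z A) :=
  (measurable_pi_lambda _ fun i => measurable_cutTraj_comp (hZ i)).prodMk
    (measurable_pi_lambda _ fun i => measurable_pi_lambda _ fun j =>
      measurable_cutTraj_comp (hA i j))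

lemma measurable_procState_history {p q : ℕ} {Z : Fin k → ℕ → Ω → EuclideanSpace ℝ (Fin d)}
    {A : Fin k → Fin k → ℕ → Ω → Bool} :
    Measurable[history Z A p q] (procState p q Z A) :=
  measurable_procState (fun i _ hr => measurable_opinion_history hr i)
    fun i j _ hr => measurable_edge_history hr i j

/-- The symmetric adjacency matrix with ones on the diagonal and given entries above it. -/
def symmEdges (b : EdgeIdx k → Bool) (i j : Fin k) : Bool :=
  if h : i < j then b ⟨(i, j), h⟩ else if h : j < i then b ⟨(j, i), h⟩ else true

lemma symmEdges_of_symm {a : Fin k → Fin k → Bool} (hs : ∀ i j, a i j = a j i)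
    (hd : ∀ i, a i i = true) : symmEdges (fun e => a e.1.1 e.1.2) = a := by
  ext i j
  unfold symmEdges
  split_ifs with h1 h2
  · rfl
  · exact hs j i
  · rw [le_antisymm (not_lt.mp h2) (not_lt.mp h1), hd]

/-- Replace the edges at time `s`. -/
def setEdges (s : ℕ) (b : EdgeIdx k → Bool) (x : TrajState k d) : TrajState k d :=
  (x.1, fun i j => Function.update (x.2 i j) s (symmEdges b i j))

/-- Replace the opinions at time `s`. -/
def setOpinions (s : ℕ) (y : Fin k → EuclideanSpace ℝ (Fin d)) (x : TrajState k d) :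
    TrajState k d :=
  (fun i => Function.update (x.1 i) s (y i), x.2)

lemma continuous_setEdges (s : ℕ) (b : EdgeIdx k → Bool) :
    Continuous (setEdges s b : TrajState k d → TrajState k d) := by
  unfold setEdges
  refine continuous_fst.prodMk (continuous_pi fun i => continuous_pi fun j => ?_)
  exact Continuous.update (by fun_prop) s continuous_const

lemma continuous_setOpinions (s : ℕ) :
    Continuous fun p : (Fin k → EuclideanSpace ℝ (Fin d)) × TrajState k d =>
      setOpinions s p.1 p.2 := by
  unfold setOpinions
  refine (continuous_pi fun i => ?_).prodMk (by fun_prop)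
  exact Continuous.update (by fun_prop) s (by fun_prop)

lemma procState_succ_edges (p s : ℕ) (Z : Fin k → ℕ → Ω → EuclideanSpace ℝ (Fin d))
    (A : Fin k → Fin k → ℕ → Ω → Bool) (ω : Ω) (hs : ∀ i j, A i j s ω = A j i s ω)
    (hd : ∀ i, A i i s ω = true) :
    procState p (s + 1) Z A ω =
      setEdges s (fun e => A e.1.1 e.1.2 s ω) (procState p s Z A ω) := by
  unfold procState setEdges
  have := symmEdges_of_symm (a := fun i j => A i j s ω) hs hd
  simp only [cutTraj_succ, this]

lemma procState_succ_opinions (s q : ℕ) (Z : Fin k → ℕ → Ω → EuclideanSpace ℝ (Fin d))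
    (A : Fin k → Fin k → ℕ → Ω → Bool) (ω : Ω) :
    procState (s + 1) q Z A ω = setOpinions s (fun i => Z i s ω) (procState s q Z A ω) := by
  unfold procState setOpinions
  simp only [cutTraj_succ]

/-- The product of the probabilities of the edges `b` at time `s`, given the state before. -/
noncomputable def edgesWeight (B0 : EuclideanSpace ℝ (Fin d) → EuclideanSpace ℝ (Fin d) → ℝ)
    (B : Bool → EuclideanSpace ℝ (Fin d) → EuclideanSpace ℝ (Fin d) → ℝ) (s : ℕ)
    (S : Finset (EdgeIdx k)) (b : EdgeIdx k → Bool) (x : TrajState k d) : ℝ :=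
  ∏ e ∈ S, bitWeight (edgeProb B0 B s (x.1 e.1.1) (x.1 e.1.2) (x.2 e.1.1 e.1.2)) (b e)

/-- Average a function of the state over the edges at time `s`. -/
noncomputable def edgeAverage (B0 : EuclideanSpace ℝ (Fin d) → EuclideanSpace ℝ (Fin d) → ℝ)
    (B : Bool → EuclideanSpace ℝ (Fin d) → EuclideanSpace ℝ (Fin d) → ℝ) (s : ℕ)
    (f : TrajState k d → ℝ) (x : TrajState k d) : ℝ :=
  ∑ b, f (setEdges s b x) * edgesWeight B0 B s Finset.univ b x

variable {B0 : EuclideanSpace ℝ (Fin d) → EuclideanSpace ℝ (Fin d) → ℝ}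
  {B : Bool → EuclideanSpace ℝ (Fin d) → EuclideanSpace ℝ (Fin d) → ℝ}

/-- The edge probability at time `s` reads opinions up to `s` and edges before `s` only, and with `s
< p` and `s ≤ q` the cut state still contains all of them. -/
lemma edgesWeight_procState (s : ℕ) (S : Finset (EdgeIdx k)) (b : EdgeIdx k → Bool)
    (Z : Fin k → ℕ → Ω → EuclideanSpace ℝ (Fin d)) (A : Fin k → Fin k → ℕ → Ω → Bool) (ω : Ω)
    {p q : ℕ} (hp : s < p) (hq : s ≤ q) :
    edgesWeight B0 B s S b (procState p q Z A ω) =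
      ∏ e ∈ S, bitWeight (edgeProb B0 B s (fun r => Z e.1.1 r ω) (fun r => Z e.1.2 r ω)
        (fun r => A e.1.1 e.1.2 r ω)) (b e) := by
  unfold edgesWeight
  refine Finset.prod_congr rfl fun e _ => ?_
  congr 1
  refine edgeProb_congr (fun r hr => ?_) (fun r hr => ?_) fun r hr => ?_
  · exact cutTraj_apply_of_lt (by omega : r < p) fun r => Z e.1.1 r ω
  · exact cutTraj_apply_of_lt (by omega : r < p) fun r => Z e.1.2 r ω
  · exact cutTraj_apply_of_lt (by omega : r < q) fun r => A e.1.1 e.1.2 r ω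

lemma measurable_edgesWeight (hB : IsInteractionPair B0 B) (s : ℕ) (S : Finset (EdgeIdx k))
    (b : EdgeIdx k → Bool) : Measurable (edgesWeight B0 B s S b) := by
  unfold edgesWeight
  refine Finset.measurable_fun_prod _ fun e _ => (measurable_bitWeight _).comp ?_
  exact (measurable_edgeProb hB s).comp (f := fun x : TrajState k d =>
    (x.1 e.1.1, x.1 e.1.2, x.2 e.1.1 e.1.2)) (by fun_prop)

lemma edgesWeight_mem (hB : IsInteractionPair B0 B) (s : ℕ) (S : Finset (EdgeIdx k))
    (b : EdgeIdx k → Bool) (x : TrajState k d) :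
    edgesWeight B0 B s S b x ∈ Set.Icc (0 : ℝ) 1 :=
  ⟨Finset.prod_nonneg fun _ _ => (bitWeight_mem (edgeProb_mem hB s _ _ _) _).1,
    Finset.prod_le_one (fun _ _ => (bitWeight_mem (edgeProb_mem hB s _ _ _) _).1)
      fun _ _ => (bitWeight_mem (edgeProb_mem hB s _ _ _) _).2⟩

lemma sum_edgesWeight (s : ℕ) (x : TrajState k d) :
    ∑ b, edgesWeight B0 B s Finset.univ b x = 1 := by
  unfold edgesWeight
  have := (Finset.prod_univ_sum (fun _ : EdgeIdx k => (Finset.univ : Finset Bool))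
    fun e b => bitWeight (edgeProb B0 B s (x.1 e.1.1) (x.1 e.1.2) (x.2 e.1.1 e.1.2)) b).symm
  rw [Fintype.piFinset_univ] at this
  rw [this]
  exact Finset.prod_eq_one fun e _ => sum_bitWeight _

lemma measurable_edgeAverage (hB : IsInteractionPair B0 B) (s : ℕ) {f : TrajState k d → ℝ}
    (hf : Measurable f) : Measurable (edgeAverage B0 B s f) := by
  unfold edgeAverage
  exact Finset.measurable_fun_sum _ fun b _ =>
    (hf.comp (continuous_setEdges s b).measurable).mul (measurable_edgesWeight hB s _ b)

lemma abs_edgeAverage_le (hB : IsInteractionPair B0 B) (s : ℕ) {f : TrajState k d → ℝ} {C : ℝ}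
    (hf : ∀ x, |f x| ≤ C) (x : TrajState k d) : |edgeAverage B0 B s f x| ≤ C := by
  unfold edgeAverage
  calc |∑ b, f (setEdges s b x) * edgesWeight B0 B s Finset.univ b x|
      ≤ ∑ b, C * edgesWeight B0 B s Finset.univ b x := by
        refine (Finset.abs_sum_le_sum_abs _ _).trans (Finset.sum_le_sum fun b _ => ?_)
        have h := (edgesWeight_mem hB s Finset.univ b x).1
        rw [abs_mul, abs_of_nonneg h]
        exact mul_le_mul_of_nonneg_right (hf _) h
    _ = C := by rw [← Finset.mul_sum, sum_edgesWeight, mul_one]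

/-- The edges at time `s` are, given the σ-algebra `m`, independent with the right
probabilities. -/
structure EdgeLaw (B0 : EuclideanSpace ℝ (Fin d) → EuclideanSpace ℝ (Fin d) → ℝ)
    (B : Bool → EuclideanSpace ℝ (Fin d) → EuclideanSpace ℝ (Fin d) → ℝ)
    (m : MeasurableSpace Ω) [MeasurableSpace Ω] (P : Measure Ω)
    (Z : Fin k → ℕ → Ω → EuclideanSpace ℝ (Fin d)) (A : Fin k → Fin k → ℕ → Ω → Bool)
    (s : ℕ) : Prop where
  measurable_opinion : ∀ i s, Measurable (Z i s)
  measurable_edge : ∀ i j s, Measurable (A i j s)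
  -- The σ-algebra may be larger than the history of these agents: for a sample it is the history of
  -- the whole system.
  history_le : history Z A (s + 1) s ≤ m
  symm : ∀ i j, ∀ᵐ ω ∂P, A i j s ω = A j i s ω
  diag : ∀ i, ∀ᵐ ω ∂P, A i i s ω = true
  integral_mul_prod : ∀ (S : Finset (EdgeIdx k)) (b : EdgeIdx k → Bool) (V : Ω → ℝ) (C : ℝ),
    Measurable[m] V → (∀ ω, |V ω| ≤ C) →
    ∫ ω, V ω * ∏ e ∈ S, (if A e.1.1 e.1.2 s ω = b e then (1 : ℝ) else 0) ∂P =
      ∫ ω, V ω * edgesWeight B0 B s S b (procState (s + 1) s Z A ω) ∂P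

/-- Split according to the values of the new edges: almost surely exactly one product of indicators
is one. The cofactor of each product is `m`-measurable, so the product may be replaced by its
conditional probability. -/
lemma EdgeLaw.integral_procState {m : MeasurableSpace Ω} [mΩ : MeasurableSpace Ω] {P : Measure Ω}
    [IsProbabilityMeasure P] {Z : Fin k → ℕ → Ω → EuclideanSpace ℝ (Fin d)}
    {A : Fin k → Fin k → ℕ → Ω → Bool} {s : ℕ} (h : EdgeLaw B0 B m P Z A s)
    (hB : IsInteractionPair B0 B) {f : TrajState k d → ℝ} (hf : Measurable f) {C : ℝ}
    (hC : ∀ x, |f x| ≤ C) :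
    ∫ ω, f (procState (s + 1) (s + 1) Z A ω) ∂P =
      ∫ ω, edgeAverage B0 B s f (procState (s + 1) s Z A ω) ∂P := by
  have hst : Measurable[m] (procState (s + 1) s Z A) :=
    measurable_procState_history.mono h.history_le le_rfl
  have hst' : Measurable (procState (s + 1) s Z A) :=
    measurable_procState (fun i r _ => h.measurable_opinion i r)
      fun i j r _ => h.measurable_edge i j r
  have hae : ∀ᵐ ω ∂P, f (procState (s + 1) (s + 1) Z A ω) =
      ∑ b : EdgeIdx k → Bool, f (setEdges s b (procState (s + 1) s Z A ω)) *
        ∏ e, (if A e.1.1 e.1.2 s ω = b e then (1 : ℝ) else 0) := by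
    have h1 : ∀ᵐ ω ∂P, ∀ i j, A i j s ω = A j i s ω := by
      simp_rw [ae_all_iff]; exact h.symm
    have h2 : ∀ᵐ ω ∂P, ∀ i, A i i s ω = true := by
      simp_rw [ae_all_iff]; exact h.diag
    filter_upwards [h1, h2] with ω h1 h2
    rw [procState_succ_edges (s + 1) s Z A ω h1 h2,
      Finset.sum_eq_single fun e : EdgeIdx k => A e.1.1 e.1.2 s ω]
    · simp
    · intro b _ hb
      obtain ⟨e, he⟩ : ∃ e : EdgeIdx k, A e.1.1 e.1.2 s ω ≠ b e := by
        by_contra! hcon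
        exact hb (funext fun e => (hcon e).symm)
      rw [Finset.prod_eq_zero (Finset.mem_univ e) (if_neg he), mul_zero]
    · simp
  rw [integral_congr_ae hae, integral_finsetSum]
  · unfold edgeAverage
    rw [integral_finsetSum]
    · refine Finset.sum_congr rfl fun b _ => ?_
      exact h.integral_mul_prod Finset.univ b _ C
        ((hf.comp (continuous_setEdges s b).measurable).comp hst) fun ω => hC _
    · intro b _
      refine Integrable.of_bound (((hf.comp (continuous_setEdges s b).measurable).mul
        (measurable_edgesWeight hB s _ b)).comp hst').aestronglyMeasurable C
        (Eventually.of_forall fun ω => ?_)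
      obtain ⟨h0, h1⟩ := edgesWeight_mem hB s Finset.univ b (procState (s + 1) s Z A ω)
      rw [Real.norm_eq_abs, abs_mul, abs_of_nonneg h0]
      have := hC (setEdges s b (procState (s + 1) s Z A ω))
      calc _ ≤ C * 1 := mul_le_mul this h1 h0 ((abs_nonneg _).trans this)
        _ = C := mul_one C
  · intro b _
    refine Integrable.of_bound (C := C) ?_ (Eventually.of_forall fun ω => ?_)
    · refine Measurable.aestronglyMeasurable (Measurable.mul
        ((hf.comp (continuous_setEdges s b).measurable).comp hst') ?_)
      exact Finset.measurable_fun_prod _ fun e _ => Measurable.ite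
        (h.measurable_edge _ _ s (measurableSet_singleton _)) measurable_const measurable_const
    · rw [Finset.prod_ite_zero, Real.norm_eq_abs]
      have := hC (setEdges s b (procState (s + 1) s Z A ω))
      split_ifs
      · simpa using this
      · simpa using (abs_nonneg _).trans this

end State

/-! ### Conditional laws of new edges and of new noise, for systems and limits -/

section Dynamics

variable {Ω : Type*} {d k : ℕ}
  {B0 : EuclideanSpace ℝ (Fin d) → EuclideanSpace ℝ (Fin d) → ℝ}
  {B : Bool → EuclideanSpace ℝ (Fin d) → EuclideanSpace ℝ (Fin d) → ℝ}

/-- The pair of distinct indices, in increasing order. -/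
def sortPair {n : ℕ} (i j : Fin n) (h : i ≠ j) : EdgeIdx n :=
  if hij : i < j then ⟨(i, j), hij⟩ else ⟨(j, i), lt_of_le_of_ne (not_lt.mp hij) h.symm⟩

/-- If two increasing pairs had the same image in crossed order, one of them would be decreasing. -/
lemma sortPair_injective {n : ℕ} {m : Fin k → Fin n} (hm : Function.Injective m) :
    Function.Injective fun e : EdgeIdx k =>
      sortPair (m e.1.1) (m e.1.2) fun h => e.2.ne (hm h) := by
  rintro ⟨⟨i, j⟩, hij⟩ ⟨⟨i', j'⟩, hij'⟩ h
  simp only [sortPair] at h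
  split_ifs at h with h1 h2 h2
  all_goals
    simp only [Subtype.mk.injEq, Prod.mk.injEq] at h ⊢
    obtain ⟨h3, h4⟩ := h
    have h3 := hm h3
    have h4 := hm h4
    simp only at hij hij'
  · exact ⟨h3, h4⟩
  · subst h3 h4; exact absurd hij (not_lt.mpr hij'.le)
  · subst h3 h4; exact absurd hij (not_lt.mpr hij'.le)
  · exact ⟨h4, h3⟩

/-- For an injective sample, distinct pairs of sampled agents are distinct pairs of the system, so
conditional independence is inherited. The sample need not be increasing, so each pair is sorted
first and the symmetry of the adjacency matrix is used. -/
lemma IsCoevolvingSystem.edgeLaw [mΩ : MeasurableSpace Ω] {P : Measure Ω} [IsProbabilityMeasure P]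
    {γ : ℝ} {ξ : ℕ → ℕ → Ω → EuclideanSpace ℝ (Fin d)} {n : ℕ}
    {Z : Fin n → ℕ → Ω → EuclideanSpace ℝ (Fin d)} {A : Fin n → Fin n → ℕ → Ω → Bool}
    (h : IsCoevolvingSystem P γ B0 B ξ n Z A) {m : Fin k → Fin n} (hm : Function.Injective m)
    (s : ℕ) :
    EdgeLaw B0 B (history Z A (s + 1) s) P (fun i => Z (m i)) (fun i j => A (m i) (m j)) s where
  measurable_opinion i := h.measurable_opinion (m i)
  measurable_edge i j := h.measurable_edge (m i) (m j)
  history_le := history_comp_le m _ _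
  symm i j := h.symm (m i) (m j) s
  diag i := h.diag (m i) s
  integral_mul_prod S b V C hV hC := by
    set φ : EdgeIdx k → EdgeIdx n := fun e => sortPair (m e.1.1) (m e.1.2) fun h => e.2.ne (hm h)
      with hφ
    have hinj : Function.Injective φ := sortPair_injective hm
    have hle := history_le h.measurable_opinion h.measurable_edge (s + 1) s
    have key := (h.edge_condIndep s).integral_mul_prod hle
      (fun e : EdgeIdx n => h.measurable_edge e.1.1 e.1.2 s)
      (fun e => h.edge_law e.1.1 e.1.2 s e.2.ne) (S.map ⟨φ, hinj⟩)
      -- The value `true` off the range of `φ` is irrelevant: only edges in the image of `S` enter.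
      (Function.extend φ b fun _ => true) hV hC
    simp only [Finset.prod_map, Function.Embedding.coeFn_mk, hinj.extend_apply] at key
    have hA : ∀ e : EdgeIdx k, ∀ᵐ ω ∂P,
        A (φ e).1.1 (φ e).1.2 s ω = A (m e.1.1) (m e.1.2) s ω := by
      intro e
      simp only [hφ, sortPair]
      split_ifs with h1
      · exact Eventually.of_forall fun _ => rfl
      · exact h.symm _ _ s
    -- The kernels are not assumed symmetric. The probabilities for the two orders of a pair agree
    -- almost surely because both are versions of the conditional probability of the same event, the
    -- matrix being symmetric.
    have hq : ∀ e : EdgeIdx k, ∀ᵐ ω ∂P,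
        edgeProb B0 B s (fun r => Z (φ e).1.1 r ω) (fun r => Z (φ e).1.2 r ω)
          (fun r => A (φ e).1.1 (φ e).1.2 r ω) =
        edgeProb B0 B s (fun r => Z (m e.1.1) r ω) (fun r => Z (m e.1.2) r ω)
          (fun r => A (m e.1.1) (m e.1.2) r ω) := by
      intro e
      have h1 := h.edge_law (φ e).1.1 (φ e).1.2 s (φ e).2.ne
      have h2 := h.edge_law (m e.1.1) (m e.1.2) s fun h => e.2.ne (hm h)
      have h3 : P⟦A (φ e).1.1 (φ e).1.2 s ⁻¹' {true} | history Z A (s + 1) s⟧ =ᵐ[P]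
          P⟦A (m e.1.1) (m e.1.2) s ⁻¹' {true} | history Z A (s + 1) s⟧ := by
        refine condExp_congr_ae ?_
        filter_upwards [hA e] with ω hω
        simp only [Set.indicator, Set.mem_preimage, hω]
      exact (h1.symm.trans h3).trans h2
    have hA' := ae_all_iff.mpr hA
    have hq' := ae_all_iff.mpr hq
    refine Eq.trans (integral_congr_ae ?_) (key.trans (integral_congr_ae ?_))
    · filter_upwards [hA'] with ω hω
      simp only [hω]
    · filter_upwards [hq'] with ω hω
      simp only [hω]
      rw [edgesWeight_procState s S b _ _ ω (Nat.lt_succ_self s) le_rfl]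

lemma IsLimitingMeanField.edgeLaw [mΩ : MeasurableSpace Ω] {P : Measure Ω}
    [IsProbabilityMeasure P] {γ : ℝ} {μ0 ν : Measure (EuclideanSpace ℝ (Fin d))} {t : ℕ}
    {ξ : Fin k → ℕ → Ω → EuclideanSpace ℝ (Fin d)}
    {Z : Fin k → ℕ → Ω → EuclideanSpace ℝ (Fin d)} {A : Fin k → Fin k → ℕ → Ω → Bool}
    (h : IsLimitingMeanField P γ B0 B μ0 ν k t ξ Z A) {s : ℕ} (hs : s ≤ t) :
    EdgeLaw B0 B (history Z A (s + 1) s) P Z A s where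
  measurable_opinion := h.measurable_opinion
  measurable_edge := h.measurable_edge
  history_le := le_rfl
  symm i j := h.symm i j s hs
  diag i := h.diag i s hs
  integral_mul_prod S b V C hV hC := by
    have hle := history_le h.measurable_opinion h.measurable_edge (s + 1) s
    have key := (h.edge_condIndep s hs).integral_mul_prod hle
      (fun e : EdgeIdx k => h.measurable_edge e.1.1 e.1.2 s)
      (fun e => h.edge_law e.1.1 e.1.2 s hs e.2) S b hV hC
    refine key.trans (integral_congr_ae (Eventually.of_forall fun ω => ?_))
    simp only
    rw [edgesWeight_procState s S b _ _ ω (Nat.lt_succ_self s) le_rfl]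

/-- The noise vector `η` is i.i.d. with law `ν` and independent of the σ-algebra `m`. -/
structure NoiseLaw (ν : Measure (EuclideanSpace ℝ (Fin d))) (m : MeasurableSpace Ω)
    [MeasurableSpace Ω] (P : Measure Ω) (η : Ω → Fin k → EuclideanSpace ℝ (Fin d)) : Prop where
  measurable : Measurable η
  indep : Indep (MeasurableSpace.comap η inferInstance) m P
  law : P.map η = Measure.pi fun _ => ν

lemma NoiseLaw.integral {α : Type*} [MeasurableSpace α] {m : MeasurableSpace Ω}
    [mΩ : MeasurableSpace Ω] {P : Measure Ω} [IsProbabilityMeasure P]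
    {ν : Measure (EuclideanSpace ℝ (Fin d))} {η : Ω → Fin k → EuclideanSpace ℝ (Fin d)}
    (h : NoiseLaw ν m P η) (hm : m ≤ mΩ) {W : Ω → α} (hW : Measurable[m] W)
    {f : α × (Fin k → EuclideanSpace ℝ (Fin d)) → ℝ} (hf : Measurable f) {C : ℝ}
    (hC : ∀ x, |f x| ≤ C) :
    ∫ ω, f (W ω, η ω) ∂P = ∫ ω, ∫ v, f (W ω, v) ∂(Measure.pi fun _ => ν) ∂P := by
  rw [← h.law]
  refine integral_eq_integral_integral_of_indepFun (hW.mono hm le_rfl) h.measurable ?_ hf hC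
  rw [IndepFun_iff_Indep]
  exact indep_of_indep_of_le_left h.indep.symm (measurable_iff_comap_le.mp hW)

/-- Average a function over the noise added to the opinions `y` at time `r`. -/
noncomputable def opinionAverage (ν : Measure (EuclideanSpace ℝ (Fin d))) (r : ℕ)
    (f : TrajState k d → ℝ) (p : TrajState k d × (Fin k → EuclideanSpace ℝ (Fin d))) : ℝ :=
  ∫ v, f (setOpinions r (p.2 + v) p.1) ∂(Measure.pi fun _ => ν)

lemma measurable_setOpinions_add (r : ℕ) :
    Measurable fun q : (TrajState k d × (Fin k → EuclideanSpace ℝ (Fin d))) ×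
      (Fin k → EuclideanSpace ℝ (Fin d)) => setOpinions r (q.1.2 + q.2) q.1.1 := by
  unfold setOpinions
  refine Measurable.prodMk (measurable_pi_lambda _ fun i => measurable_pi_lambda _ fun l => ?_)
    (by fun_prop)
  by_cases hl : l = r
  · subst hl
    simp only [Function.update_self]
    fun_prop
  · simp only [Function.update_of_ne hl]
    fun_prop

lemma measurable_opinionAverage (ν : Measure (EuclideanSpace ℝ (Fin d))) [IsProbabilityMeasure ν]
    (r : ℕ) {f : TrajState k d → ℝ} (hf : Measurable f) : Measurable (opinionAverage ν r f) :=
  (StronglyMeasurable.integral_prod_right'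
    (hf.comp (measurable_setOpinions_add r)).stronglyMeasurable).measurable

lemma abs_integral_le_of_abs_le {α : Type*} [MeasurableSpace α] {μ : Measure α}
    [IsProbabilityMeasure μ] {f : α → ℝ} {C : ℝ} (hC : ∀ x, |f x| ≤ C) : |∫ x, f x ∂μ| ≤ C := by
  have := norm_integral_le_of_norm_le_const (μ := μ) (f := f) (C := C)
    (Eventually.of_forall hC)
  simpa using this

lemma abs_opinionAverage_le (ν : Measure (EuclideanSpace ℝ (Fin d))) [IsProbabilityMeasure ν]
    (r : ℕ) {f : TrajState k d → ℝ} {C : ℝ} (hC : ∀ x, |f x| ≤ C)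
    (p : TrajState k d × (Fin k → EuclideanSpace ℝ (Fin d))) : |opinionAverage ν r f p| ≤ C :=
  abs_integral_le_of_abs_le fun _ => hC _

lemma continuous_opinionAverage (ν : Measure (EuclideanSpace ℝ (Fin d))) [IsProbabilityMeasure ν]
    (r : ℕ) (f : TrajState k d →ᵇ ℝ) : Continuous (opinionAverage ν r f) := by
  unfold opinionAverage
  refine continuous_of_dominated (bound := fun _ => ‖f‖) (fun p => ?_) (fun p => ?_)
    (integrable_const _) ?_
  · exact ((f.continuous.measurable.comp (measurable_setOpinions_add r)).comp
      (measurable_const.prodMk measurable_id)).aestronglyMeasurable (f := fun v => f _)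
  · exact Eventually.of_forall fun v => f.norm_coe_le_norm _
  · refine Eventually.of_forall fun v => f.continuous.comp ?_
    exact (continuous_setOpinions r).comp
      ((continuous_snd.add continuous_const).prodMk continuous_fst)

/-- The part `Y` of the new opinions that is known before the noise is `m`-measurable, and the noise
is independent of `m`; so Fubini's theorem integrates the noise out. -/
lemma NoiseLaw.integral_procState {m : MeasurableSpace Ω} [mΩ : MeasurableSpace Ω] {P : Measure Ω}
    [IsProbabilityMeasure P] {ν : Measure (EuclideanSpace ℝ (Fin d))}
    {η : Ω → Fin k → EuclideanSpace ℝ (Fin d)} (h : NoiseLaw ν m P η) (hm : m ≤ mΩ)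
    {Z : Fin k → ℕ → Ω → EuclideanSpace ℝ (Fin d)} {A : Fin k → Fin k → ℕ → Ω → Bool} {s q : ℕ}
    (hle : history Z A s q ≤ m) {Y : Ω → Fin k → EuclideanSpace ℝ (Fin d)} (hY : Measurable[m] Y)
    (hZ : ∀ i, ∀ᵐ ω ∂P, Z i s ω = Y ω i + η ω i) {f : TrajState k d → ℝ} (hf : Measurable f)
    {C : ℝ} (hC : ∀ x, |f x| ≤ C) :
    ∫ ω, f (procState (s + 1) q Z A ω) ∂P =
      ∫ ω, opinionAverage ν s f (procState s q Z A ω, Y ω) ∂P := by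
  have hst : Measurable[m] (procState s q Z A) := measurable_procState_history.mono hle le_rfl
  have h1 : ∀ᵐ ω ∂P, f (procState (s + 1) q Z A ω) =
      f (setOpinions s (Y ω + η ω) (procState s q Z A ω)) := by
    filter_upwards [ae_all_iff.mpr hZ] with ω hω
    rw [procState_succ_opinions]
    congr 2
    ext1 i
    exact hω i
  rw [integral_congr_ae h1]
  exact h.integral hm (hst.prodMk hY) (f := fun q => f (setOpinions s (q.1.2 + q.2) q.1.1))
    (hf.comp (measurable_setOpinions_add s)) fun _ => hC _

lemma IsSystemNoise.noiseLaw [mΩ : MeasurableSpace Ω] {P : Measure Ω} [IsProbabilityMeasure P]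
    {ξ : ℕ → ℕ → Ω → EuclideanSpace ℝ (Fin d)}
    {Z : (n : ℕ) → Fin n → ℕ → Ω → EuclideanSpace ℝ (Fin d)}
    {A : (n : ℕ) → Fin n → Fin n → ℕ → Ω → Bool} (h : IsSystemNoise P ξ Z A) {n : ℕ}
    {m : Fin k → Fin n} (hm : Function.Injective m) (s : ℕ) :
    NoiseLaw (P.map (ξ 0 0)) (history (Z n) (A n) (s + 1) (s + 1)) P
      fun ω i => ξ (m i) s ω where
  measurable := measurable_pi_lambda _ fun i => h.measurable (m i) s
  indep := by
    refine indep_of_indep_of_le (h.indep_history s) ?_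
      (le_iSup (fun n => history (Z n) (A n) (s + 1) (s + 1)) n)
    rw [← measurable_iff_comap_le]
    refine @measurable_pi_lambda _ _ _ (_) _ _ fun i => ?_
    rw [measurable_iff_comap_le]
    exact le_iSup (fun i => MeasurableSpace.comap (ξ i s) inferInstance) (m i : ℕ)
  law := by
    have h1 : iIndepFun (fun i : Fin k => ξ (m i) s) P :=
      h.indep.precomp (g := fun i : Fin k => ((m i : ℕ), s)) fun i j hij => by
        simp only [Prod.mk.injEq, and_true] at hij
        exact hm (Fin.val_injective hij)
    rw [(iIndepFun_iff_map_fun_eq_pi_map fun i => (h.measurable (m i) s).aemeasurable).mp h1]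
    congr 1
    ext1 i
    exact h.identDistrib _ _

lemma IsLimitingMeanField.noiseLaw [mΩ : MeasurableSpace Ω] {P : Measure Ω}
    [IsProbabilityMeasure P] {γ : ℝ} {μ0 ν : Measure (EuclideanSpace ℝ (Fin d))} {t : ℕ}
    {ξ : Fin k → ℕ → Ω → EuclideanSpace ℝ (Fin d)}
    {Z : Fin k → ℕ → Ω → EuclideanSpace ℝ (Fin d)} {A : Fin k → Fin k → ℕ → Ω → Bool}
    (h : IsLimitingMeanField P γ B0 B μ0 ν k t ξ Z A) {s : ℕ} (hs : s ≤ t) :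
    NoiseLaw ν (history Z A (s + 1) (s + 1)) P fun ω i => ξ i s ω where
  measurable := measurable_pi_lambda _ fun i => h.measurable_noise i s
  indep := by
    refine indep_of_indep_of_le_left (h.noise_indep_history s hs) ?_
    rw [← measurable_iff_comap_le]
    refine @measurable_pi_lambda _ _ _ (_) _ _ fun i => ?_
    rw [measurable_iff_comap_le]
    exact le_iSup (fun i => MeasurableSpace.comap (ξ i s) inferInstance) i
  law := by
    have h1 : iIndepFun (fun i : Fin k => ξ i s) P :=
      h.noise_indep.precomp (g := fun i : Fin k => (i, (⟨s, by omega⟩ : Fin (t + 1))))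
        fun i j hij => by simpa using hij
    rw [(iIndepFun_iff_map_fun_eq_pi_map fun i => (h.measurable_noise i s).aemeasurable).mp h1]
    congr 1
    ext1 i
    exact h.noise_law i s hs

end Dynamics

/-! ### Continuity of the edge probabilities off the bad set of the kernels -/

section KernelContinuity

variable {d k : ℕ} {B0 : EuclideanSpace ℝ (Fin d) → EuclideanSpace ℝ (Fin d) → ℝ}
  {B : Bool → EuclideanSpace ℝ (Fin d) → EuclideanSpace ℝ (Fin d) → ℝ}

/-- The interaction functions which are used at time `s` are continuous at the point `p`. -/
def KernelContinuousAt (B0 : EuclideanSpace ℝ (Fin d) → EuclideanSpace ℝ (Fin d) → ℝ)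
    (B : Bool → EuclideanSpace ℝ (Fin d) → EuclideanSpace ℝ (Fin d) → ℝ) (s : ℕ)
    (p : EuclideanSpace ℝ (Fin d) × EuclideanSpace ℝ (Fin d)) : Prop :=
  (s = 0 → ContinuousAt (Function.uncurry B0) p) ∧
    (s ≠ 0 → ∀ a, ContinuousAt (Function.uncurry (B a)) p)

lemma IsInteractionPair.ae_kernelContinuousAt (hB : IsInteractionPair B0 B) (s : ℕ) :
    ∀ᵐ p ∂volume, KernelContinuousAt B0 B s p := by
  filter_upwards [hB.ae_continuous_zero, ae_all_iff.mpr hB.ae_continuous_succ] with p h0 h1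
  exact ⟨fun _ => h0, fun _ => h1⟩

lemma KernelContinuousAt.continuousAt_edgeProb {s : ℕ} {z w : ℕ → EuclideanSpace ℝ (Fin d)}
    {a : ℕ → Bool} (h : KernelContinuousAt B0 B s (z s, w s)) :
    ContinuousAt (fun p : (ℕ → EuclideanSpace ℝ (Fin d)) × (ℕ → EuclideanSpace ℝ (Fin d)) ×
      (ℕ → Bool) => edgeProb B0 B s p.1 p.2.1 p.2.2) (z, w, a) := by
  cases s with
  | zero =>
    exact ContinuousAt.comp (x := (z, w, a)) (g := Function.uncurry B0) (hg := h.1 rfl) (f := fun p : (ℕ → EuclideanSpace ℝ (Fin d)) ×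
      (ℕ → EuclideanSpace ℝ (Fin d)) × (ℕ → Bool) => (p.1 0, p.2.1 0))
      (by fun_prop)
  | succ s =>
    have h1 : ContinuousAt (fun p : (ℕ → EuclideanSpace ℝ (Fin d)) ×
        (ℕ → EuclideanSpace ℝ (Fin d)) × (ℕ → Bool) => B (a s) (p.1 (s + 1)) (p.2.1 (s + 1)))
        (z, w, a) :=
      ContinuousAt.comp (x := (z, w, a)) (g := Function.uncurry (B (a s)))
        (hg := h.2 (Nat.succ_ne_zero s) (a s)) (f := fun p : (ℕ → EuclideanSpace ℝ (Fin d)) ×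
        (ℕ → EuclideanSpace ℝ (Fin d)) × (ℕ → Bool) => (p.1 (s + 1), p.2.1 (s + 1)))
        (by fun_prop)
    refine h1.congr ?_
    have h2 : ContinuousAt (fun p : (ℕ → EuclideanSpace ℝ (Fin d)) ×
        (ℕ → EuclideanSpace ℝ (Fin d)) × (ℕ → Bool) => p.2.2 s) (z, w, a) := by fun_prop
    -- Bits are discrete: near the given state the last edge is constant, so only the kernel with
    -- this fixed bit matters.
    have h3 := h2.eventually (show ∀ᶠ c in 𝓝 (a s), c = a s by simp [nhds_discrete])
    filter_upwards [h3] with p hp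
    simp only [edgeProb, hp]

lemma continuousAt_trajProb {s : ℕ} {z w : ℕ → EuclideanSpace ℝ (Fin d)}
    (h : ∀ r ≤ s, KernelContinuousAt B0 B r (z r, w r)) :
    ContinuousAt (fun p : (ℕ → EuclideanSpace ℝ (Fin d)) × (ℕ → EuclideanSpace ℝ (Fin d)) =>
      trajProb B0 B s p.1 p.2) (z, w) := by
  induction s with
  | zero =>
    exact ContinuousAt.comp (x := (z, w)) (g := Function.uncurry B0)
      (hg := (h 0 le_rfl).1 rfl) (f := fun p : (ℕ → EuclideanSpace ℝ (Fin d)) ×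
      (ℕ → EuclideanSpace ℝ (Fin d)) => (p.1 0, p.2 0)) (by fun_prop)
  | succ s ih =>
    have h1 := ih fun r hr => h r (by omega)
    have h2 : ∀ a, ContinuousAt (fun p : (ℕ → EuclideanSpace ℝ (Fin d)) ×
        (ℕ → EuclideanSpace ℝ (Fin d)) => B a (p.1 (s + 1)) (p.2 (s + 1))) (z, w) := fun a =>
      ContinuousAt.comp (x := (z, w)) (g := Function.uncurry (B a))
        (hg := (h (s + 1) le_rfl).2 (Nat.succ_ne_zero s) a) (f := fun p :
        (ℕ → EuclideanSpace ℝ (Fin d)) × (ℕ → EuclideanSpace ℝ (Fin d)) =>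
        (p.1 (s + 1), p.2 (s + 1))) (by fun_prop)
    simp only [trajProb]
    exact (h1.mul (h2 true)).add ((continuousAt_const.sub h1).mul (h2 false))

lemma continuous_bitWeight (b : Bool) : Continuous fun p => bitWeight p b := by
  cases b
  · simp only [bitWeight, Bool.false_eq_true, if_false]; fun_prop
  · simp only [bitWeight, if_true]; fun_prop

lemma continuousAt_edgeAverage {s : ℕ} {x : TrajState k d}
    (h : ∀ e : EdgeIdx k, KernelContinuousAt B0 B s (x.1 e.1.1 s, x.1 e.1.2 s))
    {f : TrajState k d → ℝ} (hf : Continuous f) : ContinuousAt (edgeAverage B0 B s f) x := by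
  unfold edgeAverage edgesWeight
  refine tendsto_finsetSum _ fun b _ => ContinuousAt.mul
    (hf.comp (continuous_setEdges s b)).continuousAt ?_
  refine tendsto_finsetProd _ fun e _ =>
    (continuous_bitWeight _).continuousAt.comp (f := fun x : TrajState k d =>
      edgeProb B0 B s (x.1 e.1.1) (x.1 e.1.2) (x.2 e.1.1 e.1.2)) ?_
  exact (h e).continuousAt_edgeProb.comp (f := fun x : TrajState k d =>
    (x.1 e.1.1, x.1 e.1.2, x.2 e.1.1 e.1.2)) (by fun_prop)

end KernelContinuity

/-! ### Convergence of sampled states and the two halves of a time step -/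

section Steps

variable {Ω : Type*} [MeasurableSpace Ω] {P : Measure Ω} {d : ℕ}
  {γ : ℝ} {B0 : EuclideanSpace ℝ (Fin d) → EuclideanSpace ℝ (Fin d) → ℝ}
  {B : Bool → EuclideanSpace ℝ (Fin d) → EuclideanSpace ℝ (Fin d) → ℝ}
  {ξ : ℕ → ℕ → Ω → EuclideanSpace ℝ (Fin d)}
  {Z : (n : ℕ) → Fin n → ℕ → Ω → EuclideanSpace ℝ (Fin d)}
  {A : (n : ℕ) → Fin n → Fin n → ℕ → Ω → Bool}

/-- The opinions before time `p` and the edges before time `q` of the agents `m 0, m 1, …`. -/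
def sampleState (Z : (n : ℕ) → Fin n → ℕ → Ω → EuclideanSpace ℝ (Fin d))
    (A : (n : ℕ) → Fin n → Fin n → ℕ → Ω → Bool) (p q k n : ℕ) (m : Fin k → Fin (n + 1)) :
    Ω → TrajState k d :=
  procState p q (fun i => Z (n + 1) (m i)) fun i j => A (n + 1) (m i) (m j)

/-- The states of `k` uniformly sampled agents converge in distribution to `μ`. -/
def SampleTendsto (P : Measure Ω) (Z : (n : ℕ) → Fin n → ℕ → Ω → EuclideanSpace ℝ (Fin d))
    (A : (n : ℕ) → Fin n → Fin n → ℕ → Ω → Bool) (p q k : ℕ) (μ : Measure (TrajState k d)) :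
    Prop :=
  WeakTendsto (fun n => avgLaw P (sampleState Z A p q k n)) μ

lemma measurable_sampleState (hsys : ∀ n, IsCoevolvingSystem P γ B0 B ξ n (Z n) (A n))
    (p q k n : ℕ) (m : Fin k → Fin (n + 1)) : Measurable (sampleState Z A p q k n m) :=
  measurable_procState (fun _ r _ => (hsys _).measurable_opinion _ r)
    fun _ _ r _ => (hsys _).measurable_edge _ _ r

variable [IsProbabilityMeasure P]

lemma isProbabilityMeasure_avgLaw_sampleState
    (hsys : ∀ n, IsCoevolvingSystem P γ B0 B ξ n (Z n) (A n)) (p q k n : ℕ) :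
    IsProbabilityMeasure (avgLaw P (sampleState Z A p q k n)) :=
  isProbabilityMeasure_avgLaw (measurable_sampleState hsys p q k n)

/-- The tested form of `SampleTendsto` for almost everywhere continuous functions. -/
lemma SampleTendsto.tendsto_avg {Ω' : Type*} [MeasurableSpace Ω'] {P' : Measure Ω'}
    [IsProbabilityMeasure P'] {k p q : ℕ} {Y : Ω' → TrajState k d} (hY : Measurable Y)
    (hsys : ∀ n, IsCoevolvingSystem P γ B0 B ξ n (Z n) (A n))
    (h : SampleTendsto P Z A p q k (P'.map Y)) {f : TrajState k d → ℝ} (hf : Measurable f)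
    {C : ℝ} (hC : ∀ x, |f x| ≤ C) (hcont : ∀ᵐ ω ∂P', ContinuousAt f (Y ω)) :
    Tendsto (fun n => avg fun m => ∫ ω, f (sampleState Z A p q k n m ω) ∂P) atTop
      (𝓝 (∫ ω, f (Y ω) ∂P')) := by
  have := isProbabilityMeasure_avgLaw_sampleState hsys p q k
  have : IsProbabilityMeasure (P'.map Y) := Measure.isProbabilityMeasure_map hY.aemeasurable
  have hcont' : ∀ᵐ x ∂(P'.map Y), ContinuousAt f x := by
    rw [ae_map_iff hY.aemeasurable]
    · exact hcont
    · exact measurableSet_of_continuousAt f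
  have h1 := WeakTendsto.tendsto_integral_of_ae_continuousAt h hf hC hcont'
  rw [integral_map hY.aemeasurable hf.aestronglyMeasurable] at h1
  refine h1.congr fun n => ?_
  exact integral_avgLaw (measurable_sampleState hsys p q k n) hf hC

lemma sampleTendsto_of_tendsto_avg {Ω' : Type*} [MeasurableSpace Ω'] {P' : Measure Ω'}
    {k p q : ℕ} {Y : Ω' → TrajState k d} (hY : Measurable Y)
    (hsys : ∀ n, IsCoevolvingSystem P γ B0 B ξ n (Z n) (A n))
    (h : ∀ f : TrajState k d →ᵇ ℝ,
      Tendsto (fun n => avg fun m => ∫ ω, f (sampleState Z A p q k n m ω) ∂P) atTop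
      (𝓝 (∫ ω, f (Y ω) ∂P'))) : SampleTendsto P Z A p q k (P'.map Y) := by
  intro f
  rw [integral_map hY.aemeasurable f.continuous.measurable.aestronglyMeasurable]
  refine (h f).congr fun n => ?_
  exact (integral_avgLaw (measurable_sampleState hsys p q k n) f.continuous.measurable
    f.norm_coe_le_norm).symm

/-- Convergence is preserved when the edges are drawn. -/
theorem SampleTendsto.edge_step {Ω' : Type*} {m' : MeasurableSpace Ω'} [MeasurableSpace Ω']
    {P' : Measure Ω'} [IsProbabilityMeasure P'] {k s : ℕ}
    {Z' : Fin k → ℕ → Ω' → EuclideanSpace ℝ (Fin d)} {A' : Fin k → Fin k → ℕ → Ω' → Bool}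
    (hB : IsInteractionPair B0 B) (hsys : ∀ n, IsCoevolvingSystem P γ B0 B ξ n (Z n) (A n))
    (h' : EdgeLaw B0 B m' P' Z' A' s)
    (hac : ∀ i j, i ≠ j → P'.map (fun ω => (Z' i s ω, Z' j s ω)) ≪ volume)
    (h : SampleTendsto P Z A (s + 1) s k (P'.map (procState (s + 1) s Z' A'))) :
    SampleTendsto P Z A (s + 1) (s + 1) k (P'.map (procState (s + 1) (s + 1) Z' A')) := by
  have hmeas : ∀ p q, Measurable (procState p q Z' A') := fun p q =>
    measurable_procState (fun i r _ => h'.measurable_opinion i r)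
      fun i j r _ => h'.measurable_edge i j r
  refine sampleTendsto_of_tendsto_avg (hmeas _ _) hsys fun f => ?_
  have hfm := f.continuous.measurable
  have hfb : ∀ x, |f x| ≤ ‖f‖ := f.norm_coe_le_norm
  rw [h'.integral_procState hB hfm hfb]
  -- The kernels are discontinuous only on a null set of pairs of opinions, and in the limit the
  -- pair of opinions has an absolutely continuous law.
  have hcont : ∀ᵐ ω ∂P', ContinuousAt (edgeAverage B0 B s f) (procState (s + 1) s Z' A' ω) := by
    have h1 : ∀ e : EdgeIdx k, ∀ᵐ ω ∂P',
        KernelContinuousAt B0 B s (Z' e.1.1 s ω, Z' e.1.2 s ω) := fun e =>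
      ae_of_ae_map ((h'.measurable_opinion _ s).prodMk (h'.measurable_opinion _ s)).aemeasurable
        ((hac e.1.1 e.1.2 e.2.ne).ae_le (hB.ae_kernelContinuousAt s))
    filter_upwards [ae_all_iff.mpr h1] with ω hω
    refine continuousAt_edgeAverage (fun e => ?_) f.continuous
    have h2 : ∀ i, (procState (s + 1) s Z' A' ω).1 i s = Z' i s ω := fun i =>
      cutTraj_apply_of_lt (Nat.lt_succ_self s) fun r => Z' i r ω
    rw [h2, h2]
    exact hω e
  have h2 := h.tendsto_avg (hmeas _ _) hsys (measurable_edgeAverage hB s hfm)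
    (abs_edgeAverage_le hB s hfb) hcont
  -- In the finite system the averaging over edges is exact only for distinct agents; the other
  -- tuples are asymptotically negligible.
  have h3 : Tendsto (fun n =>
      (avg fun m => ∫ ω, f (sampleState Z A (s + 1) (s + 1) k n m ω) ∂P) -
      avg fun m => ∫ ω, edgeAverage B0 B s f (sampleState Z A (s + 1) s k n m ω) ∂P) atTop
      (𝓝 0) := by
    refine tendsto_avg_sub_of_eq_on_injective (C := ‖f‖)
      (fun n m => abs_integral_le_of_abs_le fun _ => hfb _)
      (fun n m => abs_integral_le_of_abs_le fun _ => abs_edgeAverage_le hB s hfb _)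
      fun n m hm => ((hsys (n + 1)).edgeLaw hm s).integral_procState hB hfm hfb
  simpa using h3.add h2

lemma measurable_neighborAverage {Ω : Type*} {n : ℕ} (i : Fin n) {m : MeasurableSpace Ω}
    {z : Fin n → Ω → EuclideanSpace ℝ (Fin d)} {a : Fin n → Fin n → Ω → Bool}
    (hz : ∀ j, Measurable[m] (z j)) (ha : ∀ j l, Measurable[m] (a j l)) :
    Measurable[m] fun ω => neighborAverage (fun j => z j ω) (fun j l => a j l ω) i := by
  unfold neighborAverage
  have h1 : Measurable[m] fun ω => ∑ j, if a i j ω then (1 : ℝ) else 0 :=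
    Finset.measurable_fun_sum _ fun j _ =>
      Measurable.ite (ha i j (measurableSet_singleton _)) measurable_const measurable_const
  have h2 : Measurable[m] fun ω => ∑ j, if a i j ω then z j ω else 0 :=
    Finset.measurable_fun_sum _ fun j _ =>
      Measurable.ite (ha i j (measurableSet_singleton _)) (hz j) measurable_const
  exact h1.inv.smul h2

/-- Convergence is preserved when the opinions are updated, if the local averages are close to a
function `M` of the own trajectory. -/
theorem SampleTendsto.opinion_step {Ω' : Type*} {m' : MeasurableSpace Ω'}
    [mΩ' : MeasurableSpace Ω'] {P' : Measure Ω'} [IsProbabilityMeasure P'] {k s : ℕ}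
    {Z' : Fin k → ℕ → Ω' → EuclideanSpace ℝ (Fin d)} {A' : Fin k → Fin k → ℕ → Ω' → Bool}
    {η : Ω' → Fin k → EuclideanSpace ℝ (Fin d)} (hγ0 : 0 < γ) (hγ1 : γ < 1)
    (hsys : ∀ n, IsCoevolvingSystem P γ B0 B ξ n (Z n) (A n)) (hnoise : IsSystemNoise P ξ Z A)
    (hZ' : ∀ i s, Measurable (Z' i s)) (hA' : ∀ i j s, Measurable (A' i j s))
    (hm' : m' ≤ mΩ') (hhist : history Z' A' (s + 1) (s + 1) ≤ m')
    (hη : NoiseLaw (P.map (ξ 0 0)) m' P' η)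
    {M : (ℕ → EuclideanSpace ℝ (Fin d)) → EuclideanSpace ℝ (Fin d)} (hM : Measurable M)
    (hMcut : ∀ z, M (cutTraj (s + 1) z) = M z)
    (hstep : ∀ i, ∀ᵐ ω ∂P', Z' i (s + 1) ω =
      (1 - γ) • Z' i s ω + γ • M (fun r => Z' i r ω) + η ω i)
    (hcont : ∀ i, ∀ᵐ ω ∂P', ContinuousAt M (cutTraj (s + 1) fun r => Z' i r ω))
    (hlln : Tendsto (fun n => avg fun i : Fin (n + 1) => ∫ ω, min 1
      ‖neighborAverage (fun j => Z (n + 1) j s ω) (fun j l => A (n + 1) j l s ω) i -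
        M (fun r => Z (n + 1) i r ω)‖ ∂P) atTop (𝓝 0))
    (h : SampleTendsto P Z A (s + 1) (s + 1) k (P'.map (procState (s + 1) (s + 1) Z' A'))) :
    SampleTendsto P Z A (s + 2) (s + 1) k (P'.map (procState (s + 2) (s + 1) Z' A')) := by
  have hν : IsProbabilityMeasure (P.map (ξ 0 0)) :=
    Measure.isProbabilityMeasure_map (hnoise.measurable 0 0).aemeasurable
  have hmeas : ∀ p q, Measurable (procState p q Z' A') := fun p q =>
    measurable_procState (fun i r _ => hZ' i r) fun i j r _ => hA' i j r
  set L : (n : ℕ) → Fin (n + 1) → Ω → EuclideanSpace ℝ (Fin d) := fun n i ω =>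
    neighborAverage (fun j => Z (n + 1) j s ω) (fun j l => A (n + 1) j l s ω) i with hL
  -- This is the error in the next opinions of the sample when the local averages are replaced by
  -- `M` of the own trajectories.
  set ε : (n : ℕ) → (Fin k → Fin (n + 1)) → Ω → Fin k → EuclideanSpace ℝ (Fin d) :=
    fun n m ω i => γ • (L n (m i) ω - M fun r => Z (n + 1) (m i) r ω) with hε
  have hLm : ∀ n i, Measurable (L n i) := fun n i =>
    measurable_neighborAverage i (fun j => (hsys _).measurable_opinion j s)
      fun j l => (hsys _).measurable_edge j l s
  have hMm : ∀ n i, Measurable fun ω => M fun r => Z (n + 1) i r ω := fun n i =>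
    hM.comp (measurable_pi_lambda _ fun r => (hsys _).measurable_opinion i r)
  have hεm : ∀ n m, Measurable (ε n m) := fun n m => measurable_pi_lambda _ fun i =>
    ((hLm n (m i)).sub (hMm n (m i))).const_smul γ
  have hdev : ∀ n i, Measurable fun ω => min 1 ‖L n i ω - M fun r => Z (n + 1) i r ω‖ :=
    fun n i => measurable_const.min ((hLm n i).sub (hMm n i)).norm
  have hmin : ∀ x : EuclideanSpace ℝ (Fin d), |min 1 ‖x‖| ≤ 1 := fun x => by
    rw [abs_of_nonneg (le_min zero_le_one (norm_nonneg _))]; exact min_le_left _ _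
  have hε0 : Tendsto (fun n => avg fun m => ∫ ω, min 1 ‖ε n m ω‖ ∂P) atTop (𝓝 0) := by
    refine squeeze_zero (fun n => avg_nonneg fun m => integral_nonneg fun ω =>
      le_min zero_le_one (norm_nonneg _)) (fun n => ?_) (by simpa using hlln.const_mul (k : ℝ))
    -- The error of the vector is at most the sum of the errors of its coordinates. Each coordinate
    -- of a uniform tuple is a uniform agent, so the average becomes `k` times the quantity in
    -- `hlln`.
    have h1 : ∀ m : Fin k → Fin (n + 1), ∫ ω, min 1 ‖ε n m ω‖ ∂P ≤
        ∑ i : Fin k, ∫ ω, min 1 ‖L n (m i) ω - M fun r => Z (n + 1) (m i) r ω‖ ∂P := by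
      intro m
      have hi : ∀ i : Fin k, Integrable
          (fun ω => min 1 ‖L n (m i) ω - M fun r => Z (n + 1) (m i) r ω‖) P := fun i =>
        Integrable.of_bound (hdev n (m i)).aestronglyMeasurable 1
          (Eventually.of_forall fun ω => hmin _)
      rw [← integral_finsetSum _ fun i _ => hi i]
      refine integral_mono_of_nonneg (Eventually.of_forall fun ω =>
        le_min zero_le_one (norm_nonneg _)) (integrable_finsetSum _ fun i _ => hi i)
        (Eventually.of_forall fun ω => ?_)
      have hnn : ∀ i : Fin k, 0 ≤ min 1 ‖L n (m i) ω - M fun r => Z (n + 1) (m i) r ω‖ :=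
        fun i => le_min zero_le_one (norm_nonneg _)
      simp only
      rcases Nat.eq_zero_or_pos k with hk | hk
      · subst hk
        simp [Subsingleton.elim (ε n m ω) 0]
      · have : Nonempty (Fin k) := ⟨⟨0, hk⟩⟩
        obtain ⟨i, hi⟩ : ∃ i, ‖ε n m ω‖ = ‖ε n m ω i‖ := by
          obtain ⟨i, hi⟩ := Finite.exists_max fun i => ‖ε n m ω i‖
          exact ⟨i, le_antisymm ((pi_norm_le_iff_of_nonneg (norm_nonneg _)).mpr hi)
            (norm_le_pi_norm _ i)⟩
        refine le_trans ?_ (Finset.single_le_sum (fun i _ => hnn i) (Finset.mem_univ i))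
        refine min_le_min le_rfl ?_
        rw [hi, hε]
        simp only [norm_smul, Real.norm_eq_abs, abs_of_pos hγ0]
        exact mul_le_of_le_one_left (norm_nonneg _) hγ1.le
    refine (avg_mono h1).trans (le_of_eq ?_)
    rw [avg_sum]
    simp only [fun i : Fin k => avg_eval (α := Fin (n + 1)) i (fun j => ∫ ω, min 1 ‖L n j ω -
      M fun r => Z (n + 1) j r ω‖ ∂P), Finset.sum_const, Finset.card_univ, Fintype.card_fin,
      nsmul_eq_mul]
    rfl
  refine sampleTendsto_of_tendsto_avg (hmeas _ _) hsys fun f => ?_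
  have hfm := f.continuous.measurable
  have hfb : ∀ x, |f x| ≤ ‖f‖ := f.norm_coe_le_norm
  -- `F (x, e)` is the mean of `f` when the next opinions are the drift at `x` plus the error `e`
  -- plus fresh noise. It carries the finite system, with its error, and the limit, with error zero,
  -- to the same test function.
  set F : TrajState k d × (Fin k → EuclideanSpace ℝ (Fin d)) → ℝ := fun p =>
    opinionAverage (P.map (ξ 0 0)) (s + 1) f
      (p.1, fun i => (1 - γ) • p.1.1 i s + γ • M (p.1.1 i) + p.2 i) with hF
  have hFm : Measurable F :=
    (measurable_opinionAverage _ (s + 1) hfm).comp (measurable_fst.prodMk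
      (measurable_pi_lambda _ fun i => by fun_prop))
  have hFb : ∀ p, |F p| ≤ ‖f‖ := fun p => abs_opinionAverage_le _ _ hfb _
  have hFcont : ∀ᵐ ω ∂P', ContinuousAt F (procState (s + 1) (s + 1) Z' A' ω, 0) := by
    filter_upwards [ae_all_iff.mpr hcont] with ω hω
    refine (continuous_opinionAverage _ (s + 1) f).continuousAt.comp
      (f := fun p : TrajState k d × (Fin k → EuclideanSpace ℝ (Fin d)) =>
        (p.1, fun i => (1 - γ) • p.1.1 i s + γ • M (p.1.1 i) + p.2 i)) ?_
    refine continuousAt_fst.prodMk (continuousAt_pi.mpr fun i => ?_)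
    have h1 : ContinuousAt (fun p : TrajState k d × (Fin k → EuclideanSpace ℝ (Fin d)) =>
        M (p.1.1 i)) (procState (s + 1) (s + 1) Z' A' ω, 0) :=
      ContinuousAt.comp (f := fun p : TrajState k d × (Fin k → EuclideanSpace ℝ (Fin d)) =>
        p.1.1 i) (hω i) (by fun_prop)
    exact (ContinuousAt.add (by fun_prop) (h1.const_smul γ)).add (by fun_prop)
  have hW := measurable_sampleState hsys (s + 1) (s + 1) k
  have hP1 := Measure.isProbabilityMeasure_map (μ := P') (hmeas (s + 1) (s + 1)).aemeasurable
  have hslut := WeakTendsto.prodMk_of_tendsto_zero hW hεm h hε0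
  have h00 : Measurable fun x : TrajState k d => (x, (0 : Fin k → EuclideanSpace ℝ (Fin d))) := by
    fun_prop
  have hP2 := fun n => isProbabilityMeasure_avgLaw (P := P) fun m => (hW n m).prodMk (hεm n m)
  have hP3 := Measure.isProbabilityMeasure_map
    (μ := P'.map (procState (s + 1) (s + 1) Z' A')) h00.aemeasurable
  have h1 := hslut.tendsto_integral_of_ae_continuousAt hFm hFb (by
    rw [Measure.map_map h00 (hmeas _ _), ae_map_iff (h00.comp (hmeas _ _)).aemeasurable
      (measurableSet_of_continuousAt F)]
    exact hFcont)
  rw [integral_map h00.aemeasurable hFm.aestronglyMeasurable,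
    integral_map (f := fun x => F (x, 0)) (hmeas _ _).aemeasurable
      (hFm.comp h00).aestronglyMeasurable] at h1
  have h2 : ∫ ω, f (procState (s + 2) (s + 1) Z' A' ω) ∂P' =
      ∫ ω, F (procState (s + 1) (s + 1) Z' A' ω, 0) ∂P' := by
    -- The cut trajectory is used here because `Z' i` itself contains values later than the history
    -- `m'`.
    have hYm : Measurable[m'] fun ω => fun i : Fin k =>
        (1 - γ) • Z' i s ω + γ • M (cutTraj (s + 1) fun r => Z' i r ω) := by
      refine @measurable_pi_lambda _ _ _ m' _ _ fun i => ?_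
      have h3 : Measurable[m'] fun ω => M (cutTraj (s + 1) fun r => Z' i r ω) :=
        hM.comp (measurable_cutTraj_comp fun r hr =>
          (measurable_opinion_history hr i).mono hhist le_rfl)
      have h4 : Measurable[m'] (Z' i s) :=
        (measurable_opinion_history (Nat.lt_succ_self s) i).mono hhist le_rfl
      exact (h4.const_smul (1 - γ)).add (h3.const_smul γ)
    rw [hη.integral_procState hm' hhist hYm (fun i => ?_) hfm hfb]
    · refine integral_congr_ae (Eventually.of_forall fun ω => ?_)
      simp only [hF, Pi.zero_apply, add_zero]
      congr 3
      ext1 i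
      congr 2
      exact (cutTraj_apply_of_lt (Nat.lt_succ_self s) fun r => Z' i r ω).symm
    · filter_upwards [hstep i] with ω hω
      rw [hω, hMcut]
  rw [h2]
  have h3 : ∀ n, ∫ x, F x ∂(avgLaw P fun m ω => (sampleState Z A (s + 1) (s + 1) k n m ω,
      ε n m ω)) = avg fun m => ∫ ω, F (sampleState Z A (s + 1) (s + 1) k n m ω, ε n m ω) ∂P :=
    fun n => integral_avgLaw (fun m => (hW n m).prodMk (hεm n m)) hFm hFb
  simp only [h3] at h1
  -- The noise vector of a sample has independent coordinates only if the agents are distinct, so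
  -- this identity too is needed on injective tuples only.
  have h4 : Tendsto (fun n =>
      (avg fun m => ∫ ω, f (sampleState Z A (s + 2) (s + 1) k n m ω) ∂P) -
      avg fun m => ∫ ω, F (sampleState Z A (s + 1) (s + 1) k n m ω, ε n m ω) ∂P) atTop
      (𝓝 0) := by
    refine tendsto_avg_sub_of_eq_on_injective (C := ‖f‖)
      (fun n m => abs_integral_le_of_abs_le fun _ => hfb _)
      (fun n m => abs_integral_le_of_abs_le fun _ => hFb _) fun n m hm => ?_
    have hle := history_le (hsys (n + 1)).measurable_opinion (hsys (n + 1)).measurable_edge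
      (s + 1) (s + 1)
    have hYm : Measurable[history (Z (n + 1)) (A (n + 1)) (s + 1) (s + 1)] fun ω =>
        fun i : Fin k => (1 - γ) • Z (n + 1) (m i) s ω + γ • L n (m i) ω := by
      refine @measurable_pi_lambda _ _ _ (_) _ _ fun i => ?_
      have h3 : Measurable[history (Z (n + 1)) (A (n + 1)) (s + 1) (s + 1)] (L n (m i)) :=
        measurable_neighborAverage _
          (fun j => measurable_opinion_history (Nat.lt_succ_self s) j)
          fun j l => measurable_edge_history (Nat.lt_succ_self s) j l
      have h4 : Measurable[history (Z (n + 1)) (A (n + 1)) (s + 1) (s + 1)] (Z (n + 1) (m i) s) :=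
        measurable_opinion_history (Nat.lt_succ_self s) _
      exact (h4.const_smul (1 - γ)).add (h3.const_smul γ)
    rw [sampleState, (hnoise.noiseLaw hm s).integral_procState hle (history_comp_le m _ _) hYm
      (fun i => ?_) hfm hfb]
    · refine integral_congr_ae (Eventually.of_forall fun ω => ?_)
      simp only [hF, hε]
      congr 2
      ext1 i
      have h5 : (sampleState Z A (s + 1) (s + 1) k n m ω).1 i s = Z (n + 1) (m i) s ω :=
        cutTraj_apply_of_lt (Nat.lt_succ_self s) fun r => Z (n + 1) (m i) r ω
      have h6 : M ((sampleState Z A (s + 1) (s + 1) k n m ω).1 i) =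
          M fun r => Z (n + 1) (m i) r ω := hMcut fun r => Z (n + 1) (m i) r ω
      rw [h5, h6, smul_sub]
      abel
    · filter_upwards [(hsys (n + 1)).evolve (m i) s] with ω hω
      exact hω
  simpa using h4.add h1

end Steps

/-! ### Means weighted with the edge probabilities -/

section KernelMean

variable {d : ℕ} {B0 : EuclideanSpace ℝ (Fin d) → EuclideanSpace ℝ (Fin d) → ℝ}
  {B : Bool → EuclideanSpace ℝ (Fin d) → EuclideanSpace ℝ (Fin d) → ℝ}
  {F : Type*} [NormedAddCommGroup F] [NormedSpace ℝ F]

/-- The mean of `φ (Z'(s))`, weighted with the edge probabilities `B_s(z, Z')`, where the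
trajectory `Z'` has law `μ`. -/
noncomputable def kernelMean (B0 : EuclideanSpace ℝ (Fin d) → EuclideanSpace ℝ (Fin d) → ℝ)
    (B : Bool → EuclideanSpace ℝ (Fin d) → EuclideanSpace ℝ (Fin d) → ℝ) (s : ℕ)
    (μ : Measure (ℕ → EuclideanSpace ℝ (Fin d))) (φ : EuclideanSpace ℝ (Fin d) → F)
    (z : ℕ → EuclideanSpace ℝ (Fin d)) : F :=
  ∫ w, trajProb B0 B s z w • φ (w s) ∂μ

lemma meanFieldMass_eq_kernelMean (s : ℕ) (μ : Measure (ℕ → EuclideanSpace ℝ (Fin d)))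
    (z : ℕ → EuclideanSpace ℝ (Fin d)) :
    meanFieldMass B0 B s μ z = kernelMean B0 B s μ (fun _ => (1 : ℝ)) z := by
  simp [meanFieldMass, kernelMean]

lemma meanFieldAverage_eq_kernelMean (s : ℕ) (μ : Measure (ℕ → EuclideanSpace ℝ (Fin d)))
    (z : ℕ → EuclideanSpace ℝ (Fin d)) :
    meanFieldAverage B0 B s μ z =
      (meanFieldMass B0 B s μ z)⁻¹ • kernelMean B0 B s μ (fun x => x) z := rfl

lemma kernelMean_congr (s : ℕ) (μ : Measure (ℕ → EuclideanSpace ℝ (Fin d)))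
    (φ : EuclideanSpace ℝ (Fin d) → F) {z z' : ℕ → EuclideanSpace ℝ (Fin d)}
    (h : ∀ r ≤ s, z r = z' r) : kernelMean B0 B s μ φ z = kernelMean B0 B s μ φ z' := by
  unfold kernelMean
  simp_rw [trajProb_congr (B0 := B0) (B := B) h fun r _ => rfl]

lemma kernelMean_cutTraj (s : ℕ) (μ : Measure (ℕ → EuclideanSpace ℝ (Fin d)))
    (φ : EuclideanSpace ℝ (Fin d) → F) (z : ℕ → EuclideanSpace ℝ (Fin d)) :
    kernelMean B0 B s μ φ (cutTraj (s + 1) z) = kernelMean B0 B s μ φ z :=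
  kernelMean_congr s μ φ fun _ hr => cutTraj_apply_of_lt (Nat.lt_succ_of_le hr) z

lemma norm_trajProb_smul_le (hB : IsInteractionPair B0 B) (s : ℕ)
    (z w : ℕ → EuclideanSpace ℝ (Fin d)) (x : F) : ‖trajProb B0 B s z w • x‖ ≤ ‖x‖ := by
  obtain ⟨h0, h1⟩ := trajProb_mem hB s z w
  rw [norm_smul, Real.norm_of_nonneg h0]
  exact mul_le_of_le_one_left (norm_nonneg _) h1

variable [MeasurableSpace F] [BorelSpace F] [SecondCountableTopology F]

lemma measurable_trajProb_smul (hB : IsInteractionPair B0 B) (s : ℕ)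
    {φ : EuclideanSpace ℝ (Fin d) → F} (hφ : Measurable φ) :
    Measurable fun p : (ℕ → EuclideanSpace ℝ (Fin d)) × (ℕ → EuclideanSpace ℝ (Fin d)) =>
      trajProb B0 B s p.1 p.2 • φ (p.2 s) :=
  (measurable_trajProb hB s).smul
    (hφ.comp (f := fun p : (ℕ → EuclideanSpace ℝ (Fin d)) × (ℕ → EuclideanSpace ℝ (Fin d)) =>
      p.2 s) (by fun_prop))

lemma measurable_trajProb_smul_right (hB : IsInteractionPair B0 B) (s : ℕ)
    {φ : EuclideanSpace ℝ (Fin d) → F} (hφ : Measurable φ) (z : ℕ → EuclideanSpace ℝ (Fin d)) :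
    Measurable fun w => trajProb B0 B s z w • φ (w s) :=
  (measurable_trajProb_smul hB s hφ).comp (f := fun w => (z, w)) (by fun_prop)

lemma measurable_kernelMean (hB : IsInteractionPair B0 B) (s : ℕ)
    (μ : Measure (ℕ → EuclideanSpace ℝ (Fin d))) [IsProbabilityMeasure μ]
    {φ : EuclideanSpace ℝ (Fin d) → F} (hφ : Measurable φ) :
    Measurable (kernelMean B0 B s μ φ) :=
  (StronglyMeasurable.integral_prod_right'
    (measurable_trajProb_smul hB s hφ).stronglyMeasurable).measurable

lemma integrable_trajProb_smul (hB : IsInteractionPair B0 B) (s : ℕ)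
    {μ : Measure (ℕ → EuclideanSpace ℝ (Fin d))} {φ : EuclideanSpace ℝ (Fin d) → F}
    (hφ : Measurable φ) (hi : Integrable (fun w => φ (w s)) μ)
    (z : ℕ → EuclideanSpace ℝ (Fin d)) :
    Integrable (fun w => trajProb B0 B s z w • φ (w s)) μ :=
  hi.mono (measurable_trajProb_smul_right hB s hφ z).aestronglyMeasurable
    (Eventually.of_forall fun w => norm_trajProb_smul_le hB s z w _)

lemma norm_kernelMean_le (hB : IsInteractionPair B0 B) (s : ℕ)
    {μ : Measure (ℕ → EuclideanSpace ℝ (Fin d))} {φ : EuclideanSpace ℝ (Fin d) → F}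
    (hφ : Measurable φ) (hi : Integrable (fun w => φ (w s)) μ)
    (z : ℕ → EuclideanSpace ℝ (Fin d)) :
    ‖kernelMean B0 B s μ φ z‖ ≤ ∫ w, ‖φ (w s)‖ ∂μ :=
  (norm_integral_le_integral_norm _).trans
    (integral_mono (integrable_trajProb_smul hB s hφ hi z).norm hi.norm
      fun w => norm_trajProb_smul_le hB s z w _)

lemma kernelMean_sub (hB : IsInteractionPair B0 B) (s : ℕ)
    {μ : Measure (ℕ → EuclideanSpace ℝ (Fin d))} {φ ψ : EuclideanSpace ℝ (Fin d) → F}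
    (hφ : Measurable φ) (hi : Integrable (fun w => φ (w s)) μ) (hψ : Measurable ψ)
    (hj : Integrable (fun w => ψ (w s)) μ) (z : ℕ → EuclideanSpace ℝ (Fin d)) :
    kernelMean B0 B s μ (fun x => φ x - ψ x) z =
      kernelMean B0 B s μ φ z - kernelMean B0 B s μ ψ z := by
  unfold kernelMean
  rw [← integral_sub (integrable_trajProb_smul hB s hφ hi z)
    (integrable_trajProb_smul hB s hψ hj z)]
  simp_rw [smul_sub]

/-- The integrand reads `w` up to time `s` only. Hence laws that agree up to time `s` give the same
mean, which later allows the limiting processes to be exchanged. -/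
lemma kernelMean_map_cutTraj (hB : IsInteractionPair B0 B) (s : ℕ)
    (μ : Measure (ℕ → EuclideanSpace ℝ (Fin d))) {φ : EuclideanSpace ℝ (Fin d) → F}
    (hφ : Measurable φ) (z : ℕ → EuclideanSpace ℝ (Fin d)) :
    kernelMean B0 B s (μ.map (cutTraj (s + 1))) φ z = kernelMean B0 B s μ φ z := by
  unfold kernelMean
  rw [integral_map (measurable_cutTraj (s + 1)).aemeasurable
    (measurable_trajProb_smul_right hB s hφ z).aestronglyMeasurable]
  refine integral_congr_ae (Eventually.of_forall fun w => ?_)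
  simp only
  rw [cutTraj_apply_of_lt (Nat.lt_succ_self s),
    trajProb_congr (fun r _ => rfl) fun r hr => cutTraj_apply_of_lt (Nat.lt_succ_of_le hr) w]

/-- By dominated convergence it is enough that the edge probability is continuous in the first
trajectory for almost every second one. -/
lemma continuousAt_kernelMean (hB : IsInteractionPair B0 B) (s : ℕ)
    {μ : Measure (ℕ → EuclideanSpace ℝ (Fin d))} {φ : EuclideanSpace ℝ (Fin d) → F}
    (hφ : Measurable φ) (hi : Integrable (fun w => φ (w s)) μ)
    {z : ℕ → EuclideanSpace ℝ (Fin d)}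
    (hz : ∀ᵐ w ∂μ, ∀ r ≤ s, KernelContinuousAt B0 B r (z r, w r)) :
    ContinuousAt (kernelMean B0 B s μ φ) z := by
  unfold kernelMean
  refine continuousAt_of_dominated (bound := fun w => ‖φ (w s)‖)
    (Eventually.of_forall fun z' =>
      (measurable_trajProb_smul_right hB s hφ z').aestronglyMeasurable)
    (Eventually.of_forall fun z' => Eventually.of_forall fun w =>
      norm_trajProb_smul_le hB s z' w _) hi.norm ?_
  filter_upwards [hz] with w hw
  refine ContinuousAt.smul ?_ continuousAt_const
  exact (continuousAt_trajProb hw).comp (f := fun z' => (z', w)) (by fun_prop)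

end KernelMean

/-- At each time the product of two absolutely continuous laws does not charge the discontinuities
of the kernels; Fubini's theorem and the countability of the set of times give the nested statement.
-/
lemma ae_ae_kernelContinuousAt {d : ℕ}
    {B0 : EuclideanSpace ℝ (Fin d) → EuclideanSpace ℝ (Fin d) → ℝ}
    {B : Bool → EuclideanSpace ℝ (Fin d) → EuclideanSpace ℝ (Fin d) → ℝ}
    (hB : IsInteractionPair B0 B) (s : ℕ)
    {μ μ' : Measure (ℕ → EuclideanSpace ℝ (Fin d))} [IsProbabilityMeasure μ]
    [IsProbabilityMeasure μ'] (hac : ∀ r ≤ s, μ.map (fun w => w r) ≪ volume)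
    (hac' : ∀ r ≤ s, μ'.map (fun w => w r) ≪ volume) :
    ∀ᵐ z ∂μ, ∀ᵐ w ∂μ', ∀ r ≤ s, KernelContinuousAt B0 B r (z r, w r) := by
  have h1 : ∀ r ∈ Set.Iic s, ∀ᵐ z ∂μ, ∀ᵐ w ∂μ', KernelContinuousAt B0 B r (z r, w r) := by
    intro r hr
    have hm : Measurable fun w : ℕ → EuclideanSpace ℝ (Fin d) => w r := by fun_prop
    have hp := Measure.isProbabilityMeasure_map (μ := μ) hm.aemeasurable
    have hp' := Measure.isProbabilityMeasure_map (μ := μ') hm.aemeasurable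
    have h2 : ((μ.map fun w => w r).prod (μ'.map fun w => w r)) ≪
        (volume : Measure (EuclideanSpace ℝ (Fin d) × EuclideanSpace ℝ (Fin d))) :=
      (hac r hr).prod (hac' r hr)
    have h3 := Measure.ae_ae_of_ae_prod (h2.ae_le (hB.ae_kernelContinuousAt r))
    filter_upwards [ae_of_ae_map hm.aemeasurable h3] with z hz
    exact ae_of_ae_map hm.aemeasurable hz
  have h2 : ∀ᵐ z ∂μ, ∀ r ∈ Set.Iic s, ∀ᵐ w ∂μ', KernelContinuousAt B0 B r (z r, w r) :=
    (ae_ball_iff (Set.to_countable _)).mpr h1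
  filter_upwards [h2] with z hz
  exact (ae_ball_iff (Set.to_countable (Set.Iic s))).mpr hz

/-! ### Pairing independent families -/

section Independence

/-- Two independent families of independent random elements, paired. -/
lemma iIndepFun_prodMk {Ω ι : Type*} [MeasurableSpace Ω] {P : Measure Ω} [IsProbabilityMeasure P]
    [Fintype ι] {α β : Type*} [MeasurableSpace α] [MeasurableSpace β] {X : ι → Ω → α}
    {Y : ι → Ω → β} (hXm : ∀ i, Measurable (X i)) (hYm : ∀ i, Measurable (Y i))
    (hX : iIndepFun X P) (hY : iIndepFun Y P)
    (hXY : IndepFun (fun ω i => X i ω) (fun ω i => Y i ω) P) :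
    iIndepFun (fun i ω => (X i ω, Y i ω)) P := by
  have hpX : ∀ i, IsProbabilityMeasure (P.map (X i)) :=
    fun i => Measure.isProbabilityMeasure_map (hXm i).aemeasurable
  have hpY : ∀ i, IsProbabilityMeasure (P.map (Y i)) :=
    fun i => Measure.isProbabilityMeasure_map (hYm i).aemeasurable
  have hXv : Measurable fun ω i => X i ω := measurable_pi_lambda _ hXm
  have hYv : Measurable fun ω i => Y i ω := measurable_pi_lambda _ hYm
  have h1 := (indepFun_iff_map_prod_eq_prod_map_map hXv.aemeasurable hYv.aemeasurable).mp hXY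
  rw [(iIndepFun_iff_map_fun_eq_pi_map fun i => (hXm i).aemeasurable).mp hX,
    (iIndepFun_iff_map_fun_eq_pi_map fun i => (hYm i).aemeasurable).mp hY] at h1
  rw [iIndepFun_iff_map_fun_eq_pi_map fun i => ((hXm i).prodMk (hYm i)).aemeasurable]
  -- The vector of pairs is the pair of vectors up to the canonical equivalence, which carries a
  -- product of two product measures to the product of the pairwise products.
  have h2 : (fun ω i => (X i ω, Y i ω)) =
      (MeasurableEquiv.arrowProdEquivProdArrow α β ι).symm ∘
        fun ω => (fun i => X i ω, fun i => Y i ω) := rfl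
  rw [h2, ← Measure.map_map (MeasurableEquiv.measurable _) (hXv.prodMk hYv), h1]
  have h3 := (measurePreserving_arrowProdEquivProdArrow α β ι (fun i => P.map (X i))
    fun i => P.map (Y i)).symm.map_eq
  rw [h3]
  congr 1
  ext1 i
  have h4 : IndepFun (X i) (Y i) P := hXY.comp (measurable_pi_apply i) (measurable_pi_apply i)
  exact ((indepFun_iff_map_prod_eq_prod_map_map (hXm i).aemeasurable
    (hYm i).aemeasurable).mp h4).symm

end Independence

/-! ### Independence and absolute continuity in the limiting process -/

section LimitStructure

variable {d : ℕ} {B0 : EuclideanSpace ℝ (Fin d) → EuclideanSpace ℝ (Fin d) → ℝ}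
  {B : Bool → EuclideanSpace ℝ (Fin d) → EuclideanSpace ℝ (Fin d) → ℝ}

/-- The deterministic part of the update of the opinion in the limiting process. -/
noncomputable def meanFieldDrift (γ : ℝ)
    (B0 : EuclideanSpace ℝ (Fin d) → EuclideanSpace ℝ (Fin d) → ℝ)
    (B : Bool → EuclideanSpace ℝ (Fin d) → EuclideanSpace ℝ (Fin d) → ℝ) (s : ℕ)
    (μ : Measure (ℕ → EuclideanSpace ℝ (Fin d))) (z : ℕ → EuclideanSpace ℝ (Fin d)) :
    EuclideanSpace ℝ (Fin d) :=
  (1 - γ) • z s + γ • meanFieldAverage B0 B s μ z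

lemma meanFieldMass_cutTraj (s : ℕ) (μ : Measure (ℕ → EuclideanSpace ℝ (Fin d)))
    (z : ℕ → EuclideanSpace ℝ (Fin d)) :
    meanFieldMass B0 B s μ (cutTraj (s + 1) z) = meanFieldMass B0 B s μ z := by
  simp only [meanFieldMass_eq_kernelMean, kernelMean_cutTraj]

lemma meanFieldAverage_cutTraj (s : ℕ) (μ : Measure (ℕ → EuclideanSpace ℝ (Fin d)))
    (z : ℕ → EuclideanSpace ℝ (Fin d)) :
    meanFieldAverage B0 B s μ (cutTraj (s + 1) z) = meanFieldAverage B0 B s μ z := by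
  simp only [meanFieldAverage_eq_kernelMean, kernelMean_cutTraj, meanFieldMass_cutTraj]

lemma meanFieldDrift_cutTraj (γ : ℝ) (s : ℕ) (μ : Measure (ℕ → EuclideanSpace ℝ (Fin d)))
    (z : ℕ → EuclideanSpace ℝ (Fin d)) :
    meanFieldDrift γ B0 B s μ (cutTraj (s + 1) z) = meanFieldDrift γ B0 B s μ z := by
  simp only [meanFieldDrift, meanFieldAverage_cutTraj, cutTraj_apply_of_lt (Nat.lt_succ_self s)]

lemma measurable_meanFieldMass (hB : IsInteractionPair B0 B) (s : ℕ)
    (μ : Measure (ℕ → EuclideanSpace ℝ (Fin d))) [IsProbabilityMeasure μ] :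
    Measurable (meanFieldMass B0 B s μ) := by
  rw [funext fun z => meanFieldMass_eq_kernelMean (B0 := B0) (B := B) s μ z]
  exact measurable_kernelMean hB s μ measurable_const

lemma measurable_meanFieldAverage (hB : IsInteractionPair B0 B) (s : ℕ)
    (μ : Measure (ℕ → EuclideanSpace ℝ (Fin d))) [IsProbabilityMeasure μ] :
    Measurable (meanFieldAverage B0 B s μ) :=
  (measurable_meanFieldMass hB s μ).inv.smul
    (measurable_kernelMean hB s μ (φ := fun x => x) measurable_id)

lemma measurable_meanFieldDrift (γ : ℝ) (hB : IsInteractionPair B0 B) (s : ℕ)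
    (μ : Measure (ℕ → EuclideanSpace ℝ (Fin d))) [IsProbabilityMeasure μ] :
    Measurable (meanFieldDrift γ B0 B s μ) := by
  have h1 : Measurable fun z : ℕ → EuclideanSpace ℝ (Fin d) => z s := by fun_prop
  have h2 := measurable_meanFieldAverage hB s μ
  exact (h1.const_smul (1 - γ)).add (h2.const_smul γ)

lemma measurable_cutTraj_history {Ω ι : Type*} {Z : ι → ℕ → Ω → EuclideanSpace ℝ (Fin d)}
    {A : ι → ι → ℕ → Ω → Bool} {p q : ℕ} (i : ι) :
    Measurable[history Z A p q] fun ω => cutTraj p fun r => Z i r ω :=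
  measurable_cutTraj_comp fun _ hr => measurable_opinion_history hr i

namespace IsLimitingMeanField

variable {Ω : Type*} [mΩ : MeasurableSpace Ω] {P : Measure Ω}
  {γ : ℝ} {μ0 ν : Measure (EuclideanSpace ℝ (Fin d))} {k t : ℕ}
  {ξ : Fin k → ℕ → Ω → EuclideanSpace ℝ (Fin d)}
  {Z : Fin k → ℕ → Ω → EuclideanSpace ℝ (Fin d)} {A : Fin k → Fin k → ℕ → Ω → Bool}

lemma measurable_traj (h : IsLimitingMeanField P γ B0 B μ0 ν k t ξ Z A) (i : Fin k) :
    Measurable fun ω r => Z i r ω :=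
  measurable_pi_lambda _ fun r => h.measurable_opinion i r

lemma measurable_cut (h : IsLimitingMeanField P γ B0 B μ0 ν k t ξ Z A) (i : Fin k) (p : ℕ) :
    Measurable fun ω => cutTraj p fun r => Z i r ω :=
  (measurable_cutTraj p).comp (h.measurable_traj i)

lemma evolve_drift (h : IsLimitingMeanField P γ B0 B μ0 ν k t ξ Z A) (i : Fin k) {s : ℕ}
    (hs : s < t) : ∀ᵐ ω ∂P, Z i (s + 1) ω =
      meanFieldDrift γ B0 B s (P.map fun ω r => Z i r ω) (cutTraj (s + 1) fun r => Z i r ω) +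
        ξ i s ω := by
  filter_upwards [h.evolve i s hs] with ω hω
  rw [hω, meanFieldDrift_cutTraj]
  rfl

variable [IsProbabilityMeasure P]

lemma isProbabilityMeasure_traj (h : IsLimitingMeanField P γ B0 B μ0 ν k t ξ Z A) (i : Fin k) :
    IsProbabilityMeasure (P.map fun ω r => Z i r ω) :=
  Measure.isProbabilityMeasure_map (h.measurable_traj i).aemeasurable

lemma indepFun_noise (h : IsLimitingMeanField P γ B0 B μ0 ν k t ξ Z A) {s : ℕ} (hs : s ≤ t)
    {α : Type*} [MeasurableSpace α] {W : Ω → α}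
    (hW : Measurable[history Z A (s + 1) (s + 1)] W) :
    IndepFun W (fun ω i => ξ i s ω) P := by
  rw [IndepFun_iff_Indep]
  exact indep_of_indep_of_le_left (h.noiseLaw hs).indep.symm (measurable_iff_comap_le.mp hW)

/-- The opinion trajectories of the agents of a limiting process are independent. -/
theorem iIndepFun_cutTraj (h : IsLimitingMeanField P γ B0 B μ0 ν k t ξ Z A)
    (hB : IsInteractionPair B0 B) {s : ℕ} (hs : s ≤ t) :
    iIndepFun (fun i ω => cutTraj (s + 1) fun r => Z i r ω) P := by
  induction s with
  | zero =>
    have h1 := h.init_indep.comp (fun _ (x : EuclideanSpace ℝ (Fin d)) => cutTraj 1 fun _ : ℕ => x) fun _ => by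
      exact (measurable_cutTraj 1).comp (measurable_pi_lambda _ fun _ => measurable_id)
    refine (iIndepFun_congr fun i => ?_).mp h1
    refine Eventually.of_forall fun ω => ?_
    exact cutTraj_congr fun r hr => by rw [Nat.lt_one_iff.mp hr]
  | succ s ih =>
    have hs' : s ≤ t := by omega
    have hind : iIndepFun (fun i => ξ i s) P :=
      h.noise_indep.precomp (g := fun i : Fin k => (i, (⟨s, by omega⟩ : Fin (t + 1))))
        fun i j hij => by simpa using hij
    have h1 := iIndepFun_prodMk (fun i => h.measurable_cut i (s + 1))
      (fun i => h.measurable_noise i s) (ih hs') hind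
      (h.indepFun_noise hs' (@measurable_pi_lambda _ _ _ (_) _ _ fun i =>
        measurable_cutTraj_history i))
    have hp := h.isProbabilityMeasure_traj
    -- The next trajectory of an agent is a fixed function of its own past and its own noise, since
    -- the other agents enter only through a deterministic law. Hence independence is preserved.
    have h2 := h1.comp (fun i p => Function.update p.1 (s + 1)
      (meanFieldDrift γ B0 B s (P.map fun ω r => Z i r ω) p.1 + p.2)) fun i => by
        refine measurable_pi_lambda _ fun r => ?_
        by_cases hr : r = s + 1
        · subst hr
          simp only [Function.update_self]
          exact ((measurable_meanFieldDrift γ hB s _).comp measurable_fst).add measurable_snd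
        · simp only [Function.update_of_ne hr]
          fun_prop
    refine (iIndepFun_congr fun i => ?_).mp h2
    filter_upwards [h.evolve_drift i hs] with ω hω
    simp only [Function.comp_apply]
    rw [cutTraj_succ (s + 1), hω]

/-- After time `0` an opinion is a variable determined by the past plus independent noise, and
convolution with an absolutely continuous law is absolutely continuous. -/
lemma absolutelyContinuous (h : IsLimitingMeanField P γ B0 B μ0 ν k t ξ Z A)
    (hB : IsInteractionPair B0 B) (hμ0 : μ0 ≪ volume) (hν : ν ≪ volume) (i : Fin k) {s : ℕ}
    (hs : s ≤ t) : P.map (Z i s) ≪ volume := by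
  cases s with
  | zero => rw [h.init_law]; exact hμ0
  | succ s =>
    have hp := h.isProbabilityMeasure_traj i
    set H : Ω → EuclideanSpace ℝ (Fin d) := fun ω => meanFieldDrift γ B0 B s
      (P.map fun ω r => Z i r ω) (cutTraj (s + 1) fun r => Z i r ω) with hH
    have hHm : Measurable H := (measurable_meanFieldDrift γ hB s _).comp (h.measurable_cut i _)
    have h1 : P.map (Z i (s + 1)) = P.map (H + ξ i s) := Measure.map_congr (h.evolve_drift i hs)
    have h2 : IndepFun H (ξ i s) P := by
      have h3 := h.indepFun_noise (s := s) (by omega) (W := H)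
        ((measurable_meanFieldDrift γ hB s _).comp
          (measurable_cutTraj_history i))
      exact h3.comp measurable_id (measurable_pi_apply i)
    have := Measure.isProbabilityMeasure_map (μ := P) hHm.aemeasurable
    have hν' : IsProbabilityMeasure ν := by
      rw [← h.noise_law i s (by omega)]
      exact Measure.isProbabilityMeasure_map (h.measurable_noise i s).aemeasurable
    rw [h1, h2.map_add_eq_map_conv_map₀ hHm.aemeasurable (h.measurable_noise i s).aemeasurable,
      h.noise_law i s (by omega)]
    exact Measure.conv_absolutelyContinuous hν

/-- The trajectories of two agents are independent, so the joint law is a product of absolutely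
continuous laws. -/
lemma absolutelyContinuous_pair (h : IsLimitingMeanField P γ B0 B μ0 ν k t ξ Z A)
    (hB : IsInteractionPair B0 B) (hμ0 : μ0 ≪ volume) (hν : ν ≪ volume) {i j : Fin k}
    (hij : i ≠ j) {s : ℕ} (hs : s ≤ t) : P.map (fun ω => (Z i s ω, Z j s ω)) ≪ volume := by
  have he : Measurable fun z : ℕ → EuclideanSpace ℝ (Fin d) => z s := by fun_prop
  have h1 := ((h.iIndepFun_cutTraj hB hs).indepFun hij).comp he he
  have h2 : IndepFun (Z i s) (Z j s) P := by
    refine h1.congr (Eventually.of_forall fun ω => ?_) (Eventually.of_forall fun ω => ?_)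
    · exact cutTraj_apply_of_lt (Nat.lt_succ_self s) fun r => Z i r ω
    · exact cutTraj_apply_of_lt (Nat.lt_succ_self s) fun r => Z j r ω
  rw [(indepFun_iff_map_prod_eq_prod_map_map (h.measurable_opinion i s).aemeasurable
    (h.measurable_opinion j s).aemeasurable).mp h2]
  have := Measure.isProbabilityMeasure_map (μ := P) (h.measurable_opinion i s).aemeasurable
  have := Measure.isProbabilityMeasure_map (μ := P) (h.measurable_opinion j s).aemeasurable
  exact (h.absolutelyContinuous hB hμ0 hν i hs).prod (h.absolutelyContinuous hB hμ0 hν j hs)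

/-- The interaction is almost surely continuous along the trajectories of two agents. -/
lemma ae_ae_kernelContinuousAt (h : IsLimitingMeanField P γ B0 B μ0 ν k t ξ Z A)
    (hB : IsInteractionPair B0 B) (hμ0 : μ0 ≪ volume) (hν : ν ≪ volume) (i j : Fin k) {s : ℕ}
    (hs : s ≤ t) : ∀ᵐ ω ∂P, ∀ᵐ w ∂(P.map fun ω r => Z j r ω), ∀ r ≤ s,
      KernelContinuousAt B0 B r (cutTraj (s + 1) (fun r => Z i r ω) r, w r) := by
  have hp := h.isProbabilityMeasure_traj
  have hac : ∀ i, ∀ r ≤ s, (P.map fun ω r => Z i r ω).map (fun w => w r) ≪ volume := by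
    intro i r hr
    rw [Measure.map_map (measurable_pi_apply r) (h.measurable_traj i)]
    exact h.absolutelyContinuous hB hμ0 hν i (hr.trans hs)
  have h1 := ae_of_ae_map (h.measurable_traj i).aemeasurable
    (_root_.ae_ae_kernelContinuousAt hB s (hac i) (hac j))
  filter_upwards [h1] with ω hω
  filter_upwards [hω] with w hw r hr
  rw [cutTraj_apply_of_lt (Nat.lt_succ_of_le hr)]
  exact hw r hr

end IsLimitingMeanField

end LimitStructure

/-! ### Two edges of one agent in the limiting process -/

section TwoEdges

variable {d : ℕ} {B0 : EuclideanSpace ℝ (Fin d) → EuclideanSpace ℝ (Fin d) → ℝ}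
  {B : Bool → EuclideanSpace ℝ (Fin d) → EuclideanSpace ℝ (Fin d) → ℝ}

/-- The average of `G` over two independent bits with given probabilities. -/
noncomputable def bitAverage (p q : ℝ) (G : Bool → Bool → ℝ) : ℝ :=
  ∑ a, ∑ b, bitWeight p a * bitWeight q b * G a b

lemma abs_bitAverage_le {p q : ℝ} (hp : p ∈ Set.Icc (0 : ℝ) 1) (hq : q ∈ Set.Icc (0 : ℝ) 1)
    {G : Bool → Bool → ℝ} {C : ℝ} (hG : ∀ a b, |G a b| ≤ C) : |bitAverage p q G| ≤ C := by
  have h1 : |bitAverage p q G| ≤ ∑ a, ∑ b, bitWeight p a * bitWeight q b * C := by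
    unfold bitAverage
    refine (Finset.abs_sum_le_sum_abs _ _).trans (Finset.sum_le_sum fun a _ =>
      (Finset.abs_sum_le_sum_abs _ _).trans (Finset.sum_le_sum fun b _ => ?_))
    have h2 := mul_nonneg (bitWeight_mem hp a).1 (bitWeight_mem hq b).1
    rw [abs_mul, abs_of_nonneg h2]
    exact mul_le_mul_of_nonneg_left (hG a b) h2
  refine h1.trans (le_of_eq ?_)
  simp only [Fintype.sum_bool, bitWeight]
  simp
  ring

lemma measurable_bitAverage {α : Type*} [MeasurableSpace α] {p q : α → ℝ} (hp : Measurable p)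
    (hq : Measurable q) {G : α → Bool → Bool → ℝ} (hG : ∀ a b, Measurable fun x => G x a b) :
    Measurable fun x => bitAverage (p x) (q x) (G x) := by
  unfold bitAverage
  exact Finset.measurable_fun_sum _ fun a _ => Finset.measurable_fun_sum _ fun b _ =>
    (((measurable_bitWeight a).comp hp).mul ((measurable_bitWeight b).comp hq)).mul (hG a b)

lemma integral_bitAverage {α : Type*} [MeasurableSpace α] {ρ : Measure α} (p q : ℝ)
    {G : α → Bool → Bool → ℝ} (hG : ∀ a b, Integrable (fun v => G v a b) ρ) :
    ∫ v, bitAverage p q (G v) ∂ρ = bitAverage p q fun a b => ∫ v, G v a b ∂ρ := by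
  unfold bitAverage
  have hi : ∀ a b, Integrable (fun v => bitWeight p a * bitWeight q b * G v a b) ρ :=
    fun a b => (hG a b).const_mul _
  rw [integral_finsetSum _ fun a _ => integrable_finsetSum _ fun b _ => hi a b]
  refine Finset.sum_congr rfl fun a _ => ?_
  rw [integral_finsetSum _ fun b _ => hi a b]
  exact Finset.sum_congr rfl fun b _ => integral_const_mul _ _

lemma trajProb_cutTraj (s : ℕ) (z w : ℕ → EuclideanSpace ℝ (Fin d)) :
    trajProb B0 B s (cutTraj (s + 1) z) (cutTraj (s + 1) w) = trajProb B0 B s z w :=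
  trajProb_congr (fun _ hr => cutTraj_apply_of_lt (Nat.lt_succ_of_le hr) z)
    fun _ hr => cutTraj_apply_of_lt (Nat.lt_succ_of_le hr) w

/-- Total probability over the earlier values of both edges, which evolve separately once the
opinion trajectories are fixed. -/
lemma bitAverage_trajProb_succ (s : ℕ) (z w w' : ℕ → EuclideanSpace ℝ (Fin d))
    (G : Bool → Bool → ℝ) :
    bitAverage (trajProb B0 B (s + 1) z w) (trajProb B0 B (s + 1) z w') G =
      bitAverage (trajProb B0 B s z w) (trajProb B0 B s z w') fun a b =>
        bitAverage (B a (z (s + 1)) (w (s + 1))) (B b (z (s + 1)) (w' (s + 1))) G := by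
  simp only [bitAverage, bitWeight_trajProb_succ, Fintype.sum_bool]
  ring

/-- Extend the trajectories `x` by the value `H i (x i) + v i` at time `s`. -/
def extendTraj {k : ℕ} (s : ℕ)
    (H : Fin k → (ℕ → EuclideanSpace ℝ (Fin d)) → EuclideanSpace ℝ (Fin d))
    (x : Fin k → ℕ → EuclideanSpace ℝ (Fin d)) (v : Fin k → EuclideanSpace ℝ (Fin d)) :
    Fin k → ℕ → EuclideanSpace ℝ (Fin d) :=
  fun i => Function.update (x i) s (H i (x i) + v i)

lemma measurable_extendTraj {k : ℕ} (s : ℕ)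
    {H : Fin k → (ℕ → EuclideanSpace ℝ (Fin d)) → EuclideanSpace ℝ (Fin d)}
    (hH : ∀ i, Measurable (H i)) :
    Measurable fun p : (Fin k → ℕ → EuclideanSpace ℝ (Fin d)) ×
      (Fin k → EuclideanSpace ℝ (Fin d)) => extendTraj s H p.1 p.2 := by
  refine measurable_pi_lambda _ fun i => measurable_pi_lambda _ fun r => ?_
  have h1 : Measurable fun p : (Fin k → ℕ → EuclideanSpace ℝ (Fin d)) ×
      (Fin k → EuclideanSpace ℝ (Fin d)) => p.1 i := by fun_prop
  have h2 : Measurable fun p : (Fin k → ℕ → EuclideanSpace ℝ (Fin d)) ×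
      (Fin k → EuclideanSpace ℝ (Fin d)) => p.2 i := by fun_prop
  unfold extendTraj
  by_cases hr : r = s
  · subst hr
    simp only [Function.update_self]
    exact ((hH i).comp h1).add h2
  · simp only [Function.update_of_ne hr]
    fun_prop

/-- Here the weights depend on the past only, so integrating the noise commutes with the finite sum
over the bits. This puts back the noise that `NoiseLaw.integral_bits` removes in the induction
below. -/
lemma NoiseLaw.integral_bitAverage {Ω X : Type*} [MeasurableSpace X] {k : ℕ}
    {m : MeasurableSpace Ω} [mΩ : MeasurableSpace Ω] {P : Measure Ω} [IsProbabilityMeasure P]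
    {ν : Measure (EuclideanSpace ℝ (Fin d))} [IsProbabilityMeasure ν]
    {η : Ω → Fin k → EuclideanSpace ℝ (Fin d)}
    (h : NoiseLaw ν m P η) (hm : m ≤ mΩ) {c : Ω → X} (hc : Measurable[m] c)
    {p q : X → ℝ} (hp : Measurable p) (hq : Measurable q) (hp1 : ∀ x, p x ∈ Set.Icc (0 : ℝ) 1)
    (hq1 : ∀ x, q x ∈ Set.Icc (0 : ℝ) 1)
    {G : Bool → Bool → X × (Fin k → EuclideanSpace ℝ (Fin d)) → ℝ} (hG : ∀ a b, Measurable (G a b))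
    {C : ℝ} (hC : ∀ a b x, |G a b x| ≤ C) :
    ∫ ω, bitAverage (p (c ω)) (q (c ω)) (fun a b => G a b (c ω, η ω)) ∂P =
      ∫ ω, bitAverage (p (c ω)) (q (c ω))
        (fun a b => ∫ v, G a b (c ω, v) ∂(Measure.pi fun _ => ν)) ∂P := by
  have h1 := h.integral hm hc
    (f := fun y => bitAverage (p y.1) (q y.1) fun a b => G a b y) (C := C)
    (measurable_bitAverage (hp.comp measurable_fst) (hq.comp measurable_fst) hG)
    fun y => abs_bitAverage_le (hp1 _) (hq1 _) fun a b => hC _ _ _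
  rw [h1]
  refine integral_congr_ae (Eventually.of_forall fun ω => ?_)
  have hi : ∀ a b, Integrable (fun v => G a b (c ω, v)) (Measure.pi fun _ => ν) := fun a b =>
    Integrable.of_bound ((hG a b).comp
      (measurable_const.prodMk measurable_id)).aestronglyMeasurable C
      (Eventually.of_forall fun v => hC _ _ _)
  exact _root_.integral_bitAverage (p (c ω)) (q (c ω)) (G := fun v a b => G a b (c ω, v)) hi

lemma NoiseLaw.integral_bits {Ω X : Type*} [MeasurableSpace X] {k : ℕ}
    {m : MeasurableSpace Ω} [mΩ : MeasurableSpace Ω] {P : Measure Ω} [IsProbabilityMeasure P]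
    {ν : Measure (EuclideanSpace ℝ (Fin d))} {η : Ω → Fin k → EuclideanSpace ℝ (Fin d)}
    (h : NoiseLaw ν m P η) (hm : m ≤ mΩ) {c : Ω → X} (hc : Measurable[m] c)
    {a b : Ω → Bool} (ha : Measurable[m] a) (hb : Measurable[m] b)
    {G : Bool → Bool → X × (Fin k → EuclideanSpace ℝ (Fin d)) → ℝ} (hG : ∀ a b, Measurable (G a b))
    {C : ℝ} (hC : ∀ a b x, |G a b x| ≤ C) :
    ∫ ω, G (a ω) (b ω) (c ω, η ω) ∂P =
      ∫ ω, ∫ v, G (a ω) (b ω) (c ω, v) ∂(Measure.pi fun _ => ν) ∂P := by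
  have h1 : Measurable fun q : Bool × Bool × X × (Fin k → EuclideanSpace ℝ (Fin d)) =>
      G q.1 q.2.1 q.2.2 :=
    measurable_of_bool_prod fun a => measurable_of_bool_prod fun b => hG a b
  exact h.integral hm (W := fun ω => (a ω, b ω, c ω)) (ha.prodMk (hb.prodMk hc))
    (f := fun p => G p.1.1 p.1.2.1 (p.1.2.2, p.2)) (C := C)
    (h1.comp (f := fun p : (Bool × Bool × X) × (Fin k → EuclideanSpace ℝ (Fin d)) =>
      (p.1.1, p.1.2.1, p.1.2.2, p.2)) (by fun_prop)) fun p => hC _ _ _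

namespace IsLimitingMeanField

variable {Ω : Type*} [mΩ : MeasurableSpace Ω] {P : Measure Ω} [IsProbabilityMeasure P]
  {γ : ℝ} {μ0 ν : Measure (EuclideanSpace ℝ (Fin d))} {t : ℕ}
  {ξ : Fin 3 → ℕ → Ω → EuclideanSpace ℝ (Fin d)}
  {Z : Fin 3 → ℕ → Ω → EuclideanSpace ℝ (Fin d)} {A : Fin 3 → Fin 3 → ℕ → Ω → Bool}

/-- This removes only the newest edges: the probabilities on the right still depend on the edges one
step earlier, which the induction in `integral_two_edges` then averages out. -/
lemma integral_two_edges_step (h : IsLimitingMeanField P γ B0 B μ0 ν 3 t ξ Z A)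
    (hB : IsInteractionPair B0 B) {s : ℕ} (hs : s ≤ t)
    {G : Bool → Bool → (Fin 3 → ℕ → EuclideanSpace ℝ (Fin d)) → ℝ}
    (hG : ∀ a b, Measurable (G a b)) {C : ℝ} (hC : ∀ a b x, |G a b x| ≤ C) :
    ∫ ω, G (A 0 1 s ω) (A 0 2 s ω) (fun i => cutTraj (s + 1) fun r => Z i r ω) ∂P =
      ∫ ω, bitAverage
        (edgeProb B0 B s (fun r => Z 0 r ω) (fun r => Z 1 r ω) fun r => A 0 1 r ω)
        (edgeProb B0 B s (fun r => Z 0 r ω) (fun r => Z 2 r ω) fun r => A 0 2 r ω)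
        (fun a b => G a b fun i => cutTraj (s + 1) fun r => Z i r ω) ∂P := by
  set e1 : EdgeIdx 3 := ⟨(0, 1), by decide⟩ with he1
  set e2 : EdgeIdx 3 := ⟨(0, 2), by decide⟩ with he2
  have hne : e1 ≠ e2 := by simp [he1, he2]
  have hE := h.edgeLaw hs
  have hcut : Measurable[history Z A (s + 1) s] fun ω i => cutTraj (s + 1) fun r => Z i r ω :=
    @measurable_pi_lambda _ _ _ (_) _ _ fun i => measurable_cutTraj_history i
  have hle := history_le h.measurable_opinion h.measurable_edge (s + 1) s
  have hcut' := hcut.mono hle le_rfl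
  have key : ∀ a b, ∫ ω, G a b (fun i => cutTraj (s + 1) fun r => Z i r ω) *
      ((if A 0 1 s ω = a then (1 : ℝ) else 0) * (if A 0 2 s ω = b then (1 : ℝ) else 0)) ∂P =
      ∫ ω, G a b (fun i => cutTraj (s + 1) fun r => Z i r ω) *
        (bitWeight (edgeProb B0 B s (fun r => Z 0 r ω) (fun r => Z 1 r ω) fun r => A 0 1 r ω) a *
        bitWeight (edgeProb B0 B s (fun r => Z 0 r ω) (fun r => Z 2 r ω) fun r => A 0 2 r ω) b)
        ∂P := by
    intro a b
    have := hE.integral_mul_prod {e1, e2} (fun e => if e = e1 then a else b)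
      (fun ω => G a b fun i => cutTraj (s + 1) fun r => Z i r ω) C ((hG a b).comp hcut)
      fun ω => hC _ _ _
    simp_rw [edgesWeight_procState s _ _ Z A _ (Nat.lt_succ_self s) le_rfl,
      Finset.prod_pair hne] at this
    simpa [hne.symm, he1, he2] using this
  have h1 : ∀ ω, G (A 0 1 s ω) (A 0 2 s ω) (fun i => cutTraj (s + 1) fun r => Z i r ω) =
      ∑ a, ∑ b, G a b (fun i => cutTraj (s + 1) fun r => Z i r ω) *
      ((if A 0 1 s ω = a then (1 : ℝ) else 0) * (if A 0 2 s ω = b then (1 : ℝ) else 0)) := by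
    intro ω
    simp only [Fintype.sum_bool]
    cases A 0 1 s ω <;> cases A 0 2 s ω <;> simp
  have h2 : ∀ ω, bitAverage
        (edgeProb B0 B s (fun r => Z 0 r ω) (fun r => Z 1 r ω) fun r => A 0 1 r ω)
        (edgeProb B0 B s (fun r => Z 0 r ω) (fun r => Z 2 r ω) fun r => A 0 2 r ω)
        (fun a b => G a b fun i => cutTraj (s + 1) fun r => Z i r ω) =
      ∑ a, ∑ b, G a b (fun i => cutTraj (s + 1) fun r => Z i r ω) *
        (bitWeight (edgeProb B0 B s (fun r => Z 0 r ω) (fun r => Z 1 r ω) fun r => A 0 1 r ω) a *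
        bitWeight (edgeProb B0 B s (fun r => Z 0 r ω) (fun r => Z 2 r ω) fun r => A 0 2 r ω) b) :=
    fun ω => Finset.sum_congr rfl fun a _ => Finset.sum_congr rfl fun b _ => mul_comm _ _
  have hedge : ∀ i j a, Measurable fun ω => if A i j s ω = a then (1 : ℝ) else 0 := fun i j a =>
    Measurable.ite (h.measurable_edge i j s (measurableSet_singleton a)) measurable_const
      measurable_const
  have hw : ∀ i j a, Measurable fun ω => bitWeight
      (edgeProb B0 B s (fun r => Z i r ω) (fun r => Z j r ω) fun r => A i j r ω) a := by
    intro i j a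
    refine (measurable_bitWeight a).comp ((measurable_edgeProb hB s).comp
      (f := fun ω => ((fun r => Z i r ω), (fun r => Z j r ω), fun r => A i j r ω)) ?_)
    exact (h.measurable_traj i).prodMk ((h.measurable_traj j).prodMk
      (measurable_pi_lambda _ fun r => h.measurable_edge i j r))
  have hint : ∀ a b (w : Ω → ℝ), Measurable w → (∀ ω, |w ω| ≤ 1) →
      Integrable (fun ω => G a b (fun i => cutTraj (s + 1) fun r => Z i r ω) * w ω) P := by
    intro a b w hw hw1
    refine Integrable.of_bound (((hG a b).comp hcut').mul hw).aestronglyMeasurable C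
      (Eventually.of_forall fun ω => ?_)
    rw [norm_mul]
    have := hC a b fun i => cutTraj (s + 1) fun r => Z i r ω
    exact (mul_le_mul this (hw1 ω) (abs_nonneg _) ((abs_nonneg _).trans this)).trans
      (mul_one C).le
  have habs : ∀ x y : ℝ, x ∈ Set.Icc (0 : ℝ) 1 → y ∈ Set.Icc (0 : ℝ) 1 → |x * y| ≤ 1 :=
    fun x y hx hy => by
      rw [abs_of_nonneg (mul_nonneg hx.1 hy.1)]
      exact mul_le_one₀ hx.2 hy.1 hy.2
  have hite : ∀ p : Prop, [Decidable p] → (if p then (1 : ℝ) else 0) ∈ Set.Icc (0 : ℝ) 1 := by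
    intro p _; split_ifs <;> simp
  have hI1 : ∀ a b, Integrable (fun ω => G a b (fun i => cutTraj (s + 1) fun r => Z i r ω) *
      ((if A 0 1 s ω = a then (1 : ℝ) else 0) * (if A 0 2 s ω = b then (1 : ℝ) else 0))) P :=
    fun a b => hint a b _ ((hedge 0 1 a).mul (hedge 0 2 b)) fun ω => habs _ _ (hite _) (hite _)
  have hI2 : ∀ a b, Integrable (fun ω => G a b (fun i => cutTraj (s + 1) fun r => Z i r ω) *
      (bitWeight (edgeProb B0 B s (fun r => Z 0 r ω) (fun r => Z 1 r ω) fun r => A 0 1 r ω) a *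
      bitWeight (edgeProb B0 B s (fun r => Z 0 r ω) (fun r => Z 2 r ω) fun r => A 0 2 r ω) b)) P :=
    fun a b => hint a b _ ((hw 0 1 a).mul (hw 0 2 b)) fun ω =>
    habs _ _ (bitWeight_mem (edgeProb_mem hB s _ _ _) a)
      (bitWeight_mem (edgeProb_mem hB s _ _ _) b)
  simp_rw [h1, h2]
  rw [integral_finsetSum _ fun a _ => integrable_finsetSum _ fun b _ => hI1 a b,
    integral_finsetSum _ fun a _ => integrable_finsetSum _ fun b _ => hI2 a b]
  refine Finset.sum_congr rfl fun a _ => ?_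
  rw [integral_finsetSum _ fun b _ => hI1 a b, integral_finsetSum _ fun b _ => hI2 a b]
  exact Finset.sum_congr rfl fun b _ => key a b

/-- Given the opinion trajectories, two edges of an agent are independent with the probabilities
`trajProb`. -/
theorem integral_two_edges (h : IsLimitingMeanField P γ B0 B μ0 ν 3 t ξ Z A)
    (hB : IsInteractionPair B0 B) {s : ℕ} (hs : s ≤ t)
    {G : Bool → Bool → (Fin 3 → ℕ → EuclideanSpace ℝ (Fin d)) → ℝ}
    (hG : ∀ a b, Measurable (G a b)) {C : ℝ} (hC : ∀ a b x, |G a b x| ≤ C) :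
    ∫ ω, G (A 0 1 s ω) (A 0 2 s ω) (fun i => cutTraj (s + 1) fun r => Z i r ω) ∂P =
      ∫ ω, bitAverage (trajProb B0 B s (fun r => Z 0 r ω) fun r => Z 1 r ω)
        (trajProb B0 B s (fun r => Z 0 r ω) fun r => Z 2 r ω)
        (fun a b => G a b fun i => cutTraj (s + 1) fun r => Z i r ω) ∂P := by
  induction s generalizing G C with
  | zero => rw [h.integral_two_edges_step hB hs hG hC]; rfl
  | succ s ih =>
    have hst : s < t := by omega
    have hν : IsProbabilityMeasure ν := by
      rw [← h.noise_law 0 s hst.le]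
      exact Measure.isProbabilityMeasure_map (h.measurable_noise 0 s).aemeasurable
    have hp := h.isProbabilityMeasure_traj
    set U : (Fin 3 → ℕ → EuclideanSpace ℝ (Fin d)) → (Fin 3 → EuclideanSpace ℝ (Fin d)) →
        Fin 3 → ℕ → EuclideanSpace ℝ (Fin d) := extendTraj (s + 1)
      fun i => meanFieldDrift γ B0 B s (P.map fun ω r => Z i r ω) with hU
    have hUm : Measurable fun p : (Fin 3 → ℕ → EuclideanSpace ℝ (Fin d)) ×
        (Fin 3 → EuclideanSpace ℝ (Fin d)) => U p.1 p.2 :=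
      measurable_extendTraj _ fun i => measurable_meanFieldDrift γ hB s _
    have hstep : ∀ᵐ ω ∂P, (fun i => cutTraj (s + 2) fun r => Z i r ω) =
        U (fun i => cutTraj (s + 1) fun r => Z i r ω) fun i => ξ i s ω := by
      filter_upwards [ae_all_iff.mpr fun i => h.evolve_drift i hst] with ω hω
      funext i
      rw [cutTraj_succ (s + 1), hω i]
      rfl
    -- `G'` is `G` averaged over the edges at time `s + 1`, given the edges `a`, `b` at time `s`.
    set G' : Bool → Bool → (Fin 3 → ℕ → EuclideanSpace ℝ (Fin d)) → ℝ := fun a b x =>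
      bitAverage (B a (x 0 (s + 1)) (x 1 (s + 1))) (B b (x 0 (s + 1)) (x 2 (s + 1)))
        fun a' b' => G a' b' x with hG'
    have hG'm : ∀ a b, Measurable (G' a b) := fun a b =>
      measurable_bitAverage
        ((hB.measurable_succ a).comp (f := fun x : Fin 3 → ℕ → EuclideanSpace ℝ (Fin d) => (x 0 (s + 1), x 1 (s + 1)))
          (by fun_prop))
        ((hB.measurable_succ b).comp (f := fun x : Fin 3 → ℕ → EuclideanSpace ℝ (Fin d) => (x 0 (s + 1), x 2 (s + 1)))
          (by fun_prop)) hG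
    have hG'C : ∀ a b x, |G' a b x| ≤ C := fun a b x =>
      abs_bitAverage_le (hB.mem_succ _ _ _) (hB.mem_succ _ _ _) fun a b => hC a b x
    have hle := history_le h.measurable_opinion h.measurable_edge (s + 1) (s + 1)
    have hcut : Measurable[history Z A (s + 1) (s + 1)] fun ω i =>
        cutTraj (s + 1) fun r => Z i r ω :=
      @measurable_pi_lambda _ _ _ (_) _ _ fun i => measurable_cutTraj_history i
    have hA : ∀ i j, Measurable[history Z A (s + 1) (s + 1)] (A i j s) := fun i j =>
      measurable_edge_history (Nat.lt_succ_self s) i j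
    -- `G''` also averages over the noise at time `s`. It depends only on the trajectories up to `s`
    -- and the edges at time `s`, so the induction hypothesis applies to it.
    set G'' : Bool → Bool → (Fin 3 → ℕ → EuclideanSpace ℝ (Fin d)) → ℝ := fun a b x =>
      ∫ v, G' a b (U x v) ∂(Measure.pi fun _ => ν) with hG''
    have hG''m : ∀ a b, Measurable (G'' a b) := fun a b =>
      (StronglyMeasurable.integral_prod_right'
        ((hG'm a b).comp hUm).stronglyMeasurable).measurable
    have hG''C : ∀ a b x, |G'' a b x| ≤ C := fun a b x =>
      abs_integral_le_of_abs_le fun v => hG'C _ _ _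
    have ht : ∀ i j : Fin 3, Measurable fun p : Fin 3 → ℕ → EuclideanSpace ℝ (Fin d) =>
        trajProb B0 B s (p i) (p j) := fun i j =>
      (measurable_trajProb hB s).comp
        (f := fun p : Fin 3 → ℕ → EuclideanSpace ℝ (Fin d) => (p i, p j)) (by fun_prop)
    have e1 : ∫ ω, G (A 0 1 (s + 1) ω) (A 0 2 (s + 1) ω)
          (fun i => cutTraj (s + 2) fun r => Z i r ω) ∂P =
        ∫ ω, G' (A 0 1 s ω) (A 0 2 s ω) (fun i => cutTraj (s + 2) fun r => Z i r ω) ∂P := by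
      rw [h.integral_two_edges_step hB hs hG hC]
      refine integral_congr_ae (Eventually.of_forall fun ω => ?_)
      simp only [hG', cutTraj_apply_of_lt (show s + 1 < s + 2 by omega)]
      rfl
    have e2 : ∫ ω, G' (A 0 1 s ω) (A 0 2 s ω) (fun i => cutTraj (s + 2) fun r => Z i r ω) ∂P =
        ∫ ω, G' (A 0 1 s ω) (A 0 2 s ω)
          (U (fun i => cutTraj (s + 1) fun r => Z i r ω) fun i => ξ i s ω) ∂P := by
      refine integral_congr_ae ?_
      filter_upwards [hstep] with ω hω
      rw [hω]
    -- The noise is integrated out, the edges at time `s` are averaged by the induction hypothesis,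
    -- and the noise is then put back. This order is needed because the opinions at time `s + 1` are
    -- not covered by the hypothesis at time `s`.
    have e3 := (h.noiseLaw hst.le).integral_bits hle hcut (hA 0 1) (hA 0 2)
      (G := fun a b p => G' a b (U p.1 p.2)) (fun a b => (hG'm a b).comp hUm)
      fun a b p => hG'C a b _
    have e4 := ih hst.le hG''m hG''C
    have e5 := (h.noiseLaw hst.le).integral_bitAverage hle hcut (ht 0 1) (ht 0 2)
      (fun _ => trajProb_mem hB _ _ _) (fun _ => trajProb_mem hB _ _ _)
      (G := fun a b p => G' a b (U p.1 p.2)) (fun a b => (hG'm a b).comp hUm)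
      fun a b p => hG'C a b _
    simp only [trajProb_cutTraj] at e5
    rw [e1, e2]
    refine e3.trans (e4.trans (e5.symm.trans ?_))
    refine integral_congr_ae ?_
    filter_upwards [hstep] with ω hω
    rw [bitAverage_trajProb_succ, ← hω]
    simp only [hG', cutTraj_apply_of_lt (show s + 1 < s + 2 by omega)]

/-- The weighted sums of two edges are, given the agent, centered and uncorrelated. -/
theorem integral_inner_edges_eq_zero {F : Type*} [NormedAddCommGroup F] [InnerProductSpace ℝ F]
    [CompleteSpace F] [MeasurableSpace F] [BorelSpace F] [SecondCountableTopology F]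
    (h : IsLimitingMeanField P γ B0 B μ0 ν 3 t ξ Z A)
    (hB : IsInteractionPair B0 B) {s : ℕ} (hs : s ≤ t) {φ : EuclideanSpace ℝ (Fin d) → F}
    (hφ : Measurable φ) {R : ℝ} (hR : ∀ x, ‖φ x‖ ≤ R) {g : (ℕ → EuclideanSpace ℝ (Fin d)) → F}
    (hg : g = kernelMean B0 B s (P.map fun ω r => Z 2 r ω) φ) :
    ∫ ω, inner ℝ ((if A 0 1 s ω then φ (Z 1 s ω) else 0) - g fun r => Z 0 r ω)
      ((if A 0 2 s ω then φ (Z 2 s ω) else 0) - g fun r => Z 0 r ω) ∂P = 0 := by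
  have hp := h.isProbabilityMeasure_traj 2
  have hgm : Measurable g := by rw [hg]; exact measurable_kernelMean hB s _ hφ
  have hR0 : 0 ≤ R := (norm_nonneg _).trans (hR 0)
  have hφi : ∀ (μ : Measure (ℕ → EuclideanSpace ℝ (Fin d))) [IsProbabilityMeasure μ],
      Integrable (fun w => φ (w s)) μ := fun μ _ =>
    Integrable.of_bound (hφ.comp (measurable_pi_apply s)).aestronglyMeasurable R
      (Eventually.of_forall fun _ => hR _)
  have hgR : ∀ z, ‖g z‖ ≤ R := by
    intro z
    rw [hg]
    refine (norm_kernelMean_le hB s hφ (hφi _) z).trans ?_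
    refine (integral_mono (hφi _).norm (integrable_const R) fun w => hR _).trans ?_
    simp
  have hgcut : ∀ z, g (cutTraj (s + 1) z) = g z := fun z => by rw [hg, kernelMean_cutTraj]
  have hin : ∀ x y : F, ‖x‖ ≤ R + R → ‖y‖ ≤ R + R → |inner ℝ x y| ≤ (R + R) * (R + R) :=
    fun x y hx hy => (abs_real_inner_le_norm x y).trans
      (mul_le_mul hx hy (norm_nonneg _) (by positivity))
  have hb : ∀ (x : F) z, ‖x‖ ≤ R → ‖x - g z‖ ≤ R + R := fun x z hx =>
    (norm_sub_le _ _).trans (add_le_add hx (hgR z))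
  have hite : ∀ (a : Bool) x, ‖if a then φ x else 0‖ ≤ R := by
    intro a x; split_ifs
    · exact hR x
    · simpa using hR0
  have hzm : ∀ i : Fin 3, Measurable fun x : Fin 3 → ℕ → EuclideanSpace ℝ (Fin d) => x i s :=
    fun i => by fun_prop
  have hz0 : Measurable fun x : Fin 3 → ℕ → EuclideanSpace ℝ (Fin d) => x 0 := by fun_prop
  have h1 := h.integral_two_edges hB hs (C := (R + R) * (R + R))
    (G := fun a b x => inner ℝ ((if a then φ (x 1 s) else 0) - g (x 0))
      ((if b then φ (x 2 s) else 0) - g (x 0)))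
    (fun a b => by
      have hm : ∀ (a : Bool) (i : Fin 3), Measurable
          fun x : Fin 3 → ℕ → EuclideanSpace ℝ (Fin d) =>
          (if a then φ (x i s) else 0) - g (x 0) := fun a i => by
        refine Measurable.sub ?_ (hgm.comp hz0)
        cases a
        · simp
        · simp only [if_true]
          exact hφ.comp (hzm i)
      exact (hm a 1).inner (hm b 2))
    fun a b x => hin _ _ (hb _ _ (hite _ _)) (hb _ _ (hite _ _))
  simp only [hgcut, cutTraj_apply_of_lt (Nat.lt_succ_self s)] at h1
  -- The inner product is affine in each bit, so for independent bits its average is the inner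
  -- product of the averages.
  have h2 : ∀ (p q : ℝ) (x y v : F), bitAverage p q (fun a b =>
      inner ℝ ((if a then x else 0) - v) ((if b then y else 0) - v)) =
      inner ℝ (p • x - v) (q • y - v) := by
    intro p q x y v
    simp only [bitAverage, bitWeight, Fintype.sum_bool]
    simp only [if_true, Bool.false_eq_true, if_false, zero_sub, inner_sub_left, inner_sub_right,
      inner_neg_left, inner_neg_right, real_inner_smul_left, real_inner_smul_right]
    ring
  simp only [h2] at h1
  rw [h1]
  -- Agent `2` is integrated out with agents `0` and `1` fixed. This centres the second factor, so
  -- the law of agent `1` plays no role.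
  have hind : IndepFun (fun ω => (cutTraj (s + 1) fun r => Z 0 r ω,
      cutTraj (s + 1) fun r => Z 1 r ω)) (fun ω => cutTraj (s + 1) fun r => Z 2 r ω) P :=
    (h.iIndepFun_cutTraj hB hs).indepFun_prodMk (fun i => h.measurable_cut i (s + 1)) 0 1 2
      (by decide) (by decide)
  have hk := measurable_trajProb_smul hB s hφ
  have hfm : Measurable fun p : ((ℕ → EuclideanSpace ℝ (Fin d)) × (ℕ → EuclideanSpace ℝ (Fin d))) ×
      (ℕ → EuclideanSpace ℝ (Fin d)) =>
      inner ℝ (trajProb B0 B s p.1.1 p.1.2 • φ (p.1.2 s) - g p.1.1)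
        (trajProb B0 B s p.1.1 p.2 • φ (p.2 s) - g p.1.1) := by
    have hg1 : Measurable fun p : ((ℕ → EuclideanSpace ℝ (Fin d)) ×
        (ℕ → EuclideanSpace ℝ (Fin d))) × (ℕ → EuclideanSpace ℝ (Fin d)) => g p.1.1 :=
      hgm.comp (measurable_fst.comp measurable_fst)
    refine Measurable.inner (Measurable.sub ?_ hg1) (Measurable.sub ?_ hg1)
    · exact hk.comp measurable_fst
    · exact hk.comp ((measurable_fst.comp measurable_fst).prodMk measurable_snd)
  have hle : ∀ z w, ‖trajProb B0 B s z w • φ (w s)‖ ≤ R := fun z w =>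
    (norm_trajProb_smul_le hB s z w _).trans (hR _)
  have h3 := integral_eq_integral_integral_of_indepFun
    ((h.measurable_cut 0 (s + 1)).prodMk (h.measurable_cut 1 (s + 1)))
    (h.measurable_cut 2 (s + 1)) hind hfm
    (C := (R + R) * (R + R)) fun p => hin _ _ (hb _ _ (hle _ _)) (hb _ _ (hle _ _))
  simp only [hgcut, cutTraj_apply_of_lt (Nat.lt_succ_self s), trajProb_cutTraj] at h3
  rw [h3, ← integral_zero Ω ℝ (μ := P)]
  refine integral_congr_ae (Eventually.of_forall fun ω => ?_)
  have hpc : IsProbabilityMeasure (P.map fun ω => cutTraj (s + 1) fun r => Z 2 r ω) :=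
    Measure.isProbabilityMeasure_map (h.measurable_cut 2 (s + 1)).aemeasurable
  simp only
  have hi := integrable_trajProb_smul hB s hφ
    (hφi (P.map fun ω => cutTraj (s + 1) fun r => Z 2 r ω)) (cutTraj (s + 1) fun r => Z 0 r ω)
  have hin' := integral_inner (𝕜 := ℝ) (hi.sub (integrable_const (g fun r => Z 0 r ω)))
    (trajProb B0 B s (fun r => Z 0 r ω) (fun r => Z 1 r ω) • φ (Z 1 s ω) - g fun r => Z 0 r ω)
  simp only [Pi.sub_apply] at hin'
  rw [hin', integral_sub hi (integrable_const _)]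
  have h4 : ∫ w, trajProb B0 B s (cutTraj (s + 1) fun r => Z 0 r ω) w • φ (w s)
      ∂(P.map fun ω => cutTraj (s + 1) fun r => Z 2 r ω) = g fun r => Z 0 r ω := by
    rw [hg, ← kernelMean_cutTraj s _ φ fun r => Z 0 r ω, ← kernelMean_map_cutTraj hB s _ hφ,
      Measure.map_map (measurable_cutTraj (s + 1)) (h.measurable_traj 2)]
    rfl
  rw [h4]
  simp

end IsLimitingMeanField

end TwoEdges

/-! ### The law of large numbers for neighbour sums, in mean square -/

section LawOfLargeNumbers

variable {Ω : Type*} [MeasurableSpace Ω] {P : Measure Ω} {d : ℕ} {γ : ℝ}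
  {B0 : EuclideanSpace ℝ (Fin d) → EuclideanSpace ℝ (Fin d) → ℝ}
  {B : Bool → EuclideanSpace ℝ (Fin d) → EuclideanSpace ℝ (Fin d) → ℝ}
  {ξ : ℕ → ℕ → Ω → EuclideanSpace ℝ (Fin d)}
  {Z : (n : ℕ) → Fin n → ℕ → Ω → EuclideanSpace ℝ (Fin d)}
  {A : (n : ℕ) → Fin n → Fin n → ℕ → Ω → Bool} [IsProbabilityMeasure P]
  {Ω' : Type*} [MeasurableSpace Ω'] {P' : Measure Ω'} [IsProbabilityMeasure P']
  {μ0 ν : Measure (EuclideanSpace ℝ (Fin d))} {t : ℕ}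
  {ξ' : Fin 3 → ℕ → Ω' → EuclideanSpace ℝ (Fin d)}
  {Z' : Fin 3 → ℕ → Ω' → EuclideanSpace ℝ (Fin d)} {A' : Fin 3 → Fin 3 → ℕ → Ω' → Bool}

/-- The weighted sum over the neighbours of the agent `i`, divided by the number of agents. -/
noncomputable def neighborSum {N : ℕ} {F : Type*} [NormedAddCommGroup F] [NormedSpace ℝ F]
    (φ : EuclideanSpace ℝ (Fin d) → F) (z : Fin N → EuclideanSpace ℝ (Fin d))
    (a : Fin N → Fin N → Bool) (i : Fin N) : F :=
  (N : ℝ)⁻¹ • ∑ j, if a i j then φ (z j) else 0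

lemma norm_neighborSum_le {N : ℕ} {F : Type*} [NormedAddCommGroup F] [NormedSpace ℝ F]
    (φ : EuclideanSpace ℝ (Fin d) → F) (z : Fin N → EuclideanSpace ℝ (Fin d))
    (a : Fin N → Fin N → Bool) (i : Fin N) :
    ‖neighborSum φ z a i‖ ≤ avg fun j => ‖φ (z j)‖ := by
  unfold neighborSum avg
  rw [norm_smul, Fintype.card_fin, div_eq_inv_mul, norm_inv, Real.norm_natCast]
  gcongr
  refine (norm_sum_le _ _).trans (Finset.sum_le_sum fun j _ => ?_)
  split_ifs <;> simp

lemma measurable_neighborSum {N : ℕ} {F : Type*} [NormedAddCommGroup F] [NormedSpace ℝ F]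
    [MeasurableSpace F] [BorelSpace F] [SecondCountableTopology F]
    {φ : EuclideanSpace ℝ (Fin d) → F} (hφ : Measurable φ)
    {z : Fin N → Ω → EuclideanSpace ℝ (Fin d)} {a : Fin N → Fin N → Ω → Bool}
    (hz : ∀ j, Measurable (z j)) (ha : ∀ i j, Measurable (a i j)) (i : Fin N) :
    Measurable fun ω => neighborSum φ (fun j => z j ω) (fun i j => a i j ω) i := by
  unfold neighborSum
  have h : Measurable fun ω => ∑ j, if a i j ω then φ (z j ω) else 0 :=
    Finset.measurable_fun_sum _ fun j _ =>
      Measurable.ite (ha i j (measurableSet_singleton _)) (hφ.comp (hz j)) measurable_const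
  exact h.const_smul (N : ℝ)⁻¹

/-- The deviation is the mean over `j` of terms with `v` subtracted, and its square is a double
mean. Averaging over `i` as well gives a mean over triples, an observable of a sample of size three.
-/
lemma sq_norm_neighborSum_sub {N : ℕ} {F : Type*} [NormedAddCommGroup F]
    [InnerProductSpace ℝ F]
    (φ : EuclideanSpace ℝ (Fin d) → F) (z : Fin (N + 1) → EuclideanSpace ℝ (Fin d))
    (a : Fin (N + 1) → Fin (N + 1) → Bool) (i : Fin (N + 1)) (v : F) :
    ‖neighborSum φ z a i - v‖ ^ 2 = avg fun j => avg fun l =>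
      inner ℝ ((if a i j then φ (z j) else 0) - v) ((if a i l then φ (z l) else 0) - v) := by
  have hN : ((N + 1 : ℕ) : ℝ) ≠ 0 := by positivity
  have h1 : neighborSum φ z a i - v = ((N + 1 : ℕ) : ℝ)⁻¹ •
      ∑ j, ((if a i j then φ (z j) else 0) - v) := by
    unfold neighborSum
    rw [Finset.sum_sub_distrib, smul_sub, Finset.sum_const, Finset.card_univ, Fintype.card_fin,
      ← Nat.cast_smul_eq_nsmul ℝ, inv_smul_smul₀ hN]
  rw [h1, ← real_inner_self_eq_norm_sq, real_inner_smul_left, real_inner_smul_right, sum_inner]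
  simp_rw [inner_sum]
  unfold avg
  simp only [Fintype.card_fin, div_eq_inv_mul, Finset.mul_sum]

/-- The weak law of large numbers for the neighbour sums, in mean square. -/
theorem SampleTendsto.tendsto_sq_neighborSum {F : Type*} [NormedAddCommGroup F]
    [InnerProductSpace ℝ F] [CompleteSpace F] [MeasurableSpace F] [BorelSpace F]
    [SecondCountableTopology F] (hB : IsInteractionPair B0 B)
    (hsys : ∀ n, IsCoevolvingSystem P γ B0 B ξ n (Z n) (A n))
    (h' : IsLimitingMeanField P' γ B0 B μ0 ν 3 t ξ' Z' A') (hμ0 : μ0 ≪ volume) (hν : ν ≪ volume)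
    {s : ℕ} (hs : s ≤ t)
    (h : SampleTendsto P Z A (s + 1) (s + 1) 3 (P'.map (procState (s + 1) (s + 1) Z' A')))
    {φ : EuclideanSpace ℝ (Fin d) → F} (hφ : Continuous φ) {R : ℝ} (hR : ∀ x, ‖φ x‖ ≤ R)
    {μ : Measure (ℕ → EuclideanSpace ℝ (Fin d))} (hμ : μ = P'.map fun ω r => Z' 2 r ω) :
    Tendsto (fun n => avg fun i : Fin (n + 1) => ∫ ω,
      ‖neighborSum φ (fun j => Z (n + 1) j s ω) (fun j l => A (n + 1) j l s ω) i -
        kernelMean B0 B s μ φ (fun r => Z (n + 1) i r ω)‖ ^ 2 ∂P) atTop (𝓝 0) := by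
  have hp : IsProbabilityMeasure μ := by rw [hμ]; exact h'.isProbabilityMeasure_traj 2
  set g := kernelMean B0 B s μ φ with hg
  have hgm : Measurable g := measurable_kernelMean hB s _ hφ.measurable
  have hR0 : 0 ≤ R := (norm_nonneg _).trans (hR 0)
  have hφi : Integrable (fun w => φ (w s)) μ :=
    Integrable.of_bound (hφ.measurable.comp (measurable_pi_apply s)).aestronglyMeasurable R
      (Eventually.of_forall fun _ => hR _)
  have hgR : ∀ z, ‖g z‖ ≤ R := by
    intro z
    refine (norm_kernelMean_le hB s hφ.measurable hφi z).trans ?_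
    refine (integral_mono hφi.norm (integrable_const R) fun w => hR _).trans ?_
    simp
  have hgcut : ∀ z, g (cutTraj (s + 1) z) = g z := fun z => by rw [hg, kernelMean_cutTraj]
  set u : Fin 3 → TrajState 3 d → F := fun j x =>
    (if x.2 0 j s then φ (x.1 j s) else 0) - g (x.1 0) with hu
  have huR : ∀ j x, ‖u j x‖ ≤ R + R := by
    intro j x
    refine (norm_sub_le _ _).trans (add_le_add ?_ (hgR _))
    split_ifs
    · exact hR _
    · simpa using hR0
  have hum : ∀ j, Measurable (u j) := by
    intro j
    have h1 : Measurable fun x : TrajState 3 d => x.2 0 j s := by fun_prop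
    have h2 : Measurable fun x : TrajState 3 d => x.1 j s := by fun_prop
    have h3 : Measurable fun x : TrajState 3 d => x.1 0 := by fun_prop
    exact (Measurable.ite (h1 (measurableSet_singleton true)) (hφ.measurable.comp h2)
      measurable_const).sub (hgm.comp h3)
  have huc : ∀ j, ∀ᵐ ω ∂P', ContinuousAt (u j) (procState (s + 1) (s + 1) Z' A' ω) := by
    intro j
    filter_upwards [h'.ae_ae_kernelContinuousAt hB hμ0 hν 0 2 hs] with ω hω
    rw [← hμ] at hω
    have h1 : Continuous fun p : Bool × EuclideanSpace ℝ (Fin d) =>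
        if p.1 then φ p.2 else (0 : F) := by
      rw [continuous_prod_of_discrete_left]
      intro b
      cases b
      · simpa using continuous_const
      · simpa using hφ
    have h2 : Continuous fun x : TrajState 3 d => if x.2 0 j s then φ (x.1 j s) else (0 : F) :=
      h1.comp (g := fun p : Bool × EuclideanSpace ℝ (Fin d) => if p.1 then φ p.2 else (0 : F))
        (f := fun x : TrajState 3 d => (x.2 0 j s, x.1 j s)) (by fun_prop)
    refine h2.continuousAt.sub ?_
    exact ContinuousAt.comp (x := procState (s + 1) (s + 1) Z' A' ω) (g := g)
      (f := fun x : TrajState 3 d => x.1 0)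
      (hg := continuousAt_kernelMean hB s hφ.measurable hφi hω) (by fun_prop)
  have hin : ∀ x, |inner ℝ (u 1 x) (u 2 x)| ≤ (R + R) * (R + R) := fun x =>
    (abs_real_inner_le_norm _ _).trans
      (mul_le_mul (huR 1 x) (huR 2 x) (norm_nonneg _) (by positivity))
  have hfm : Measurable fun x => inner ℝ (u 1 x) (u 2 x) := (hum 1).inner (hum 2)
  have hmeas : Measurable (procState (s + 1) (s + 1) Z' A') :=
    measurable_procState (fun i r _ => h'.measurable_opinion i r)
      fun i j r _ => h'.measurable_edge i j r
  -- The inner product is a bounded test function on the states of three agents. It is continuous at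
  -- almost every limiting state because bits are discrete and `g` is continuous along the limiting
  -- trajectories.
  have key := h.tendsto_avg hmeas hsys hfm hin (by
    filter_upwards [huc 1, huc 2] with ω h1 h2 using h1.inner h2)
  have hlim : ∫ ω, inner ℝ (u 1 (procState (s + 1) (s + 1) Z' A' ω))
      (u 2 (procState (s + 1) (s + 1) Z' A' ω)) ∂P' = 0 := by
    rw [← h'.integral_inner_edges_eq_zero hB hs hφ.measurable hR (g := g) (by rw [hg, hμ])]
    refine integral_congr_ae (Eventually.of_forall fun ω => ?_)
    simp only [hu, procState, hgcut]
    simp only [cutTraj_apply_of_lt (Nat.lt_succ_self s)]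
  rw [hlim] at key
  -- The double sum in the square contains the coinciding indices too, and sampling with replacement
  -- includes exactly these triples, so no correction is needed.
  refine key.congr fun n => ?_
  simp only [avg_fin_succ, avg_fin_zero]
  congr 1
  ext i
  have hint : ∀ m, Integrable (fun ω => inner ℝ (u 1 (sampleState Z A (s + 1) (s + 1) 3 n m ω))
      (u 2 (sampleState Z A (s + 1) (s + 1) 3 n m ω))) P := fun m =>
    Integrable.of_bound (hfm.comp (measurable_sampleState hsys _ _ _ n m)).aestronglyMeasurable
      _ (Eventually.of_forall fun ω => hin _)
  simp_rw [sq_norm_neighborSum_sub]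
  simp_rw [← integral_avg fun t => hint _]
  rw [← integral_avg fun t => integrable_avg fun l => hint _]
  refine integral_congr_ae (Eventually.of_forall fun ω => ?_)
  simp only [hu, sampleState, procState, hgcut]
  simp only [cutTraj_apply_of_lt (Nat.lt_succ_self s)]
  rfl

lemma tendsto_zero_of_forall_eventually_le {u : ℕ → ℝ} (h0 : ∀ n, 0 ≤ u n)
    (h : ∀ ε > 0, ∀ᶠ n in atTop, u n ≤ ε) : Tendsto u atTop (𝓝 0) := by
  rw [Metric.tendsto_atTop']
  intro ε hε
  obtain ⟨N, hN⟩ := eventually_atTop.mp (h (ε / 2) (half_pos hε))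
  refine ⟨N, fun n hn => ?_⟩
  rw [Real.dist_eq, sub_zero, abs_of_nonneg (h0 n)]
  linarith [hN n hn.le]

/-- Mean-square convergence implies convergence in mean by `x ≤ ε / 2 + (ε / 2)⁻¹ * x ^ 2`,
according to whether `x` is below or above `ε / 2`. -/
lemma tendsto_avg_integral_of_sq {T : ℕ → Type*} [∀ n, Fintype (T n)] [∀ n, Nonempty (T n)]
    {X : ∀ n, T n → Ω → ℝ} (hX : ∀ n i, Measurable (X n i)) (h0 : ∀ n i ω, 0 ≤ X n i ω) {C : ℝ}
    (hC : ∀ n i ω, X n i ω ≤ C)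
    (h : Tendsto (fun n => avg fun i => ∫ ω, X n i ω ^ 2 ∂P) atTop (𝓝 0)) :
    Tendsto (fun n => avg fun i => ∫ ω, X n i ω ∂P) atTop (𝓝 0) := by
  refine tendsto_zero_of_forall_eventually_le
    (fun n => avg_nonneg fun i => integral_nonneg (h0 n i)) fun ε hε => ?_
  have h1 : ∀ᶠ n in atTop, (avg fun i => ∫ ω, X n i ω ^ 2 ∂P) < ε / 2 * (ε / 2) :=
    h.eventually (gt_mem_nhds (by positivity))
  filter_upwards [h1] with n hn
  have i1 : ∀ i, Integrable (X n i) P := fun i =>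
    Integrable.of_bound (hX n i).aestronglyMeasurable C (Eventually.of_forall fun ω => by
      rw [Real.norm_of_nonneg (h0 n i ω)]; exact hC n i ω)
  have i2 : ∀ i, Integrable (fun ω => X n i ω ^ 2) P := fun i =>
    Integrable.of_bound ((hX n i).pow_const 2).aestronglyMeasurable (C ^ 2)
      (Eventually.of_forall fun ω => by
        rw [Real.norm_of_nonneg (sq_nonneg _)]
        exact pow_le_pow_left₀ (h0 n i ω) (hC n i ω) 2)
  calc (avg fun i => ∫ ω, X n i ω ∂P)
      ≤ avg fun i => ε / 2 + (ε / 2)⁻¹ * ∫ ω, X n i ω ^ 2 ∂P := by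
        refine avg_mono fun i => ?_
        have h2 : ∫ ω, X n i ω ∂P ≤ ∫ ω, (ε / 2 + (ε / 2)⁻¹ * X n i ω ^ 2) ∂P := by
          refine integral_mono (i1 i) ((integrable_const _).add ((i2 i).const_mul _)) fun ω => ?_
          have h3 := h0 n i ω
          have h4 : (ε / 2)⁻¹ * X n i ω ^ 2 = X n i ω ^ 2 / (ε / 2) := by ring
          simp only [h4]
          rcases le_total (X n i ω) (ε / 2) with h5 | h5
          · have : 0 ≤ X n i ω ^ 2 / (ε / 2) := by positivity
            linarith
          · have : X n i ω ≤ X n i ω ^ 2 / (ε / 2) := by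
              rw [le_div_iff₀ (half_pos hε), sq]
              exact mul_le_mul_of_nonneg_left h5 h3
            linarith
        rw [integral_add (integrable_const _) ((i2 i).const_mul _), integral_const_mul] at h2
        simpa using h2
    _ = ε / 2 + (ε / 2)⁻¹ * avg fun i => ∫ ω, X n i ω ^ 2 ∂P := by
        rw [avg_add, avg_const, avg_const_mul]
    _ ≤ ε / 2 + (ε / 2)⁻¹ * (ε / 2 * (ε / 2)) := by gcongr
    _ = ε := by field_simp; ring

/-- A continuous softTruncation of the identity. -/
noncomputable def softTruncation (R : ℝ) (z : EuclideanSpace ℝ (Fin d)) :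
    EuclideanSpace ℝ (Fin d) :=
  max 0 (min 1 (R + 1 - ‖z‖)) • z

lemma continuous_softTruncation (R : ℝ) :
    Continuous (softTruncation R : EuclideanSpace ℝ (Fin d) → EuclideanSpace ℝ (Fin d)) := by
  unfold softTruncation; fun_prop

lemma norm_softTruncation_le {R : ℝ} (hR : 0 ≤ R) (z : EuclideanSpace ℝ (Fin d)) :
    ‖softTruncation R z‖ ≤ R + 1 := by
  unfold softTruncation
  rw [norm_smul, Real.norm_of_nonneg (le_max_left _ _)]
  rcases le_total ‖z‖ (R + 1) with h | h
  · refine (mul_le_of_le_one_left (norm_nonneg _) ?_).trans h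
    exact max_le zero_le_one (min_le_left _ _)
  · rw [max_eq_left ((min_le_right _ _).trans (by linarith)), zero_mul]
    linarith

/-- Nothing is cut when `‖z‖ ≤ R`; otherwise `2 * ‖z‖ - R ≥ ‖z‖`, so the right-hand side is at least
`exp ‖z‖`. The truncation error thus becomes small uniformly, at the price of one exponential
moment. -/
lemma norm_sub_softTruncation_le (R : ℝ) (z : EuclideanSpace ℝ (Fin d)) :
    ‖z - softTruncation R z‖ ≤ Real.exp (-R) * Real.exp (2 * ‖z‖) := by
  have h1 : z - softTruncation R z = (1 - max 0 (min 1 (R + 1 - ‖z‖))) • z := by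
    rw [sub_smul, one_smul]; rfl
  have h2 : max 0 (min 1 (R + 1 - ‖z‖)) ≤ 1 := max_le zero_le_one (min_le_left _ _)
  rw [h1, norm_smul, Real.norm_of_nonneg (by linarith)]
  rcases le_total ‖z‖ R with h | h
  · rw [min_eq_left (by linarith), max_eq_right zero_le_one, sub_self, zero_mul]
    positivity
  · refine (mul_le_of_le_one_left (norm_nonneg _) ?_).trans ?_
    · linarith [le_max_left 0 (min 1 (R + 1 - ‖z‖))]
    · rw [← Real.exp_add]
      have := Real.add_one_le_exp (-R + 2 * ‖z‖)
      linarith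

end LawOfLargeNumbers

/-! ### From neighbour sums to local averages: truncation and quotients -/

section LawOfLargeNumbers

variable {Ω : Type*} [MeasurableSpace Ω] {P : Measure Ω} {d : ℕ} {γ : ℝ}
  {B0 : EuclideanSpace ℝ (Fin d) → EuclideanSpace ℝ (Fin d) → ℝ}
  {B : Bool → EuclideanSpace ℝ (Fin d) → EuclideanSpace ℝ (Fin d) → ℝ}
  {ξ : ℕ → ℕ → Ω → EuclideanSpace ℝ (Fin d)}
  {Z : (n : ℕ) → Fin n → ℕ → Ω → EuclideanSpace ℝ (Fin d)}
  {A : (n : ℕ) → Fin n → Fin n → ℕ → Ω → Bool} [IsProbabilityMeasure P]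

lemma norm_neighborSum_sub_le {N : ℕ} {F : Type*} [NormedAddCommGroup F] [NormedSpace ℝ F]
    (φ ψ : EuclideanSpace ℝ (Fin d) → F) (z : Fin N → EuclideanSpace ℝ (Fin d))
    (a : Fin N → Fin N → Bool) (i : Fin N) :
    ‖neighborSum φ z a i - neighborSum ψ z a i‖ ≤ avg fun j => ‖φ (z j) - ψ (z j)‖ := by
  have h : neighborSum φ z a i - neighborSum ψ z a i = neighborSum (fun x => φ x - ψ x) z a i := by
    unfold neighborSum
    rw [← smul_sub, ← Finset.sum_sub_distrib]
    congr 1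
    refine Finset.sum_congr rfl fun j _ => ?_
    split_ifs <;> simp
  rw [h]
  exact norm_neighborSum_le (fun x => φ x - ψ x) z a i

/-- The loop at `i` makes the degree nonzero, so the normalisation in the local average can be
undone. -/
lemma neighborSum_id_eq {N : ℕ} (z : Fin N → EuclideanSpace ℝ (Fin d))
    (a : Fin N → Fin N → Bool) (i : Fin N) (hi : a i i = true) :
    neighborSum (fun x => x) z a i =
      neighborSum (fun _ => (1 : ℝ)) z a i • neighborAverage z a i := by
  have h : (∑ j, if a i j then (1 : ℝ) else 0) ≠ 0 := by
    have : (1 : ℝ) ≤ ∑ j, if a i j then (1 : ℝ) else 0 := by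
      refine le_trans ?_ (Finset.single_le_sum (f := fun j => if a i j then (1 : ℝ) else 0)
        (fun j _ => by positivity) (Finset.mem_univ i))
      simp [hi]
    linarith
  unfold neighborSum neighborAverage
  rw [smul_smul, smul_eq_mul, mul_assoc, mul_inv_cancel₀ h, mul_one]

/-- Comparison of two ratios with close numerators and denominators. -/
lemma sq_mul_min_norm_sub_le {F : Type*} [NormedAddCommGroup F] [NormedSpace ℝ F]
    {g0 c D : ℝ} {g L : F} (hg0 : 0 ≤ g0) (hg1 : g0 ≤ 1) (hgc : ‖g‖ ≤ c) :
    g0 ^ 2 * min 1 ‖L - g0⁻¹ • g‖ ≤ ‖D • L - g‖ + (c + 1) * |D - g0| := by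
  have hc : 0 ≤ c := (norm_nonneg _).trans hgc
  rcases hg0.eq_or_lt with h0 | h0
  · rw [← h0]
    have := norm_nonneg (D • L - g)
    have : 0 ≤ (c + 1) * |D - 0| := by positivity
    simp only [ne_eq, OfNat.ofNat_ne_zero, not_false_eq_true, zero_pow, zero_mul]
    linarith
  set M := g0⁻¹ • g with hM
  have hgM : g = g0 • M := by rw [hM, smul_inv_smul₀ h0.ne']
  have h1 : g0 • (L - M) = (D • L - g) - (D - g0) • M - (D - g0) • (L - M) := by
    rw [hgM]; module
  have h2 : g0 * ‖L - M‖ ≤ ‖D • L - g‖ + |D - g0| * ‖M‖ + |D - g0| * ‖L - M‖ := by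
    have h3 : ‖g0 • (L - M)‖ = g0 * ‖L - M‖ := by rw [norm_smul, Real.norm_of_nonneg hg0]
    rw [← h3, h1]
    refine (norm_sub_le _ _).trans (add_le_add ((norm_sub_le _ _).trans (add_le_add le_rfl ?_)) ?_)
    · rw [norm_smul, Real.norm_eq_abs]
    · rw [norm_smul, Real.norm_eq_abs]
  have hMc : g0 * ‖M‖ ≤ c := by
    rw [hgM, norm_smul, Real.norm_of_nonneg hg0] at hgc
    exact hgc
  have hX := norm_nonneg (D • L - g)
  have hY := abs_nonneg (D - g0)
  have hMn := norm_nonneg M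
  have h4 : g0 * min 1 ‖L - M‖ ≤ ‖D • L - g‖ + |D - g0| * (‖M‖ + 1) := by
    rcases le_total ‖L - M‖ 1 with h5 | h5
    · rw [min_eq_right h5]
      have : |D - g0| * ‖L - M‖ ≤ |D - g0| * 1 := by gcongr
      linarith
    · rw [min_eq_left h5, mul_one]
      -- If `g0` exceeded the bound, multiplying by `‖L - M‖ ≥ 1` would contradict `h2`.
      by_contra! hcon
      have h6 : (‖D • L - g‖ + |D - g0| * ‖M‖) * 1 ≤
          (‖D • L - g‖ + |D - g0| * ‖M‖) * ‖L - M‖ := by gcongr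
      have h7 : (‖D • L - g‖ + |D - g0| * (‖M‖ + 1)) * ‖L - M‖ < g0 * ‖L - M‖ := by gcongr
      nlinarith
  -- The second factor `g0` is needed because only `g0 * ‖M‖`, not `‖M‖`, is bounded by `c`.
  calc g0 ^ 2 * min 1 ‖L - M‖ = g0 * (g0 * min 1 ‖L - M‖) := by ring
    _ ≤ g0 * (‖D • L - g‖ + |D - g0| * (‖M‖ + 1)) := by gcongr
    _ = g0 * ‖D • L - g‖ + |D - g0| * (g0 * ‖M‖ + g0) := by ring
    _ ≤ 1 * ‖D • L - g‖ + |D - g0| * (c + 1) := by gcongr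
    _ = _ := by ring

/-- If `y ^ 2 ≥ δ`, the first term suffices; otherwise, with `r = y ^ 2 / δ ≤ 1`, use `x ≤ r * x +
(1 - r)`. The second term is a continuous stand-in for the indicator of a small denominator. -/
lemma min_le_add_max {x y δ : ℝ} (hδ : 0 < δ) (hx : 0 ≤ x) (hx1 : x ≤ 1) :
    x ≤ δ⁻¹ * (y ^ 2 * x) + max 0 (1 - δ⁻¹ * y ^ 2) := by
  have h0 : 0 ≤ δ⁻¹ * y ^ 2 := by positivity
  have h1 := le_max_right 0 (1 - δ⁻¹ * y ^ 2)
  have h2 := le_max_left 0 (1 - δ⁻¹ * y ^ 2)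
  rcases le_total 1 (δ⁻¹ * y ^ 2) with h | h
  · nlinarith
  · nlinarith

variable
  {Ω' : Type*} [MeasurableSpace Ω'] {P' : Measure Ω'} [IsProbabilityMeasure P']
  {μ0 ν : Measure (EuclideanSpace ℝ (Fin d))} {t : ℕ}
  {ξ' : Fin 3 → ℕ → Ω' → EuclideanSpace ℝ (Fin d)}
  {Z' : Fin 3 → ℕ → Ω' → EuclideanSpace ℝ (Fin d)} {A' : Fin 3 → Fin 3 → ℕ → Ω' → Bool}

/-- The weak law of large numbers for bounded weights, in mean. -/
theorem SampleTendsto.tendsto_norm_neighborSum {F : Type*} [NormedAddCommGroup F]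
    [InnerProductSpace ℝ F] [CompleteSpace F] [MeasurableSpace F] [BorelSpace F]
    [SecondCountableTopology F] (hB : IsInteractionPair B0 B)
    (hsys : ∀ n, IsCoevolvingSystem P γ B0 B ξ n (Z n) (A n))
    (h' : IsLimitingMeanField P' γ B0 B μ0 ν 3 t ξ' Z' A') (hμ0 : μ0 ≪ volume) (hν : ν ≪ volume)
    {s : ℕ} (hs : s ≤ t)
    (h : SampleTendsto P Z A (s + 1) (s + 1) 3 (P'.map (procState (s + 1) (s + 1) Z' A')))
    {φ : EuclideanSpace ℝ (Fin d) → F} (hφ : Continuous φ) {R : ℝ} (hR : ∀ x, ‖φ x‖ ≤ R)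
    {μ : Measure (ℕ → EuclideanSpace ℝ (Fin d))} (hμ : μ = P'.map fun ω r => Z' 2 r ω) :
    Tendsto (fun n => avg fun i : Fin (n + 1) => ∫ ω,
      ‖neighborSum φ (fun j => Z (n + 1) j s ω) (fun j l => A (n + 1) j l s ω) i -
        kernelMean B0 B s μ φ (fun r => Z (n + 1) i r ω)‖ ∂P) atTop (𝓝 0) := by
  have hp : IsProbabilityMeasure μ := by rw [hμ]; exact h'.isProbabilityMeasure_traj 2
  have hφi : Integrable (fun w => φ (w s)) μ :=
    Integrable.of_bound (hφ.measurable.comp (measurable_pi_apply s)).aestronglyMeasurable R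
      (Eventually.of_forall fun _ => hR _)
  refine tendsto_avg_integral_of_sq (C := R + R) (fun n i => ?_) (fun n i ω => norm_nonneg _)
    (fun n i ω => ?_) (h.tendsto_sq_neighborSum hB hsys h' hμ0 hν hs hφ hR hμ)
  · refine Measurable.norm (Measurable.sub ?_ ?_)
    · exact measurable_neighborSum hφ.measurable (fun j => (hsys _).measurable_opinion j s)
        (fun i j => (hsys _).measurable_edge i j s) i
    · exact (measurable_kernelMean hB s μ hφ.measurable).comp
        (measurable_pi_lambda _ fun r => (hsys _).measurable_opinion i r)
  · refine (norm_sub_le _ _).trans (add_le_add ?_ ?_)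
    · refine (norm_neighborSum_le _ _ _ _).trans ((avg_mono fun j => hR _).trans ?_)
      rw [avg_const]
    · refine (norm_kernelMean_le hB s hφ.measurable hφi _).trans ?_
      refine (integral_mono hφi.norm (integrable_const R) fun w => hR _).trans ?_
      simp

/-- The weak law of large numbers for the opinions, in mean. -/
theorem SampleTendsto.tendsto_norm_neighborSum_id (hB : IsInteractionPair B0 B)
    (hsys : ∀ n, IsCoevolvingSystem P γ B0 B ξ n (Z n) (A n))
    (h' : IsLimitingMeanField P' γ B0 B μ0 ν 3 t ξ' Z' A') (hμ0 : μ0 ≪ volume) (hν : ν ≪ volume)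
    {s : ℕ} (hs : s ≤ t)
    (h : SampleTendsto P Z A (s + 1) (s + 1) 3 (P'.map (procState (s + 1) (s + 1) Z' A')))
    {μ : Measure (ℕ → EuclideanSpace ℝ (Fin d))} (hμ : μ = P'.map fun ω r => Z' 2 r ω)
    {K : ℝ} (hmom : ∀ᶠ n : ℕ in atTop,
      (∀ i, Integrable (fun ω => Real.exp (2 * ‖Z (n + 1) i s ω‖)) P) ∧
      (avg fun i => ∫ ω, Real.exp (2 * ‖Z (n + 1) i s ω‖) ∂P) ≤ K)
    (hμi : Integrable (fun w => Real.exp (2 * ‖w s‖)) μ) :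
    Tendsto (fun n => avg fun i : Fin (n + 1) => ∫ ω,
      ‖neighborSum (fun x => x) (fun j => Z (n + 1) j s ω) (fun j l => A (n + 1) j l s ω) i -
        kernelMean B0 B s μ (fun x => x) (fun r => Z (n + 1) i r ω)‖ ∂P) atTop (𝓝 0) := by
  have hp : IsProbabilityMeasure μ := by rw [hμ]; exact h'.isProbabilityMeasure_traj 2
  have hle : ∀ x : ℝ, x ≤ Real.exp (2 * x) ∨ x < 0 := fun x => by
    rcases le_or_gt 0 x with hx | hx
    · left; linarith [Real.add_one_le_exp (2 * x)]
    · exact Or.inr hx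
  have hidi : Integrable (fun w => w s) μ := by
    refine hμi.mono (measurable_pi_apply s).aestronglyMeasurable (Eventually.of_forall fun w => ?_)
    rw [Real.norm_of_nonneg (Real.exp_pos _).le]
    exact (hle ‖w s‖).resolve_right (not_lt.mpr (norm_nonneg _))
  set K' := ∫ w, Real.exp (2 * ‖w s‖) ∂μ with hK'
  refine tendsto_zero_of_forall_eventually_le
    (fun n => avg_nonneg fun i => integral_nonneg fun ω => norm_nonneg _) fun ε hε => ?_
  -- The truncation costs `exp (-R)` times the exponential moment, both in the finite system (`K`)
  -- and in the limit (`K'`), uniformly in `n`.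
  obtain ⟨R, hR0, hR⟩ : ∃ R : ℝ, 0 ≤ R ∧ Real.exp (-R) * (K + K') ≤ ε / 2 := by
    have h1 : Tendsto (fun R : ℝ => Real.exp (-R) * (K + K')) atTop (𝓝 0) := by
      simpa using (Real.tendsto_exp_neg_atTop_nhds_zero).mul_const (K + K')
    have h2 := (h1.eventually (gt_mem_nhds (half_pos hε))).and (eventually_ge_atTop 0)
    obtain ⟨R, h3, h4⟩ := h2.exists
    exact ⟨R, h4, h3.le⟩
  have hφi : Integrable (fun w => softTruncation R (w s)) μ :=
    Integrable.of_bound ((continuous_softTruncation R).measurable.comp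
      (measurable_pi_apply s)).aestronglyMeasurable (R + 1)
      (Eventually.of_forall fun _ => norm_softTruncation_le hR0 _)
  have hB1 := h.tendsto_norm_neighborSum hB hsys h' hμ0 hν hs (continuous_softTruncation R)
    (norm_softTruncation_le hR0) hμ
  filter_upwards [hB1.eventually (gt_mem_nhds (half_pos hε)), hmom] with n hn ⟨hi, hK⟩
  have hZm : ∀ i, Measurable fun ω r => Z (n + 1) i r ω := fun i =>
    measurable_pi_lambda _ fun r => (hsys _).measurable_opinion i r
  have hnb : ∀ ω i, ‖neighborSum (softTruncation R) (fun j => Z (n + 1) j s ω)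
      (fun j l => A (n + 1) j l s ω) i -
        kernelMean B0 B s μ (softTruncation R) (fun r => Z (n + 1) i r ω)‖ ≤
          (R + 1) + (R + 1) := by
    intro ω i
    refine (norm_sub_le _ _).trans (add_le_add ?_ ?_)
    · refine (norm_neighborSum_le _ _ _ _).trans
        ((avg_mono fun j => norm_softTruncation_le hR0 _).trans ?_)
      rw [avg_const]
    · refine (norm_kernelMean_le hB s (continuous_softTruncation R).measurable hφi _).trans ?_
      refine (integral_mono hφi.norm (integrable_const (R + 1)) fun w =>
        norm_softTruncation_le hR0 _).trans ?_
      simp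
  have hNm : ∀ i, Measurable fun ω => ‖neighborSum (softTruncation R) (fun j => Z (n + 1) j s ω)
      (fun j l => A (n + 1) j l s ω) i -
        kernelMean B0 B s μ (softTruncation R) (fun r => Z (n + 1) i r ω)‖ := fun i =>
    Measurable.norm (Measurable.sub (measurable_neighborSum
      (continuous_softTruncation R).measurable (fun j => (hsys _).measurable_opinion j s)
      (fun i j => (hsys _).measurable_edge i j s) i)
      ((measurable_kernelMean hB s μ (continuous_softTruncation R).measurable).comp (hZm i)))
  have hIφ : ∀ i, Integrable (fun ω => ‖neighborSum (softTruncation R)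
      (fun j => Z (n + 1) j s ω) (fun j l => A (n + 1) j l s ω) i -
        kernelMean B0 B s μ (softTruncation R) (fun r => Z (n + 1) i r ω)‖) P := fun i =>
    Integrable.of_bound (hNm i).aestronglyMeasurable _ (Eventually.of_forall fun ω => by
      rw [Real.norm_of_nonneg (norm_nonneg _)]; exact hnb ω i)
  have hpt : ∀ ω i, ‖neighborSum (fun x => x) (fun j => Z (n + 1) j s ω)
      (fun j l => A (n + 1) j l s ω) i -
        kernelMean B0 B s μ (fun x => x) (fun r => Z (n + 1) i r ω)‖ ≤
      ‖neighborSum (softTruncation R) (fun j => Z (n + 1) j s ω)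
        (fun j l => A (n + 1) j l s ω) i -
        kernelMean B0 B s μ (softTruncation R) (fun r => Z (n + 1) i r ω)‖ +
      Real.exp (-R) * ((avg fun j => Real.exp (2 * ‖Z (n + 1) j s ω‖)) + K') := by
    intro ω i
    have h1 := norm_neighborSum_sub_le (fun x => x) (softTruncation R)
      (fun j => Z (n + 1) j s ω) (fun j l => A (n + 1) j l s ω) i
    have h2 : (avg fun j => ‖Z (n + 1) j s ω - softTruncation R (Z (n + 1) j s ω)‖) ≤
        Real.exp (-R) * avg fun j => Real.exp (2 * ‖Z (n + 1) j s ω‖) := by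
      rw [← avg_const_mul]
      exact avg_mono fun j => norm_sub_softTruncation_le R _
    have hdi : Integrable (fun w => w s - softTruncation R (w s)) μ := hidi.sub hφi
    have h3 : ‖kernelMean B0 B s μ (fun x => x) (fun r => Z (n + 1) i r ω) -
        kernelMean B0 B s μ (softTruncation R) (fun r => Z (n + 1) i r ω)‖ ≤
        Real.exp (-R) * K' := by
      rw [← kernelMean_sub hB s (φ := fun x => x) measurable_id hidi (continuous_softTruncation R).measurable hφi]
      refine (norm_kernelMean_le hB s (measurable_id.sub
        (continuous_softTruncation R).measurable) hdi _).trans ?_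
      rw [hK', ← integral_const_mul]
      exact integral_mono hdi.norm (hμi.const_mul _) fun w => norm_sub_softTruncation_le R _
    have h4 : ∀ a b a' b' : EuclideanSpace ℝ (Fin d),
        ‖a - b‖ ≤ ‖a' - b'‖ + (‖a - a'‖ + ‖b - b'‖) := by
      intro a b a' b'
      have : a - b = (a' - b') + ((a - a') - (b - b')) := by abel
      rw [this]
      exact (norm_add_le _ _).trans (add_le_add le_rfl (norm_sub_le _ _))
    refine (h4 _ _ _ _).trans (add_le_add le_rfl ?_)
    rw [mul_add]
    exact add_le_add (h1.trans h2) h3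
  have havg : Integrable (fun ω => avg fun j => Real.exp (2 * ‖Z (n + 1) j s ω‖)) P :=
    integrable_avg hi
  calc _ ≤ avg fun i : Fin (n + 1) => (∫ ω, ‖neighborSum (softTruncation R)
        (fun j => Z (n + 1) j s ω) (fun j l => A (n + 1) j l s ω) i -
          kernelMean B0 B s μ (softTruncation R) (fun r => Z (n + 1) i r ω)‖ ∂P) +
        Real.exp (-R) * (K + K') := by
        refine avg_mono fun i => ?_
        refine (integral_mono_of_nonneg (Eventually.of_forall fun ω => norm_nonneg _)
          ((hIφ i).add ((havg.add (integrable_const K')).const_mul (Real.exp (-R))))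
          (Eventually.of_forall fun ω => hpt ω i)).trans ?_
        rw [integral_add' (hIφ i) ((havg.add (integrable_const K')).const_mul (Real.exp (-R))),
          integral_const_mul, integral_add' havg (integrable_const K'), integral_avg hi]
        simp only [integral_const, probReal_univ, one_smul]
        gcongr
    _ ≤ ε / 2 + ε / 2 := by
        rw [avg_add, avg_const]
        exact add_le_add hn.le hR
    _ = ε := add_halves ε

/-- With `δ = 1 / (n + 1)` the integrand vanishes for large `n` wherever `y` is positive, and it is
bounded by one. -/
lemma exists_integral_max_lt {α : Type*} [MeasurableSpace α] {μ : Measure α}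
    [IsProbabilityMeasure μ] {y : α → ℝ} (hy : Measurable y) (h : ∀ᵐ x ∂μ, 0 < y x) {ε : ℝ}
    (hε : 0 < ε) : ∃ δ : ℝ, 0 < δ ∧ ∫ x, max 0 (1 - δ⁻¹ * y x ^ 2) ∂μ < ε := by
  have h1 : Tendsto (fun n : ℕ => ∫ x, max 0 (1 - ((n : ℝ) + 1) * y x ^ 2) ∂μ) atTop
      (𝓝 (∫ _, (0 : ℝ) ∂μ)) := by
    refine tendsto_integral_of_dominated_convergence (fun _ => (1 : ℝ)) (fun n => ?_)
      (integrable_const _) (fun n => Eventually.of_forall fun x => ?_) ?_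
    · exact (measurable_const.max
        (measurable_const.sub ((hy.pow_const 2).const_mul _))).aestronglyMeasurable
    · rw [Real.norm_of_nonneg (le_max_left _ _)]
      refine max_le zero_le_one ?_
      have : 0 ≤ ((n : ℝ) + 1) * y x ^ 2 := by positivity
      linarith
    · filter_upwards [h] with x hx
      refine tendsto_const_nhds.congr' ?_
      obtain ⟨N, hN⟩ := exists_nat_ge (y x ^ 2)⁻¹
      filter_upwards [eventually_ge_atTop N] with n hn
      have h2 : 0 < y x ^ 2 := by positivity
      have h3 : (y x ^ 2)⁻¹ ≤ (n : ℝ) + 1 := by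
        have : (N : ℝ) ≤ n := Nat.cast_le.mpr hn
        linarith
      have h4 : 1 ≤ ((n : ℝ) + 1) * y x ^ 2 := by
        calc (1 : ℝ) = (y x ^ 2)⁻¹ * y x ^ 2 := (inv_mul_cancel₀ h2.ne').symm
          _ ≤ _ := mul_le_mul_of_nonneg_right h3 h2.le
      rw [max_eq_left (by linarith)]
  rw [integral_zero] at h1
  obtain ⟨n, hn⟩ := (h1.eventually (gt_mem_nhds hε)).exists
  exact ⟨((n : ℝ) + 1)⁻¹, by positivity, by simpa using hn⟩

/-- The local averages are asymptotically close to the mean-field averages. -/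
theorem SampleTendsto.tendsto_neighborAverage (hB : IsInteractionPair B0 B)
    (hsys : ∀ n, IsCoevolvingSystem P γ B0 B ξ n (Z n) (A n))
    (h' : IsLimitingMeanField P' γ B0 B μ0 ν 3 t ξ' Z' A') (hμ0 : μ0 ≪ volume) (hν : ν ≪ volume)
    {s : ℕ} (hs : s ≤ t)
    (h : SampleTendsto P Z A (s + 1) (s + 1) 3 (P'.map (procState (s + 1) (s + 1) Z' A')))
    {μ : Measure (ℕ → EuclideanSpace ℝ (Fin d))} (hμ : μ = P'.map fun ω r => Z' 2 r ω)
    {K : ℝ} (hmom : ∀ᶠ n : ℕ in atTop,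
      (∀ i, Integrable (fun ω => Real.exp (2 * ‖Z (n + 1) i s ω‖)) P) ∧
      (avg fun i => ∫ ω, Real.exp (2 * ‖Z (n + 1) i s ω‖) ∂P) ≤ K)
    (hμi : Integrable (fun w => Real.exp (2 * ‖w s‖)) μ)
    (hpos : ∀ᵐ ω ∂P', 0 < meanFieldMass B0 B s μ fun r => Z' 0 r ω) :
    Tendsto (fun n => avg fun i : Fin (n + 1) => ∫ ω, min 1
      ‖neighborAverage (fun j => Z (n + 1) j s ω) (fun j l => A (n + 1) j l s ω) i -
        meanFieldAverage B0 B s μ (fun r => Z (n + 1) i r ω)‖ ∂P) atTop (𝓝 0) := by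
  have hp : IsProbabilityMeasure μ := by rw [hμ]; exact h'.isProbabilityMeasure_traj 2
  have hidi : Integrable (fun w => w s) μ := by
    refine hμi.mono (measurable_pi_apply s).aestronglyMeasurable (Eventually.of_forall fun w => ?_)
    rw [Real.norm_of_nonneg (Real.exp_pos _).le]
    linarith [Real.add_one_le_exp (2 * ‖w s‖), norm_nonneg (w s)]
  set c := ∫ w, ‖w s‖ ∂μ with hc
  have hc0 : 0 ≤ c := integral_nonneg fun w => norm_nonneg _
  set g0 := meanFieldMass B0 B s μ with hg0
  have hg0m : Measurable g0 := measurable_meanFieldMass hB s μ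
  have hone : Integrable (fun _ : ℕ → EuclideanSpace ℝ (Fin d) => (1 : ℝ)) μ := integrable_const 1
  have hg0mem : ∀ z, 0 ≤ g0 z ∧ g0 z ≤ 1 := by
    intro z
    refine ⟨integral_nonneg fun w => (trajProb_mem hB s z w).1, ?_⟩
    have := norm_kernelMean_le hB s (φ := fun _ => (1 : ℝ)) measurable_const hone z
    rw [← meanFieldMass_eq_kernelMean] at this
    exact (le_abs_self _).trans (by simpa using this)
  have hN1 := h.tendsto_norm_neighborSum_id hB hsys h' hμ0 hν hs hμ hmom hμi
  have hN2 := h.tendsto_norm_neighborSum hB hsys h' hμ0 hν hs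
    (φ := fun _ => (1 : ℝ)) continuous_const (R := 1) (fun _ => by simp) hμ
  simp_rw [← meanFieldMass_eq_kernelMean, Real.norm_eq_abs, ← hg0] at hN2
  refine tendsto_zero_of_forall_eventually_le (fun n => avg_nonneg fun i =>
    integral_nonneg fun ω => le_min zero_le_one (norm_nonneg _)) fun ε hε => ?_
  have hg0Z : Measurable fun ω => g0 fun r => Z' 0 r ω := hg0m.comp (h'.measurable_traj 0)
  -- `δ` is the level below which the squared mass counts as small; in the limit such agents
  -- contribute less than `ε / 2`.
  obtain ⟨δ, hδ, hβ⟩ := exists_integral_max_lt hg0Z hpos (half_pos hε)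
  have hfm : Measurable fun x : TrajState 3 d => max 0 (1 - δ⁻¹ * g0 (x.1 0) ^ 2) := by
    have h1 : Measurable fun x : TrajState 3 d => g0 (x.1 0) := hg0m.comp (by fun_prop)
    exact measurable_const.max (measurable_const.sub ((h1.pow_const 2).const_mul _))
  have hmax : ∀ y : ℝ, max 0 (1 - δ⁻¹ * y ^ 2) ∈ Set.Icc (0 : ℝ) 1 := fun y => by
    refine ⟨le_max_left _ _, max_le zero_le_one ?_⟩
    have : 0 ≤ δ⁻¹ * y ^ 2 := by positivity
    linarith
  have hmeas : Measurable (procState (s + 1) (s + 1) Z' A') :=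
    measurable_procState (fun i r _ => h'.measurable_opinion i r)
      fun i j r _ => h'.measurable_edge i j r
  -- The weight of the agents with small mass is itself a test function that is continuous at almost
  -- every limiting state, so its average over the finite system converges to the limiting one.
  have hN3 := h.tendsto_avg hmeas hsys hfm (C := 1)
    (fun x => by rw [abs_of_nonneg (hmax _).1]; exact (hmax _).2) (by
      filter_upwards [h'.ae_ae_kernelContinuousAt hB hμ0 hν 0 2 hs] with ω hω
      rw [← hμ] at hω
      have h1 := continuousAt_kernelMean hB s (φ := fun _ => (1 : ℝ)) measurable_const hone hω
      have h2 : ContinuousAt g0 (cutTraj (s + 1) fun r => Z' 0 r ω) := by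
        rw [hg0, funext fun z => meanFieldMass_eq_kernelMean (B0 := B0) (B := B) s μ z]
        exact h1
      have h3 : ContinuousAt (fun x : TrajState 3 d => g0 (x.1 0))
          (procState (s + 1) (s + 1) Z' A' ω) :=
        ContinuousAt.comp (x := procState (s + 1) (s + 1) Z' A' ω) (g := g0)
          (f := fun x : TrajState 3 d => x.1 0) (hg := h2) (by fun_prop)
      exact continuousAt_const.max (continuousAt_const.sub
        (continuousAt_const.mul (h3.pow 2))))
  have hg0cut : ∀ z, g0 (cutTraj (s + 1) z) = g0 z := meanFieldMass_cutTraj s μ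
  simp only [sampleState, procState, hg0cut] at hN3
  simp_rw [avg_eval (0 : Fin 3) fun i => ∫ ω, max 0 (1 - δ⁻¹ *
    g0 (fun r => Z (_ + 1) i r ω) ^ 2) ∂P] at hN3
  have hsum := ((hN1.add (hN2.const_mul (c + 1))).const_mul δ⁻¹).add hN3
  simp only [mul_zero, add_zero, zero_add] at hsum
  filter_upwards [hsum.eventually (gt_mem_nhds (hβ.trans (half_lt_self hε))), hmom] with n hn hi
  refine le_trans ?_ hn.le
  rw [← avg_const_mul (c + 1), ← avg_add, ← avg_const_mul, ← avg_add]
  refine avg_mono fun i => ?_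
  have hZm : Measurable fun ω r => Z (n + 1) i r ω :=
    measurable_pi_lambda _ fun r => (hsys _).measurable_opinion i r
  have hZsi : ∀ j, Integrable (fun ω => ‖Z (n + 1) j s ω‖) P := fun j => by
    refine (hi.1 j).mono ((hsys _).measurable_opinion j s).norm.aestronglyMeasurable
      (Eventually.of_forall fun ω => ?_)
    rw [Real.norm_of_nonneg (Real.exp_pos _).le, norm_norm]
    linarith [Real.add_one_le_exp (2 * ‖Z (n + 1) j s ω‖), norm_nonneg (Z (n + 1) j s ω)]
  have hkm : Measurable (kernelMean B0 B s μ fun x => x) :=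
    measurable_kernelMean hB s μ measurable_id
  have i1 : Integrable (fun ω => ‖neighborSum (fun x => x) (fun j => Z (n + 1) j s ω)
      (fun j l => A (n + 1) j l s ω) i -
        kernelMean B0 B s μ (fun x => x) (fun r => Z (n + 1) i r ω)‖) P := by
    refine Integrable.mono ((integrable_avg hZsi).add (integrable_const c))
      (Measurable.norm (Measurable.sub (measurable_neighborSum measurable_id
        (fun j => (hsys _).measurable_opinion j s) (fun i j => (hsys _).measurable_edge i j s) i)
        (hkm.comp hZm))).aestronglyMeasurable (Eventually.of_forall fun ω => ?_)
    rw [norm_norm]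
    refine le_trans ?_ (le_abs_self _)
    exact (norm_sub_le _ _).trans (add_le_add (norm_neighborSum_le _ _ _ _)
      (norm_kernelMean_le hB s measurable_id hidi _))
  have i2 : Integrable (fun ω => |neighborSum (fun _ => (1 : ℝ)) (fun j => Z (n + 1) j s ω)
      (fun j l => A (n + 1) j l s ω) i - g0 fun r => Z (n + 1) i r ω|) P := by
    refine Integrable.of_bound (Measurable.norm (Measurable.sub (measurable_neighborSum
      measurable_const (fun j => (hsys _).measurable_opinion j s)
      (fun i j => (hsys _).measurable_edge i j s) i) (hg0m.comp hZm))).aestronglyMeasurable (1 + 1)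
      (Eventually.of_forall fun ω => ?_)
    rw [Real.norm_eq_abs, abs_abs]
    refine (abs_sub _ _).trans (add_le_add ?_ ?_)
    · refine (norm_neighborSum_le (fun _ => (1 : ℝ)) _ _ _).trans (le_of_eq ?_)
      simp only [norm_one]
      exact avg_const _
    · rw [abs_of_nonneg (hg0mem _).1]
      exact (hg0mem _).2
  have i3 : Integrable (fun ω => max 0 (1 - δ⁻¹ * g0 (fun r => Z (n + 1) i r ω) ^ 2)) P := by
    refine Integrable.of_bound (measurable_const.max (measurable_const.sub
      (((hg0m.comp hZm).pow_const 2).const_mul _))).aestronglyMeasurable 1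
      (Eventually.of_forall fun ω => ?_)
    rw [Real.norm_of_nonneg (hmax _).1]
    exact (hmax _).2
  have i12 := (i1.add (i2.const_mul (c + 1))).const_mul δ⁻¹
  simp only [Pi.add_apply] at i12
  rw [← integral_const_mul (c + 1), ← integral_add i1 (i2.const_mul _), ← integral_const_mul,
    ← integral_add i12 i3]
  refine integral_mono_of_nonneg (Eventually.of_forall fun ω =>
    le_min zero_le_one (norm_nonneg _)) (i12.add i3) ?_
  filter_upwards [(hsys (n + 1)).diag i s] with ω hω
  set L := neighborAverage (fun j => Z (n + 1) j s ω) (fun j l => A (n + 1) j l s ω) i with hL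
  -- The bound `c` of the numerator is the mean norm of the limiting opinion, which dominates the
  -- kernel mean since the edge probabilities are at most one.
  have h1 := sq_mul_min_norm_sub_le (L := L)
    (D := neighborSum (fun _ => (1 : ℝ)) (fun j => Z (n + 1) j s ω)
      (fun j l => A (n + 1) j l s ω) i)
    (hg0mem fun r => Z (n + 1) i r ω).1 (hg0mem _).2
    (norm_kernelMean_le hB s measurable_id hidi fun r => Z (n + 1) i r ω)
  rw [hL, ← neighborSum_id_eq _ _ _ hω] at h1
  refine (min_le_add_max hδ (le_min zero_le_one (norm_nonneg _)) (min_le_left _ _)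
    (y := g0 fun r => Z (n + 1) i r ω)).trans (add_le_add ?_ le_rfl)
  exact mul_le_mul_of_nonneg_left h1 (by positivity)

end LawOfLargeNumbers

/-! ### Second moments of degrees and the mean inverse degree -/

section EdgeMoments

variable {Ω : Type*} {d : ℕ} {γ : ℝ}
  {B0 : EuclideanSpace ℝ (Fin d) → EuclideanSpace ℝ (Fin d) → ℝ}
  {B : Bool → EuclideanSpace ℝ (Fin d) → EuclideanSpace ℝ (Fin d) → ℝ}
  {ξ : ℕ → ℕ → Ω → EuclideanSpace ℝ (Fin d)} {N : ℕ}
  {Z : Fin N → ℕ → Ω → EuclideanSpace ℝ (Fin d)} {A : Fin N → Fin N → ℕ → Ω → Bool}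

/-- The probability, just before the edges at time `s` are drawn, that `i` and `j` are linked. -/
noncomputable def linkProb (B0 : EuclideanSpace ℝ (Fin d) → EuclideanSpace ℝ (Fin d) → ℝ)
    (B : Bool → EuclideanSpace ℝ (Fin d) → EuclideanSpace ℝ (Fin d) → ℝ)
    (Z : Fin N → ℕ → Ω → EuclideanSpace ℝ (Fin d)) (A : Fin N → Fin N → ℕ → Ω → Bool)
    (s : ℕ) (i j : Fin N) (ω : Ω) : ℝ :=
  edgeProb B0 B s (fun r => Z i r ω) (fun r => Z j r ω) fun r => A i j r ω

lemma linkProb_mem (hB : IsInteractionPair B0 B) (s : ℕ) (i j : Fin N) (ω : Ω) :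
    linkProb B0 B Z A s i j ω ∈ Set.Icc (0 : ℝ) 1 := edgeProb_mem hB s _ _ _

lemma measurable_linkProb (hB : IsInteractionPair B0 B) (s : ℕ) (i j : Fin N) :
    Measurable[history Z A (s + 1) s] (linkProb B0 B Z A s i j) := by
  have h1 : Measurable[history Z A (s + 1) s] fun ω => (cutTraj (s + 1) (fun r => Z i r ω),
      cutTraj (s + 1) (fun r => Z j r ω), cutTraj s fun r => A i j r ω) :=
    (measurable_cutTraj_history i).prodMk ((measurable_cutTraj_history j).prodMk
      (measurable_cutTraj_comp fun r hr => measurable_edge_history hr i j))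
  have h2 := (measurable_edgeProb hB s).comp h1
  convert h2 using 1
  ext ω
  exact edgeProb_congr
    (fun r hr => (cutTraj_apply_of_lt (Nat.lt_succ_of_le hr) fun r => Z i r ω).symm)
    (fun r hr => (cutTraj_apply_of_lt (Nat.lt_succ_of_le hr) fun r => Z j r ω).symm)
    fun r hr => (cutTraj_apply_of_lt hr fun r => A i j r ω).symm

/-- The indicator of an edge. -/
def link (A : Fin N → Fin N → ℕ → Ω → Bool) (s : ℕ) (i j : Fin N) (ω : Ω) : ℝ :=
  if A i j s ω then 1 else 0

lemma link_mem (s : ℕ) (i j : Fin N) (ω : Ω) : link A s i j ω ∈ Set.Icc (0 : ℝ) 1 := by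
  unfold link; split_ifs <;> simp

namespace IsCoevolvingSystem

variable [mΩ : MeasurableSpace Ω] {P : Measure Ω}

lemma measurable_link (h : IsCoevolvingSystem P γ B0 B ξ N Z A) (s : ℕ) (i j : Fin N) :
    Measurable (link A s i j) :=
  Measurable.ite (h.measurable_edge i j s (measurableSet_singleton _)) measurable_const
    measurable_const

/-- The number of edges of `i` (with the loop at `i`). -/
lemma ae_degree (h : IsCoevolvingSystem P γ B0 B ξ N Z A) (s : ℕ) (i : Fin N) :
    ∀ᵐ ω ∂P, ∑ j, link A s i j ω = 1 + ∑ j ∈ Finset.univ.erase i, link A s i j ω := by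
  filter_upwards [h.diag i s] with ω hω
  rw [← Finset.add_sum_erase _ _ (Finset.mem_univ i)]
  simp [link, hω]

variable [IsProbabilityMeasure P]

lemma integral_mul_link (h : IsCoevolvingSystem P γ B0 B ξ N Z A) {i j : Fin N} (hij : i ≠ j)
    (s : ℕ) {V : Ω → ℝ} (hV : Measurable[history Z A (s + 1) s] V) {C : ℝ}
    (hC : ∀ ω, |V ω| ≤ C) :
    ∫ ω, V ω * link A s i j ω ∂P = ∫ ω, V ω * linkProb B0 B Z A s i j ω ∂P := by
  have hinj : Function.Injective ![i, j] := by
    intro a b hab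
    fin_cases a <;> fin_cases b <;> simp_all [eq_comm]
  have h1 := (h.edgeLaw hinj s).integral_mul_prod {(⟨(0, 1), by decide⟩ : EdgeIdx 2)}
    (fun _ => true) V C hV hC
  simp_rw [edgesWeight_procState s _ _ _ _ _ (Nat.lt_succ_self s) le_rfl,
    Finset.prod_singleton] at h1
  exact h1

lemma integral_mul_link_mul_link (h : IsCoevolvingSystem P γ B0 B ξ N Z A) {i j l : Fin N}
    (hij : i ≠ j) (hil : i ≠ l) (hjl : j ≠ l)
    (s : ℕ) {V : Ω → ℝ} (hV : Measurable[history Z A (s + 1) s] V) {C : ℝ}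
    (hC : ∀ ω, |V ω| ≤ C) :
    ∫ ω, V ω * (link A s i j ω * link A s i l ω) ∂P =
      ∫ ω, V ω * (linkProb B0 B Z A s i j ω * linkProb B0 B Z A s i l ω) ∂P := by
  have hinj : Function.Injective ![i, j, l] := by
    intro a b hab
    fin_cases a <;> fin_cases b <;> simp_all [eq_comm]
  have hne : (⟨(0, 1), by decide⟩ : EdgeIdx 3) ≠ ⟨(0, 2), by decide⟩ := by simp
  have h1 := (h.edgeLaw hinj s).integral_mul_prod
    {(⟨(0, 1), by decide⟩ : EdgeIdx 3), ⟨(0, 2), by decide⟩} (fun _ => true) V C hV hC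
  simp_rw [edgesWeight_procState s _ _ _ _ _ (Nat.lt_succ_self s) le_rfl,
    Finset.prod_pair hne] at h1
  exact h1

/-- This bounds a conditional variance: the edges of `i` are conditionally independent, so the mixed
terms vanish, and a bit with mean `p` has variance at most `p`. -/
lemma integral_sq_le (h : IsCoevolvingSystem P γ B0 B ξ N Z A) (hB : IsInteractionPair B0 B)
    (s : ℕ) (i : Fin N) {V : Ω → ℝ} (hV : Measurable[history Z A (s + 1) s] V)
    (h0 : ∀ ω, 0 ≤ V ω) {C : ℝ} (hC : ∀ ω, V ω ≤ C) :
    ∫ ω, V ω * (∑ j ∈ Finset.univ.erase i, (link A s i j ω - linkProb B0 B Z A s i j ω)) ^ 2 ∂P ≤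
      ∫ ω, V ω * ∑ j ∈ Finset.univ.erase i, linkProb B0 B Z A s i j ω ∂P := by
  have hle := history_le h.measurable_opinion h.measurable_edge (s + 1) s
  set a := link A s i with ha
  set p := linkProb B0 B Z A s i with hp
  have hC0 : ∀ ω, |V ω| ≤ C := fun ω => by rw [abs_of_nonneg (h0 ω)]; exact hC ω
  have hpm : ∀ j, Measurable[history Z A (s + 1) s] (p j) := measurable_linkProb hB s i
  have ham : ∀ j, Measurable (a j) := h.measurable_link s i
  have hV' : Measurable V := hV.mono hle le_rfl
  have hpm' : ∀ j, Measurable (p j) := fun j => (hpm j).mono hle le_rfl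
  have habs : ∀ {x y : ℝ}, |x| ≤ 1 → |y| ≤ 1 → |x * y| ≤ 1 := fun hx hy => by
    rw [abs_mul]; exact mul_le_one₀ hx (abs_nonneg _) hy
  have ha1 : ∀ j ω, |a j ω| ≤ 1 := fun j ω => by
    rw [abs_of_nonneg (link_mem s i j ω).1]; exact (link_mem s i j ω).2
  have hp1 : ∀ j ω, |p j ω| ≤ 1 := fun j ω => by
    rw [abs_of_nonneg (linkProb_mem hB s i j ω).1]; exact (linkProb_mem hB s i j ω).2
  have hVb : ∀ {x : Ω → ℝ}, (∀ ω, |x ω| ≤ 1) → ∀ ω, |V ω * x ω| ≤ C := fun hx ω => by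
    rw [abs_mul]
    exact (mul_le_mul (hC0 ω) (hx ω) (abs_nonneg _) ((abs_nonneg _).trans (hC0 ω))).trans
      (mul_one C).le
  have hint : ∀ {x : Ω → ℝ}, Measurable x → (∀ ω, |x ω| ≤ 1) →
      Integrable (fun ω => V ω * x ω) P := fun hx hx1 =>
    Integrable.of_bound (hV'.mul hx).aestronglyMeasurable C (Eventually.of_forall (hVb hx1))
  -- When the product is expanded, the terms linear in one link are treated with the weight `V`
  -- times the other probability, which is also known before the edges are drawn.
  have hoff : ∀ j ∈ Finset.univ.erase i, ∀ l ∈ Finset.univ.erase i, j ≠ l →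
      ∫ ω, V ω * ((a j ω - p j ω) * (a l ω - p l ω)) ∂P = 0 := by
    intro j hj l hl hjl
    have hij := (Finset.ne_of_mem_erase hj).symm
    have hil := (Finset.ne_of_mem_erase hl).symm
    have e1 := h.integral_mul_link_mul_link hij hil hjl s hV hC0
    have e2 := h.integral_mul_link hij s (hV.mul (hpm l)) (hVb (hp1 l))
    have e3 := h.integral_mul_link hil s (hV.mul (hpm j)) (hVb (hp1 j))
    have i1 := hint ((ham j).mul (ham l)) fun ω => habs (ha1 j ω) (ha1 l ω)
    have i2 := hint ((hpm' l).mul (ham j)) fun ω => habs (hp1 l ω) (ha1 j ω)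
    have i3 := hint ((hpm' j).mul (ham l)) fun ω => habs (hp1 j ω) (ha1 l ω)
    have i4 := hint ((hpm' j).mul (hpm' l)) fun ω => habs (hp1 j ω) (hp1 l ω)
    simp only [Pi.mul_apply, mul_assoc] at e1 e2 e3 i1 i2 i3 i4
    have e4 : ∀ ω, V ω * ((a j ω - p j ω) * (a l ω - p l ω)) =
        V ω * (a j ω * a l ω) - V ω * (p l ω * a j ω) - V ω * (p j ω * a l ω) +
          V ω * (p j ω * p l ω) := fun ω => by ring
    simp_rw [e4]
    have i5 := i1.sub i2
    have i6 := i5.sub i3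
    simp only [Pi.sub_def] at i5 i6
    rw [integral_add i6 i4, integral_sub i5 i3, integral_sub i1 i2]
    rw [e1, e2, e3]
    simp only [← hp, mul_comm (p l _) (p j _)]
    ring
  have hdiag : ∀ j ∈ Finset.univ.erase i,
      ∫ ω, V ω * ((a j ω - p j ω) * (a j ω - p j ω)) ∂P ≤ ∫ ω, V ω * p j ω ∂P := by
    intro j hj
    have hij := (Finset.ne_of_mem_erase hj).symm
    have e2 := h.integral_mul_link hij s (hV.mul (hpm j)) (hVb (hp1 j))
    have e1 := h.integral_mul_link hij s hV hC0
    have i1 := hint (ham j) (ha1 j)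
    have i2 := hint ((hpm' j).mul (ham j)) fun ω => habs (hp1 j ω) (ha1 j ω)
    have i4 := hint ((hpm' j).mul (hpm' j)) fun ω => habs (hp1 j ω) (hp1 j ω)
    simp only [Pi.mul_apply, mul_assoc] at e1 e2 i1 i2 i4
    have e4 : ∀ ω, V ω * ((a j ω - p j ω) * (a j ω - p j ω)) =
        V ω * a j ω - 2 * (V ω * (p j ω * a j ω)) + V ω * (p j ω * p j ω) := fun ω => by
      have : a j ω * a j ω = a j ω := by
        simp only [ha, link]; split_ifs <;> simp
      linear_combination V ω * this
    simp_rw [e4]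
    have i5 := i1.sub (i2.const_mul 2)
    simp only [Pi.sub_def] at i5
    rw [integral_add i5 i4, integral_sub i1 (i2.const_mul 2),
      integral_const_mul, e1, e2, ← hp]
    have : 0 ≤ ∫ ω, V ω * (p j ω * p j ω) ∂P :=
      integral_nonneg fun ω => mul_nonneg (h0 ω) (mul_self_nonneg _)
    linarith
  have hsub1 : ∀ j ω, |a j ω - p j ω| ≤ 1 := fun j ω => by
    have h1 := link_mem (A := A) s i j ω
    have h2 := linkProb_mem (Z := Z) (A := A) hB s i j ω
    rw [abs_le]
    constructor <;> linarith [h1.1, h1.2, h2.1, h2.2]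
  have hI : ∀ j l, Integrable (fun ω => V ω * ((a j ω - p j ω) * (a l ω - p l ω))) P :=
    fun j l => hint (((ham j).sub (hpm' j)).mul ((ham l).sub (hpm' l)))
      fun ω => habs (hsub1 j ω) (hsub1 l ω)
  simp_rw [sq, Finset.sum_mul_sum, Finset.mul_sum]
  rw [integral_finsetSum _ fun j _ => integrable_finsetSum _ fun l _ => hI j l,
    integral_finsetSum _ fun j _ => hint (hpm' j) (hp1 j)]
  refine Finset.sum_le_sum fun j hj => ?_
  rw [integral_finsetSum _ fun l _ => hI j l, Finset.sum_eq_single_of_mem j hj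
    fun l hl hlj => hoff j hj l hl hlj.symm]
  exact hdiag j hj

/-- If `D ≥ m / 2`, the first term suffices. If `D ≤ m / 2`, then `(D - m) ^ 2 ≥ m ^ 2 / 4`, so the
second term is at least one, and `D⁻¹ ≤ 1`. -/
lemma inv_le_of_one_le {D m : ℝ} (hD : 1 ≤ D) (hm : 1 ≤ m) :
    D⁻¹ ≤ 2 * m⁻¹ + 4 * ((m ^ 2)⁻¹ * (D - m) ^ 2) := by
  have hm2 : 0 < m ^ 2 := by positivity
  have h0 : 0 ≤ (m ^ 2)⁻¹ * (D - m) ^ 2 := by positivity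
  have h1 : 0 < m⁻¹ := by positivity
  rcases le_total (m / 2) D with h | h
  · have : D⁻¹ ≤ (m / 2)⁻¹ := inv_anti₀ (by linarith) h
    have h2 : (m / 2)⁻¹ = 2 * m⁻¹ := by rw [inv_div]; ring
    linarith
  · have h2 : D⁻¹ ≤ 1 := inv_le_one_of_one_le₀ hD
    have h3 : 1 ≤ 4 * ((m ^ 2)⁻¹ * (D - m) ^ 2) := by
      have h4 : (m / 2) ^ 2 ≤ (D - m) ^ 2 := by nlinarith
      have h5 : (m ^ 2)⁻¹ * (m / 2) ^ 2 ≤ (m ^ 2)⁻¹ * (D - m) ^ 2 := by gcongr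
      have h6 : (m ^ 2)⁻¹ * (m / 2) ^ 2 = 1 / 4 := by field_simp; norm_num
      linarith
    linarith

/-- The expected number of neighbours, plus one for the agent itself. -/
lemma integral_mul_inv_degree_le (h : IsCoevolvingSystem P γ B0 B ξ N Z A)
    (hB : IsInteractionPair B0 B) (s : ℕ) (i : Fin N) {V : Ω → ℝ}
    (hV : Measurable[history Z A (s + 1) s] V) (h0 : ∀ ω, 0 ≤ V ω) {C : ℝ} (hC : ∀ ω, V ω ≤ C) :
    ∫ ω, V ω * (∑ j, link A s i j ω)⁻¹ ∂P ≤
      6 * ∫ ω, V ω * (1 + ∑ j ∈ Finset.univ.erase i, linkProb B0 B Z A s i j ω)⁻¹ ∂P := by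
  have hle := history_le h.measurable_opinion h.measurable_edge (s + 1) s
  set m : Ω → ℝ := fun ω => 1 + ∑ j ∈ Finset.univ.erase i, linkProb B0 B Z A s i j ω with hm
  have hm1 : ∀ ω, 1 ≤ m ω := fun ω => le_add_of_nonneg_right
    (Finset.sum_nonneg fun j _ => (linkProb_mem hB s i j ω).1)
  have hmm : Measurable[history Z A (s + 1) s] m :=
    measurable_const.add (Finset.measurable_fun_sum _ fun j _ => measurable_linkProb hB s i j)
  -- The variance estimate is applied with the weight `V / m ^ 2`; since the sum of the
  -- probabilities is at most `m`, it yields the mean of `V / m`. With the constants of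
  -- `inv_le_of_one_le` the total is `2 + 4 = 6`.
  set V' : Ω → ℝ := fun ω => V ω * (m ω ^ 2)⁻¹ with hV'
  have hV'm : Measurable[history Z A (s + 1) s] V' := hV.mul (hmm.pow_const 2).inv
  have hinv1 : ∀ ω, (m ω ^ 2)⁻¹ ≤ 1 := fun ω =>
    inv_le_one_of_one_le₀ (one_le_pow₀ (hm1 ω))
  have hV'0 : ∀ ω, 0 ≤ V' ω := fun ω => mul_nonneg (h0 ω) (by positivity)
  have hV'C : ∀ ω, V' ω ≤ C := fun ω => (mul_le_of_le_one_right (h0 ω) (hinv1 ω)).trans (hC ω)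
  have key := h.integral_sq_le hB s i hV'm hV'0 hV'C
  have hVi : Integrable (fun ω => V ω * (m ω)⁻¹) P := by
    refine Integrable.of_bound ((hV.mul hmm.inv).mono hle le_rfl).aestronglyMeasurable C
      (Eventually.of_forall fun ω => ?_)
    have h1 : (0 : ℝ) ≤ (m ω)⁻¹ := inv_nonneg.mpr (zero_le_one.trans (hm1 ω))
    rw [Real.norm_of_nonneg (mul_nonneg (h0 ω) h1)]
    exact (mul_le_of_le_one_right (h0 ω) (inv_le_one_of_one_le₀ (hm1 ω))).trans (hC ω)
  set T : Ω → ℝ := fun ω => (∑ j ∈ Finset.univ.erase i,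
    (link A s i j ω - linkProb B0 B Z A s i j ω)) ^ 2 with hT
  have hTm : Measurable T := (Finset.measurable_fun_sum _ fun j _ =>
    (h.measurable_link s i j).sub ((measurable_linkProb hB s i j).mono hle le_rfl)).pow_const 2
  have hTi : Integrable (fun ω => V' ω * T ω) P := by
    refine Integrable.of_bound ((hV'm.mono hle le_rfl).mul hTm).aestronglyMeasurable (C * N ^ 2)
      (Eventually.of_forall fun ω => ?_)
    have h2 : |∑ j ∈ Finset.univ.erase i, (link A s i j ω - linkProb B0 B Z A s i j ω)| ≤ N := by
      refine (Finset.abs_sum_le_sum_abs _ _).trans ((Finset.sum_le_sum (g := fun _ => (1 : ℝ))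
        fun j _ => ?_).trans ?_)
      · have h1 := link_mem (A := A) s i j ω
        have h2 := linkProb_mem (Z := Z) (A := A) hB s i j ω
        rw [abs_le]
        constructor <;> linarith [h1.1, h1.2, h2.1, h2.2]
      · simp only [Finset.sum_const, nsmul_eq_mul, mul_one]
        have : (Finset.univ.erase i).card ≤ N :=
          (Finset.card_le_univ _).trans (Fintype.card_fin N).le
        exact_mod_cast this
    have h3 : T ω ≤ (N : ℝ) ^ 2 := by
      rw [hT]; simp only
      rw [← sq_abs]
      exact pow_le_pow_left₀ (abs_nonneg _) h2 2
    have hT0 : 0 ≤ T ω := sq_nonneg _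
    rw [Real.norm_of_nonneg (mul_nonneg (hV'0 ω) hT0)]
    exact mul_le_mul (hV'C ω) h3 hT0 ((hV'0 ω).trans (hV'C ω))
  calc ∫ ω, V ω * (∑ j, link A s i j ω)⁻¹ ∂P
      ≤ ∫ ω, (2 * (V ω * (m ω)⁻¹) + 4 * (V' ω * T ω)) ∂P := by
        refine integral_mono_of_nonneg (Eventually.of_forall fun ω => mul_nonneg (h0 ω)
          (inv_nonneg.mpr (Finset.sum_nonneg fun j _ => (link_mem s i j ω).1)))
          ((hVi.const_mul 2).add (hTi.const_mul 4)) ?_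
        filter_upwards [h.ae_degree s i] with ω hω
        simp only [hω]
        have hD : 1 ≤ 1 + ∑ j ∈ Finset.univ.erase i, link A s i j ω :=
          le_add_of_nonneg_right (Finset.sum_nonneg fun j _ => (link_mem s i j ω).1)
        have h1 := mul_le_mul_of_nonneg_left (inv_le_of_one_le hD (hm1 ω)) (h0 ω)
        refine h1.trans (le_of_eq ?_)
        simp only [hV', hT, hm, Finset.sum_sub_distrib]
        ring
    _ = 2 * ∫ ω, V ω * (m ω)⁻¹ ∂P + 4 * ∫ ω, V' ω * T ω ∂P := by
        rw [integral_add (hVi.const_mul 2) (hTi.const_mul 4), integral_const_mul,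
          integral_const_mul]
    _ ≤ 2 * ∫ ω, V ω * (m ω)⁻¹ ∂P + 4 * ∫ ω, V ω * (m ω)⁻¹ ∂P := by
        have h2 : ∫ ω, V' ω * ∑ j ∈ Finset.univ.erase i, linkProb B0 B Z A s i j ω ∂P ≤
            ∫ ω, V ω * (m ω)⁻¹ ∂P := by
          refine integral_mono_of_nonneg (Eventually.of_forall fun ω => mul_nonneg (hV'0 ω)
            (Finset.sum_nonneg fun j _ => (linkProb_mem hB s i j ω).1)) hVi
            (Eventually.of_forall fun ω => ?_)
          have h3 : 0 < m ω := zero_lt_one.trans_le (hm1 ω)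
          have h4 : ∑ j ∈ Finset.univ.erase i, linkProb B0 B Z A s i j ω ≤ m ω := by
            simp only [hm]; linarith
          calc V' ω * ∑ j ∈ Finset.univ.erase i, linkProb B0 B Z A s i j ω
              ≤ V' ω * m ω := mul_le_mul_of_nonneg_left h4 (hV'0 ω)
            _ = V ω * (m ω)⁻¹ := by simp only [hV']; field_simp
        linarith [key.trans h2]
    _ = _ := by ring

end IsCoevolvingSystem

end EdgeMoments

/-! ### Exponential moments of local averages -/

section ExponentialMoments

variable {Ω : Type*} {d : ℕ} {γ : ℝ}
  {B0 : EuclideanSpace ℝ (Fin d) → EuclideanSpace ℝ (Fin d) → ℝ}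
  {B : Bool → EuclideanSpace ℝ (Fin d) → EuclideanSpace ℝ (Fin d) → ℝ}
  {ξ : ℕ → ℕ → Ω → EuclideanSpace ℝ (Fin d)}

/-- The triangle inequality splits `‖x - y‖`, so the lower bound becomes a product of a factor for
each agent; this is what makes the sum over neighbours tractable. -/
lemma AtMostExponentialDecay.linkProb_ge (h : AtMostExponentialDecay B0 B) :
    ∃ b : ℝ, 0 < b ∧ ∃ c : ℝ, 0 < c ∧ ∀ (N : ℕ)
      (Z : Fin N → ℕ → Ω → EuclideanSpace ℝ (Fin d)) (A : Fin N → Fin N → ℕ → Ω → Bool) s i j ω,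
      c * Real.exp (-(b * ‖Z i s ω‖)) * Real.exp (-(b * ‖Z j s ω‖)) ≤
        linkProb B0 B Z A s i j ω := by
  obtain ⟨b, hb, c, hc, h0, h1⟩ := h
  refine ⟨b, hb, c, hc, fun N Z A s i j ω => ?_⟩
  have key : ∀ (x y : EuclideanSpace ℝ (Fin d)) (q : ℝ), c ≤ q * Real.exp (b * ‖x - y‖) →
      c * Real.exp (-(b * ‖x‖)) * Real.exp (-(b * ‖y‖)) ≤ q := by
    intro x y q hq
    have h2 : q = q * Real.exp (b * ‖x - y‖) * Real.exp (-(b * ‖x - y‖)) := by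
      rw [mul_assoc, ← Real.exp_add, add_neg_cancel, Real.exp_zero, mul_one]
    rw [h2, mul_assoc, ← Real.exp_add]
    refine mul_le_mul hq (Real.exp_le_exp.mpr ?_) (Real.exp_pos _).le (hc.le.trans hq)
    have := mul_le_mul_of_nonneg_left (norm_sub_le x y) hb.le
    linarith
  cases s with
  | zero => exact key _ _ _ (h0 _ _)
  | succ s => exact key _ _ _ (h1 _ _ _)

variable [mΩ : MeasurableSpace Ω] {P : Measure Ω}

/-- Monotone convergence for the truncations of a function, with a weight. -/
lemma tendsto_lintegral_min_mul {V w : Ω → ℝ} (hV : Measurable V) (hw : Measurable w)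
    (hw0 : ∀ ω, 0 ≤ w ω) :
    Tendsto (fun R : ℕ => ∫⁻ ω, ENNReal.ofReal (min (V ω) R * w ω) ∂P) atTop
      (𝓝 (∫⁻ ω, ENNReal.ofReal (V ω * w ω) ∂P)) := by
  refine lintegral_tendsto_of_tendsto_of_monotone
    (fun R => ((hV.min measurable_const).mul hw).ennreal_ofReal.aemeasurable)
    (Eventually.of_forall fun ω R R' hR => ?_) (Eventually.of_forall fun ω => ?_)
  · refine ENNReal.ofReal_le_ofReal (mul_le_mul_of_nonneg_right ?_ (hw0 ω))
    exact min_le_min le_rfl (Nat.cast_le.mpr hR)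
  · refine tendsto_const_nhds.congr' ?_
    obtain ⟨R0, hR0⟩ := exists_nat_ge (V ω)
    filter_upwards [eventually_ge_atTop R0] with R hR
    rw [min_eq_left (hR0.trans (Nat.cast_le.mpr hR))]

/-- The bounded case applied to `min V R`, followed by monotone convergence in `R`. Integrability of
`V` is not needed. -/
lemma IsCoevolvingSystem.lintegral_mul_inv_degree_le [IsProbabilityMeasure P] {N : ℕ}
    {Z : Fin N → ℕ → Ω → EuclideanSpace ℝ (Fin d)} {A : Fin N → Fin N → ℕ → Ω → Bool}
    (h : IsCoevolvingSystem P γ B0 B ξ N Z A) (hB : IsInteractionPair B0 B) (s : ℕ) (i : Fin N)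
    {V : Ω → ℝ} (hV : Measurable[history Z A (s + 1) s] V) (h0 : ∀ ω, 0 ≤ V ω) :
    ∫⁻ ω, ENNReal.ofReal (V ω * (∑ j, link A s i j ω)⁻¹) ∂P ≤ ENNReal.ofReal 6 *
      ∫⁻ ω, ENNReal.ofReal
        (V ω * (1 + ∑ j ∈ Finset.univ.erase i, linkProb B0 B Z A s i j ω)⁻¹) ∂P := by
  have hle := history_le h.measurable_opinion h.measurable_edge (s + 1) s
  set D : Ω → ℝ := fun ω => ∑ j, link A s i j ω with hD
  set m : Ω → ℝ := fun ω => 1 + ∑ j ∈ Finset.univ.erase i, linkProb B0 B Z A s i j ω with hm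
  have hm1 : ∀ ω, 1 ≤ m ω := fun ω => le_add_of_nonneg_right
    (Finset.sum_nonneg fun j _ => (linkProb_mem hB s i j ω).1)
  have hmm : Measurable m := (measurable_const.add (Finset.measurable_fun_sum _ fun j _ =>
    measurable_linkProb hB s i j)).mono hle le_rfl
  have hDm : Measurable D := Finset.measurable_fun_sum _ fun j _ => h.measurable_link s i j
  have hD0 : ∀ ω, 0 ≤ D ω := fun ω => Finset.sum_nonneg fun j _ => (link_mem s i j ω).1
  refine le_of_tendsto' (tendsto_lintegral_min_mul (hV.mono hle le_rfl) hDm.inv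
    fun ω => inv_nonneg.mpr (hD0 ω)) fun R => ?_
  have hVR : Measurable[history Z A (s + 1) s] fun ω => min (V ω) R := hV.min measurable_const
  have hVR0 : ∀ ω, 0 ≤ min (V ω) R := fun ω => le_min (h0 ω) (Nat.cast_nonneg R)
  have key := h.integral_mul_inv_degree_le hB s i hVR hVR0 fun ω => min_le_right _ _
  have hint : ∀ {w : Ω → ℝ}, Measurable w → (∀ᵐ ω ∂P, 0 ≤ w ω ∧ w ω ≤ 1) →
      Integrable (fun ω => min (V ω) R * w ω) P := by
    intro w hw hw1
    refine Integrable.of_bound ((hVR.mono hle le_rfl).mul hw).aestronglyMeasurable R ?_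
    filter_upwards [hw1] with ω hω
    rw [Real.norm_of_nonneg (mul_nonneg (hVR0 ω) hω.1)]
    exact (mul_le_of_le_one_right (hVR0 ω) hω.2).trans (min_le_right _ _)
  have i1 := hint hDm.inv (by
    filter_upwards [h.ae_degree s i] with ω hω
    refine ⟨inv_nonneg.mpr (hD0 ω), inv_le_one_of_one_le₀ ?_⟩
    simp only [hD, hω]
    exact le_add_of_nonneg_right (Finset.sum_nonneg fun j _ => (link_mem s i j ω).1))
  have i2 := hint hmm.inv (Eventually.of_forall fun ω =>
    ⟨inv_nonneg.mpr (zero_le_one.trans (hm1 ω)), inv_le_one_of_one_le₀ (hm1 ω)⟩)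
  simp only [Pi.inv_apply] at i1 i2
  change ∫⁻ ω, ENNReal.ofReal (min (V ω) R * (D ω)⁻¹) ∂P ≤ _
  rw [← ofReal_integral_eq_lintegral_ofReal i1 (Eventually.of_forall fun ω =>
    mul_nonneg (hVR0 ω) (inv_nonneg.mpr (hD0 ω)))]
  refine (ENNReal.ofReal_le_ofReal key).trans ?_
  rw [ENNReal.ofReal_mul (by norm_num), ofReal_integral_eq_lintegral_ofReal i2
    (Eventually.of_forall fun ω => mul_nonneg (hVR0 ω)
      (inv_nonneg.mpr (zero_le_one.trans (hm1 ω))))]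
  gcongr with ω
  · exact inv_nonneg.mpr (zero_le_one.trans (hm1 ω))
  · exact min_le_left _ _

/-- Jensen's inequality for `exp` with weights `1 / degree`. The sum is then enlarged from the
neighbours to all agents, so that the new edges survive only in the degree. -/
lemma exp_norm_neighborAverage_le {N : ℕ} (z : Fin N → EuclideanSpace ℝ (Fin d))
    (a : Fin N → Fin N → Bool) (i : Fin N) (hi : a i i = true) {C : ℝ} (hC : 0 ≤ C) :
    Real.exp (C * ‖neighborAverage z a i‖) ≤
      (∑ j, Real.exp (C * ‖z j‖)) * (∑ j, if a i j then (1 : ℝ) else 0)⁻¹ := by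
  set D := ∑ j, if a i j then (1 : ℝ) else 0 with hD
  have hD1 : 1 ≤ D := by
    refine le_trans ?_ (Finset.single_le_sum (f := fun j => if a i j then (1 : ℝ) else 0)
      (fun j _ => by positivity) (Finset.mem_univ i))
    simp [hi]
  have hD0 : 0 < D := by linarith
  set w : Fin N → ℝ := fun j => D⁻¹ * if a i j then (1 : ℝ) else 0 with hw
  have hw0 : ∀ j, 0 ≤ w j := fun j => by positivity
  have hw1 : ∑ j, w j = 1 := by
    rw [← Finset.mul_sum, inv_mul_cancel₀ hD0.ne']
  have h1 : C * ‖neighborAverage z a i‖ ≤ ∑ j, w j • (C * ‖z j‖) := by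
    unfold neighborAverage
    rw [norm_smul, norm_inv, Real.norm_of_nonneg (by rw [← hD]; exact hD0.le), ← hD]
    calc C * (D⁻¹ * ‖∑ j, if a i j = true then z j else 0‖)
        ≤ C * (D⁻¹ * ∑ j, ‖if a i j = true then z j else 0‖) := by
          gcongr
          exact norm_sum_le _ _
      _ = ∑ j, w j • (C * ‖z j‖) := by
          rw [Finset.mul_sum, Finset.mul_sum]
          refine Finset.sum_congr rfl fun j _ => ?_
          simp only [hw, smul_eq_mul]
          split_ifs
          · ring
          · simp
  refine (Real.exp_le_exp.mpr h1).trans ((convexOn_exp.map_sum_le (fun j _ => hw0 j) hw1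
    fun j _ => Set.mem_univ _).trans ?_)
  rw [Finset.sum_mul]
  refine Finset.sum_le_sum fun j _ => ?_
  rw [smul_eq_mul, mul_comm]
  refine mul_le_mul_of_nonneg_left ?_ (Real.exp_pos _).le
  simp only [hw]
  split_ifs
  · simp
  · simpa using hD0.le

/-- Put `y i = exp (C' * x i)` and `S = ∑ y i`. The factorised bound gives denominators of at least
`min 1 c * (y i)⁻¹ * ∑ (y j)⁻¹`, and Cauchy–Schwarz gives `∑ (y j)⁻¹ ≥ N ^ 2 / S`. The sum is thus
at most `(min 1 c)⁻¹ * S ^ 3 / N ^ 2`, and `S ^ 3 / N ^ 2 ≤ ∑ y i ^ 3` by the power mean inequality.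
The powers of `N` cancel, which is the point. -/
lemma sum_mul_inv_le_sum_exp {N : ℕ} {x : Fin N → ℝ} (hx : ∀ i, 0 ≤ x i) {c b C C' : ℝ}
    (hc : 0 < c) (hb : b ≤ C') (hC : C ≤ C') (hC'0 : 0 ≤ C') {p : Fin N → Fin N → ℝ}
    (hp : ∀ i j, c * Real.exp (-(b * x i)) * Real.exp (-(b * x j)) ≤ p i j) :
    ∑ i, (∑ j, Real.exp (C * x j)) * (1 + ∑ j ∈ Finset.univ.erase i, p i j)⁻¹ ≤
      (min 1 c)⁻¹ * ∑ i, Real.exp (3 * C' * x i) := by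
  rcases Nat.eq_zero_or_pos N with hN | hN
  · subst hN; simp
  have hN' : (0 : ℝ) < N := Nat.cast_pos.mpr hN
  set y : Fin N → ℝ := fun i => Real.exp (C' * x i) with hy
  have hy0 : ∀ i, 0 < y i := fun i => Real.exp_pos _
  set c' := min 1 c with hc'
  have hc'0 : 0 < c' := lt_min one_pos hc
  set S := ∑ i, y i with hS
  have hne : (Finset.univ : Finset (Fin N)).Nonempty := ⟨⟨0, hN⟩, Finset.mem_univ _⟩
  have hS0 : 0 < S := Finset.sum_pos (fun i _ => hy0 i) hne
  have hyb : ∀ i, (y i)⁻¹ ≤ Real.exp (-(b * x i)) := fun i => by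
    rw [hy]; simp only
    rw [← Real.exp_neg]
    exact Real.exp_le_exp.mpr (neg_le_neg (mul_le_mul_of_nonneg_right hb (hx i)))
  have hyb' : ∀ i j, c' * (y i)⁻¹ * (y j)⁻¹ ≤ c * Real.exp (-(b * x i)) * Real.exp (-(b * x j)) :=
    fun i j => by
      have h1 := hyb i
      have h2 := hyb j
      have h3 : c' ≤ c := min_le_right _ _
      have h4 := (inv_pos.mpr (hy0 i)).le
      have h5 := (inv_pos.mpr (hy0 j)).le
      gcongr
  have hy1 : ∀ i, (y i)⁻¹ ≤ 1 := fun i => by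
    refine inv_le_one_of_one_le₀ ?_
    rw [hy]; simp only
    exact Real.one_le_exp (mul_nonneg hC'0 (hx i))
  -- The term `j = i` is compared with the one contributed by the loop; this is why `c` is replaced
  -- by `min 1 c`.
  have hm : ∀ i, c' * (y i)⁻¹ * ∑ j, (y j)⁻¹ ≤ 1 + ∑ j ∈ Finset.univ.erase i, p i j := by
    intro i
    rw [← Finset.add_sum_erase _ _ (Finset.mem_univ i), mul_add, Finset.mul_sum]
    refine add_le_add ?_ (Finset.sum_le_sum fun j _ => (hyb' i j).trans (hp i j))
    have h1 : c' ≤ 1 := min_le_left _ _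
    have h4 := (inv_pos.mpr (hy0 i)).le
    calc c' * (y i)⁻¹ * (y i)⁻¹ ≤ 1 * 1 * 1 := by
          have := hy1 i
          gcongr
      _ = 1 := by norm_num
  have hcs : (N : ℝ) ^ 2 ≤ S * ∑ j, (y j)⁻¹ := by
    have := Finset.sum_sq_le_sum_mul_sum_of_sq_le_mul (Finset.univ : Finset (Fin N))
      (r := fun _ => (1 : ℝ)) (f := y) (g := fun j => (y j)⁻¹) (fun i _ => (hy0 i).le)
      (fun i _ => (inv_pos.mpr (hy0 i)).le) fun i _ => by
        rw [mul_inv_cancel₀ (hy0 i).ne', one_pow]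
    simpa using this
  have hminv : ∀ i, (1 + ∑ j ∈ Finset.univ.erase i, p i j)⁻¹ ≤ c'⁻¹ * y i * (S / N ^ 2) := by
    intro i
    have hT : 0 < ∑ j, (y j)⁻¹ := Finset.sum_pos (fun i _ => inv_pos.mpr (hy0 i)) hne
    have h1 : 0 < c' * (y i)⁻¹ * ∑ j, (y j)⁻¹ :=
      mul_pos (mul_pos hc'0 (inv_pos.mpr (hy0 i))) hT
    refine (inv_anti₀ h1 (hm i)).trans ?_
    rw [mul_inv, mul_inv, inv_inv]
    have h2 := mul_pos (inv_pos.mpr hc'0) (hy0 i)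
    refine mul_le_mul_of_nonneg_left ?_ h2.le
    rw [inv_le_iff_one_le_mul₀ hT, div_mul_eq_mul_div, one_le_div (by positivity)]
    exact hcs
  have hW : ∑ j, Real.exp (C * x j) ≤ S := Finset.sum_le_sum fun j _ =>
    Real.exp_le_exp.mpr (mul_le_mul_of_nonneg_right hC (hx j))
  calc ∑ i, (∑ j, Real.exp (C * x j)) * (1 + ∑ j ∈ Finset.univ.erase i, p i j)⁻¹
      ≤ ∑ i, S * (c'⁻¹ * y i * (S / N ^ 2)) := by
        refine Finset.sum_le_sum fun i _ => ?_
        refine (mul_le_mul_of_nonneg_left (hminv i)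
          (Finset.sum_nonneg fun j _ => (Real.exp_pos _).le)).trans ?_
        refine mul_le_mul_of_nonneg_right hW ?_
        have := hy0 i
        positivity
    _ = c'⁻¹ * (S ^ 3 / N ^ 2) := by
        rw [← Finset.mul_sum, ← Finset.sum_mul, ← Finset.mul_sum, ← hS]
        ring
    _ ≤ c'⁻¹ * ∑ i, y i ^ 3 := by
        have h1 := pow_sum_div_card_le_sum_pow (s := (Finset.univ : Finset (Fin N))) (f := y)
          (fun i _ => (hy0 i).le) 2
        rw [Finset.card_univ, Fintype.card_fin] at h1
        exact mul_le_mul_of_nonneg_left h1 (inv_pos.mpr hc'0).le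
    _ = _ := by
        congr 1
        refine Finset.sum_congr rfl fun i _ => ?_
        rw [hy]; simp only
        rw [← Real.exp_nat_mul]
        congr 1
        push_cast
        ring

/-- All exponential moments of the opinions at time `s`, averaged over the agents, are bounded. -/
def HasAvgExpMoments (P : Measure Ω) (Z : (n : ℕ) → Fin n → ℕ → Ω → EuclideanSpace ℝ (Fin d))
    (s : ℕ) : Prop :=
  ∀ C : ℝ, ∃ K : ENNReal, K < ⊤ ∧ ∀ᶠ n in atTop,
    ∑ i : Fin (n + 1), ∫⁻ ω, ENNReal.ofReal (Real.exp (C * ‖Z (n + 1) i s ω‖)) ∂P ≤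
      (n + 1 : ℕ) * K

/-- The exponential moments of the local averages are controlled by those of the opinions. -/
def LocalAverageControl (P : Measure Ω) (Z : (n : ℕ) → Fin n → ℕ → Ω → EuclideanSpace ℝ (Fin d))
    (A : (n : ℕ) → Fin n → Fin n → ℕ → Ω → Bool) (s : ℕ) : Prop :=
  ∀ C : ℝ, 0 ≤ C → ∃ (C' : ℝ) (K : ENNReal), K < ⊤ ∧ ∀ n,
    ∑ i : Fin n, ∫⁻ ω, ENNReal.ofReal (Real.exp (C * ‖neighborAverage (fun j => Z n j s ω)
      (fun j l => A n j l s ω) i‖)) ∂P ≤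
      K * ∑ i : Fin n, ∫⁻ ω, ENNReal.ofReal (Real.exp (C' * ‖Z n i s ω‖)) ∂P

variable {Z : (n : ℕ) → Fin n → ℕ → Ω → EuclideanSpace ℝ (Fin d)}
  {A : (n : ℕ) → Fin n → Fin n → ℕ → Ω → Bool} [IsProbabilityMeasure P]

lemma measurable_exp_norm {Y : Ω → EuclideanSpace ℝ (Fin d)} (hY : Measurable Y) (C : ℝ) :
    Measurable fun ω => ENNReal.ofReal (Real.exp (C * ‖Y ω‖)) :=
  (Real.measurable_exp.comp (hY.norm.const_mul C)).ennreal_ofReal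

/-- Jensen's inequality, the mean inverse degree and the deterministic bound
`sum_mul_inv_le_sum_exp` are combined; the last one is applied pointwise, after the sum over agents
has been moved inside the integral. -/
lemma localAverageControl_of_atMostExponentialDecay (hB : IsInteractionPair B0 B)
    (hdec : AtMostExponentialDecay B0 B)
    (hsys : ∀ n, IsCoevolvingSystem P γ B0 B ξ n (Z n) (A n)) (s : ℕ) :
    LocalAverageControl P Z A s := by
  intro C hC
  obtain ⟨b, hb, c, hc, hp⟩ := hdec.linkProb_ge (Ω := Ω)
  refine ⟨3 * max b C, ENNReal.ofReal 6 * ENNReal.ofReal (min 1 c)⁻¹,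
    ENNReal.mul_lt_top ENNReal.ofReal_lt_top ENNReal.ofReal_lt_top, fun n => ?_⟩
  have hmZ : ∀ j, Measurable[history (Z n) (A n) (s + 1) s] (Z n j s) := fun j =>
    measurable_opinion_history (Nat.lt_succ_self s) j
  have hle := history_le (hsys n).measurable_opinion (hsys n).measurable_edge (s + 1) s
  set W : Ω → ℝ := fun ω => ∑ j, Real.exp (C * ‖Z n j s ω‖) with hW
  have hWm : Measurable[history (Z n) (A n) (s + 1) s] W :=
    Finset.measurable_fun_sum _ fun j _ =>
      Real.measurable_exp.comp ((measurable_norm.comp (hmZ j)).const_mul C)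
  have hW0 : ∀ ω, 0 ≤ W ω := fun ω => Finset.sum_nonneg fun j _ => (Real.exp_pos _).le
  have hm0 : ∀ i ω, 0 ≤ (1 + ∑ j ∈ Finset.univ.erase i,
      linkProb B0 B (Z n) (A n) s i j ω)⁻¹ := fun i ω => inv_nonneg.mpr
    (add_nonneg zero_le_one (Finset.sum_nonneg fun j _ => (linkProb_mem hB s i j ω).1))
  have hmm : ∀ i, Measurable fun ω => (1 + ∑ j ∈ Finset.univ.erase i,
      linkProb B0 B (Z n) (A n) s i j ω)⁻¹ := fun i =>
    (measurable_const.add (Finset.measurable_fun_sum _ fun j _ =>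
      (measurable_linkProb hB s i j).mono hle le_rfl)).inv
  calc ∑ i : Fin n, ∫⁻ ω, ENNReal.ofReal (Real.exp (C * ‖neighborAverage (fun j => Z n j s ω)
      (fun j l => A n j l s ω) i‖)) ∂P
      ≤ ∑ i : Fin n, ENNReal.ofReal 6 * ∫⁻ ω, ENNReal.ofReal (W ω *
        (1 + ∑ j ∈ Finset.univ.erase i, linkProb B0 B (Z n) (A n) s i j ω)⁻¹) ∂P := by
        refine Finset.sum_le_sum fun i _ => ?_
        refine le_trans (lintegral_mono_ae ?_)
          ((hsys n).lintegral_mul_inv_degree_le hB s i hWm hW0)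
        filter_upwards [(hsys n).diag i s] with ω hω
        exact ENNReal.ofReal_le_ofReal (exp_norm_neighborAverage_le _ _ i hω hC)
    _ = ENNReal.ofReal 6 * ∫⁻ ω, ENNReal.ofReal (∑ i, W ω *
        (1 + ∑ j ∈ Finset.univ.erase i, linkProb B0 B (Z n) (A n) s i j ω)⁻¹) ∂P := by
        have hWmm : ∀ i, Measurable fun ω => ENNReal.ofReal (W ω *
            (1 + ∑ j ∈ Finset.univ.erase i, linkProb B0 B (Z n) (A n) s i j ω)⁻¹) :=
          fun i => ((hWm.mono hle le_rfl).mul (hmm i)).ennreal_ofReal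
        rw [← Finset.mul_sum, ← lintegral_finsetSum _ fun i _ => hWmm i]
        congr 1
        refine lintegral_congr fun ω => ?_
        rw [ENNReal.ofReal_sum_of_nonneg fun i _ => mul_nonneg (hW0 ω) (hm0 i ω)]
    _ ≤ ENNReal.ofReal 6 * ∫⁻ ω, ENNReal.ofReal (min 1 c)⁻¹ *
        ∑ i, ENNReal.ofReal (Real.exp (3 * max b C * ‖Z n i s ω‖)) ∂P := by
        gcongr with ω
        rw [← ENNReal.ofReal_sum_of_nonneg fun i _ => (Real.exp_pos _).le,
          ← ENNReal.ofReal_mul (inv_nonneg.mpr (le_min zero_le_one hc.le))]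
        exact ENNReal.ofReal_le_ofReal (sum_mul_inv_le_sum_exp (fun i => norm_nonneg _) hc
          (le_max_left b C) (le_max_right b C) (hb.le.trans (le_max_left b C))
          fun i j => hp n (Z n) (A n) s i j ω)
    _ = _ := by
        rw [lintegral_const_mul _ (Finset.measurable_fun_sum _ fun i _ =>
          measurable_exp_norm ((hsys n).measurable_opinion i s) _), lintegral_finsetSum _
          fun i _ => measurable_exp_norm ((hsys n).measurable_opinion i s) _, mul_assoc]

/-- Linked agents are within the range of interaction. -/
lemma IsCoevolvingSystem.ae_link_le {N : ℕ}
    {Z : Fin N → ℕ → Ω → EuclideanSpace ℝ (Fin d)} {A : Fin N → Fin N → ℕ → Ω → Bool}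
    (h : IsCoevolvingSystem P γ B0 B ξ N Z A) {b : ℝ} (hb : 0 < b)
    (hzero : ∀ x y, b < ‖x - y‖ → B0 x y = 0 ∧ ∀ a, B a x y = 0) (s : ℕ) (i j : Fin N) :
    ∀ᵐ ω ∂P, A i j s ω = true → ‖Z j s ω - Z i s ω‖ ≤ b := by
  rcases eq_or_ne i j with hij | hij
  · subst hij
    exact Eventually.of_forall fun ω _ => by simpa using hb.le
  have hmZ : ∀ j, Measurable[history Z A (s + 1) s] (Z j s) := fun j =>
    measurable_opinion_history (Nat.lt_succ_self s) j
  have hset : MeasurableSet[history Z A (s + 1) s] {ω | b < ‖Z i s ω - Z j s ω‖} :=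
    (measurable_norm.comp ((hmZ i).sub (hmZ j))) measurableSet_Ioi
  -- The event that the two opinions are out of range is known before the edges are drawn, and there
  -- the conditional probability of a link is zero.
  set V : Ω → ℝ := {ω | b < ‖Z i s ω - Z j s ω‖}.indicator fun _ => 1 with hV
  have hV01 : ∀ ω, V ω ∈ Set.Icc (0 : ℝ) 1 := fun ω => by
    rw [hV]; unfold Set.indicator; split_ifs <;> simp
  have hVm : Measurable[history Z A (s + 1) s] V :=
    (@measurable_const _ _ _ (history Z A (s + 1) s) _).indicator hset
  have hle := history_le h.measurable_opinion h.measurable_edge (s + 1) s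
  have h1 := h.integral_mul_link hij s hVm (C := 1) fun ω => by
    rw [abs_of_nonneg (hV01 ω).1]; exact (hV01 ω).2
  have h2 : ∀ ω, V ω * linkProb B0 B Z A s i j ω = 0 := by
    intro ω
    by_cases hω : b < ‖Z i s ω - Z j s ω‖
    · have : linkProb B0 B Z A s i j ω = 0 := by
        unfold linkProb
        cases s with
        | zero => exact (hzero _ _ hω).1
        | succ s => exact (hzero _ _ hω).2 _
      rw [this, mul_zero]
    · have : V ω = 0 :=
        Set.indicator_of_notMem (s := {ω | b < ‖Z i s ω - Z j s ω‖}) hω _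
      rw [this, zero_mul]
  simp only [h2, integral_zero] at h1
  have h3 : Integrable (fun ω => V ω * link A s i j ω) P := by
    refine Integrable.of_bound ((hVm.mono hle le_rfl).mul
      (h.measurable_link s i j)).aestronglyMeasurable 1 (Eventually.of_forall fun ω => ?_)
    rw [Real.norm_of_nonneg (mul_nonneg (hV01 ω).1 (link_mem s i j ω).1)]
    exact mul_le_one₀ (hV01 ω).2 (link_mem s i j ω).1 (link_mem s i j ω).2
  rw [integral_eq_zero_iff_of_nonneg (fun ω => mul_nonneg (hV01 ω).1 (link_mem s i j ω).1) h3]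
    at h1
  filter_upwards [h1] with ω hω hA
  by_contra! hcon
  rw [norm_sub_rev] at hcon
  have h4 : V ω = 1 := Set.indicator_of_mem (s := {ω | b < ‖Z i s ω - Z j s ω‖}) hcon _
  simp only [h4, link, hA, Pi.zero_apply] at hω
  norm_num at hω

/-- The local average differs from `z i` by an average of the displacements `z j - z i` over the
neighbours. -/
lemma norm_neighborAverage_le_add {N : ℕ} (z : Fin N → EuclideanSpace ℝ (Fin d))
    (a : Fin N → Fin N → Bool) (i : Fin N) (hi : a i i = true) {b : ℝ}
    (hb : ∀ j, a i j = true → ‖z j - z i‖ ≤ b) : ‖neighborAverage z a i‖ ≤ ‖z i‖ + b := by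
  set D := ∑ j, if a i j then (1 : ℝ) else 0 with hD
  have hD1 : 1 ≤ D := by
    refine le_trans ?_ (Finset.single_le_sum (f := fun j => if a i j then (1 : ℝ) else 0)
      (fun j _ => by positivity) (Finset.mem_univ i))
    simp [hi]
  have hD0 : 0 < D := by linarith
  have h1 : neighborAverage z a i = z i + D⁻¹ • ∑ j, if a i j then z j - z i else 0 := by
    have h2 : ∑ j, (if a i j then z j else 0) =
        D • z i + ∑ j, if a i j then z j - z i else 0 := by
      rw [hD, Finset.sum_smul, ← Finset.sum_add_distrib]
      refine Finset.sum_congr rfl fun j _ => ?_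
      split_ifs <;> simp
    unfold neighborAverage
    rw [← hD, h2, smul_add, inv_smul_smul₀ hD0.ne']
  rw [h1]
  refine (norm_add_le _ _).trans (add_le_add le_rfl ?_)
  rw [norm_smul, norm_inv, Real.norm_of_nonneg hD0.le, inv_mul_le_iff₀ hD0]
  refine (norm_sum_le _ _).trans ?_
  rw [hD, Finset.sum_mul]
  refine Finset.sum_le_sum fun j _ => ?_
  split_ifs with h
  · simpa using hb j h
  · simp

lemma localAverageControl_of_finiteRange (hfin : FiniteRange B0 B)
    (hsys : ∀ n, IsCoevolvingSystem P γ B0 B ξ n (Z n) (A n)) (s : ℕ) :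
    LocalAverageControl P Z A s := by
  intro C hC
  obtain ⟨⟨b, hb, hzero⟩, -⟩ := hfin
  refine ⟨C, ENNReal.ofReal (Real.exp (C * b)), ENNReal.ofReal_lt_top, fun n => ?_⟩
  rw [Finset.mul_sum]
  refine Finset.sum_le_sum fun i _ => ?_
  rw [← lintegral_const_mul _ (measurable_exp_norm ((hsys n).measurable_opinion i s) _)]
  refine lintegral_mono_ae ?_
  filter_upwards [(hsys n).diag i s,
    ae_all_iff.mpr fun j => (hsys n).ae_link_le hb hzero s i j] with ω h1 h2
  rw [← ENNReal.ofReal_mul (Real.exp_pos _).le, ← Real.exp_add]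
  refine ENNReal.ofReal_le_ofReal (Real.exp_le_exp.mpr ?_)
  have := mul_le_mul_of_nonneg_left
    (norm_neighborAverage_le_add (fun j => Z n j s ω) (fun j l => A n j l s ω) i h1 h2) hC
  linarith

end ExponentialMoments

/-! ### Propagation of exponential moments in time and to the limit -/

section MomentPropagation

variable {Ω : Type*} {d : ℕ} {γ : ℝ}
  {B0 : EuclideanSpace ℝ (Fin d) → EuclideanSpace ℝ (Fin d) → ℝ}
  {B : Bool → EuclideanSpace ℝ (Fin d) → EuclideanSpace ℝ (Fin d) → ℝ}
  {ξ : ℕ → ℕ → Ω → EuclideanSpace ℝ (Fin d)}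
  [MeasurableSpace Ω] {P : Measure Ω}
  {Z : (n : ℕ) → Fin n → ℕ → Ω → EuclideanSpace ℝ (Fin d)}
  {A : (n : ℕ) → Fin n → Fin n → ℕ → Ω → Bool}

/-- The hypothesis concerns agent `0` only; by exchangeability every agent has the same initial
moment. -/
lemma HasExponentialMoments.hasAvgExpMoments_zero (h : HasExponentialMoments P ξ Z)
    (hZ : ∀ n i, Measurable (Z n i 0))
    (hex : ∀ (n : ℕ) (σ : Equiv.Perm (Fin n)),
      P.map (fun ω i => Z n (σ i) 0 ω) = P.map (fun ω i => Z n i 0 ω)) :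
    HasAvgExpMoments P Z 0 := by
  intro C
  obtain ⟨K, hK1, hK2⟩ := exists_between (h.initial C)
  refine ⟨K, hK2, ?_⟩
  filter_upwards [eventually_lt_of_limsup_lt hK1] with n hn
  have h1 : ∀ i : Fin (n + 1), ∫⁻ ω, ENNReal.ofReal (Real.exp (C * ‖Z (n + 1) i 0 ω‖)) ∂P =
      ∫⁻ ω, ENNReal.ofReal (Real.exp (C * ‖Z (n + 1) 0 0 ω‖)) ∂P := by
    intro i
    have hg : Measurable fun x : Fin (n + 1) → EuclideanSpace ℝ (Fin d) =>
        ENNReal.ofReal (Real.exp (C * ‖x 0‖)) := measurable_exp_norm (measurable_pi_apply 0) C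
    have hm : ∀ σ : Equiv.Perm (Fin (n + 1)), Measurable fun ω i => Z (n + 1) (σ i) 0 ω :=
      fun σ => measurable_pi_lambda _ fun j => hZ _ _
    have h2 := congrArg (fun μ => ∫⁻ x, ENNReal.ofReal (Real.exp (C * ‖x 0‖)) ∂μ)
      (hex (n + 1) (Equiv.swap 0 i))
    rw [lintegral_map hg (hm _), lintegral_map hg (show Measurable fun ω i => Z (n + 1) i 0 ω from hm 1)] at h2
    simpa using h2
  rw [Finset.sum_congr rfl fun i _ => h1 i, Finset.sum_const, Finset.card_univ, Fintype.card_fin,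
    nsmul_eq_mul]
  gcongr

/-- The sum is at most three times its largest term. Thus no independence is needed to separate
opinion, local average and noise; only the exponent grows. -/
lemma ofReal_exp_mul_add_add_le {C : ℝ} (hC : 0 ≤ C) (a b c : ℝ) :
    ENNReal.ofReal (Real.exp (C * (a + b + c))) ≤ ENNReal.ofReal (Real.exp (3 * C * a)) +
      ENNReal.ofReal (Real.exp (3 * C * b)) + ENNReal.ofReal (Real.exp (3 * C * c)) := by
  rw [← ENNReal.ofReal_add (Real.exp_pos _).le (Real.exp_pos _).le,
    ← ENNReal.ofReal_add (add_pos (Real.exp_pos _) (Real.exp_pos _)).le (Real.exp_pos _).le]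
  refine ENNReal.ofReal_le_ofReal ?_
  have ha := Real.exp_pos (3 * C * a)
  have hb := Real.exp_pos (3 * C * b)
  have hc := Real.exp_pos (3 * C * c)
  have key : ∀ x, a ≤ x → b ≤ x → c ≤ x →
      Real.exp (C * (a + b + c)) ≤ Real.exp (3 * C * x) := fun x h1 h2 h3 => by
    refine Real.exp_le_exp.mpr ?_
    have := mul_le_mul_of_nonneg_left (show a + b + c ≤ 3 * x by linarith) hC
    linarith
  rcases le_total a b with h1 | h1 <;> rcases le_total b c with h2 | h2 <;>
    rcases le_total a c with h3 | h3 <;>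
    first
      | linarith [key a le_rfl (by linarith) (by linarith)]
      | linarith [key b (by linarith) le_rfl (by linarith)]
      | linarith [key c (by linarith) (by linarith) le_rfl]

/-- The norm of the new opinion is at most the sum of the norms of the old opinion, the local
average and the noise. The growth of the exponent at each step is harmless because all exponents are
admitted. -/
lemma HasAvgExpMoments.succ (hγ0 : 0 < γ) (hγ1 : γ < 1)
    (hsys : ∀ n, IsCoevolvingSystem P γ B0 B ξ n (Z n) (A n)) (hnoise : IsSystemNoise P ξ Z A)
    (hmom : HasExponentialMoments P ξ Z) {s : ℕ} (h : HasAvgExpMoments P Z s)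
    (hL : LocalAverageControl P Z A s) : HasAvgExpMoments P Z (s + 1) := by
  intro C
  set c := |C| with hc
  have hc0 : 0 ≤ c := abs_nonneg C
  obtain ⟨C', K, hK, hL⟩ := hL (3 * c) (by positivity)
  obtain ⟨K1, hK1, h1⟩ := h (3 * c)
  obtain ⟨K2, hK2, h2⟩ := h C'
  set K3 := ∫⁻ ω, ENNReal.ofReal (Real.exp (3 * c * ‖ξ 0 0 ω‖)) ∂P with hK3
  refine ⟨K1 + K * K2 + K3, ENNReal.add_lt_top.mpr ⟨ENNReal.add_lt_top.mpr
    ⟨hK1, ENNReal.mul_lt_top hK hK2⟩, hmom.noise _⟩, ?_⟩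
  filter_upwards [h1, h2] with n h1 h2
  have hξ : ∀ i, ∫⁻ ω, ENNReal.ofReal (Real.exp (3 * c * ‖ξ i s ω‖)) ∂P = K3 := by
    intro i
    have hg : Measurable fun x : EuclideanSpace ℝ (Fin d) =>
        ENNReal.ofReal (Real.exp (3 * c * ‖x‖)) := measurable_exp_norm measurable_id _
    rw [hK3, ← lintegral_map hg (hnoise.measurable i s),
      ← lintegral_map hg (hnoise.measurable 0 0), hnoise.identDistrib]
  set N := n + 1 with hN
  set L : Fin N → Ω → EuclideanSpace ℝ (Fin d) := fun i ω =>
    neighborAverage (fun j => Z N j s ω) (fun j l => A N j l s ω) i with hLdef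
  have hLm : ∀ i, Measurable (L i) := fun i =>
    measurable_neighborAverage i (fun j => (hsys _).measurable_opinion j s)
      fun j l => (hsys _).measurable_edge j l s
  have hpt : ∀ i : Fin N, ∫⁻ ω, ENNReal.ofReal (Real.exp (C * ‖Z N i (s + 1) ω‖)) ∂P ≤
      ∫⁻ ω, ENNReal.ofReal (Real.exp (3 * c * ‖Z N i s ω‖)) ∂P +
      ∫⁻ ω, ENNReal.ofReal (Real.exp (3 * c * ‖L i ω‖)) ∂P + K3 := by
    intro i
    have hsum : Measurable fun ω => ENNReal.ofReal (Real.exp (3 * c * ‖Z N i s ω‖)) +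
        ENNReal.ofReal (Real.exp (3 * c * ‖L i ω‖)) :=
      (measurable_exp_norm ((hsys _).measurable_opinion i s) _).add
        (measurable_exp_norm (hLm i) _)
    rw [← hξ i, ← lintegral_add_left (measurable_exp_norm ((hsys _).measurable_opinion i s) _),
      ← lintegral_add_left hsum]
    refine lintegral_mono_ae ?_
    filter_upwards [(hsys N).evolve i s] with ω hω
    refine le_trans (ENNReal.ofReal_le_ofReal (Real.exp_le_exp.mpr ?_))
      (ofReal_exp_mul_add_add_le hc0 ‖Z N i s ω‖ ‖L i ω‖ ‖ξ i s ω‖)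
    refine (mul_le_mul_of_nonneg_right (le_abs_self C) (norm_nonneg _)).trans
      (mul_le_mul_of_nonneg_left ?_ hc0)
    rw [hω]
    refine (norm_add_le _ _).trans (add_le_add ((norm_add_le _ _).trans (add_le_add ?_ ?_)) le_rfl)
    · rw [norm_smul, Real.norm_of_nonneg (by linarith)]
      exact mul_le_of_le_one_left (norm_nonneg _) (by linarith)
    · rw [norm_smul, Real.norm_of_nonneg hγ0.le]
      exact mul_le_of_le_one_left (norm_nonneg _) hγ1.le
  refine (Finset.sum_le_sum fun i _ => hpt i).trans ?_
  rw [Finset.sum_add_distrib, Finset.sum_add_distrib, Finset.sum_const, Finset.card_univ,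
    Fintype.card_fin, nsmul_eq_mul, mul_add, mul_add]
  refine add_le_add (add_le_add h1 ((hL N).trans ?_)) le_rfl
  rw [mul_left_comm]
  gcongr

lemma HasAvgExpMoments.eventually_integrable {s : ℕ} (h : HasAvgExpMoments P Z s)
    (hZ : ∀ n i, Measurable (Z n i s)) (C : ℝ) : ∃ K : ℝ, ∀ᶠ n : ℕ in atTop,
      (∀ i, Integrable (fun ω => Real.exp (C * ‖Z (n + 1) i s ω‖)) P) ∧
      (avg fun i => ∫ ω, Real.exp (C * ‖Z (n + 1) i s ω‖) ∂P) ≤ K := by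
  obtain ⟨K, hK, h⟩ := h C
  refine ⟨K.toReal, ?_⟩
  filter_upwards [h] with n hn
  have htop : ((n + 1 : ℕ) : ENNReal) * K < ⊤ :=
    ENNReal.mul_lt_top (ENNReal.natCast_lt_top _) hK
  have hint : ∀ i, Integrable (fun ω => Real.exp (C * ‖Z (n + 1) i s ω‖)) P := by
    intro i
    have hm : Measurable fun ω => Real.exp (C * ‖Z (n + 1) i s ω‖) :=
      Real.measurable_exp.comp ((hZ _ i).norm.const_mul C)
    refine ⟨hm.aestronglyMeasurable, ?_⟩
    rw [hasFiniteIntegral_iff_ofReal (Eventually.of_forall fun ω => (Real.exp_pos _).le)]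
    refine lt_of_le_of_lt (le_trans ?_ hn) htop
    exact Finset.single_le_sum (f := fun i => ∫⁻ ω, ENNReal.ofReal
      (Real.exp (C * ‖Z (n + 1) i s ω‖)) ∂P) (fun _ _ => zero_le) (Finset.mem_univ i)
  refine ⟨hint, ?_⟩
  unfold avg
  rw [Fintype.card_fin, div_le_iff₀ (by positivity)]
  have h1 : ∑ i, ∫ ω, Real.exp (C * ‖Z (n + 1) i s ω‖) ∂P = (∑ i : Fin (n + 1),
      ∫⁻ ω, ENNReal.ofReal (Real.exp (C * ‖Z (n + 1) i s ω‖)) ∂P).toReal := by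
    rw [ENNReal.toReal_sum]
    · refine Finset.sum_congr rfl fun i _ => ?_
      rw [integral_eq_lintegral_of_nonneg_ae (Eventually.of_forall fun ω => (Real.exp_pos _).le)
        (hint i).1]
    · intro i _
      have := (hint i).2
      rw [hasFiniteIntegral_iff_ofReal (Eventually.of_forall fun ω => (Real.exp_pos _).le)] at this
      exact this.ne
  rw [h1]
  refine (ENNReal.toReal_mono htop.ne hn).trans ?_
  rw [ENNReal.toReal_mul, ENNReal.toReal_natCast, mul_comm]

/-- Truncated at level `R`, the exponential is a bounded continuous test function, so the bound `K`
of the finite systems passes to the limit for every `R`; monotone convergence removes the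
truncation. -/
lemma SampleTendsto.integrable_exp [IsProbabilityMeasure P] {Ω' : Type*} [MeasurableSpace Ω'] {P' : Measure Ω'}
    [IsProbabilityMeasure P'] {k q s : ℕ} {Z' : Fin k → ℕ → Ω' → EuclideanSpace ℝ (Fin d)}
    {A' : Fin k → Fin k → ℕ → Ω' → Bool} (hZ' : ∀ i s, Measurable (Z' i s))
    (hA' : ∀ i j s, Measurable (A' i j s))
    (hsys : ∀ n, IsCoevolvingSystem P γ B0 B ξ n (Z n) (A n))
    (h : SampleTendsto P Z A (s + 1) q k (P'.map (procState (s + 1) q Z' A')))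
    (hmom : HasAvgExpMoments P Z s) (C : ℝ) (i : Fin k) :
    Integrable (fun ω => Real.exp (C * ‖Z' i s ω‖)) P' := by
  have hY : Measurable (procState (s + 1) q Z' A') :=
    measurable_procState (fun i r _ => hZ' i r) fun i j r _ => hA' i j r
  obtain ⟨K, hK⟩ := hmom.eventually_integrable (fun n i => (hsys n).measurable_opinion i s) C
  have hm : Measurable fun ω => Real.exp (C * ‖Z' i s ω‖) :=
    Real.measurable_exp.comp ((hZ' i s).norm.const_mul C)
  have happ : ∀ ω, (procState (s + 1) q Z' A' ω).1 i s = Z' i s ω := fun ω =>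
    cutTraj_apply_of_lt (Nat.lt_succ_self s) fun r => Z' i r ω
  have happ' : ∀ n (m : Fin k → Fin (n + 1)) ω,
      (sampleState Z A (s + 1) q k n m ω).1 i s = Z (n + 1) (m i) s ω := fun n m ω =>
    cutTraj_apply_of_lt (Nat.lt_succ_self s) fun r => Z (n + 1) (m i) r ω
  have hbound : ∀ R : ℕ, ∫ ω, min (Real.exp (C * ‖Z' i s ω‖)) R ∂P' ≤ K := by
    intro R
    have hcont : Continuous fun x : TrajState k d => min (Real.exp (C * ‖x.1 i s‖)) (R : ℝ) := by
      fun_prop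
    have h1 := h.tendsto_avg hY hsys hcont.measurable (C := R) (fun x => by
      rw [abs_of_nonneg (le_min (Real.exp_pos _).le (Nat.cast_nonneg R))]
      exact min_le_right _ _) (Eventually.of_forall fun ω => hcont.continuousAt)
    simp only [happ, happ'] at h1
    refine le_of_tendsto h1 ?_
    filter_upwards [hK] with n hn
    rw [avg_eval i fun j => ∫ ω, min (Real.exp (C * ‖Z (n + 1) j s ω‖)) (R : ℝ) ∂P]
    refine (avg_mono fun j => ?_).trans hn.2
    have hmj : Measurable fun ω => Real.exp (C * ‖Z (n + 1) j s ω‖) :=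
      Real.measurable_exp.comp (((hsys _).measurable_opinion j s).norm.const_mul C)
    refine integral_mono ?_ (hn.1 j) fun ω => min_le_left _ _
    refine (hn.1 j).mono (hmj.min measurable_const).aestronglyMeasurable
      (Eventually.of_forall fun ω => ?_)
    rw [Real.norm_of_nonneg (le_min (Real.exp_pos _).le (Nat.cast_nonneg R)),
      Real.norm_of_nonneg (Real.exp_pos _).le]
    exact min_le_left _ _
  refine ⟨hm.aestronglyMeasurable, ?_⟩
  rw [hasFiniteIntegral_iff_ofReal (Eventually.of_forall fun ω => (Real.exp_pos _).le)]
  have h2 := tendsto_lintegral_min_mul (P := P') hm (w := fun _ => 1) measurable_const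
    fun _ => zero_le_one
  simp only [mul_one] at h2
  refine lt_of_le_of_lt (le_of_tendsto' h2 fun R => ?_) (ENNReal.ofReal_lt_top (r := K))
  rw [← ofReal_integral_eq_lintegral_ofReal]
  · exact ENNReal.ofReal_le_ofReal (hbound R)
  · refine Integrable.of_bound (hm.min measurable_const).aestronglyMeasurable R
      (Eventually.of_forall fun ω => ?_)
    rw [Real.norm_of_nonneg (le_min (Real.exp_pos _).le (Nat.cast_nonneg R))]
    exact min_le_right _ _
  · exact Eventually.of_forall fun ω => le_min (Real.exp_pos _).le (Nat.cast_nonneg R)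

end MomentPropagation

/-! ### Positivity of the mean-field denominator -/

section Positivity

variable {d : ℕ}
  {B0 : EuclideanSpace ℝ (Fin d) → EuclideanSpace ℝ (Fin d) → ℝ}
  {B : Bool → EuclideanSpace ℝ (Fin d) → EuclideanSpace ℝ (Fin d) → ℝ}

/-- Each `B_s` with `s > 0` is a convex combination of two positive numbers. -/
lemma trajProb_pos (hB : IsInteractionPair B0 B) {z w : ℕ → EuclideanSpace ℝ (Fin d)}
    (h0 : 0 < B0 (z 0) (w 0)) (h1 : ∀ a r, 0 < B a (z r) (w r)) (s : ℕ) :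
    0 < trajProb B0 B s z w := by
  cases s with
  | zero => exact h0
  | succ s =>
    obtain ⟨h2, h3⟩ := trajProb_mem hB s z w
    have h4 := h1 true (s + 1)
    have h5 := h1 false (s + 1)
    simp only [trajProb]
    rcases h2.eq_or_lt with h | h
    · rw [← h]; simpa using h5
    · exact add_pos_of_pos_of_nonneg (mul_pos h h4) (mul_nonneg (by linarith) h5.le)

/-- The mean-field denominator is almost surely positive. -/
lemma ae_meanFieldMass_pos (hB : IsInteractionPair B0 B)
    (hrange : AtMostExponentialDecay B0 B ∨ FiniteRange B0 B) (s : ℕ)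
    (μ : Measure (ℕ → EuclideanSpace ℝ (Fin d))) [IsProbabilityMeasure μ] :
    ∀ᵐ z ∂μ, 0 < meanFieldMass B0 B s μ z := by
  have hint : ∀ z, Integrable (fun w => trajProb B0 B s z w) μ := fun z => by
    have := integrable_trajProb_smul hB s (μ := μ) (φ := fun _ => (1 : ℝ)) measurable_const
      (integrable_const 1) z
    simpa using this
  have hpos : ∀ z, 0 < μ (Function.support fun w => trajProb B0 B s z w) →
      0 < meanFieldMass B0 B s μ z := fun z hz =>
    (integral_pos_iff_support_of_nonneg (fun w => (trajProb_mem hB s z w).1) (hint z)).mpr hz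
  rcases hrange with ⟨b, -, c, hc, h0, h1⟩ | ⟨-, h0, h1⟩
  · refine Eventually.of_forall fun z => hpos z ?_
    have : (Function.support fun w => trajProb B0 B s z w) = Set.univ := by
      refine Set.eq_univ_of_forall fun w => ne_of_gt (trajProb_pos hB ?_ (fun a r => ?_) s)
      · exact pos_of_mul_pos_left (hc.trans_le (h0 _ _)) (Real.exp_pos _).le
      · exact pos_of_mul_pos_left (hc.trans_le (h1 a _ _)) (Real.exp_pos _).le
    rw [this, measure_univ]
    exact one_pos
  -- Almost every trajectory lies in the support of its law, so each of its neighbourhoods has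
  -- positive mass. The edge probability is positive and continuous at `(z, z)`, hence positive for
  -- all `w` in such a neighbourhood.
  · filter_upwards [Measure.support_mem_ae (μ := μ)] with z hz
    refine hpos z ?_
    rw [Measure.mem_support_iff_forall] at hz
    have hc : ContinuousAt (fun p : (ℕ → EuclideanSpace ℝ (Fin d)) ×
        (ℕ → EuclideanSpace ℝ (Fin d)) => trajProb B0 B s p.1 p.2) (z, z) :=
      continuousAt_trajProb fun r _ => ⟨fun _ => (h0 _).2, fun _ a => (h1 a _).2⟩
    have hc' : ContinuousAt (fun w => trajProb B0 B s z w) z :=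
      ContinuousAt.comp (x := z) (f := fun w => (z, w)) (hg := hc) (by fun_prop)
    have hev : ∀ᶠ w in 𝓝 z, 0 < trajProb B0 B s z w :=
      hc'.eventually_const_lt (trajProb_pos hB (h0 _).1 (fun a r => (h1 a _).1) s)
    exact hz _ (hev.mono fun w hw => ne_of_gt hw)

end Positivity

/-! ### Convergence to product measures -/

section ProductConvergence

/-- Weak convergence to a product measure follows from the convergence on boxes whose sides have
null frontier. -/
lemma weakTendsto_pi_of_tendsto_prod {X : Type*} [PseudoMetricSpace X]
    [SecondCountableTopology X] [MeasurableSpace X] [BorelSpace X] {k : ℕ} {μ : Measure X}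
    [IsProbabilityMeasure μ] {μs : ℕ → Measure (Fin k → X)} [hp : ∀ n, IsProbabilityMeasure (μs n)]
    (h : ∀ s : Fin k → Set X, (∀ i, MeasurableSet (s i)) → (∀ i, μ (frontier (s i)) = 0) →
      Tendsto (fun n => ∫ x, ∏ i, (s i).indicator (fun _ => (1 : ℝ)) (x i) ∂(μs n)) atTop
        (𝓝 (∏ i, μ.real (s i)))) :
    WeakTendsto μs (Measure.pi fun _ => μ) := by
  rw [weakTendsto_iff_tendsto_probabilityMeasure]
  let S : Set (Set (Fin k → X)) := {t | ∃ s : Fin k → Set X, t = Set.univ.pi s ∧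
    (∀ i, MeasurableSet (s i)) ∧ ∀ i, μ (frontier (s i)) = 0}
  have hS : IsPiSystem S := by
    rintro - ⟨s, rfl, smeas, hs⟩ - ⟨s', rfl, s'meas, hs'⟩ -
    exact ⟨fun i => s i ∩ s' i, Set.pi_inter_distrib.symm,
      fun i => (smeas i).inter (s'meas i), fun i => null_frontier_inter (hs i) (hs' i)⟩
  refine hS.tendsto_probabilityMeasure_of_tendsto_of_mem ?_ ?_ ?_
  · rintro - ⟨s, rfl, smeas, hs⟩
    exact MeasurableSet.univ_pi smeas
  · intro u u_open x xu
    obtain ⟨ε, εpos, hε⟩ : ∃ ε > 0, Metric.ball x ε ⊆ u := Metric.isOpen_iff.1 u_open x xu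
    -- The radii can be chosen so that the balls have null frontier; the boxes of such balls form
    -- neighbourhoods inside `u`.
    have hA : ∀ i, ∃ r ∈ Set.Ioo 0 ε, μ (frontier (Metric.thickening r {x i})) = 0 := fun i =>
      exists_null_frontier_thickening _ _ εpos
    choose r rpos hr using hA
    refine ⟨Set.univ.pi fun i => Metric.ball (x i) (r i), ⟨fun i => Metric.ball (x i) (r i), rfl,
      fun i => measurableSet_ball, fun i => by simpa using hr i⟩, ?_, ?_⟩
    · exact (isOpen_set_pi Set.finite_univ (by simp)).mem_nhds
        fun i _ => Metric.mem_ball_self (rpos i).1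
    · refine subset_trans (fun y hy => ?_) hε
      rw [ball_pi _ εpos]
      exact fun i hi => Metric.ball_subset_ball (rpos i).2.le (hy i hi)
  · rintro - ⟨s, rfl, smeas, hs⟩
    have hind : ∀ x : Fin k → X, ∏ i, (s i).indicator (fun _ => (1 : ℝ)) (x i) =
        (Set.univ.pi s).indicator (fun _ => 1) x := by
      intro x
      by_cases hx : x ∈ Set.univ.pi s
      · rw [Set.indicator_of_mem hx]
        exact Finset.prod_eq_one fun i _ => Set.indicator_of_mem (hx i trivial) _
      · rw [Set.indicator_of_notMem hx]
        simp only [Set.mem_univ_pi, not_forall] at hx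
        obtain ⟨i, hi⟩ := hx
        exact Finset.prod_eq_zero (Finset.mem_univ i) (Set.indicator_of_notMem hi _)
    have h1 := h s smeas hs
    simp_rw [hind, integral_indicator_const (1 : ℝ) (MeasurableSet.univ_pi smeas)] at h1
    rw [← NNReal.tendsto_coe]
    have h2 : (Measure.pi fun _ : Fin k => μ).real (Set.univ.pi s) = ∏ i, μ.real (s i) := by
      simp [Measure.real, Measure.pi_pi]
    rw [← h2] at h1
    simp only [smul_eq_mul, mul_one] at h1
    exact h1

/-- Exchange one factor at a time; the remaining factors are at most one. -/
lemma abs_prod_sub_prod_le {κ : Type*} (S : Finset κ) {a b : κ → ℝ}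
    (ha : ∀ i, a i ∈ Set.Icc (0 : ℝ) 1) (hb : ∀ i, b i ∈ Set.Icc (0 : ℝ) 1) :
    |∏ i ∈ S, a i - ∏ i ∈ S, b i| ≤ ∑ i ∈ S, |a i - b i| := by
  classical
  induction S using Finset.induction_on with
  | empty => simp
  | insert i S hi ih =>
    rw [Finset.prod_insert hi, Finset.prod_insert hi, Finset.sum_insert hi]
    have h1 : a i * ∏ i ∈ S, a i - b i * ∏ i ∈ S, b i =
        (a i - b i) * ∏ i ∈ S, a i + b i * (∏ i ∈ S, a i - ∏ i ∈ S, b i) := by ring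
    rw [h1]
    refine (abs_add_le _ _).trans (add_le_add ?_ ?_)
    · rw [abs_mul, abs_of_nonneg (Finset.prod_nonneg fun j _ => (ha j).1)]
      exact mul_le_of_le_one_right (abs_nonneg _)
        (Finset.prod_le_one (fun j _ => (ha j).1) fun j _ => (ha j).2)
    · rw [abs_mul, abs_of_nonneg (hb i).1]
      exact (mul_le_of_le_one_left (abs_nonneg _) (hb i).2).trans ih

/-- The coordinates of a uniform tuple drawn with replacement are independent. -/
lemma avg_pi_prod {T : Type*} [Fintype T] {k : ℕ} (F : Fin k → T → ℝ) :
    (avg fun m : Fin k → T => ∏ i, F i (m i)) = ∏ i, avg (F i) := by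
  classical
  unfold avg
  rw [Finset.prod_div_distrib, Finset.prod_univ_sum, Finset.prod_const, Finset.card_univ,
    Fintype.card_fin, Fintype.card_fun, Fintype.card_fin, Fintype.piFinset_univ]
  push_cast
  rfl

/-- Exchangeability is stated for permutations of all agents; this extends the bijection between two
injective samples to such a permutation, so the initial laws of all injective samples agree. -/
lemma exists_perm_comp_eq {κ T : Type*} [Fintype T] {m m' : κ → T}
    (hm : Function.Injective m) (hm' : Function.Injective m') :
    ∃ σ : Equiv.Perm T, ∀ i, σ (m i) = m' i := by
  classical
  have := Finite.of_injective m hm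
  have := Fintype.ofFinite κ
  set e : {x // x ∈ Set.range m} ≃ {x // x ∈ Set.range m'} :=
    (Equiv.ofInjective m hm).symm.trans (Equiv.ofInjective m' hm') with he
  refine ⟨e.extendSubtype, fun i => ?_⟩
  rw [Equiv.extendSubtype_apply_of_mem e (m i) ⟨i, rfl⟩]
  have h1 : (⟨m i, ⟨i, rfl⟩⟩ : {x // x ∈ Set.range m}) = Equiv.ofInjective m hm i := rfl
  rw [h1, he, Equiv.trans_apply, Equiv.symm_apply_apply]
  rfl

end ProductConvergence

/-! ### Asymptotic independence of the initial opinions -/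

section InitialConvergence

variable {Ω : Type*} [MeasurableSpace Ω] {P : Measure Ω} [IsProbabilityMeasure P] {d : ℕ}
  {μ0 : Measure (EuclideanSpace ℝ (Fin d))} [IsProbabilityMeasure μ0]
  {Z : (n : ℕ) → Fin n → ℕ → Ω → EuclideanSpace ℝ (Fin d)}

lemma IsInitialCondition.integral_comp_eq (h : IsInitialCondition P μ0 Z)
    (hZ : ∀ n i, Measurable (Z n i 0)) {κ : Type*} [Countable κ] {n : ℕ} {m m' : κ → Fin n}
    (hm : Function.Injective m) (hm' : Function.Injective m')
    {f : (κ → EuclideanSpace ℝ (Fin d)) → ℝ} (hf : Measurable f) :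
    ∫ ω, f (fun i => Z n (m i) 0 ω) ∂P = ∫ ω, f (fun i => Z n (m' i) 0 ω) ∂P := by
  obtain ⟨σ, hσ⟩ := exists_perm_comp_eq hm' hm
  have hg : Measurable fun x : Fin n → EuclideanSpace ℝ (Fin d) => f fun i => x (m' i) :=
    hf.comp (measurable_pi_lambda _ fun i => measurable_pi_apply _)
  have hmeas : ∀ σ : Equiv.Perm (Fin n), Measurable fun ω i => Z n (σ i) 0 ω :=
    fun σ => measurable_pi_lambda _ fun j => hZ _ _
  have h2 := congrArg (fun μ => ∫ x, f (fun i => x (m' i)) ∂μ) (h.exchangeable n σ)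
  rw [integral_map (hmeas σ).aemeasurable hg.aestronglyMeasurable,
    integral_map (show Measurable fun ω i => Z n i 0 ω from hmeas 1).aemeasurable
      hg.aestronglyMeasurable] at h2
  simpa [hσ] using h2

/-- The law of large numbers for the initial opinions, in quadratic mean. -/
lemma IsInitialCondition.tendsto_integral_sq (h : IsInitialCondition P μ0 Z)
    (hZ : ∀ n i, Measurable (Z n i 0)) {φ : EuclideanSpace ℝ (Fin d) → ℝ} (hφ : Measurable φ)
    (h01 : ∀ x, φ x ∈ Set.Icc (0 : ℝ) 1) (hcont : ∀ᵐ x ∂μ0, ContinuousAt φ x) :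
    Tendsto (fun n => ∫ ω, ((avg fun j => φ (Z (n + 1) j 0 ω)) - ∫ x, φ x ∂μ0) ^ 2 ∂P) atTop
      (𝓝 0) := by
  set c := ∫ x, φ x ∂μ0 with hc
  have hφi : Integrable φ μ0 := Integrable.of_bound hφ.aestronglyMeasurable 1
    (Eventually.of_forall fun x => by rw [Real.norm_of_nonneg (h01 x).1]; exact (h01 x).2)
  have hc01 : c ∈ Set.Icc (0 : ℝ) 1 := ⟨integral_nonneg fun x => (h01 x).1, by
    simpa using integral_mono hφi (integrable_const 1) fun x => (h01 x).2⟩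
  have habs : ∀ x, |φ x - c| ≤ 1 := fun x =>
    abs_le.mpr ⟨by linarith [(h01 x).1, hc01.2], by linarith [(h01 x).2, hc01.1]⟩
  set f : EuclideanSpace ℝ (Fin d) × EuclideanSpace ℝ (Fin d) → ℝ :=
    fun p => (φ p.1 - c) * (φ p.2 - c) with hf
  have hfm : Measurable f := ((hφ.comp measurable_fst).sub_const c).mul
    ((hφ.comp measurable_snd).sub_const c)
  have hf1 : ∀ p, |f p| ≤ 1 := fun p => by
    rw [hf]; simp only [abs_mul]
    exact mul_le_one₀ (habs _) (abs_nonneg _) (habs _)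
  have hpm : ∀ n, Measurable fun ω => (Z (n + 2) 0 0 ω, Z (n + 2) 1 0 ω) :=
    fun n => (hZ _ _).prodMk (hZ _ _)
  -- The assumed convergence of a single pair makes the covariance of two distinct agents vanish in
  -- the limit.
  have hpair : Tendsto (fun n => ∫ ω, f (Z (n + 2) 0 0 ω, Z (n + 2) 1 0 ω) ∂P) atTop (𝓝 0) := by
    have hp : ∀ n, IsProbabilityMeasure (P.map fun ω => (Z (n + 2) 0 0 ω, Z (n + 2) 1 0 ω)) :=
      fun n => Measure.isProbabilityMeasure_map (hpm n).aemeasurable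
    have hw : WeakTendsto (fun n => P.map fun ω => (Z (n + 2) 0 0 ω, Z (n + 2) 1 0 ω))
        (μ0.prod μ0) := by
      rw [weakTendsto_iff_tendsto_probabilityMeasure]
      have h1 := h.tendsto_pair.tendsto
      simp only [Measure.map_id'] at h1
      exact h1
    have hae : ∀ᵐ p ∂(μ0.prod μ0), ContinuousAt f p := by
      filter_upwards [Measure.quasiMeasurePreserving_fst.ae hcont,
        Measure.quasiMeasurePreserving_snd.ae hcont] with p h1 h2
      refine ContinuousAt.mul (ContinuousAt.sub ?_ continuousAt_const)
        (ContinuousAt.sub ?_ continuousAt_const)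
      · exact ContinuousAt.comp (x := p) (g := φ) (f := Prod.fst) (hg := h1) continuousAt_fst
      · exact ContinuousAt.comp (x := p) (g := φ) (f := Prod.snd) (hg := h2) continuousAt_snd
    have h2 := hw.tendsto_integral_of_ae_continuousAt hfm hf1 hae
    have h3 : ∫ p, f p ∂(μ0.prod μ0) = 0 := by
      rw [hf, integral_prod_mul (fun x => φ x - c) fun x => φ x - c,
        integral_sub hφi (integrable_const c)]
      simp [← hc]
    rw [h3] at h2
    refine h2.congr fun n => integral_map (hpm n).aemeasurable hfm.aestronglyMeasurable
  set F : (n : ℕ) → (Fin 2 → Fin (n + 1)) → ℝ := fun n m =>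
    ∫ ω, f (Z (n + 1) (m 0) 0 ω, Z (n + 1) (m 1) 0 ω) ∂P with hF
  have hFb : ∀ n m, |F n m| ≤ 1 := fun n m =>
    abs_integral_le_of_abs_le fun ω => hf1 _
  -- The square of an average is the average over pairs. Pairs of equal agents are negligible, and
  -- all other pairs have the same covariance by exchangeability.
  have hEq : ∀ n, ∫ ω, ((avg fun j => φ (Z (n + 1) j 0 ω)) - c) ^ 2 ∂P = avg (F n) := by
    intro n
    rw [hF, ← integral_avg]
    · refine integral_congr_ae (Eventually.of_forall fun ω => ?_)
      have h1 : (avg fun j => φ (Z (n + 1) j 0 ω)) - c =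
          avg fun j => φ (Z (n + 1) j 0 ω) - c := by
        rw [avg_sub, avg_const]
      have h2 := avg_pi_prod (k := 2) fun (_ : Fin 2) (j : Fin (n + 1)) => φ (Z (n + 1) j 0 ω) - c
      simp only [Fin.prod_univ_two] at h2
      simp only
      rw [h1, sq, ← h2]
    · intro m
      exact Integrable.of_bound (hfm.comp ((hZ _ _).prodMk (hZ _ _))).aestronglyMeasurable 1
        (Eventually.of_forall fun ω => hf1 _)
  -- The reference pair is `(0, 1)`. For `n = 0` both entries are `0`, but then no pair is injective
  -- and nothing is claimed.
  set m0 : (n : ℕ) → Fin 2 → Fin (n + 1) := fun n i => Fin.ofNat (n + 1) i with hm0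
  have hdiff := tendsto_avg_sub_of_eq_on_injective (F := F)
    (G := fun n _ => F n (m0 n)) hFb (fun n _ => hFb n (m0 n)) (by
      intro n m hm
      have hn : 1 ≤ n := by
        have := Fintype.card_le_of_injective m hm
        simp at this
        omega
      have hinj : Function.Injective (m0 n) := by
        intro a b hab
        rw [Fin.ext_iff] at hab ⊢
        simp only [hm0, Fin.ofNat] at hab
        have ha := a.isLt
        have hb := b.isLt
        rw [Nat.mod_eq_of_lt (by omega), Nat.mod_eq_of_lt (by omega)] at hab
        exact hab
      exact h.integral_comp_eq hZ (f := fun x => f (x 0, x 1)) hm hinj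
        (hfm.comp ((measurable_pi_apply 0).prodMk (measurable_pi_apply 1))))
  simp only [avg_const] at hdiff
  have hG : Tendsto (fun n => F n (m0 n)) atTop (𝓝 0) :=
    (tendsto_add_atTop_iff_nat 1).mp hpair
  simp_rw [hEq]
  simpa using hdiff.add hG

/-- Initially, finitely many sampled agents are asymptotically independent. -/
lemma IsInitialCondition.tendsto_avg_prod (h : IsInitialCondition P μ0 Z)
    (hZ : ∀ n i, Measurable (Z n i 0)) {k : ℕ} {φ : Fin k → EuclideanSpace ℝ (Fin d) → ℝ}
    (hφ : ∀ i, Measurable (φ i)) (h01 : ∀ i x, φ i x ∈ Set.Icc (0 : ℝ) 1)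
    (hcont : ∀ i, ∀ᵐ x ∂μ0, ContinuousAt (φ i) x) :
    Tendsto (fun n => avg fun m : Fin k → Fin (n + 1) =>
      ∫ ω, ∏ i, φ i (Z (n + 1) (m i) 0 ω) ∂P) atTop (𝓝 (∏ i, ∫ x, φ i x ∂μ0)) := by
  set S : (n : ℕ) → Fin k → Ω → ℝ := fun n i ω => avg fun j => φ i (Z (n + 1) j 0 ω) with hS
  have hφi : ∀ i, Integrable (φ i) μ0 := fun i =>
    Integrable.of_bound (hφ i).aestronglyMeasurable 1
      (Eventually.of_forall fun x => by rw [Real.norm_of_nonneg (h01 i x).1]; exact (h01 i x).2)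
  have hc01 : ∀ i, ∫ x, φ i x ∂μ0 ∈ Set.Icc (0 : ℝ) 1 := fun i =>
    ⟨integral_nonneg fun x => (h01 i x).1, by
      simpa using integral_mono (hφi i) (integrable_const 1) fun x => (h01 i x).2⟩
  have hS01 : ∀ n i ω, S n i ω ∈ Set.Icc (0 : ℝ) 1 := fun n i ω =>
    ⟨avg_nonneg fun j => (h01 i _).1,
      (avg_mono fun j => (h01 i _).2).trans (avg_const (T := Fin (n + 1)) 1).le⟩
  have hSm : ∀ n i, Measurable (S n i) := fun n i =>
    (Finset.measurable_fun_sum _ fun j _ => (hφ i).comp (hZ _ j)).div_const _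
  have hdm : ∀ n i, Measurable fun ω => |S n i ω - ∫ x, φ i x ∂μ0| := fun n i =>
    ((hSm n i).sub_const _).abs
  have hd1 : ∀ n i ω, |S n i ω - ∫ x, φ i x ∂μ0| ≤ 1 := fun n i ω =>
    abs_le.mpr ⟨by linarith [(hS01 n i ω).1, (hc01 i).2], by linarith [(hS01 n i ω).2, (hc01 i).1]⟩
  have hdi : ∀ n i, Integrable (fun ω => |S n i ω - ∫ x, φ i x ∂μ0|) P := fun n i =>
    Integrable.of_bound (hdm n i).aestronglyMeasurable 1
      (Eventually.of_forall fun ω => by rw [Real.norm_eq_abs, abs_abs]; exact hd1 n i ω)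
  have hL1 : ∀ i, Tendsto (fun n => ∫ ω, |S n i ω - ∫ x, φ i x ∂μ0| ∂P) atTop (𝓝 0) := by
    intro i
    have h1 := tendsto_avg_integral_of_sq (P := P) (T := fun _ => Unit)
      (X := fun n _ ω => |S n i ω - ∫ x, φ i x ∂μ0|) (fun n _ => hdm n i)
      (fun n _ ω => abs_nonneg _) (fun n _ => hd1 n i) (by
        simp only [avg_const, sq_abs]
        exact h.tendsto_integral_sq hZ (hφ i) (h01 i) (hcont i))
    simpa only [avg_const] using h1
  -- For fixed `ω` the sampled agents are independent, so the average of the product is a product of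
  -- empirical means, each of which converges to a constant.
  have hprod : ∀ n, (avg fun m : Fin k → Fin (n + 1) => ∫ ω, ∏ i, φ i (Z (n + 1) (m i) 0 ω) ∂P) =
      ∫ ω, ∏ i, S n i ω ∂P := by
    intro n
    rw [← integral_avg]
    · refine integral_congr_ae (Eventually.of_forall fun ω => ?_)
      exact avg_pi_prod fun i j => φ i (Z (n + 1) j 0 ω)
    · intro m
      refine Integrable.of_bound (Finset.measurable_fun_prod _ fun i _ =>
        (hφ i).comp (hZ _ _)).aestronglyMeasurable 1 (Eventually.of_forall fun ω => ?_)
      rw [Real.norm_of_nonneg (Finset.prod_nonneg fun i _ => (h01 i _).1)]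
      exact Finset.prod_le_one (fun i _ => (h01 i _).1) fun i _ => (h01 i _).2
  simp_rw [hprod]
  rw [tendsto_iff_norm_sub_tendsto_zero]
  refine squeeze_zero (fun n => norm_nonneg _) (fun n => ?_)
    (by simpa using tendsto_finsetSum (Finset.univ : Finset (Fin k)) fun i _ => hL1 i)
  have hPi : Integrable (fun ω => ∏ i, S n i ω) P := by
    refine Integrable.of_bound (Finset.measurable_fun_prod _ fun i _ =>
      hSm n i).aestronglyMeasurable 1 (Eventually.of_forall fun ω => ?_)
    rw [Real.norm_of_nonneg (Finset.prod_nonneg fun i _ => (hS01 n i _).1)]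
    exact Finset.prod_le_one (fun i _ => (hS01 n i _).1) fun i _ => (hS01 n i _).2
  have h1 : ∫ ω, ∏ i, S n i ω ∂P - ∏ i, ∫ x, φ i x ∂μ0 =
      ∫ ω, (∏ i, S n i ω - ∏ i, ∫ x, φ i x ∂μ0) ∂P := by
    rw [integral_sub hPi (integrable_const _)]
    simp
  rw [h1, ← integral_finsetSum _ fun i _ => hdi n i]
  refine (norm_integral_le_integral_norm _).trans (integral_mono
    (hPi.sub (integrable_const _)).norm (integrable_finsetSum _ fun i _ => hdi n i) fun ω => ?_)
  exact abs_prod_sub_prod_le _ (fun i => hS01 n i ω) hc01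

/-- Initially, sampled agents converge in distribution to independent agents. -/
theorem IsInitialCondition.weakTendsto (h : IsInitialCondition P μ0 Z)
    (hZ : ∀ n i, Measurable (Z n i 0)) (k : ℕ) :
    WeakTendsto (fun n => avgLaw P fun (m : Fin k → Fin (n + 1)) ω i => Z (n + 1) (m i) 0 ω)
      (Measure.pi fun _ => μ0) := by
  have hm : ∀ n (m : Fin k → Fin (n + 1)), Measurable fun ω i => Z (n + 1) (m i) 0 ω :=
    fun n m => measurable_pi_lambda _ fun i => hZ _ _
  have hp : ∀ n, IsProbabilityMeasure (avgLaw P fun (m : Fin k → Fin (n + 1)) ω i =>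
      Z (n + 1) (m i) 0 ω) := fun n => isProbabilityMeasure_avgLaw (hm n)
  refine weakTendsto_pi_of_tendsto_prod fun s hs hfr => ?_
  have hind : ∀ i, Measurable ((s i).indicator fun _ => (1 : ℝ)) := fun i =>
    measurable_const.indicator (hs i)
  have h01 : ∀ i x, (s i).indicator (fun _ => (1 : ℝ)) x ∈ Set.Icc (0 : ℝ) 1 := fun i x => by
    unfold Set.indicator; split_ifs <;> simp
  have h1 := h.tendsto_avg_prod hZ hind h01 fun i => by
    -- An indicator is continuous off the frontier of its set, and the frontier is a null set.
    filter_upwards [measure_eq_zero_iff_ae_notMem.mp (hfr i)] with x hx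
    exact continuousOn_const.continuousAt_indicator hx
  simp_rw [integral_indicator_const (1 : ℝ) (hs _), smul_eq_mul, mul_one] at h1
  refine h1.congr fun n => ?_
  have hfm : Measurable fun x : Fin k → EuclideanSpace ℝ (Fin d) =>
      ∏ i, (s i).indicator (fun _ => (1 : ℝ)) (x i) :=
    Finset.measurable_fun_prod _ fun i _ => (hind i).comp (measurable_pi_apply i)
  refine (integral_avgLaw (hm n) hfm (C := 1) fun x => ?_).symm
  rw [abs_of_nonneg (Finset.prod_nonneg fun i _ => (h01 i _).1)]
  exact Finset.prod_le_one (fun i _ => (h01 i _).1) fun i _ => (h01 i _).2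

variable {γ : ℝ} {B0 : EuclideanSpace ℝ (Fin d) → EuclideanSpace ℝ (Fin d) → ℝ}
  {B : Bool → EuclideanSpace ℝ (Fin d) → EuclideanSpace ℝ (Fin d) → ℝ}
  {ξ : ℕ → ℕ → Ω → EuclideanSpace ℝ (Fin d)}
  {A : (n : ℕ) → Fin n → Fin n → ℕ → Ω → Bool}

/-- The state with the given opinions at time `0`. -/
def initialState {k d : ℕ} (x : Fin k → EuclideanSpace ℝ (Fin d)) : TrajState k d :=
  (fun i => cutTraj 1 fun _ => x i, fun _ _ => cutTraj 0 fun _ => default)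

lemma continuous_initialState {k d : ℕ} : Continuous (initialState (k := k) (d := d)) :=
  Continuous.prodMk (continuous_pi fun i => (continuous_cutTraj 1).comp
      (continuous_pi fun _ => continuous_apply i)) continuous_const

lemma procState_one_zero {Ω : Type*} {k d : ℕ} (Z : Fin k → ℕ → Ω → EuclideanSpace ℝ (Fin d))
    (A : Fin k → Fin k → ℕ → Ω → Bool) (ω : Ω) :
    procState 1 0 Z A ω = initialState fun i => Z i 0 ω := by
  refine Prod.ext (funext fun i => ?_) (funext fun i => funext fun j => ?_)
  · refine cutTraj_congr (z := fun r => Z i r ω) fun r hr => ?_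
    rw [Nat.lt_one_iff.mp hr]
  · exact cutTraj_congr (z := fun r => A i j r ω) (w := fun _ => default) fun r hr => absurd hr (Nat.not_lt_zero r)

theorem IsInitialCondition.sampleTendsto (h : IsInitialCondition P μ0 Z)
    (hsys : ∀ n, IsCoevolvingSystem P γ B0 B ξ n (Z n) (A n)) {Ω' : Type*} [MeasurableSpace Ω']
    {P' : Measure Ω'} [IsProbabilityMeasure P'] {ν : Measure (EuclideanSpace ℝ (Fin d))}
    {k t : ℕ} {ξ' : Fin k → ℕ → Ω' → EuclideanSpace ℝ (Fin d)}
    {Z' : Fin k → ℕ → Ω' → EuclideanSpace ℝ (Fin d)} {A' : Fin k → Fin k → ℕ → Ω' → Bool}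
    (h' : IsLimitingMeanField P' γ B0 B μ0 ν k t ξ' Z' A') :
    SampleTendsto P Z A 1 0 k (P'.map (procState 1 0 Z' A')) := by
  have hZ : ∀ n i, Measurable (Z n i 0) := fun n i => (hsys n).measurable_opinion i 0
  have hY : Measurable (procState 1 0 Z' A') :=
    measurable_procState (fun i r _ => h'.measurable_opinion i r)
      fun i j r _ => h'.measurable_edge i j r
  have hlaw : P'.map (fun ω i => Z' i 0 ω) = Measure.pi fun _ => μ0 := by
    rw [(iIndepFun_iff_map_fun_eq_pi_map fun i =>
      (h'.measurable_opinion i 0).aemeasurable).mp h'.init_indep]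
    simp_rw [h'.init_law]
  have hm : ∀ n (m : Fin k → Fin (n + 1)), Measurable fun ω i => Z (n + 1) (m i) 0 ω :=
    fun n m => measurable_pi_lambda _ fun i => hZ _ _
  refine sampleTendsto_of_tendsto_avg hY hsys fun f => ?_
  have h1 := h.weakTendsto hZ k (f.compContinuous ⟨initialState, continuous_initialState⟩)
  rw [← hlaw, integral_map (measurable_pi_lambda _ fun i =>
    h'.measurable_opinion i 0).aemeasurable
    (f.compContinuous ⟨initialState, continuous_initialState⟩).continuous.measurable.aestronglyMeasurable] at h1
  simp only [procState_one_zero]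
  refine h1.congr fun n => ?_
  rw [integral_avgLaw (hm n) (f.compContinuous ⟨initialState, continuous_initialState⟩).continuous.measurable
    (f.compContinuous ⟨initialState, continuous_initialState⟩).norm_coe_le_norm]
  simp only [sampleState, procState_one_zero]
  rfl

end InitialConvergence

/-! ### Random bits from uniform thresholds -/

section Thresholds

/-- The uniform distribution on the unit interval. -/
noncomputable def unitUniform : Measure ℝ := volume.restrict (Set.Icc 0 1)

instance isProbabilityMeasure_unitUniform : IsProbabilityMeasure unitUniform :=
  ⟨by simp [unitUniform]⟩

lemma integral_threshold {q : ℝ} (hq : q ∈ Set.Icc (0 : ℝ) 1) (b : Bool) :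
    ∫ v, (if decide (v < q) = b then (1 : ℝ) else 0) ∂unitUniform = bitWeight q b := by
  have h1 : unitUniform.real (Set.Iio q) = q := by
    unfold unitUniform
    rw [Measure.real, Measure.restrict_apply measurableSet_Iio]
    have : Set.Iio q ∩ Set.Icc 0 1 = Set.Ico 0 q := by
      ext x
      simp only [Set.mem_inter_iff, Set.mem_Iio, Set.mem_Icc, Set.mem_Ico]
      exact ⟨fun h => ⟨h.2.1, h.1⟩, fun h => ⟨h.2, h.1, h.2.le.trans hq.2⟩⟩
    rw [this, Real.volume_Ico, sub_zero, ENNReal.toReal_ofReal hq.1]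
  have h2 : ∫ v, (Set.Iio q).indicator (fun _ => (1 : ℝ)) v ∂unitUniform = q := by
    rw [integral_indicator_const (1 : ℝ) measurableSet_Iio, h1]; simp
  cases b with
  | true =>
    simp only [decide_eq_true_eq, bitWeight, if_true]
    refine (integral_congr_ae (Eventually.of_forall fun v => ?_)).trans h2
    unfold Set.indicator
    by_cases h : v < q <;> simp [h]
  | false =>
    have h3 : ∀ v, (if decide (v < q) = false then (1 : ℝ) else 0) =
        1 - (Set.Iio q).indicator (fun _ => (1 : ℝ)) v := by
      intro v
      unfold Set.indicator
      by_cases h : v < q <;> simp [h]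
    simp_rw [h3]
    rw [integral_sub (integrable_const _)
      ((integrable_const _).indicator measurableSet_Iio), h2]
    simp [bitWeight]

lemma measurable_threshold {α : Type*} [MeasurableSpace α] {f g : α → ℝ} (hf : Measurable f)
    (hg : Measurable g) : Measurable fun x => decide (f x < g x) :=
  measurable_to_bool (by
    have : (fun x => decide (f x < g x)) ⁻¹' {true} = {x | f x < g x} := by
      ext x; simp
    rw [this]
    exact measurableSet_lt hf hg)

/-- Bits obtained by comparing independent uniform variables with predictable thresholds are
conditionally independent. -/
lemma condExp_threshold {Ω κ : Type*} [Fintype κ] {m : MeasurableSpace Ω}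
    [mΩ : MeasurableSpace Ω] {P : Measure Ω} [IsProbabilityMeasure P] (hm : m ≤ mΩ)
    {V : κ → Ω → ℝ} (hV : ∀ e, Measurable (V e)) (hVi : iIndepFun V P)
    (hVl : ∀ e, P.map (V e) = unitUniform)
    (hind : Indep m (MeasurableSpace.comap (fun ω e => V e ω) inferInstance) P)
    {q : κ → Ω → ℝ} (hq : ∀ e, Measurable[m] (q e)) (hq01 : ∀ e ω, q e ω ∈ Set.Icc (0 : ℝ) 1)
    (S : Finset κ) (b : κ → Bool) :
    P⟦⋂ e ∈ S, (fun ω => decide (V e ω < q e ω)) ⁻¹' {b e} | m⟧ =ᵐ[P]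
      fun ω => ∏ e ∈ S, bitWeight (q e ω) (b e) := by
  classical
  have hqm : ∀ e, Measurable (q e) := fun e => (hq e).mono hm le_rfl
  have hset : MeasurableSet (⋂ e ∈ S, (fun ω => decide (V e ω < q e ω)) ⁻¹' {b e}) :=
    Finset.measurableSet_biInter _ fun e _ =>
      measurable_threshold (hV e) (hqm e) (MeasurableSet.singleton _)
  have hgm : Measurable[m] fun ω => ∏ e ∈ S, bitWeight (q e ω) (b e) :=
    Finset.measurable_fun_prod _ fun e _ => (measurable_bitWeight (b e)).comp (hq e)
  have hg01 : ∀ ω, ‖∏ e ∈ S, bitWeight (q e ω) (b e)‖ ≤ 1 := fun ω => by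
    rw [Real.norm_of_nonneg (Finset.prod_nonneg fun e _ => (bitWeight_mem (hq01 e ω) _).1)]
    exact Finset.prod_le_one (fun e _ => (bitWeight_mem (hq01 e ω) _).1)
      fun e _ => (bitWeight_mem (hq01 e ω) _).2
  have hgi : Integrable (fun ω => ∏ e ∈ S, bitWeight (q e ω) (b e)) P :=
    Integrable.of_bound (hgm.mono hm le_rfl).aestronglyMeasurable 1 (Eventually.of_forall hg01)
  refine (ae_eq_condExp_of_forall_setIntegral_eq hm ((integrable_const (1 : ℝ)).indicator hset)
    (fun G _ _ => hgi.integrableOn) (fun G hG _ => ?_)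
    hgm.stronglyMeasurable.aestronglyMeasurable).symm
  -- `W` records, as one `m`-measurable element, membership in the test set `G` and all thresholds.
  -- The integrand is then a function of `W` and of the independent uniform variables, and Fubini's
  -- theorem applies.
  set W : Ω → ℝ × (κ → ℝ) := fun ω => (G.indicator (fun _ => 1) ω, fun e => q e ω) with hW
  have hWm : Measurable[m] W :=
    ((@measurable_const _ _ _ m _).indicator hG).prodMk
      (@measurable_pi_lambda _ _ _ m _ _ fun e => hq e)
  set F : (ℝ × (κ → ℝ)) × (κ → ℝ) → ℝ := fun x => (if x.1.1 = 1 then 1 else 0) *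
    ∏ e ∈ S, if decide (x.2 e < x.1.2 e) = b e then (1 : ℝ) else 0 with hF
  have hFm : Measurable F := by
    refine Measurable.mul (Measurable.ite ?_ measurable_const measurable_const)
      (Finset.measurable_fun_prod _ fun e _ =>
        Measurable.ite ?_ measurable_const measurable_const)
    · exact (measurable_fst.comp measurable_fst) (MeasurableSet.singleton (1 : ℝ))
    · exact measurable_threshold ((measurable_pi_apply e).comp measurable_snd)
        ((measurable_pi_apply e).comp (measurable_snd.comp measurable_fst))
        (MeasurableSet.singleton (b e))
  have hF1 : ∀ x, |F x| ≤ 1 := fun x => by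
    have h1 : ∀ p : Prop, ∀ [Decidable p], (if p then (1 : ℝ) else 0) ∈ Set.Icc (0 : ℝ) 1 :=
      fun p _ => by split_ifs <;> simp
    have h2 := Finset.prod_nonneg (s := S) fun e _ => (h1 (decide (x.2 e < x.1.2 e) = b e)).1
    rw [hF, abs_of_nonneg (mul_nonneg (h1 _).1 h2)]
    exact mul_le_one₀ (h1 _).2 h2 (Finset.prod_le_one (fun e _ => (h1 _).1) fun e _ => (h1 _).2)
  have hVm : Measurable fun ω e => V e ω := measurable_pi_lambda _ hV
  have hind' : IndepFun W (fun ω e => V e ω) P :=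
    indep_of_indep_of_le_left hind hWm.comap_le
  have hlaw : P.map (fun ω e => V e ω) = Measure.pi fun _ => unitUniform := by
    rw [(iIndepFun_iff_map_fun_eq_pi_map fun e => (hV e).aemeasurable).mp hVi]
    simp_rw [hVl]
  have hmain := integral_eq_integral_integral_of_indepFun (hWm.mono hm le_rfl) hVm hind' hFm hF1
  rw [hlaw] at hmain
  have hinner : ∀ ω, ∫ v, F (W ω, v) ∂(Measure.pi fun _ => unitUniform) =
      (if G.indicator (fun _ => (1 : ℝ)) ω = 1 then 1 else 0) *
        ∏ e ∈ S, bitWeight (q e ω) (b e) := by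
    intro ω
    simp only [hF, hW]
    set c : ℝ := if G.indicator (fun _ => (1 : ℝ)) ω = 1 then 1 else 0
    have h0 := integral_const_mul (L := ℝ) (μ := Measure.pi fun _ : κ => unitUniform) c
      fun v : κ → ℝ => ∏ e ∈ S, if decide (v e < q e ω) = b e then (1 : ℝ) else 0
    refine h0.trans ?_
    congr 1
    -- The product is extended to all indices by factors one, so that the product measure factorises
    -- over the whole index type.
    have h1 : ∀ v : κ → ℝ, (∏ e ∈ S, if decide (v e < q e ω) = b e then (1 : ℝ) else 0) =
        ∏ e, if e ∈ S then (if decide (v e < q e ω) = b e then (1 : ℝ) else 0) else 1 := by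
      intro v; rw [Finset.prod_ite_mem, Finset.univ_inter]
    simp_rw [h1]
    rw [integral_fintype_prod_eq_prod (𝕜 := ℝ) (fun e (x : ℝ) =>
      if e ∈ S then (if decide (x < q e ω) = b e then (1 : ℝ) else 0) else 1)]
    have h2 : ∀ e, ∫ x, (if e ∈ S then (if decide (x < q e ω) = b e then (1 : ℝ) else 0) else 1)
        ∂unitUniform = if e ∈ S then bitWeight (q e ω) (b e) else 1 := by
      intro e
      by_cases he : e ∈ S
      · simp only [he, if_true]; exact integral_threshold (hq01 e ω) (b e)
      · simp [he]
    simp_rw [h2]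
    rw [Finset.prod_ite_mem, Finset.univ_inter]
  simp_rw [hinner] at hmain
  have hG' := hm _ hG
  have hind1 : ∀ ω (x : ℝ), (if G.indicator (fun _ => (1 : ℝ)) ω = 1 then 1 else 0) * x =
      G.indicator (fun _ => x) ω := by
    intro ω x
    by_cases h : ω ∈ G <;> simp [h]
  rw [← integral_indicator hG', ← integral_indicator hG']
  refine Eq.trans (Eq.trans ?_ hmain.symm) ?_
  · refine integral_congr_ae (Eventually.of_forall fun ω => ?_)
    simp only [hind1]
    by_cases h : ω ∈ G <;> simp [h]
  · refine integral_congr_ae (Eventually.of_forall fun ω => ?_)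
    simp only [hF, hW, hind1]
    by_cases h : ω ∈ G
    · simp only [h, Set.indicator_of_mem]
      by_cases h' : ω ∈ ⋂ e ∈ S, (fun ω => decide (V e ω < q e ω)) ⁻¹' {b e}
      · rw [Set.indicator_of_mem h']
        simp only [Set.mem_iInter, Set.mem_preimage, Set.mem_singleton_iff] at h'
        exact Finset.prod_eq_one fun e he => if_pos (h' e he)
      · rw [Set.indicator_of_notMem h']
        simp only [Set.mem_iInter, Set.mem_preimage, Set.mem_singleton_iff, not_forall] at h'
        obtain ⟨e, he, h'⟩ := h'
        exact Finset.prod_eq_zero he (if_neg h')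
    · simp [h]

end Thresholds

/-! ### The limiting dynamics as a function of a driving sequence -/

section DrivenTrajectory

variable {d : ℕ} (γ : ℝ)
  (B0 : EuclideanSpace ℝ (Fin d) → EuclideanSpace ℝ (Fin d) → ℝ)
  (B : Bool → EuclideanSpace ℝ (Fin d) → EuclideanSpace ℝ (Fin d) → ℝ)
  (η : Measure (ℕ → EuclideanSpace ℝ (Fin d)))

/-- The trajectory up to time `s` of the limiting dynamics driven by the sequence `x`, whose law
is `η`; its first term is the initial opinion. -/
noncomputable def drivenUpTo : ℕ → (ℕ → EuclideanSpace ℝ (Fin d)) → ℕ → EuclideanSpace ℝ (Fin d)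
  | 0, x => fun _ => x 0
  | s + 1, x => Function.update (drivenUpTo s x) (s + 1)
      -- The law entering step `s + 1` is that of the trajectory already built up to time `s`, so
      -- the recursion is not circular.
      (meanFieldDrift γ B0 B s (η.map (drivenUpTo s)) (drivenUpTo s x) + x (s + 1))

/-- The trajectory of the limiting dynamics driven by `x`. -/
noncomputable def drivenTraj (x : ℕ → EuclideanSpace ℝ (Fin d)) : ℕ → EuclideanSpace ℝ (Fin d) :=
  fun r => drivenUpTo γ B0 B η r x r

lemma drivenUpTo_apply {r s : ℕ} (h : r ≤ s) (x : ℕ → EuclideanSpace ℝ (Fin d)) :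
    drivenUpTo γ B0 B η s x r = drivenTraj γ B0 B η x r := by
  induction s with
  | zero => rw [Nat.le_zero.mp h]; rfl
  | succ s ih =>
    rcases h.eq_or_lt with rfl | h
    · rfl
    · rw [← ih (Nat.lt_succ_iff.mp h)]
      exact Function.update_of_ne h.ne _ _

lemma cutTraj_drivenUpTo (s : ℕ) (x : ℕ → EuclideanSpace ℝ (Fin d)) :
    cutTraj (s + 1) (drivenUpTo γ B0 B η s x) = cutTraj (s + 1) (drivenTraj γ B0 B η x) :=
  cutTraj_congr fun _ hr => drivenUpTo_apply γ B0 B η (Nat.lt_succ_iff.mp hr) x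

lemma drivenUpTo_congr {s : ℕ} {x y : ℕ → EuclideanSpace ℝ (Fin d)} (h : ∀ r ≤ s, x r = y r) :
    drivenUpTo γ B0 B η s x = drivenUpTo γ B0 B η s y := by
  induction s with
  | zero => simp [drivenUpTo, h 0 le_rfl]
  | succ s ih => simp [drivenUpTo, ih fun r hr => h r (hr.trans s.le_succ), h (s + 1) le_rfl]

variable {B0 B}

lemma measurable_drivenUpTo (hB : IsInteractionPair B0 B) [IsProbabilityMeasure η] (s : ℕ) :
    Measurable (drivenUpTo γ B0 B η s) := by
  induction s with
  | zero => exact measurable_pi_lambda _ fun _ => measurable_pi_apply 0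
  | succ s ih =>
    have : IsProbabilityMeasure (η.map (drivenUpTo γ B0 B η s)) :=
      Measure.isProbabilityMeasure_map ih.aemeasurable
    exact measurable_update'.comp (ih.prodMk
      (((measurable_meanFieldDrift γ hB s _).comp ih).add (measurable_pi_apply (s + 1))))

lemma measurable_drivenTraj (hB : IsInteractionPair B0 B) [IsProbabilityMeasure η] :
    Measurable (drivenTraj γ B0 B η) :=
  measurable_pi_lambda _ fun r =>
    (measurable_pi_apply r).comp (measurable_drivenUpTo γ η hB r)

lemma meanFieldMass_congr_law (hB : IsInteractionPair B0 B) (s : ℕ)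
    {μ μ' : Measure (ℕ → EuclideanSpace ℝ (Fin d))}
    (h : μ.map (cutTraj (s + 1)) = μ'.map (cutTraj (s + 1))) :
    meanFieldMass B0 B s μ = meanFieldMass B0 B s μ' := by
  ext1 z
  rw [meanFieldMass_eq_kernelMean, meanFieldMass_eq_kernelMean,
    ← kernelMean_map_cutTraj hB s μ measurable_const,
    ← kernelMean_map_cutTraj hB s μ' measurable_const, h]

/-- The average at time `s` sees a law only through trajectories up to time `s`. This replaces
stagewise laws by the full law, and the law of one limiting process by that of another. -/
lemma meanFieldAverage_congr_law (hB : IsInteractionPair B0 B) (s : ℕ)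
    {μ μ' : Measure (ℕ → EuclideanSpace ℝ (Fin d))}
    (h : μ.map (cutTraj (s + 1)) = μ'.map (cutTraj (s + 1))) :
    meanFieldAverage B0 B s μ = meanFieldAverage B0 B s μ' := by
  ext1 z
  rw [meanFieldAverage_eq_kernelMean, meanFieldAverage_eq_kernelMean,
    meanFieldMass_congr_law hB s h,
    ← kernelMean_map_cutTraj hB s μ (φ := fun x => x) measurable_id,
    ← kernelMean_map_cutTraj hB s μ' (φ := fun x => x) measurable_id, h]

/-- The trajectory built up to time `s` and the full one agree up to time `s`, hence so do their
laws as far as the drift can see. The recursion therefore satisfies the self-consistent equation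
with the full law. -/
lemma drivenTraj_succ (hB : IsInteractionPair B0 B) [IsProbabilityMeasure η] (s : ℕ)
    (x : ℕ → EuclideanSpace ℝ (Fin d)) :
    drivenTraj γ B0 B η x (s + 1) =
      meanFieldDrift γ B0 B s (η.map (drivenTraj γ B0 B η)) (drivenTraj γ B0 B η x) +
        x (s + 1) := by
  have h1 : drivenTraj γ B0 B η x (s + 1) = meanFieldDrift γ B0 B s
      (η.map (drivenUpTo γ B0 B η s)) (drivenUpTo γ B0 B η s x) + x (s + 1) :=
    Function.update_self _ _ _
  rw [h1, ← meanFieldDrift_cutTraj, cutTraj_drivenUpTo, meanFieldDrift_cutTraj,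
    meanFieldDrift, meanFieldDrift,
    meanFieldAverage_congr_law hB s (μ' := η.map (drivenTraj γ B0 B η))]
  rw [Measure.map_map (measurable_cutTraj _) (measurable_drivenUpTo γ η hB s),
    Measure.map_map (measurable_cutTraj _) (measurable_drivenTraj γ η hB)]
  congr 1
  ext1 x
  exact cutTraj_drivenUpTo γ B0 B η s x

/-- The driven trajectory is non-anticipating; this yields measurability with respect to the drivers
up to a given time. -/
lemma drivenTraj_cutTraj {r s : ℕ} (h : r ≤ s) (x : ℕ → EuclideanSpace ℝ (Fin d)) :
    drivenTraj γ B0 B η (cutTraj (s + 1) x) r = drivenTraj γ B0 B η x r := by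
  unfold drivenTraj
  rw [drivenUpTo_congr γ B0 B η (y := x) fun r' hr' =>
    cutTraj_apply_of_lt (Nat.lt_succ_iff.mpr (hr'.trans h)) x]

end DrivenTrajectory

/-! ### Edges driven by uniform variables -/

section DrivenEdges

variable {d : ℕ} (B0 : EuclideanSpace ℝ (Fin d) → EuclideanSpace ℝ (Fin d) → ℝ)
  (B : Bool → EuclideanSpace ℝ (Fin d) → EuclideanSpace ℝ (Fin d) → ℝ)

/-- The edge trajectory driven by the sequence `u` in the unit interval. -/
noncomputable def drivenEdge (z w : ℕ → EuclideanSpace ℝ (Fin d)) (u : ℕ → ℝ) : ℕ → Bool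
  | 0 => decide (u 0 < B0 (z 0) (w 0))
  | s + 1 => decide (u (s + 1) < B (drivenEdge z w u s) (z (s + 1)) (w (s + 1)))

lemma drivenEdge_eq (z w : ℕ → EuclideanSpace ℝ (Fin d)) (u : ℕ → ℝ) (s : ℕ) :
    drivenEdge B0 B z w u s =
      decide (u s < edgeProb B0 B s z w (drivenEdge B0 B z w u)) := by
  cases s <;> rfl

variable {B0 B}

lemma measurable_drivenEdge (hB : IsInteractionPair B0 B) {Ω : Type*} [MeasurableSpace Ω]
    {z w : ℕ → Ω → EuclideanSpace ℝ (Fin d)} {u : ℕ → Ω → ℝ} (s : ℕ)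
    (hz : ∀ r ≤ s, Measurable (z r)) (hw : ∀ r ≤ s, Measurable (w r))
    (hu : ∀ r ≤ s, Measurable (u r)) :
    Measurable fun ω => drivenEdge B0 B (fun r => z r ω) (fun r => w r ω) (fun r => u r ω) s := by
  induction s with
  | zero =>
    exact measurable_threshold (hu 0 le_rfl)
      (hB.measurable_zero.comp ((hz 0 le_rfl).prodMk (hw 0 le_rfl)))
  | succ s ih =>
    have ih := ih (fun r hr => hz r (hr.trans s.le_succ)) (fun r hr => hw r (hr.trans s.le_succ))
      fun r hr => hu r (hr.trans s.le_succ)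
    refine measurable_threshold (hu _ le_rfl) ?_
    have h : Measurable fun p : Bool × EuclideanSpace ℝ (Fin d) × EuclideanSpace ℝ (Fin d) =>
        B p.1 p.2.1 p.2.2 := measurable_of_bool_prod fun b => hB.measurable_succ b
    exact h.comp
      (ih.prodMk ((hz _ le_rfl).prodMk (hw _ le_rfl)))

end DrivenEdges

/-! ### Construction of a limiting process from independent drivers -/

section Existence

variable {Ω : Type*} {d k : ℕ} {γ : ℝ}
  {B0 : EuclideanSpace ℝ (Fin d) → EuclideanSpace ℝ (Fin d) → ℝ}
  {B : Bool → EuclideanSpace ℝ (Fin d) → EuclideanSpace ℝ (Fin d) → ℝ}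

/-- The opinions driven by the first components of the diagonal entries of `W`. -/
noncomputable def drivenOpinion (γ : ℝ)
    (B0 : EuclideanSpace ℝ (Fin d) → EuclideanSpace ℝ (Fin d) → ℝ)
    (B : Bool → EuclideanSpace ℝ (Fin d) → EuclideanSpace ℝ (Fin d) → ℝ)
    (η : Measure (ℕ → EuclideanSpace ℝ (Fin d)))
    (W : (Fin k × Fin k) × ℕ → Ω → EuclideanSpace ℝ (Fin d) × ℝ) (i : Fin k) (s : ℕ) (ω : Ω) :
    EuclideanSpace ℝ (Fin d) :=
  drivenTraj γ B0 B η (fun r => (W ((i, i), r) ω).1) s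

/-- The edges driven by the second components of the off-diagonal entries of `W`. -/
noncomputable def drivenLink (γ : ℝ)
    (B0 : EuclideanSpace ℝ (Fin d) → EuclideanSpace ℝ (Fin d) → ℝ)
    (B : Bool → EuclideanSpace ℝ (Fin d) → EuclideanSpace ℝ (Fin d) → ℝ)
    (η : Measure (ℕ → EuclideanSpace ℝ (Fin d)))
    (W : (Fin k × Fin k) × ℕ → Ω → EuclideanSpace ℝ (Fin d) × ℝ) (i j : Fin k) (s : ℕ) (ω : Ω) :
    Bool :=
  if i = j then true else
    drivenEdge B0 B (fun r => drivenOpinion γ B0 B η W (min i j) r ω)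
      (fun r => drivenOpinion γ B0 B η W (max i j) r ω)
      (fun r => (W ((min i j, max i j), r) ω).2) s

variable {η : Measure (ℕ → EuclideanSpace ℝ (Fin d))}
  {W : (Fin k × Fin k) × ℕ → Ω → EuclideanSpace ℝ (Fin d) × ℝ}

lemma measurable_drivenOpinion (hB : IsInteractionPair B0 B) [IsProbabilityMeasure η]
    [MeasurableSpace Ω] (i : Fin k) (s : ℕ) (hW : ∀ r ≤ s, Measurable (W ((i, i), r))) :
    Measurable (drivenOpinion γ B0 B η W i s) := by
  have h1 : drivenOpinion γ B0 B η W i s = fun ω =>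
      drivenTraj γ B0 B η (cutTraj (s + 1) fun r => (W ((i, i), r) ω).1) s := by
    ext1 ω
    exact (drivenTraj_cutTraj γ η le_rfl _).symm
  rw [h1]
  suffices h2 : Measurable fun ω => cutTraj (s + 1) fun r => (W ((i, i), r) ω).1 from
    ((measurable_pi_apply s).comp (measurable_drivenTraj γ η hB)).comp h2
  refine measurable_pi_lambda _ fun r => ?_
  unfold cutTraj
  by_cases hr : r < s + 1
  · simp only [hr, if_true]
    exact measurable_fst.comp (hW r (Nat.lt_succ_iff.mp hr))
  · simp only [hr, if_false]
    exact measurable_const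

lemma measurable_drivenLink (hB : IsInteractionPair B0 B) [IsProbabilityMeasure η]
    [MeasurableSpace Ω] (i j : Fin k) (s : ℕ) (hW : ∀ e, ∀ r ≤ s, Measurable (W (e, r))) :
    Measurable (drivenLink γ B0 B η W i j s) := by
  unfold drivenLink
  by_cases hij : i = j
  · simp only [hij, if_true]; exact measurable_const
  · simp only [hij, if_false]
    exact measurable_drivenEdge hB s
      (fun r hr => measurable_drivenOpinion hB _ r fun r' hr' => hW _ r' (hr'.trans hr))
      (fun r hr => measurable_drivenOpinion hB _ r fun r' hr' => hW _ r' (hr'.trans hr))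
      fun r hr => measurable_snd.comp (hW _ r hr)

lemma drivenLink_of_lt {i j : Fin k} (hij : i < j) (s : ℕ) (ω : Ω) :
    drivenLink γ B0 B η W i j s ω = decide ((W ((i, j), s) ω).2 < edgeProb B0 B s
      (fun r => drivenOpinion γ B0 B η W i r ω) (fun r => drivenOpinion γ B0 B η W j r ω)
      fun r => drivenLink γ B0 B η W i j r ω) := by
  have h1 : ∀ r, drivenLink γ B0 B η W i j r ω =
      drivenEdge B0 B (fun r => drivenOpinion γ B0 B η W i r ω)
        (fun r => drivenOpinion γ B0 B η W j r ω) (fun r => (W ((i, j), r) ω).2) r := by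
    intro r
    unfold drivenLink
    rw [if_neg hij.ne, min_eq_left hij.le, max_eq_right hij.le]
  simp_rw [h1]
  exact drivenEdge_eq B0 B _ _ _ s

/-- The σ-algebra generated by the entries of `W` with index in `S`. -/
@[reducible] def driverAlgebra (W : (Fin k × Fin k) × ℕ → Ω → EuclideanSpace ℝ (Fin d) × ℝ)
    (S : Set ((Fin k × Fin k) × ℕ)) : MeasurableSpace Ω :=
  ⨆ p ∈ S, MeasurableSpace.comap (W p) inferInstance

lemma measurable_driverAlgebra {S : Set ((Fin k × Fin k) × ℕ)} {p : (Fin k × Fin k) × ℕ}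
    (hp : p ∈ S) : Measurable[driverAlgebra W S] (W p) := by
  rw [measurable_iff_comap_le]
  exact le_iSup₂_of_le p hp le_rfl

/-- Opinions up to time `s` use the diagonal drivers up to `s`, while edges before `q` use drivers
before `q`. Locating the history in an index set reduces independence statements to the disjointness
of index sets. -/
lemma history_driven_le (hB : IsInteractionPair B0 B) [IsProbabilityMeasure η] {s q : ℕ}
    {S : Set ((Fin k × Fin k) × ℕ)} (h1 : ∀ i, ∀ r ≤ s, ((i, i), r) ∈ S)
    (h2 : ∀ e, ∀ r < q, (e, r) ∈ S) :
    history (drivenOpinion γ B0 B η W) (drivenLink γ B0 B η W) (s + 1) q ≤ driverAlgebra W S := by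
  rw [history_le_iff]
  refine ⟨fun i r hr => ?_, fun i j r hr => ?_⟩
  · exact @measurable_drivenOpinion _ _ _ _ _ _ _ _ hB _ (driverAlgebra W S) i r
      fun r' hr' => measurable_driverAlgebra (h1 i r' (hr'.trans (Nat.lt_succ_iff.mp hr)))
  · exact @measurable_drivenLink _ _ _ _ _ _ _ _ hB _ (driverAlgebra W S) i j r
      fun e r' hr' => measurable_driverAlgebra (h2 e r' (hr'.trans_lt hr))

/-- Every pair of agents and every time has an independent driver with a vector and a uniform
component: the vectors on the diagonal give the initial opinions and the noise, the uniform
variables above it give the edges. -/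
theorem isLimitingMeanField_driven [mΩ : MeasurableSpace Ω] {P : Measure Ω}
    [IsProbabilityMeasure P] {μ0 ν : Measure (EuclideanSpace ℝ (Fin d))}
    [IsProbabilityMeasure μ0] [IsProbabilityMeasure ν]
    (hB : IsInteractionPair B0 B) [IsProbabilityMeasure η]
    (hη : η = Measure.infinitePi fun r => if r = 0 then μ0 else ν)
    (hW : ∀ p, Measurable (W p)) (hWi : iIndepFun W P)
    (hWl : ∀ p, P.map (W p) = (if p.2 = 0 then μ0 else ν).prod unitUniform) (t : ℕ) :
    IsLimitingMeanField P γ B0 B μ0 ν k t (fun i s ω => (W ((i, i), s + 1) ω).1)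
      (drivenOpinion γ B0 B η W) (drivenLink γ B0 B η W) := by
  have hle : ∀ p, MeasurableSpace.comap (W p) inferInstance ≤ mΩ := fun p => (hW p).comap_le
  have hZ : ∀ i s, Measurable (drivenOpinion γ B0 B η W i s) := fun i s =>
    measurable_drivenOpinion hB i s fun r _ => hW _
  have hA : ∀ i j s, Measurable (drivenLink γ B0 B η W i j s) := fun i j s =>
    measurable_drivenLink hB i j s fun e r _ => hW _
  have hp : ∀ r : ℕ, IsProbabilityMeasure (if r = 0 then μ0 else ν) := fun r => by
    split_ifs <;> infer_instance
  have hfst : ∀ p, P.map (fun ω => (W p ω).1) = if p.2 = 0 then μ0 else ν := by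
    intro p
    have h1 := Measure.map_map (μ := P) measurable_fst (hW p)
    rw [hWl p, Measure.map_fst_prod, measure_univ, one_smul] at h1
    exact h1.symm
  have hsnd : ∀ p, P.map (fun ω => (W p ω).2) = unitUniform := by
    intro p
    have h1 := Measure.map_map (μ := P) measurable_snd (hW p)
    have := hp p.2
    rw [hWl p, Measure.map_snd_prod, measure_univ, one_smul] at h1
    exact h1.symm
  have hfsti : iIndepFun (fun p ω => (W p ω).1) P := hWi.comp (fun _ => Prod.fst)
    fun _ => measurable_fst
  have hsndi : iIndepFun (fun p ω => (W p ω).2) P := hWi.comp (fun _ => Prod.snd)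
    fun _ => measurable_snd
  have hdrive : ∀ i, P.map (fun ω r => (W ((i, i), r) ω).1) = η := by
    intro i
    have h1 : iIndepFun (fun (r : ℕ) ω => (W ((i, i), r) ω).1) P :=
      hfsti.precomp (g := fun r : ℕ => ((i, i), r)) fun a b h => (Prod.mk.inj h).2
    have hm : ∀ r : ℕ, Measurable fun ω => (W ((i, i), r) ω).1 := fun r =>
      measurable_fst.comp (hW _)
    rw [(iIndepFun_iff_map_fun_eq_infinitePi_map hm).mp h1, hη]
    congr 1
    ext1 r
    exact hfst _
  have hlaw : ∀ i, P.map (fun ω r => drivenOpinion γ B0 B η W i r ω) =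
      η.map (drivenTraj γ B0 B η) := by
    intro i
    have hm : Measurable fun ω (r : ℕ) => (W ((i, i), r) ω).1 :=
      measurable_pi_lambda _ fun r => measurable_fst.comp (hW _)
    have h1 := Measure.map_map (μ := P) (measurable_drivenTraj (B0 := B0) (B := B) γ η hB) hm
    rw [hdrive i] at h1
    exact h1.symm
  have hindep : ∀ S T : Set ((Fin k × Fin k) × ℕ), Disjoint S T →
      Indep (driverAlgebra W S) (driverAlgebra W T) P := fun S T hST =>
    indep_iSup_of_disjoint hle hWi hST
  -- the conditional law of the edges
  have hedge : ∀ s (S : Finset (EdgeIdx k)) (b : EdgeIdx k → Bool),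
      P⟦⋂ e ∈ S, drivenLink γ B0 B η W e.1.1 e.1.2 s ⁻¹' {b e} |
        history (drivenOpinion γ B0 B η W) (drivenLink γ B0 B η W) (s + 1) s⟧ =ᵐ[P]
      fun ω => ∏ e ∈ S, bitWeight (edgeProb B0 B s
        (fun r => drivenOpinion γ B0 B η W e.1.1 r ω) (fun r => drivenOpinion γ B0 B η W e.1.2 r ω)
        fun r => drivenLink γ B0 B η W e.1.1 e.1.2 r ω) (b e) := by
    intro s S b
    have h1 : ∀ e : EdgeIdx k, drivenLink γ B0 B η W e.1.1 e.1.2 s = fun ω =>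
        decide ((W (e.1, s) ω).2 < edgeProb B0 B s
          (fun r => drivenOpinion γ B0 B η W e.1.1 r ω)
          (fun r => drivenOpinion γ B0 B η W e.1.2 r ω)
          fun r => drivenLink γ B0 B η W e.1.1 e.1.2 r ω) := fun e =>
      funext fun ω => drivenLink_of_lt e.2 s ω
    have h2 : (⋂ e ∈ S, drivenLink γ B0 B η W e.1.1 e.1.2 s ⁻¹' {b e}) =
        ⋂ e ∈ S, (fun ω => decide ((W (e.1, s) ω).2 < edgeProb B0 B s
          (fun r => drivenOpinion γ B0 B η W e.1.1 r ω)
          (fun r => drivenOpinion γ B0 B η W e.1.2 r ω)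
          fun r => drivenLink γ B0 B η W e.1.1 e.1.2 r ω)) ⁻¹' {b e} :=
      Set.iInter₂_congr fun e _ => by rw [← h1 e]
    rw [h2]
    refine condExp_threshold (m := history (drivenOpinion γ B0 B η W) (drivenLink γ B0 B η W)
      (s + 1) s) (mΩ := mΩ) (V := fun (e : EdgeIdx k) ω => (W (e.1, s) ω).2)
      (history_le hZ hA _ _) (fun e => measurable_snd.comp (hW _))
      (hsndi.precomp (g := fun e : EdgeIdx k => (e.1, s))
        fun a b h => Subtype.ext (Prod.mk.inj h).1) (fun e => hsnd _) ?_ (fun e => ?_)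
      (fun e ω => edgeProb_mem hB s _ _ _) S b
    -- Just before the edges at time `s` are drawn, the history uses all drivers before `s` and the
    -- diagonal drivers at `s`. The new thresholds sit at the off-diagonal drivers at `s`, a
    -- disjoint set.
    · refine indep_of_indep_of_le_left (indep_of_indep_of_le_right (hindep
        {p | p.2 < s ∨ p.2 = s ∧ p.1.1 = p.1.2} {p | p.2 = s ∧ p.1.1 ≠ p.1.2} ?_) ?_) ?_
      · rw [Set.disjoint_left]
        rintro p (h | h) ⟨h3, h4⟩
        · exact h.ne h3
        · exact h4 h.2
      · rw [← measurable_iff_comap_le]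
        refine @measurable_pi_lambda _ _ _ (_) _ _ fun e => ?_
        exact measurable_snd.comp (measurable_driverAlgebra ⟨rfl, e.2.ne⟩)
      · refine history_driven_le hB (fun i r hr => ?_) fun e r hr => Or.inl hr
        rcases hr.lt_or_eq with h | h
        · exact Or.inl h
        · exact Or.inr ⟨h, rfl⟩
    · have h3 : (fun ω => edgeProb B0 B s (fun r => drivenOpinion γ B0 B η W e.1.1 r ω)
          (fun r => drivenOpinion γ B0 B η W e.1.2 r ω)
          fun r => drivenLink γ B0 B η W e.1.1 e.1.2 r ω) = fun ω => edgeProb B0 B s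
          ((procState (s + 1) s (drivenOpinion γ B0 B η W) (drivenLink γ B0 B η W) ω).1 e.1.1)
          ((procState (s + 1) s (drivenOpinion γ B0 B η W) (drivenLink γ B0 B η W) ω).1 e.1.2)
          ((procState (s + 1) s (drivenOpinion γ B0 B η W) (drivenLink γ B0 B η W) ω).2
            e.1.1 e.1.2) := by
        ext1 ω
        exact edgeProb_congr
          (fun r hr => (cutTraj_apply_of_lt (Nat.lt_succ_of_le hr) fun r =>
            drivenOpinion γ B0 B η W e.1.1 r ω).symm)
          (fun r hr => (cutTraj_apply_of_lt (Nat.lt_succ_of_le hr) fun r =>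
            drivenOpinion γ B0 B η W e.1.2 r ω).symm)
          fun r hr => (cutTraj_apply_of_lt hr fun r =>
            drivenLink γ B0 B η W e.1.1 e.1.2 r ω).symm
      rw [h3]
      have h4 : Measurable fun x : TrajState k d =>
          edgeProb B0 B s (x.1 e.1.1) (x.1 e.1.2) (x.2 e.1.1 e.1.2) :=
        (measurable_edgeProb hB s).comp (f := fun x : TrajState k d =>
          (x.1 e.1.1, x.1 e.1.2, x.2 e.1.1 e.1.2)) (by fun_prop)
      exact h4.comp measurable_procState_history
  have hedge1 : ∀ s (e : EdgeIdx k) (b : Bool),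
      P⟦drivenLink γ B0 B η W e.1.1 e.1.2 s ⁻¹' {b} |
        history (drivenOpinion γ B0 B η W) (drivenLink γ B0 B η W) (s + 1) s⟧ =ᵐ[P]
      fun ω => bitWeight (edgeProb B0 B s
        (fun r => drivenOpinion γ B0 B η W e.1.1 r ω) (fun r => drivenOpinion γ B0 B η W e.1.2 r ω)
        fun r => drivenLink γ B0 B η W e.1.1 e.1.2 r ω) b := by
    intro s e b
    have h1 := hedge s {e} fun _ => b
    simpa only [Finset.mem_singleton, Set.iInter_iInter_eq_left, Finset.prod_singleton] using h1
  refine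
    { measurable_noise := fun i s => measurable_fst.comp (hW _)
      measurable_opinion := hZ
      measurable_edge := hA
      init_indep := ?_
      init_law := fun i => ?_
      noise_indep := ?_
      noise_law := fun i s _ => ?_
      noise_indep_history := fun s _ => ?_
      evolve := fun i s _ => Eventually.of_forall fun ω => ?_
      symm := fun i j s _ => Eventually.of_forall fun ω => ?_
      diag := fun i s _ => Eventually.of_forall fun ω => ?_
      edge_law := fun i j s _ hij => ?_
      edge_condIndep := fun s _ S b => ?_ }
  · exact hfsti.precomp (g := fun i : Fin k => ((i, i), 0))
      fun a b h => (Prod.mk.inj (Prod.mk.inj h).1).1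
  · exact hfst ((i, i), 0)
  · refine hfsti.precomp (g := fun p : Fin k × Fin (t + 1) => ((p.1, p.1), (p.2 : ℕ) + 1)) ?_
    rintro ⟨a, r⟩ ⟨b, r'⟩ h
    simp only [Prod.mk.injEq, Nat.add_right_cancel_iff] at h
    exact Prod.ext h.1.1 (Fin.ext h.2)
  · exact hfst ((i, i), s + 1)
  -- The noise at time `s` is the driver at time `s + 1`, since the driver at time `0` is the
  -- initial opinion; the history at time `s` uses only drivers up to `s`.
  · refine indep_of_indep_of_le_left (indep_of_indep_of_le_right (hindep
      {p | p.2 = s + 1} {p | p.2 ≤ s} ?_) ?_) ?_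
    · rw [Set.disjoint_left]
      intro p (h1 : p.2 = s + 1) (h2 : p.2 ≤ s)
      omega
    · exact history_driven_le hB (fun i r hr => hr) fun e r hr => Nat.lt_succ_iff.mp hr
    · refine iSup_le fun i => ?_
      rw [← measurable_iff_comap_le]
      exact measurable_fst.comp (measurable_driverAlgebra rfl)
  · rw [hlaw i]
    exact drivenTraj_succ γ η hB s _
  · unfold drivenLink
    rw [min_comm, max_comm]
    by_cases h : i = j
    · simp [h]
    · rw [if_neg h, if_neg (Ne.symm h)]
  · simp [drivenLink]
  · have h1 := hedge1 s ⟨(i, j), hij⟩ true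
    simpa only [bitWeight, if_true] using h1
  · have h1 := ae_all_iff.mpr fun e => hedge1 s e (b e)
    filter_upwards [hedge s S b, h1] with ω h2 h3
    rw [h2, Finset.prod_apply]
    exact Finset.prod_congr rfl fun e _ => (h3 e).symm

/-- A limiting mean-field process exists. -/
theorem exists_isLimitingMeanField (hB : IsInteractionPair B0 B) (γ : ℝ)
    (μ0 ν : Measure (EuclideanSpace ℝ (Fin d))) [IsProbabilityMeasure μ0] [IsProbabilityMeasure ν]
    (k t : ℕ) :
    ∃ (Ω' : Type) (_ : MeasurableSpace Ω') (P' : Measure Ω') (_ : IsProbabilityMeasure P')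
      (ξ' : Fin k → ℕ → Ω' → EuclideanSpace ℝ (Fin d))
      (Z' : Fin k → ℕ → Ω' → EuclideanSpace ℝ (Fin d))
      (A' : Fin k → Fin k → ℕ → Ω' → Bool),
      IsLimitingMeanField P' γ B0 B μ0 ν k t ξ' Z' A' := by
  have hp : ∀ r : ℕ, IsProbabilityMeasure (if r = 0 then μ0 else ν) := fun r => by
    split_ifs <;> infer_instance
  have hp' : ∀ p : (Fin k × Fin k) × ℕ,
      IsProbabilityMeasure ((if p.2 = 0 then μ0 else ν).prod unitUniform) := fun p => by
    have := hp p.2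
    infer_instance
  refine ⟨(Fin k × Fin k) × ℕ → EuclideanSpace ℝ (Fin d) × ℝ, inferInstance,
    Measure.infinitePi fun p => (if p.2 = 0 then μ0 else ν).prod unitUniform, inferInstance, _, _, _,
    isLimitingMeanField_driven (η := Measure.infinitePi fun r => if r = 0 then μ0 else ν)
      (W := fun p ω => ω p) hB rfl (fun p => measurable_pi_apply p)
      (iIndepFun_infinitePi (X := fun _ x => x) fun _ => measurable_id)
      (fun p => Measure.infinitePi_map_eval _ p) t⟩

end Existence

/-! ### Induction over time -/

section Propagation

variable {Ω : Type*} {d : ℕ} {γ : ℝ}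
  {B0 : EuclideanSpace ℝ (Fin d) → EuclideanSpace ℝ (Fin d) → ℝ}
  {B : Bool → EuclideanSpace ℝ (Fin d) → EuclideanSpace ℝ (Fin d) → ℝ}

/-- Numerator and denominator are continuous at `z`, and positivity of the mass keeps the quotient
away from the convention for division by zero. -/
lemma continuousAt_meanFieldAverage (hB : IsInteractionPair B0 B) (s : ℕ)
    {μ : Measure (ℕ → EuclideanSpace ℝ (Fin d))} [IsProbabilityMeasure μ]
    (hi : Integrable (fun w => w s) μ) {z : ℕ → EuclideanSpace ℝ (Fin d)}
    (hz : ∀ᵐ w ∂μ, ∀ r ≤ s, KernelContinuousAt B0 B r (z r, w r))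
    (hpos : 0 < meanFieldMass B0 B s μ z) : ContinuousAt (meanFieldAverage B0 B s μ) z := by
  have h1 : ContinuousAt (meanFieldMass B0 B s μ) z := by
    rw [funext fun z => meanFieldMass_eq_kernelMean (B0 := B0) (B := B) s μ z]
    exact continuousAt_kernelMean hB s measurable_const (integrable_const 1) hz
  exact (h1.inv₀ hpos.ne').smul
    (continuousAt_kernelMean hB s (φ := fun x => x) measurable_id hi hz)

variable [MeasurableSpace Ω] {P : Measure Ω} [IsProbabilityMeasure P]
  {ξ : ℕ → ℕ → Ω → EuclideanSpace ℝ (Fin d)}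
  {Z : (n : ℕ) → Fin n → ℕ → Ω → EuclideanSpace ℝ (Fin d)}
  {A : (n : ℕ) → Fin n → Fin n → ℕ → Ω → Bool}

lemma hasAvgExpMoments (hγ0 : 0 < γ) (hγ1 : γ < 1) (hB : IsInteractionPair B0 B)
    (hsys : ∀ n, IsCoevolvingSystem P γ B0 B ξ n (Z n) (A n)) (hnoise : IsSystemNoise P ξ Z A)
    {μ0 : Measure (EuclideanSpace ℝ (Fin d))} [IsProbabilityMeasure μ0]
    (hinit : IsInitialCondition P μ0 Z) (hmom : HasExponentialMoments P ξ Z)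
    (hrange : AtMostExponentialDecay B0 B ∨ FiniteRange B0 B) (s : ℕ) :
    HasAvgExpMoments P Z s := by
  induction s with
  | zero =>
    exact hmom.hasAvgExpMoments_zero (fun n i => (hsys n).measurable_opinion i 0)
      hinit.exchangeable
  | succ s ih =>
    refine ih.succ hγ0 hγ1 hsys hnoise hmom ?_
    rcases hrange with h | h
    · exact localAverageControl_of_atMostExponentialDecay hB h hsys s
    · exact localAverageControl_of_finiteRange h hsys s

/-- The limits of the opinion trajectories of sampled agents are unique. -/
lemma SampleTendsto.map_cutTraj_eq {Ω₁ Ω₂ : Type*} [MeasurableSpace Ω₁] [MeasurableSpace Ω₂]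
    {P₁ : Measure Ω₁} {P₂ : Measure Ω₂} [IsProbabilityMeasure P₁] [IsProbabilityMeasure P₂]
    {k₁ k₂ p q₁ q₂ : ℕ} {Z₁ : Fin k₁ → ℕ → Ω₁ → EuclideanSpace ℝ (Fin d)}
    {A₁ : Fin k₁ → Fin k₁ → ℕ → Ω₁ → Bool} {Z₂ : Fin k₂ → ℕ → Ω₂ → EuclideanSpace ℝ (Fin d)}
    {A₂ : Fin k₂ → Fin k₂ → ℕ → Ω₂ → Bool}
    (hZ₁ : ∀ i s, Measurable (Z₁ i s)) (hA₁ : ∀ i j s, Measurable (A₁ i j s))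
    (hZ₂ : ∀ i s, Measurable (Z₂ i s)) (hA₂ : ∀ i j s, Measurable (A₂ i j s))
    (hsys : ∀ n, IsCoevolvingSystem P γ B0 B ξ n (Z n) (A n))
    (h₁ : SampleTendsto P Z A p q₁ k₁ (P₁.map (procState p q₁ Z₁ A₁)))
    (h₂ : SampleTendsto P Z A p q₂ k₂ (P₂.map (procState p q₂ Z₂ A₂))) (i : Fin k₁) (j : Fin k₂) :
    P₁.map (fun ω => cutTraj p fun r => Z₁ i r ω) =
      P₂.map (fun ω => cutTraj p fun r => Z₂ j r ω) := by
  have hY₁ : Measurable (procState p q₁ Z₁ A₁) :=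
    measurable_procState (fun i r _ => hZ₁ i r) fun i j r _ => hA₁ i j r
  have hY₂ : Measurable (procState p q₂ Z₂ A₂) :=
    measurable_procState (fun i r _ => hZ₂ i r) fun i j r _ => hA₂ i j r
  have hm₁ : Measurable fun ω => cutTraj p fun r => Z₁ i r ω :=
    (measurable_cutTraj p).comp (measurable_pi_lambda _ fun r => hZ₁ i r)
  have hm₂ : Measurable fun ω => cutTraj p fun r => Z₂ j r ω :=
    (measurable_cutTraj p).comp (measurable_pi_lambda _ fun r => hZ₂ j r)
  have := Measure.isProbabilityMeasure_map (μ := P₁) hm₁.aemeasurable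
  have := Measure.isProbabilityMeasure_map (μ := P₂) hm₂.aemeasurable
  refine ext_of_forall_integral_eq_of_IsFiniteMeasure fun f => ?_
  rw [integral_map hm₁.aemeasurable f.continuous.measurable.aestronglyMeasurable,
    integral_map hm₂.aemeasurable f.continuous.measurable.aestronglyMeasurable]
  have key : ∀ {k : ℕ} (i : Fin k), Continuous fun x : TrajState k d => f (x.1 i) := fun i =>
    f.continuous.comp ((continuous_apply i).comp continuous_fst)
  have hb : ∀ {k : ℕ} (i : Fin k) (x : TrajState k d), |f (x.1 i)| ≤ ‖f‖ := fun i x =>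
    f.norm_coe_le_norm _
  have t₁ := h₁.tendsto_avg hY₁ hsys (key i).measurable (hb i)
    (Eventually.of_forall fun ω => (key i).continuousAt)
  have t₂ := h₂.tendsto_avg hY₂ hsys (key j).measurable (hb j)
    (Eventually.of_forall fun ω => (key j).continuousAt)
  -- A function of one sampled agent has the same average whatever the sample size and the position,
  -- so both limits are limits of the same sequence.
  have e : ∀ {k : ℕ} (q : ℕ) (i : Fin k) (n : ℕ),
      (avg fun m => ∫ ω, f ((sampleState Z A p q k n m ω).1 i) ∂P) =
      avg fun l : Fin (n + 1) => ∫ ω, f (cutTraj p fun r => Z (n + 1) l r ω) ∂P := fun q i n =>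
    avg_eval i fun l : Fin (n + 1) => ∫ ω, f (cutTraj p fun r => Z (n + 1) l r ω) ∂P
  simp_rw [e] at t₁ t₂
  exact tendsto_nhds_unique t₁ t₂

variable {μ0 : Measure (EuclideanSpace ℝ (Fin d))}

lemma integrable_of_integrable_exp {Ω' : Type*} [MeasurableSpace Ω'] {P' : Measure Ω'}
    {Y : Ω' → EuclideanSpace ℝ (Fin d)} (hY : AEStronglyMeasurable Y P') {C : ℝ} (hC : 1 ≤ C)
    (h : Integrable (fun ω => Real.exp (C * ‖Y ω‖)) P') : Integrable Y P' := by
  refine h.mono hY (Eventually.of_forall fun ω => ?_)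
  rw [Real.norm_of_nonneg (Real.exp_pos _).le]
  have h1 := mul_le_mul_of_nonneg_right hC (norm_nonneg (Y ω))
  linarith [Real.add_one_le_exp (C * ‖Y ω‖)]

lemma IsLimitingMeanField.ae_meanFieldMass_pos {Ω' : Type*} [MeasurableSpace Ω']
    {P' : Measure Ω'} [IsProbabilityMeasure P'] {ν : Measure (EuclideanSpace ℝ (Fin d))} {k t : ℕ}
    {ξ' : Fin k → ℕ → Ω' → EuclideanSpace ℝ (Fin d)}
    {Z' : Fin k → ℕ → Ω' → EuclideanSpace ℝ (Fin d)} {A' : Fin k → Fin k → ℕ → Ω' → Bool}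
    (h' : IsLimitingMeanField P' γ B0 B μ0 ν k t ξ' Z' A') (hB : IsInteractionPair B0 B)
    (hrange : AtMostExponentialDecay B0 B ∨ FiniteRange B0 B) (i : Fin k) (s : ℕ) :
    ∀ᵐ ω ∂P', 0 < meanFieldMass B0 B s (P'.map fun ω r => Z' i r ω) fun r => Z' i r ω := by
  have := h'.isProbabilityMeasure_traj i
  exact ae_of_ae_map (h'.measurable_traj i).aemeasurable
    (_root_.ae_meanFieldMass_pos hB hrange s (P'.map fun ω r => Z' i r ω))

/-- The opinion step of the propagation of chaos; the law of large numbers is derived from a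
limiting process with three agents. -/
lemma sampleTendsto_opinion_step (hγ0 : 0 < γ) (hγ1 : γ < 1)
    (hB : IsInteractionPair B0 B)
    (hsys : ∀ n, IsCoevolvingSystem P γ B0 B ξ n (Z n) (A n)) (hnoise : IsSystemNoise P ξ Z A)
    (hμ0 : μ0 ≪ volume) (hrange : AtMostExponentialDecay B0 B ∨ FiniteRange B0 B)
    {s t k : ℕ} (hs : s < t) (hmom : HasAvgExpMoments P Z s)
    {Ω₃ : Type*} [MeasurableSpace Ω₃] {P₃ : Measure Ω₃} [IsProbabilityMeasure P₃]
    {ξ₃ : Fin 3 → ℕ → Ω₃ → EuclideanSpace ℝ (Fin d)}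
    {Z₃ : Fin 3 → ℕ → Ω₃ → EuclideanSpace ℝ (Fin d)} {A₃ : Fin 3 → Fin 3 → ℕ → Ω₃ → Bool}
    (h₃ : IsLimitingMeanField P₃ γ B0 B μ0 (P.map (ξ 0 0)) 3 t ξ₃ Z₃ A₃)
    (c₃ : SampleTendsto P Z A (s + 1) (s + 1) 3 (P₃.map (procState (s + 1) (s + 1) Z₃ A₃)))
    {Ω' : Type*} [MeasurableSpace Ω'] {P' : Measure Ω'} [IsProbabilityMeasure P']
    {ξ' : Fin k → ℕ → Ω' → EuclideanSpace ℝ (Fin d)}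
    {Z' : Fin k → ℕ → Ω' → EuclideanSpace ℝ (Fin d)} {A' : Fin k → Fin k → ℕ → Ω' → Bool}
    (h' : IsLimitingMeanField P' γ B0 B μ0 (P.map (ξ 0 0)) k t ξ' Z' A')
    (c' : SampleTendsto P Z A (s + 1) (s + 1) k (P'.map (procState (s + 1) (s + 1) Z' A'))) :
    SampleTendsto P Z A (s + 2) (s + 1) k (P'.map (procState (s + 2) (s + 1) Z' A')) := by
  have hν := hnoise.absolutelyContinuous
  set μ := P₃.map fun ω r => Z₃ 2 r ω with hμ
  have hpμ : IsProbabilityMeasure μ := h₃.isProbabilityMeasure_traj 2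
  have law₃ : ∀ i, (P₃.map fun ω r => Z₃ i r ω).map (cutTraj (s + 1)) =
      μ.map (cutTraj (s + 1)) := by
    intro i
    rw [hμ, Measure.map_map (measurable_cutTraj _) (h₃.measurable_traj i),
      Measure.map_map (measurable_cutTraj _) (h₃.measurable_traj 2)]
    exact c₃.map_cutTraj_eq h₃.measurable_opinion h₃.measurable_edge h₃.measurable_opinion
      h₃.measurable_edge hsys c₃ i 2
  -- Up to time `s` every agent of either process has the same law, so the average obtained from the
  -- three-agent law of large numbers is also the one in the equation of the `k`-agent process.
  have law' : ∀ i, (P'.map fun ω r => Z' i r ω).map (cutTraj (s + 1)) =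
      μ.map (cutTraj (s + 1)) := by
    intro i
    rw [hμ, Measure.map_map (measurable_cutTraj _) (h'.measurable_traj i),
      Measure.map_map (measurable_cutTraj _) (h₃.measurable_traj 2)]
    exact c'.map_cutTraj_eq h'.measurable_opinion h'.measurable_edge h₃.measurable_opinion
      h₃.measurable_edge hsys c₃ i 2
  refine c'.opinion_step hγ0 hγ1 hsys hnoise h'.measurable_opinion h'.measurable_edge
    (history_le h'.measurable_opinion h'.measurable_edge _ _) le_rfl (h'.noiseLaw hs.le)
    (M := meanFieldAverage B0 B s μ) (measurable_meanFieldAverage hB s μ)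
    (meanFieldAverage_cutTraj s μ) (fun i => ?_) (fun i => ?_) ?_
  · rw [← meanFieldAverage_congr_law hB s (law' i)]
    exact h'.evolve i s hs
  · rw [← meanFieldAverage_congr_law hB s (law' i)]
    have hp := h'.isProbabilityMeasure_traj i
    have hexp := c'.integrable_exp h'.measurable_opinion h'.measurable_edge hsys hmom 1 i
    have hint : Integrable (fun w => w s) (P'.map fun ω r => Z' i r ω) := by
      rw [integrable_map_measure (measurable_pi_apply s).aestronglyMeasurable
        (h'.measurable_traj i).aemeasurable]
      exact integrable_of_integrable_exp
        (h'.measurable_opinion i s).aestronglyMeasurable le_rfl hexp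
    filter_upwards [h'.ae_ae_kernelContinuousAt hB hμ0 hν i i hs.le,
      h'.ae_meanFieldMass_pos hB hrange i s] with ω h1 h2
    refine continuousAt_meanFieldAverage hB s hint h1 ?_
    rwa [meanFieldMass_cutTraj]
  · obtain ⟨K, hK⟩ := hmom.eventually_integrable
      (fun n i => (hsys n).measurable_opinion i s) 2
    have hexp := c₃.integrable_exp h₃.measurable_opinion h₃.measurable_edge hsys hmom 2 2
    refine c₃.tendsto_neighborAverage hB hsys h₃ hμ0 hν hs.le hμ hK ?_ ?_
    · have hm : Measurable fun w : ℕ → EuclideanSpace ℝ (Fin d) => Real.exp (2 * ‖w s‖) :=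
        Real.measurable_exp.comp ((measurable_pi_apply s).norm.const_mul 2)
      rw [hμ, integrable_map_measure hm.aestronglyMeasurable (h₃.measurable_traj 2).aemeasurable]
      exact hexp
    -- Positivity is known for agent `0` with its own law, which agrees with `μ`, the law of agent
    -- `2`, up to time `s`.
    · rw [← meanFieldMass_congr_law hB s (law₃ 0)]
      exact h₃.ae_meanFieldMass_pos hB hrange 0 s

lemma IsLimitingMeanField.edge_step {Ω' : Type*} [MeasurableSpace Ω'] {P' : Measure Ω'}
    [IsProbabilityMeasure P'] {ν : Measure (EuclideanSpace ℝ (Fin d))} {k t : ℕ}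
    {ξ' : Fin k → ℕ → Ω' → EuclideanSpace ℝ (Fin d)}
    {Z' : Fin k → ℕ → Ω' → EuclideanSpace ℝ (Fin d)} {A' : Fin k → Fin k → ℕ → Ω' → Bool}
    (h' : IsLimitingMeanField P' γ B0 B μ0 ν k t ξ' Z' A') (hB : IsInteractionPair B0 B)
    (hsys : ∀ n, IsCoevolvingSystem P γ B0 B ξ n (Z n) (A n)) (hμ0 : μ0 ≪ volume)
    (hν : ν ≪ volume) {s : ℕ} (hs : s ≤ t)
    (h : SampleTendsto P Z A (s + 1) s k (P'.map (procState (s + 1) s Z' A'))) :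
    SampleTendsto P Z A (s + 1) (s + 1) k (P'.map (procState (s + 1) (s + 1) Z' A')) :=
  h.edge_step hB hsys (h'.edgeLaw hs)
    fun _ _ hij => h'.absolutelyContinuous_pair hB hμ0 hν hij hs

/-- Propagation of chaos: the states of uniformly sampled agents converge to those of the
limiting mean-field process. -/
theorem IsLimitingMeanField.sampleTendsto [IsProbabilityMeasure μ0] (hγ0 : 0 < γ) (hγ1 : γ < 1)
    (hB : IsInteractionPair B0 B)
    (hsys : ∀ n, IsCoevolvingSystem P γ B0 B ξ n (Z n) (A n)) (hnoise : IsSystemNoise P ξ Z A)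
    (hinit : IsInitialCondition P μ0 Z) (hmom : HasExponentialMoments P ξ Z)
    (hrange : AtMostExponentialDecay B0 B ∨ FiniteRange B0 B) {t k : ℕ}
    {Ω' : Type*} [MeasurableSpace Ω'] {P' : Measure Ω'} [IsProbabilityMeasure P']
    {ξ' : Fin k → ℕ → Ω' → EuclideanSpace ℝ (Fin d)}
    {Z' : Fin k → ℕ → Ω' → EuclideanSpace ℝ (Fin d)} {A' : Fin k → Fin k → ℕ → Ω' → Bool}
    (h' : IsLimitingMeanField P' γ B0 B μ0 (P.map (ξ 0 0)) k t ξ' Z' A') {s : ℕ} (hs : s ≤ t) :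
    SampleTendsto P Z A (s + 1) (s + 1) k (P'.map (procState (s + 1) (s + 1) Z' A')) := by
  have hμ0 := hinit.absolutelyContinuous
  have hν := hnoise.absolutelyContinuous
  have hpν : IsProbabilityMeasure (P.map (ξ 0 0)) :=
    Measure.isProbabilityMeasure_map (hnoise.measurable 0 0).aemeasurable
  obtain ⟨Ω₃, _, P₃, _, ξ₃, Z₃, A₃, h₃⟩ :=
    exists_isLimitingMeanField hB γ μ0 (P.map (ξ 0 0)) 3 t
  -- The opinion step for any `k` consumes the convergence for three agents at the same time, so
  -- both are proved in one induction.
  have key : SampleTendsto P Z A (s + 1) (s + 1) 3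
        (P₃.map (procState (s + 1) (s + 1) Z₃ A₃)) ∧
      SampleTendsto P Z A (s + 1) (s + 1) k (P'.map (procState (s + 1) (s + 1) Z' A')) := by
    induction s with
    | zero =>
      exact ⟨h₃.edge_step hB hsys hμ0 hν hs (hinit.sampleTendsto hsys h₃),
        h'.edge_step hB hsys hμ0 hν hs (hinit.sampleTendsto hsys h')⟩
    | succ s ih =>
      obtain ⟨c₃, c'⟩ := ih (Nat.le_of_succ_le hs)
      have hm := hasAvgExpMoments hγ0 hγ1 hB hsys hnoise hinit hmom hrange s
      exact ⟨h₃.edge_step hB hsys hμ0 hν hs (sampleTendsto_opinion_step hγ0 hγ1 hB hsys hnoise hμ0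
          hrange hs hm h₃ c₃ h₃ c₃),
        h'.edge_step hB hsys hμ0 hν hs (sampleTendsto_opinion_step hγ0 hγ1 hB hsys hnoise hμ0
          hrange hs hm h₃ c₃ h' c')⟩
  exact key.2

end Propagation

/-! ### Uniform samples with and without replacement -/

section Sampling

variable {T : Type*} [Fintype T]

lemma integral_uniformOn [MeasurableSpace T] [MeasurableSingletonClass T] (S : Finset T)
    (G : T → ℝ) : ∫ t, G t ∂(uniformOn (S : Set T)) = (∑ t ∈ S, G t) / S.card := by
  classical
  rcases S.eq_empty_or_nonempty with rfl | hS
  · simp [uniformOn_empty_meas]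
  have hp : IsProbabilityMeasure (uniformOn (S : Set T)) :=
    isProbabilityMeasure_uniformOn S.finite_toSet hS
  rw [integral_fintype Integrable.of_finite, Finset.sum_div,
    ← Finset.sum_filter_add_sum_filter_not Finset.univ (· ∈ S)]
  have h1 : ∀ t, (uniformOn (S : Set T)).real {t} = if t ∈ S then (S.card : ℝ)⁻¹ else 0 := by
    intro t
    have h2 := uniformOn_apply_finset (s := S) (t := {t})
    rw [Finset.coe_singleton] at h2
    rw [Measure.real, h2]
    by_cases h : t ∈ S <;> simp [h]
  simp only [h1, smul_eq_mul]
  rw [Finset.sum_eq_zero (s := Finset.univ.filter fun t => t ∉ S) fun t ht => by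
    rw [if_neg (Finset.mem_filter.mp ht).2, zero_mul], add_zero]
  have h3 : (Finset.univ.filter fun t => t ∈ S) = S := by ext t; simp
  rw [h3]
  exact Finset.sum_congr rfl fun t ht => by rw [if_pos ht, div_eq_inv_mul]

/-- Restricting a uniform average to `S` changes it by at most `2 * C` times the share of the
complement. With `S` the injective tuples, this compares the two ways of sampling. -/
lemma abs_sum_div_card_sub_avg_le [DecidableEq T] {S : Finset T} (hS : S.Nonempty) {G : T → ℝ}
    {C : ℝ} (hG : ∀ t, |G t| ≤ C) :
    |(∑ t ∈ S, G t) / S.card - avg G| ≤ 2 * C * avg fun t => if t ∈ S then (0 : ℝ) else 1 := by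
  have hp : (0 : ℝ) < S.card := Nat.cast_pos.mpr hS.card_pos
  have hN : (0 : ℝ) < Fintype.card T :=
    hp.trans_le (Nat.cast_le.mpr (Finset.card_le_univ S))
  have hsum : ∀ U : Finset T, |∑ t ∈ U, G t| ≤ U.card * C := fun U =>
    (Finset.abs_sum_le_sum_abs _ _).trans (by
      simpa using Finset.sum_le_sum fun t (_ : t ∈ U) => hG t)
  have hind : (avg fun t => if t ∈ S then (0 : ℝ) else 1) = (Sᶜ.card : ℝ) / Fintype.card T := by
    unfold avg
    congr 1
    have h1 : ∀ t, (if t ∈ S then (0 : ℝ) else 1) = if t ∈ Sᶜ then 1 else 0 := fun t => by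
      by_cases h : t ∈ S <;> simp [h]
    simp_rw [h1]
    rw [Finset.sum_ite_mem, Finset.univ_inter]
    simp
  have hcard : (Sᶜ.card : ℝ) = Fintype.card T - S.card := by
    rw [eq_sub_iff_add_eq, ← Nat.cast_add, add_comm, Finset.card_add_card_compl]
  -- The difference of the two weights `1 / |S|` and `1 / |T|` is `|Sᶜ| / (|S| |T|)`; the sums over
  -- `S` and over its complement then each contribute `C * |Sᶜ| / |T|`.
  have h2 : (∑ t ∈ S, G t) / S.card - avg G = (∑ t ∈ S, G t) * (Sᶜ.card / (S.card *
      Fintype.card T)) - (∑ t ∈ Sᶜ, G t) / Fintype.card T := by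
    unfold avg
    rw [← Finset.sum_add_sum_compl S G, hcard]
    field_simp
    ring
  rw [hind, h2]
  refine (abs_sub _ _).trans ?_
  rw [abs_mul, abs_div _ (Fintype.card T : ℝ), abs_of_pos hN,
    abs_of_nonneg (a := (Sᶜ.card : ℝ) / _) (by positivity)]
  have h3 := mul_le_mul_of_nonneg_right (hsum S)
    (show (0 : ℝ) ≤ Sᶜ.card / (S.card * Fintype.card T) by positivity)
  have h4 := div_le_div_of_nonneg_right (hsum Sᶜ) hN.le
  refine (add_le_add h3 h4).trans (le_of_eq ?_)
  field_simp
  ring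

end Sampling

/-! ### Trajectories of a randomly chosen sample -/

section SampledTrajectories

variable {Ω : Type*} {d k N t : ℕ}

/-- The opinions and edges of the agents `m 0, m 1, …` up to time `t`. -/
def windowState (t : ℕ) (m : Fin k → Fin N) (x : TrajState N d) :
    (Fin k → Fin (t + 1) → EuclideanSpace ℝ (Fin d)) × (Fin k → Fin k → Fin (t + 1) → Bool) :=
  (fun i s => x.1 (m i) s, fun i j s => x.2 (m i) (m j) s)

lemma continuous_windowState (t : ℕ) (m : Fin k → Fin N) :
    Continuous (windowState (d := d) t m) := by
  unfold windowState
  fun_prop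

lemma measurable_windowState (t : ℕ) (m : Fin k → Fin N) :
    Measurable (windowState (d := d) t m) := by
  unfold windowState
  fun_prop

lemma windowState_procState (Z : Fin N → ℕ → Ω → EuclideanSpace ℝ (Fin d))
    (A : Fin N → Fin N → ℕ → Ω → Bool) (m : Fin k → Fin N) (ω : Ω) :
    windowState t m (procState (t + 1) (t + 1) Z A ω) = sampledTrajectory t Z A m ω := by
  refine Prod.ext (funext fun i => funext fun s => ?_)
    (funext fun i => funext fun j => funext fun s => ?_)
  · exact cutTraj_apply_of_lt s.isLt fun r => Z (m i) r ω
  · exact cutTraj_apply_of_lt s.isLt fun r => A (m i) (m j) r ω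

lemma measurable_sampledTrajectory [MeasurableSpace Ω]
    {Z : Fin N → ℕ → Ω → EuclideanSpace ℝ (Fin d)} {A : Fin N → Fin N → ℕ → Ω → Bool}
    (hZ : ∀ i s, Measurable (Z i s)) (hA : ∀ i j s, Measurable (A i j s)) (m : Fin k → Fin N) :
    Measurable (sampledTrajectory t Z A m) := by
  rw [funext fun ω => (windowState_procState (t := t) Z A m ω).symm]
  exact (measurable_windowState t m).comp
    (measurable_procState (fun i r _ => hZ i r) fun i j r _ => hA i j r)

lemma measurable_sampledTrajectory_random [MeasurableSpace Ω]
    {Z : Fin N → ℕ → Ω → EuclideanSpace ℝ (Fin d)} {A : Fin N → Fin N → ℕ → Ω → Bool}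
    (hZ : ∀ i s, Measurable (Z i s)) (hA : ∀ i j s, Measurable (A i j s))
    {m : Ω → Fin k → Fin N} (hm : Measurable m) :
    Measurable fun ω => sampledTrajectory t Z A (m ω) ω := by
  have h : Measurable fun p : (Fin k → Fin N) × Ω => sampledTrajectory t Z A p.1 p.2 :=
    measurable_from_prod_countable_right fun m => measurable_sampledTrajectory hZ hA m
  exact h.comp (hm.prodMk measurable_id)

/-- The sample may be averaged separately if it is independent of the history. -/
lemma integral_sampledTrajectory [MeasurableSpace Ω] {P : Measure Ω} [IsProbabilityMeasure P]
    {Z : Fin N → ℕ → Ω → EuclideanSpace ℝ (Fin d)} {A : Fin N → Fin N → ℕ → Ω → Bool}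
    (hZ : ∀ i s, Measurable (Z i s)) (hA : ∀ i j s, Measurable (A i j s))
    {m : Ω → Fin k → Fin N} (hm : Measurable m)
    (hind : Indep (MeasurableSpace.comap m inferInstance) (history Z A (t + 1) (t + 1)) P)
    (f : ((Fin k → Fin (t + 1) → EuclideanSpace ℝ (Fin d)) ×
      (Fin k → Fin k → Fin (t + 1) → Bool)) →ᵇ ℝ) :
    ∫ ω, f (sampledTrajectory t Z A (m ω) ω) ∂P =
      ∫ j, ∫ ω, f (sampledTrajectory t Z A j ω) ∂P ∂(P.map m) := by
  have hY : Measurable (procState (t + 1) (t + 1) Z A) :=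
    measurable_procState (fun i r _ => hZ i r) fun i j r _ => hA i j r
  have hfm := f.continuous.measurable
  have hF : Measurable fun p : (Fin k → Fin N) × TrajState N d => f (windowState t p.1 p.2) :=
    measurable_from_prod_countable_right fun m => hfm.comp (measurable_windowState t m)
  -- The sample is independent of the state of the whole system up to time `t`, and the sampled
  -- trajectory is a function of the two.
  have hi : IndepFun m (procState (t + 1) (t + 1) Z A) P :=
    indep_of_indep_of_le_right hind measurable_procState_history.comap_le
  have h1 := integral_eq_integral_integral_of_indepFun hm hY hi hF
    (C := ‖f‖) fun p => f.norm_coe_le_norm _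
  have h2 : ∀ j : Fin k → Fin N, ∫ x, f (windowState t j x)
      ∂(P.map (procState (t + 1) (t + 1) Z A)) = ∫ ω, f (sampledTrajectory t Z A j ω) ∂P := by
    intro j
    have h3 : Measurable fun x : TrajState N d => f (windowState t j x) :=
      hfm.comp (measurable_windowState t j)
    rw [integral_map hY.aemeasurable h3.aestronglyMeasurable]
    simp only [windowState_procState]
  simp only [windowState_procState, h2] at h1
  rw [h1, integral_map hm.aemeasurable (measurable_of_finite _).aestronglyMeasurable]

end SampledTrajectories

/-! ### The asymptotic distribution of a random sample -/

theorem mainTheorem1 {d : ℕ} {Ω : Type*} [MeasurableSpace Ω] (P : Measure Ω)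
    [IsProbabilityMeasure P] (γ : ℝ) (hγ0 : 0 < γ) (hγ1 : γ < 1)
    (B0 : EuclideanSpace ℝ (Fin d) → EuclideanSpace ℝ (Fin d) → ℝ)
    (B : Bool → EuclideanSpace ℝ (Fin d) → EuclideanSpace ℝ (Fin d) → ℝ)
    (hB : IsInteractionPair B0 B)
    (ξ : ℕ → ℕ → Ω → EuclideanSpace ℝ (Fin d))
    (Z : (n : ℕ) → Fin n → ℕ → Ω → EuclideanSpace ℝ (Fin d))
    (A : (n : ℕ) → Fin n → Fin n → ℕ → Ω → Bool)
    (hsys : ∀ n, IsCoevolvingSystem P γ B0 B ξ n (Z n) (A n))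
    (hnoise : IsSystemNoise P ξ Z A)
    (μ0 : Measure (EuclideanSpace ℝ (Fin d))) [IsProbabilityMeasure μ0]
    (hinit : IsInitialCondition P μ0 Z)
    (hmom : HasExponentialMoments P ξ Z)
    (hrange : AtMostExponentialDecay B0 B ∨ FiniteRange B0 B)
    (t k : ℕ) (m : (n : ℕ) → Ω → Fin k → Fin (n + 1))
    (hm_meas : ∀ n, Measurable (m n))
    (hm_indep : ∀ n, Indep (MeasurableSpace.comap (m n) inferInstance)
      (history (Z (n + 1)) (A (n + 1)) (t + 1) (t + 1)) P)
    (hm_unif : (∀ n, IsSampleWithReplacement P (m n)) ∨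
      (∀ n, k ≤ n + 1 → IsSampleWithoutReplacement P (m n))) :
    (∃ (Ω' : Type) (_ : MeasurableSpace Ω') (P' : Measure Ω') (_ : IsProbabilityMeasure P')
      (ξ' : Fin k → ℕ → Ω' → EuclideanSpace ℝ (Fin d))
      (Z' : Fin k → ℕ → Ω' → EuclideanSpace ℝ (Fin d))
      (A' : Fin k → Fin k → ℕ → Ω' → Bool),
      IsLimitingMeanField P' γ B0 B μ0 (P.map (ξ 0 0)) k t ξ' Z' A') ∧
    ∀ (Ω' : Type*) [MeasurableSpace Ω'] (P' : Measure Ω') [IsProbabilityMeasure P']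
      (ξ' : Fin k → ℕ → Ω' → EuclideanSpace ℝ (Fin d))
      (Z' : Fin k → ℕ → Ω' → EuclideanSpace ℝ (Fin d))
      (A' : Fin k → Fin k → ℕ → Ω' → Bool),
      IsLimitingMeanField P' γ B0 B μ0 (P.map (ξ 0 0)) k t ξ' Z' A' →
      (∀ i, ∀ s < t, Integrable (Z' i s) P' ∧
        ∀ᵐ ω ∂P', 0 < meanFieldMass B0 B s (P'.map (fun ω' r => Z' i r ω'))
          (fun r => Z' i r ω)) ∧
      TendstoInDistribution
        (fun n ω => sampledTrajectory t (Z (n + 1)) (A (n + 1)) (m n ω) ω) atTop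
        (sampledTrajectory t Z' A' (fun i => i)) (fun _ => P) P' := by
  have hpν : IsProbabilityMeasure (P.map (ξ 0 0)) :=
    Measure.isProbabilityMeasure_map (hnoise.measurable 0 0).aemeasurable
  refine ⟨exists_isLimitingMeanField hB γ μ0 (P.map (ξ 0 0)) k t, ?_⟩
  intro Ω' _ P' _ ξ' Z' A' h'
  have hconv : ∀ s ≤ t, SampleTendsto P Z A (s + 1) (s + 1) k
      (P'.map (procState (s + 1) (s + 1) Z' A')) := fun s hs =>
    h'.sampleTendsto hγ0 hγ1 hB hsys hnoise hinit hmom hrange hs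
  refine ⟨fun i s hs => ⟨?_, h'.ae_meanFieldMass_pos hB hrange i s⟩, ?_⟩
  · have h1 := hasAvgExpMoments hγ0 hγ1 hB hsys hnoise hinit hmom hrange s
    exact integrable_of_integrable_exp (h'.measurable_opinion i s).aestronglyMeasurable le_rfl
      ((hconv s hs.le).integrable_exp h'.measurable_opinion h'.measurable_edge hsys h1 1 i)
  have hY : Measurable (procState (t + 1) (t + 1) Z' A') :=
    measurable_procState (fun i r _ => h'.measurable_opinion i r)
      fun i j r _ => h'.measurable_edge i j r
  have hlim : Measurable (sampledTrajectory t Z' A' fun i => i) :=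
    measurable_sampledTrajectory h'.measurable_opinion h'.measurable_edge _
  have hpre : ∀ n, Measurable fun ω =>
      sampledTrajectory t (Z (n + 1)) (A (n + 1)) (m n ω) ω := fun n =>
    measurable_sampledTrajectory_random (hsys _).measurable_opinion (hsys _).measurable_edge
      (hm_meas n)
  refine ⟨fun n => (hpre n).aemeasurable, hlim.aemeasurable, ?_⟩
  have hp : ∀ n, IsProbabilityMeasure (P.map fun ω =>
      sampledTrajectory t (Z (n + 1)) (A (n + 1)) (m n ω) ω) := fun n =>
    Measure.isProbabilityMeasure_map (hpre n).aemeasurable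
  have hp' : IsProbabilityMeasure (P'.map (sampledTrajectory t Z' A' fun i => i)) :=
    Measure.isProbabilityMeasure_map hlim.aemeasurable
  refine weakTendsto_iff_tendsto_probabilityMeasure.mp fun f => ?_
  have hfm := f.continuous.measurable
  rw [integral_map hlim.aemeasurable hfm.aestronglyMeasurable]
  set G : (n : ℕ) → (Fin k → Fin (n + 1)) → ℝ := fun n j =>
    ∫ ω, f (sampledTrajectory t (Z (n + 1)) (A (n + 1)) j ω) ∂P with hG
  have hGb : ∀ n j, |G n j| ≤ ‖f‖ := fun n j =>
    abs_integral_le_of_abs_le fun ω => f.norm_coe_le_norm _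
  -- Reading off the states up to time `t` is continuous, so the propagation result gives the limit
  -- for averages over all tuples.
  have havg : Tendsto (fun n => avg (G n)) atTop
      (𝓝 (∫ ω, f (sampledTrajectory t Z' A' (fun i => i) ω) ∂P')) := by
    have hc : Continuous fun x : TrajState k d => f (windowState t (fun i => i) x) :=
      f.continuous.comp (continuous_windowState t _)
    have h1 := (hconv t le_rfl).tendsto_avg hY hsys hc.measurable (C := ‖f‖)
      (fun x => f.norm_coe_le_norm _) (Eventually.of_forall fun ω => hc.continuousAt)
    simp only [sampleState, windowState_procState] at h1
    exact h1
  have hint : ∀ n, ∫ x, f x ∂(P.map fun ω =>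
      sampledTrajectory t (Z (n + 1)) (A (n + 1)) (m n ω) ω) = ∫ j, G n j ∂(P.map (m n)) := by
    intro n
    rw [integral_map (hpre n).aemeasurable hfm.aestronglyMeasurable]
    exact integral_sampledTrajectory (hsys _).measurable_opinion (hsys _).measurable_edge
      (hm_meas n) (hm_indep n) f
  simp_rw [hint]
  -- With replacement, the integral over the sample is exactly the average over all tuples. Without
  -- replacement, it is the average over injective tuples, which differs by a vanishing amount.
  rcases hm_unif with hu | hu
  · refine havg.congr fun n => ?_
    have h1 := integral_uniformOn (Finset.univ : Finset (Fin k → Fin (n + 1))) (G n)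
    rw [Finset.coe_univ] at h1
    rw [hu n, h1]
    rfl
  · classical
    have hbound := (tendsto_avg_injective k).const_mul (2 * ‖f‖)
    rw [mul_zero] at hbound
    have hdiff : Tendsto (fun n => ∫ j, G n j ∂(P.map (m n)) - avg (G n)) atTop (𝓝 0) := by
      refine squeeze_zero_norm' ?_ hbound
      filter_upwards [eventually_ge_atTop k] with n hn
      set S : Finset (Fin k → Fin (n + 1)) := Finset.univ.filter fun j => Function.Injective j
        with hS
      -- For `k ≤ n` the inclusion of `Fin k` into `Fin (n + 1)` is an injective tuple, so the
      -- conditional average is not a division by zero.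
      have hne : S.Nonempty := ⟨Fin.castLE (by omega), by simp [hS, Fin.castLE_injective]⟩
      have h1 := integral_uniformOn S (G n)
      have h2 : (S : Set (Fin k → Fin (n + 1))) = {j | Function.Injective j} := by
        ext j; simp [hS]
      rw [h2] at h1
      rw [hu n (by omega), h1, Real.norm_eq_abs]
      refine (abs_sum_div_card_sub_avg_le hne (hGb n)).trans (le_of_eq ?_)
      congr 2
      ext j
      simp [hS]
    simpa using hdiff.add havg
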